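/- For $A\in\mathbb R^{n\times d}$ let $\mathcal X\subset\mathbb R^{n\times k}$ be the set of matrices all of whose rows are standard basis vectors, and for $X\in\mathcal X$, $C\in\mathbb R^{k\times d}$ let $\mathrm{cost}_A(X,C)=\|XC-A\|_F^2$. A $(1+\epsilon)$-approximate solution to the $k$-means problem on $A$ is a pair $(X,C)$ with $X\in\mathcal X$ and $\mathrm{cost}_A(X,C)\le(1+\epsilon)\min_{X'\in\mathcal X,\,C'\in\mathbb R^{k\times d}}\mathrm{cost}_A(X',C')$. Let $\operatorname{vec}(A)\in\mathbb R^{nd}$ be the flattening of $A$. Machine model. Algorithms are fixed programs (uniform in $n,d,k,\epsilon$) of a randomized real random access machine. Its memory consists of finitely many arrays of cells, each holding a real number or a natural number ("word"). One step is an assignment, a test, or drawing a uniformly random word from $\{0,\dots,m\}$; real arithmetic is $+,-,\times,\div$ and comparison, without rounding. Space is the number of memory cells; random words count if they are stored. Theorem. (1) There are an absolute constant $c$ and a program $R$ such that for all $n,d,k\ge1$ and $\epsilon\in(0,1)$ there are $t\le c\log(nk)/\epsilon^2$, $s\le ck/\epsilon$ and $w\le ck^2\log(n)/\epsilon^3$,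 and probability distributions of matrices $T\in\mathbb R^{d\times t}$, $S\in\mathbb R^{s\times n}$, $W\in\mathbb R^{w\times nd}$, such that for every $A\in\mathbb R^{n\times d}$, if $T,S,W$ are drawn independently, then with probability at least $2/3$ the program $R$, given only $n,d,k,t,s,w,\epsilon$, the matrices $T,S,W$ and the sketches $SA$, $AT$, $W\operatorname{vec}(A)$, halts with a $(1+\epsilon)$-approximate solution $(X,C)$ to the $k$-means problem on $A$. (2) There are a one-pass streaming algorithm (an initialization program, an update program and a post-processing program) and an absolute constant $c$ such that the following holds for all $k\ge1$, $\epsilon\in(0,1)$ and $n,d>c(k/\epsilon)^{c}$. Let $A\in\mathbb R^{n\times d}$ be given by any finite turnstile stream: $A$ starts at $0$ and undergoes updates $A_{i,j}\leftarrow A_{i,j}+\Delta$ with $\Delta\in\mathbb R$. With probability at least $2/3$ the algorithm outputs a $(1+\epsilon)$-approximate solution $(X,C)$ (assignment and centers) to the $k$-means problem on $A$. For every outcome of its random choices it - uses at most $c\,(n/\epsilon^2+dk/\epsilon)\,(1+\log(ndk/\epsilon))^{c}=\tilde O(n/\epsilon^2+dk/\epsilon)$ memory cells, in which all words are at most $c(ndk/\epsilon)^c$,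 at all times including the post-processing; - takes at most $d^{\,c}\cdot n^{\,c(k^2/\epsilon)(1+\log(k/\epsilon))^{c}}=d^{O(1)}\,n^{\tilde O(k^2/\epsilon)}$ steps for the post-processing, and at most as many for the initialization and for each update. Moreover, if all $\Delta$ are integers and the entries of $A$ are at most $M\ge1$ in absolute value at all times of the stream, then every real number that is kept in memory from one update to the next is an integer of absolute value at most $c(ndkM/\epsilon)^c$, so the memory kept during the stream is $\tilde O(n/\epsilon^2+dk/\epsilon)\cdot O(1+\log M)$ bits. -/

import Mathlib

open MeasureTheory

/-! ## Euclidean `k`-means clustering -/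

/-- The set `𝒳` of assignment matrices: every row is a standard basis vector. -/
def IsAssignment {n k : ℕ} (X : Matrix (Fin n) (Fin k) ℝ) : Prop :=
  ∀ i, ∃ j, X i = Pi.single j 1

/-- The `k`-means cost `‖X C - A‖_F ^ 2`. -/
def kMeansCost {n d k : ℕ} (A : Matrix (Fin n) (Fin d) ℝ) (X : Matrix (Fin n) (Fin k) ℝ)
    (C : Matrix (Fin k) (Fin d) ℝ) : ℝ :=
  ∑ i, ∑ j, ((X * C - A) i j) ^ 2

/-- `(X, C)` is a feasible solution whose cost is at most `1 + ε` times the minimum cost. -/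
def IsApproxKMeans {n d k : ℕ} (A : Matrix (Fin n) (Fin d) ℝ) (ε : ℝ)
    (X : Matrix (Fin n) (Fin k) ℝ) (C : Matrix (Fin k) (Fin d) ℝ) : Prop :=
  IsAssignment X ∧
    ∀ (X' : Matrix (Fin n) (Fin k) ℝ) (C' : Matrix (Fin k) (Fin d) ℝ), IsAssignment X' →
      kMeansCost A X C ≤ (1 + ε) * kMeansCost A X' C'

/-! ## Random matrices and flattening -/

/-- The product (Borel) sigma-algebra on real matrices. -/
instance matrixMeasurableSpace {m n : ℕ} : MeasurableSpace (Matrix (Fin m) (Fin n) ℝ) :=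
  inferInstanceAs (MeasurableSpace (Fin m → Fin n → ℝ))

/-- The row-major flattening of `A`: the entry `(i, j)` is at position `i * d + j`. -/
def flatten {n d : ℕ} (A : Matrix (Fin n) (Fin d) ℝ) : Fin (n * d) → ℝ :=
  fun x => A (finProdFinEquiv.symm x).1 (finProdFinEquiv.symm x).2

/-! ## A randomized real random access machine

Programs of a small structured language act on finitely many arrays of natural numbers ("words")
and finitely many arrays of real numbers.  All cells can be addressed indirectly.  The real
operations are `+`, `-`, `*`, `/` and comparison; there is no rounding, and no conversion from reals
to words.  Every elementary command or test costs one step (the expressions in it are part of the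
fixed program text, so they have constant size). -/

/-- Word-valued expressions.  `sub` is truncated; `div` and `mod` are those of `ℕ`. -/
inductive NExp where
  | lit (c : ℕ)
  | input (r : ℕ)
  | cell (a : ℕ) (i : NExp)
  | add (x y : NExp)
  | sub (x y : NExp)
  | mul (x y : NExp)
  | div (x y : NExp)
  | mod (x y : NExp)

/-- Real-valued expressions. -/
inductive RExp where
  | ofWord (x : NExp)
  | input (a : ℕ) (i j : NExp)
  | cell (a : ℕ) (i : NExp)
  | add (x y : RExp)
  | sub (x y : RExp)
  | mul (x y : RExp)
  | div (x y : RExp)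

/-- Tests. -/
inductive BExp where
  | wordLt (x y : NExp)
  | realLt (x y : RExp)
  | not (b : BExp)
  | and (b c : BExp)

/-- Programs. -/
inductive Cmd where
  | skip
  /-- write a word to cell `i` of word array `a` -/
  | setWord (a : ℕ) (i v : NExp)
  /-- write a real to cell `i` of real array `a` -/
  | setReal (a : ℕ) (i : NExp) (v : RExp)
  /-- write a fresh uniformly random element of `{0, …, m}` to cell `i` of word array `a` -/
  | draw (a : ℕ) (i m : NExp)
  | seq (p q : Cmd)
  | branch (b : BExp) (p q : Cmd)
  | loop (b : BExp) (p : Cmd)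

/-- Read-only inputs of a program: word registers, and real arrays with two indices. -/
structure Inputs where
  word : ℕ → ℕ
  real : ℕ → ℕ → ℕ → ℝ

/-- The read-write memory, and the number of random draws made so far (which programs cannot
read). -/
structure State where
  word : ℕ → ℕ → ℕ
  real : ℕ → ℕ → ℝ
  draws : ℕ

/-- The initial memory. -/
def State.blank : State := ⟨fun _ _ => 0, fun _ _ => 0, 0⟩

/-- The source of randomness: its entry at `(r, m)` is the element of `{0, …, m}` that is
returned if the `r`-th random draw asks for an element of `{0, …, m}`. -/
abbrev Tape : Type := (q : ℕ × ℕ) → Fin (q.2 + 1)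

/-- All entries of the tape are independent and uniform. -/
noncomputable def tapeMeasure : Measure Tape :=
  Measure.infinitePi fun q : ℕ × ℕ => (PMF.uniformOfFintype (Fin (q.2 + 1))).toMeasure

def NExp.eval (inp : Inputs) (σ : State) : NExp → ℕ
  | .lit c => c
  | .input r => inp.word r
  | .cell a i => σ.word a (i.eval inp σ)
  | .add x y => x.eval inp σ + y.eval inp σ
  | .sub x y => x.eval inp σ - y.eval inp σ
  | .mul x y => x.eval inp σ * y.eval inp σ
  | .div x y => x.eval inp σ / y.eval inp σ
  | .mod x y => x.eval inp σ % y.eval inp σ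

noncomputable def RExp.eval (inp : Inputs) (σ : State) : RExp → ℝ
  | .ofWord x => (x.eval inp σ : ℝ)
  | .input a i j => inp.real a (i.eval inp σ) (j.eval inp σ)
  | .cell a i => σ.real a (i.eval inp σ)
  | .add x y => x.eval inp σ + y.eval inp σ
  | .sub x y => x.eval inp σ - y.eval inp σ
  | .mul x y => x.eval inp σ * y.eval inp σ
  | .div x y => x.eval inp σ / y.eval inp σ

def BExp.Holds (inp : Inputs) (σ : State) : BExp → Prop
  | .wordLt x y => x.eval inp σ < y.eval inp σ
  | .realLt x y => x.eval inp σ < y.eval inp σ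
  | .not b => ¬ b.Holds inp σ
  | .and b c => b.Holds inp σ ∧ c.Holds inp σ

def State.setWord (σ : State) (a i v : ℕ) : State :=
  { σ with word := Function.update σ.word a (Function.update (σ.word a) i v) }

def State.setReal (σ : State) (a i : ℕ) (v : ℝ) : State :=
  { σ with real := Function.update σ.real a (Function.update (σ.real a) i v) }

/-- A machine configuration: the commands still to be executed, and the memory.  The machine has
halted if no command is left. -/
abbrev Config : Type := List Cmd × State

open Classical in
/-- One step of the machine. -/
noncomputable def step (inp : Inputs) (ω : Tape) : Config → Config
  | ([], σ) => ([], σ)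
  | (.skip :: K, σ) => (K, σ)
  | (.setWord a i v :: K, σ) => (K, σ.setWord a (i.eval inp σ) (v.eval inp σ))
  | (.setReal a i v :: K, σ) => (K, σ.setReal a (i.eval inp σ) (v.eval inp σ))
  | (.draw a i m :: K, σ) =>
      (K, { σ.setWord a (i.eval inp σ) (ω (σ.draws, m.eval inp σ)) with draws := σ.draws + 1 })
  | (.seq p q :: K, σ) => (p :: q :: K, σ)
  | (.branch b p q :: K, σ) => (if b.Holds inp σ then p :: K else q :: K, σ)
  | (.loop b p :: K, σ) => (if b.Holds inp σ then p :: .loop b p :: K else K, σ)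

/-- The configuration after `N` steps of the program `c` from the memory `σ`. -/
noncomputable def runSteps (inp : Inputs) (ω : Tape) (c : Cmd) (σ : State) (N : ℕ) : Config :=
  (step inp ω)^[N] ([c], σ)

/-- The program `c`, started with the memory `σ`, halts with the memory `σ'`. -/
def Computes (inp : Inputs) (ω : Tape) (c : Cmd) (σ σ' : State) : Prop :=
  ∃ N, runSteps inp ω c σ N = ([], σ')

/-- The program `c`, started with the memory `σ`, halts with the memory `σ'` after at most `T`
steps, and all memories on the way satisfy `ok`. -/
def ComputesWithin (ok : State → Prop) (T : ℕ) (inp : Inputs) (ω : Tape) (c : Cmd)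
    (σ σ' : State) : Prop :=
  ∃ N ≤ T, runSteps inp ω c σ N = ([], σ') ∧ ∀ i ≤ N, ok (runSteps inp ω c σ i).2

/-- The memory is confined to the first `L` cells of each of `m` word arrays and `m` real arrays
(`2 * m * L` cells altogether), and no word exceeds `B`. -/
def State.Fits (m L B : ℕ) (σ : State) : Prop :=
  (∀ a i, m ≤ a ∨ L ≤ i → σ.word a i = 0 ∧ σ.real a i = 0) ∧ ∀ a i, σ.word a i ≤ B

/-- Output convention: the cluster of point `i` is in cell `i` of word array `0`. -/
def outAssignment (n k : ℕ) (σ : State) : Matrix (Fin n) (Fin k) ℝ :=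
  Matrix.of fun i j => if σ.word 0 i = j then 1 else 0

/-- Output convention: coordinate `l` of center `j` is in cell `j * d + l` of real array `0`. -/
def outCenters (k d : ℕ) (σ : State) : Matrix (Fin k) (Fin d) ℝ :=
  Matrix.of fun j l => σ.real 0 (j * d + l)

/-! ## Recovery from sketches -/

/-- A matrix as an input array (zero outside its range). -/
def matrixArray {m n : ℕ} (M : Matrix (Fin m) (Fin n) ℝ) : ℕ → ℕ → ℝ :=
  fun i j => if h : i < m ∧ j < n then M ⟨i, h.1⟩ ⟨j, h.2⟩ else 0

/-- A vector as the first row of an input array. -/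
def vectorArray {m : ℕ} (v : Fin m → ℝ) : ℕ → ℕ → ℝ :=
  fun i j => if h : i = 0 ∧ j < m then v ⟨j, h.2⟩ else 0

/-- What a recovery program gets: the parameters, the sketching matrices, and the sketches
`SA`, `AT`, `Wa` of the data (but not the data). -/
def recoveryInput {n d t s w : ℕ} (k : ℕ) (ε : ℝ) (T : Matrix (Fin d) (Fin t) ℝ)
    (S : Matrix (Fin s) (Fin n) ℝ) (W : Matrix (Fin w) (Fin (n * d)) ℝ)
    (SA : Matrix (Fin s) (Fin d) ℝ) (AT : Matrix (Fin n) (Fin t) ℝ) (Wa : Fin w → ℝ) : Inputs where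
  word
    | 0 => n
    | 1 => d
    | 2 => k
    | 3 => t
    | 4 => s
    | 5 => w
    | _ => 0
  real
    | 0 => fun _ _ => ε
    | 1 => matrixArray T
    | 2 => matrixArray S
    | 3 => matrixArray W
    | 4 => matrixArray SA
    | 5 => matrixArray AT
    | 6 => vectorArray Wa
    | _ => fun _ _ => 0

/-! ## Turnstile streams -/

/-- The update `A i j ← A i j + Δ`. -/
structure Update (n d : ℕ) where
  row : Fin n
  col : Fin d
  delta : ℝ

/-- The matrix defined by a turnstile stream: start at `0` and apply the updates in order. -/
def streamMatrix {n d : ℕ} (us : List (Update n d)) : Matrix (Fin n) (Fin d) ℝ :=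
  us.foldl (fun A u => A + Matrix.single u.row u.col u.delta) 0

/-- Inputs while no update is being read: only the parameters. -/
def paramInput (n d k : ℕ) (ε : ℝ) : Inputs where
  word
    | 0 => n
    | 1 => d
    | 2 => k
    | _ => 0
  real
    | 0 => fun _ _ => ε
    | _ => fun _ _ => 0

/-- Inputs while the update `u` is being read: the parameters and `u`. -/
def updateInput {n d : ℕ} (k : ℕ) (ε : ℝ) (u : Update n d) : Inputs where
  word
    | 0 => n
    | 1 => d
    | 2 => k
    | 3 => u.row
    | 4 => u.col
    | _ => 0
  real
    | 0 => fun _ _ => ε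
    | 1 => fun _ _ => u.delta
    | _ => fun _ _ => 0

/-- A one-pass streaming algorithm: a program that is run before the stream, a program that is run
on each update, and a program that is run after the stream. -/
structure StreamAlg where
  init : Cmd
  update : Cmd
  finish : Cmd

/-- The updates `us` are processed one after the other, leading from the memory `σ` to `σ'`; each
of them takes at most `T` steps, and all memories on the way satisfy `ok`. -/
def Processes (ok : State → Prop) (T : ℕ) (c : Cmd) {n d : ℕ} (k : ℕ) (ε : ℝ) (ω : Tape) :
    List (Update n d) → State → State → Prop
  | [], σ, σ' => σ' = σ
  | u :: us, σ, σ' => ∃ τ, ComputesWithin ok T (updateInput k ε u) ω c σ τ ∧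
      Processes ok T c k ε ω us τ σ'

/-- On the stream `us` the algorithm `P` carries the memory `mid` at the end of the stream and
halts with the memory `out`.  The initialization, each update and the post-processing take at most
`T` steps each, and all memories on the way satisfy `ok`. -/
def StreamAlg.Runs (P : StreamAlg) (ok : State → Prop) (T : ℕ) {n d : ℕ} (k : ℕ) (ε : ℝ)
    (ω : Tape) (us : List (Update n d)) (mid out : State) : Prop :=
  ∃ start, ComputesWithin ok T (paramInput n d k ε) ω P.init State.blank start ∧
    Processes ok T P.update k ε ω us start mid ∧
    ComputesWithin ok T (paramInput n d k ε) ω P.finish mid out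

/-! The method is to sketch, enumerate and solve. Put q = ⌈1/ε⌉, δ = 1/(16q) and l = ⌈log₂(nk)⌉. The
best centers of a partition are its centroids. By averaging, every nonempty cluster contains 16q
points (with repetition) whose mean is so close to the centroid that replacing all centroids by such
means costs only a factor 1 + δ (`exists_sample_means`). Hence one of the n^(16kq) tuples of
samples, with every point moved to its nearest mean, gives a nearly optimal partition, and all
tuples can be tried.

The search sees only AT. It estimates a squared norm ‖x‖² (up to a fixed scale) from xT as a median
over groups of columns of sums of squares. The point is how few estimates have to be accurate. The
cost of a partition is half the sum, over ordered pairs of points in a common cluster, of the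
squared distance divided by the cluster size (`sum_pairs_eq`). The coefficients are nonnegative, so
accurate estimates for the n² differences of rows evaluate all partitions at once. To know that a
good candidate takes part in the comparison, the differences between rows and sample means are
needed for a single tuple only, which is fixed before T is drawn (`partCost_searchFin_le`). These
are at most 2(nk)² vectors independent of T, so O(log(nk)/ε²) columns suffice
(`prob_not_forall_estGood_le`). No third sketch is needed: w = 0.

The centers in ℝᵈ come from SA as a least squares solution C of SXC ≈ SA for the partition X that
was found. X depends on T only and is therefore fixed relative to S. The excess cost of C is
controlled by the normal equations as soon as S does not shrink the column space of X by more than a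
constant factor (`prob_not_lower_bound_le`) and nearly keeps X orthogonal to the residual
(`avg_sketchCorr_le`); both are combined in `prob_not_centers_good_le`. Only a lower bound on the
column space is needed. It follows from a Laplace transform estimate for the lower tail, a union
bound over integer grid points and a rounding argument.

All of this uses at most fourth moments of a row. So the columns of T and the rows of S may consist
of the centered values of random cubic polynomials modulo a prime p ≥ n + d + 5, which are four-wise
independent by the Vandermonde determinant (`cubic_bijective`). Four words describe such a row. The
streaming algorithm keeps these words and the two linear sketches, which are integral for integral
data.

The losses multiply to (1 + δ)⁴ / (1 - δ)² ≤ 1 + 16δ ≤ 1 + ε, and T and S each fail with probability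
at most 1/6.

The programs are verified in a calculus of total correctness, `wp`, that also tracks memory. If no
loop makes more than H iterations, a fixed program makes polynomially many steps in H
(`Cmd.cost_le_pow`); the power n^(16kq) in H comes from the enumeration. -/

/-! ## A program logic for the random access machine -/

/-- The surroundings of a run: inputs, tape, memory bounds and a bound `H` on the number of
iterations of every loop. -/
structure Env where
  inp : Inputs
  tape : Tape
  m : ℕ
  L : ℕ
  B : ℕ
  H : ℕ

def Env.Ok (E : Env) (σ : State) : Prop := σ.Fits E.m E.L E.B

/-- The largest number of steps of a program all of whose loops make at most `H` iterations. -/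
def Cmd.cost (H : ℕ) : Cmd → ℕ
  | .skip => 1
  | .setWord _ _ _ => 1
  | .setReal _ _ _ => 1
  | .draw _ _ _ => 1
  | .seq p q => 1 + p.cost H + q.cost H
  | .branch _ p q => 1 + p.cost H + q.cost H
  | .loop _ p => 1 + H * (1 + p.cost H)

/-- Boolean values and `Nat.beq` make `writesWord a = false` hold by `rfl` for concrete programs and
arrays; all frame arguments below rely on this. -/
def Cmd.writesWord : Cmd → ℕ → Bool
  | .skip, _ => false
  | .setWord a _ _, x => Nat.beq a x
  | .setReal _ _ _, _ => false
  | .draw a _ _, x => Nat.beq a x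
  | .seq p q, x => p.writesWord x || q.writesWord x
  | .branch _ p q, x => p.writesWord x || q.writesWord x
  | .loop _ p, x => p.writesWord x

def Cmd.writesReal : Cmd → ℕ → Bool
  | .skip, _ => false
  | .setWord _ _ _, _ => false
  | .setReal a _ _, x => Nat.beq a x
  | .draw _ _ _, _ => false
  | .seq p q, x => p.writesReal x || q.writesReal x
  | .branch _ p q, x => p.writesReal x || q.writesReal x
  | .loop _ p, x => p.writesReal x

/-- The polynomial depends on the program text only. This turns a bound on the iterations of single
loops into a time bound with absolute constants. -/
theorem Cmd.cost_le_pow (c : Cmd) : ∃ K D : ℕ, ∀ H, c.cost H ≤ K * (H + 1) ^ D := by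
  have key : ∀ (a b K K' D D' H : ℕ), a ≤ K * (H + 1) ^ D → b ≤ K' * (H + 1) ^ D' →
      1 + a + b ≤ (1 + K + K') * (H + 1) ^ (D + D') := by
    intro a b K K' D D' H ha hb
    have h1 : (H + 1) ^ D ≤ (H + 1) ^ (D + D') := Nat.pow_le_pow_right (by omega) (by omega)
    have h2 : (H + 1) ^ D' ≤ (H + 1) ^ (D + D') := Nat.pow_le_pow_right (by omega) (by omega)
    have h3 : 1 ≤ (H + 1) ^ (D + D') := Nat.one_le_pow _ _ (by omega)
    have h4 := Nat.mul_le_mul_left K h1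
    have h5 := Nat.mul_le_mul_left K' h2
    nlinarith
  induction c with
  | skip => exact ⟨1, 0, by simp [Cmd.cost]⟩
  | setWord a i v => exact ⟨1, 0, by simp [Cmd.cost]⟩
  | setReal a i v => exact ⟨1, 0, by simp [Cmd.cost]⟩
  | draw a i v => exact ⟨1, 0, by simp [Cmd.cost]⟩
  | seq p q hp hq =>
    obtain ⟨K, D, h⟩ := hp
    obtain ⟨K', D', h'⟩ := hq
    exact ⟨_, _, fun H => key _ _ _ _ _ _ _ (h H) (h' H)⟩
  | branch b p q hp hq =>
    obtain ⟨K, D, h⟩ := hp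
    obtain ⟨K', D', h'⟩ := hq
    exact ⟨_, _, fun H => key _ _ _ _ _ _ _ (h H) (h' H)⟩
  | loop b p hp =>
    obtain ⟨K, D, h⟩ := hp
    refine ⟨K + 2, D + 1, fun H => ?_⟩
    have h3 : 1 ≤ (H + 1) ^ D := Nat.one_le_pow _ _ (by omega)
    have h1 := h H
    have h4 : H * (1 + p.cost H) ≤ H * (1 + K * (H + 1) ^ D) :=
      Nat.mul_le_mul_left _ (by omega)
    simp only [Cmd.cost, pow_succ]
    nlinarith [Nat.zero_le (K * (H + 1) ^ D), Nat.zero_le (H * (H + 1) ^ D),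
      Nat.mul_le_mul_left H h3]

/-- The arrays that are not written by `c` are the same in `σ` and in `σ'`. -/
structure Frame (c : Cmd) (σ σ' : State) : Prop where
  word : ∀ a, c.writesWord a = false → σ'.word a = σ.word a
  real : ∀ a, c.writesReal a = false → σ'.real a = σ.real a

theorem Frame.refl (c : Cmd) (σ : State) : Frame c σ σ := ⟨fun _ _ => rfl, fun _ _ => rfl⟩

theorem Frame.trans {c : Cmd} {σ σ' σ'' : State} (h : Frame c σ σ') (h' : Frame c σ' σ'') :
    Frame c σ σ'' :=
  ⟨fun a ha => (h'.word a ha).trans (h.word a ha), fun a ha => (h'.real a ha).trans (h.real a ha)⟩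

theorem Frame.mono {c c' : Cmd} {σ σ' : State} (h : Frame c σ σ')
    (hw : ∀ a, c'.writesWord a = false → c.writesWord a = false)
    (hr : ∀ a, c'.writesReal a = false → c.writesReal a = false) : Frame c' σ σ' :=
  ⟨fun a ha => h.word a (hw a ha), fun a ha => h.real a (hr a ha)⟩

namespace State

@[simp] theorem setWord_real (σ : State) (a i v : ℕ) : (σ.setWord a i v).real = σ.real := rfl
@[simp] theorem setReal_word (σ : State) (a i : ℕ) (v : ℝ) : (σ.setReal a i v).word = σ.word := rfl
@[simp] theorem setWord_draws (σ : State) (a i v : ℕ) : (σ.setWord a i v).draws = σ.draws := rfl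
@[simp] theorem setReal_draws (σ : State) (a i : ℕ) (v : ℝ) :
    (σ.setReal a i v).draws = σ.draws := rfl

theorem setWord_word (σ : State) (a i v b j : ℕ) :
    (σ.setWord a i v).word b j = if b = a ∧ j = i then v else σ.word b j := by
  simp only [setWord, Function.update_apply]
  by_cases h : b = a <;> by_cases h' : j = i <;> simp [h, h']

theorem setReal_real (σ : State) (a i : ℕ) (v : ℝ) (b j : ℕ) :
    (σ.setReal a i v).real b j = if b = a ∧ j = i then v else σ.real b j := by
  simp only [setReal, Function.update_apply]
  by_cases h : b = a <;> by_cases h' : j = i <;> simp [h, h']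

@[simp] theorem setWord_word_self (σ : State) (a i v : ℕ) : (σ.setWord a i v).word a i = v := by
  simp [setWord_word]

@[simp] theorem setReal_real_self (σ : State) (a i : ℕ) (v : ℝ) :
    (σ.setReal a i v).real a i = v := by
  simp [setReal_real]

theorem setWord_word_of_ne (σ : State) {a b : ℕ} (i v : ℕ) (h : b ≠ a) :
    (σ.setWord a i v).word b = σ.word b := by
  simp [setWord, Function.update_of_ne h]

theorem setReal_real_of_ne (σ : State) {a b : ℕ} (i : ℕ) (v : ℝ) (h : b ≠ a) :
    (σ.setReal a i v).real b = σ.real b := by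
  simp [setReal, Function.update_of_ne h]

end State

/-- In `n` steps, all of them within the memory bounds, the machine gets from `x` to `y`. -/
def Env.Reach (E : Env) (n : ℕ) (x y : Config) : Prop :=
  (step E.inp E.tape)^[n] x = y ∧ ∀ i ≤ n, E.Ok ((step E.inp E.tape)^[i] x).2

theorem Env.Reach.trans {E : Env} {n n' : ℕ} {x y z : Config} (h : E.Reach n x y)
    (h' : E.Reach n' y z) : E.Reach (n + n') x z := by
  refine ⟨?_, fun i hi => ?_⟩
  · rw [add_comm, Function.iterate_add_apply, h.1, h'.1]
  · rcases le_total i n with hin | hin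
    · exact h.2 i hin
    · obtain ⟨j, rfl⟩ := Nat.exists_eq_add_of_le hin
      rw [add_comm n j, Function.iterate_add_apply, h.1]
      exact h'.2 j (by omega)

theorem Env.Reach.single {E : Env} {x y : Config} (h : step E.inp E.tape x = y) (hx : E.Ok x.2)
    (hy : E.Ok y.2) : E.Reach 1 x y := by
  refine ⟨by simpa using h, fun i hi => ?_⟩
  interval_cases i
  · simpa using hx
  · simpa [h] using hy

theorem Env.Reach.ok {E : Env} {n : ℕ} {x y : Config} (h : E.Reach n x y) : E.Ok y.2 := by
  have := h.2 n le_rfl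
  rwa [h.1] at this

/-- Total correctness with resource bounds: from a memory `σ` within the bounds, the program `c`
halts in a memory with property `Q`. -/
def wp (E : Env) (c : Cmd) (Q : State → Prop) (σ : State) : Prop :=
  E.Ok σ → ∀ K, ∃ n σ', n ≤ c.cost E.H ∧ E.Reach n (c :: K, σ) (K, σ') ∧ Frame c σ σ' ∧ Q σ'

/-! ### Proof rules for the basic commands and for loops. -/

section rules
variable {E : Env} {Q Q' : State → Prop} {σ : State}

theorem wp_ok {c : Cmd} (h : E.Ok σ → wp E c Q σ) : wp E c Q σ := fun hσ => h hσ hσ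

theorem wp.conseq {c : Cmd} (h : wp E c Q' σ)
    (hQ : ∀ σ', E.Ok σ' → Frame c σ σ' → Q' σ' → Q σ') : wp E c Q σ := by
  intro hσ K
  obtain ⟨n, σ', h1, h2, h3, h4⟩ := h hσ K
  exact ⟨n, σ', h1, h2, h3, hQ σ' h2.ok h3 h4⟩

theorem wp_skip (h : Q σ) : wp E .skip Q σ := fun hσ _ =>
  ⟨1, σ, le_rfl, .single rfl hσ hσ, .refl _ _, h⟩

theorem Env.Ok.setWord {a i v : ℕ} (hσ : E.Ok σ) (ha : a < E.m) (hi : i < E.L) (hv : v ≤ E.B) :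
    E.Ok (σ.setWord a i v) := by
  refine ⟨fun b j hb => ⟨?_, (hσ.1 b j hb).2⟩, fun b j => ?_⟩
  · rw [State.setWord_word, if_neg (by omega), (hσ.1 b j hb).1]
  · rw [State.setWord_word]
    split_ifs
    exacts [hv, hσ.2 b j]

theorem wp_setWord {a : ℕ} {i v : NExp} (ha : a < E.m) (hi : i.eval E.inp σ < E.L)
    (hv : v.eval E.inp σ ≤ E.B)
    (h : Q (σ.setWord a (i.eval E.inp σ) (v.eval E.inp σ))) : wp E (.setWord a i v) Q σ := by
  intro hσ K
  refine ⟨1, _, le_rfl, .single rfl hσ (hσ.setWord ha hi hv), ⟨fun b hb => ?_, fun b _ => rfl⟩, h⟩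
  exact State.setWord_word_of_ne _ _ _ fun hab => by simp [Cmd.writesWord, hab] at hb

theorem wp_setReal {a : ℕ} {i : NExp} {v : RExp} (ha : a < E.m) (hi : i.eval E.inp σ < E.L)
    (h : Q (σ.setReal a (i.eval E.inp σ) (v.eval E.inp σ))) : wp E (.setReal a i v) Q σ := by
  intro hσ K
  refine ⟨1, _, le_rfl, .single rfl hσ ?_, ⟨fun b _ => rfl, fun b hb => ?_⟩, h⟩
  · refine ⟨fun b j hb => ⟨(hσ.1 b j hb).1, ?_⟩, fun b j => hσ.2 b j⟩
    rw [State.setReal_real, if_neg (by omega), (hσ.1 b j hb).2]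
  · exact State.setReal_real_of_ne _ _ _ fun hab => by simp [Cmd.writesReal, hab] at hb

theorem wp_draw {a : ℕ} {i v : NExp} (ha : a < E.m) (hi : i.eval E.inp σ < E.L)
    (hv : v.eval E.inp σ ≤ E.B)
    (h : Q { σ.setWord a (i.eval E.inp σ) (E.tape (σ.draws, v.eval E.inp σ)) with
      draws := σ.draws + 1 }) : wp E (.draw a i v) Q σ := by
  intro hσ K
  refine ⟨1, _, le_rfl, .single rfl hσ ?_, ⟨fun b hb => ?_, fun b _ => rfl⟩, h⟩
  · exact hσ.setWord ha hi (by have := (E.tape (σ.draws, v.eval E.inp σ)).2; dsimp at this; omega)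
  · exact State.setWord_word_of_ne _ _ _ fun hab => by simp [Cmd.writesWord, hab] at hb

/-- Because `wp` quantifies over the remaining commands `K`, the first program can be run with `q ::
K` as its continuation. -/
theorem wp_seq {p q : Cmd} (h : wp E p (wp E q Q) σ) : wp E (.seq p q) Q σ := by
  intro hσ K
  obtain ⟨n, σ', h1, h2, h3, h4⟩ := h hσ (q :: K)
  obtain ⟨n', σ'', h1', h2', h3', h4'⟩ := h4 h2.ok K
  refine ⟨1 + n + n', σ'', ?_, ((Env.Reach.single rfl hσ hσ).trans h2).trans h2',
    (h3.mono ?_ ?_).trans (h3'.mono ?_ ?_), h4'⟩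
  · simp only [Cmd.cost]; omega
  all_goals intro a ha; simp_all [Cmd.writesWord, Cmd.writesReal]

/-- The rule of composition with an intermediate assertion. -/
theorem wp_seq' {p q : Cmd} (R : State → Prop) (h : wp E p R σ)
    (h' : ∀ σ', E.Ok σ' → Frame p σ σ' → R σ' → wp E q Q σ') : wp E (.seq p q) Q σ :=
  wp_seq (h.conseq h')

theorem wp_branch {b : BExp} {p q : Cmd} (h : b.Holds E.inp σ → wp E p Q σ)
    (h' : ¬ b.Holds E.inp σ → wp E q Q σ) : wp E (.branch b p q) Q σ := by
  intro hσ K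
  by_cases hb : b.Holds E.inp σ
  · obtain ⟨n, σ', h1, h2, h3, h4⟩ := h hb hσ K
    refine ⟨1 + n, σ', ?_, (Env.Reach.single ?_ hσ hσ).trans h2, h3.mono ?_ ?_, h4⟩
    · simp only [Cmd.cost]; omega
    · simp [step, hb]
    all_goals intro a ha; simp_all [Cmd.writesWord, Cmd.writesReal]
  · obtain ⟨n, σ', h1, h2, h3, h4⟩ := h' hb hσ K
    refine ⟨1 + n, σ', ?_, (Env.Reach.single ?_ hσ hσ).trans h2, h3.mono ?_ ?_, h4⟩
    · simp only [Cmd.cost]; omega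
    · simp [step, hb]
    all_goals intro a ha; simp_all [Cmd.writesWord, Cmd.writesReal]

/-- The rule for loops that make at most `N` iterations; `I i` holds after `i` iterations. -/
theorem wp_loop {b : BExp} {p : Cmd} (N : ℕ) (I : ℕ → State → Prop) (hN : N ≤ E.H) (h0 : I 0 σ)
    (hb : ∀ i σ', E.Ok σ' → Frame p σ σ' → I i σ' →
      (b.Holds E.inp σ' ∧ i < N ∧ wp E p (I (i + 1)) σ') ∨ (¬ b.Holds E.inp σ' ∧ Q σ')) :
    wp E (.loop b p) Q σ := by
  -- Induction on the number `r` of iterations that are still allowed; `i < N` in the continuing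
  -- case is what forces termination.
  have key : ∀ (r i : ℕ) (σ₁ : State), N - i = r → E.Ok σ₁ → Frame p σ σ₁ → I i σ₁ →
      ∀ K, ∃ n σ', n ≤ 1 + r * (1 + p.cost E.H) ∧ E.Reach n (.loop b p :: K, σ₁) (K, σ') ∧
        Frame p σ σ' ∧ Q σ' := by
    intro r
    induction r with
    | zero =>
      intro i σ₁ hr hok hf hI K
      rcases hb i σ₁ hok hf hI with h | h
      · omega
      · exact ⟨1, σ₁, by omega, .single (by simp [step, h.1]) hok hok, hf, h.2⟩
    | succ r ih =>
      intro i σ₁ hr hok hf hI K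
      rcases hb i σ₁ hok hf hI with h | h
      · obtain ⟨n, σ₂, h1, h2, h3, h4⟩ := h.2.2 hok (.loop b p :: K)
        obtain ⟨n', σ₃, h1', h2', h3', h4'⟩ := ih (i + 1) σ₂ (by omega) h2.ok (hf.trans h3) h4 K
        refine ⟨1 + n + n', σ₃, ?_,
          ((Env.Reach.single (by simp [step, h.1]) hok hok).trans h2).trans h2', h3', h4'⟩
        rw [Nat.add_one_mul]
        omega
      · exact ⟨1, σ₁, by omega, .single (by simp [step, h.1]) hok hok, hf, h.2⟩
  intro hσ K
  obtain ⟨n, σ', h1, h2, h3, h4⟩ := key N 0 σ rfl hσ (.refl _ _) h0 K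
  refine ⟨n, σ', h1.trans ?_, h2, ⟨h3.word, h3.real⟩, h4⟩
  simp only [Cmd.cost]
  gcongr

end rules

/-! ### Derived commands -/

/-- The word variable kept in cell `0` of the word array `a`. -/
abbrev NExp.var (a : ℕ) : NExp := .cell a (.lit 0)
/-- The real variable kept in cell `0` of the real array `a`. -/
abbrev RExp.var (a : ℕ) : RExp := .cell a (.lit 0)
abbrev Cmd.setN (a : ℕ) (v : NExp) : Cmd := .setWord a (.lit 0) v
abbrev Cmd.setR (a : ℕ) (v : RExp) : Cmd := .setReal a (.lit 0) v

/-- `for x < e do p` -/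
def Cmd.for (x : ℕ) (e : NExp) (p : Cmd) : Cmd :=
  .seq (.setN x (.lit 0))
    (.loop (.wordLt (.var x) e) (.seq p (.setN x (.add (.var x) (.lit 1)))))

/-- `acc := ∑ x < e, f` -/
def Cmd.sum (acc x : ℕ) (e : NExp) (f : RExp) : Cmd :=
  .seq (.setR acc (.ofWord (.lit 0))) (.for x e (.setR acc (.add (.var acc) f)))

/-! ### Counting loops and sums. -/

section rules
variable {E : Env} {Q : State → Prop} {σ : State}

/-- The bound `e` is evaluated anew before each iteration, so its value has to be stable. Advancing
the counter is itself a write to memory, which is why the invariant for `i + 1` is required after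
that write. -/
theorem wp_for {x : ℕ} {e : NExp} {p : Cmd} (N : ℕ) (I : ℕ → State → Prop) (hx : x < E.m)
    (hL : 0 < E.L) (hN : N ≤ E.H) (hB : N ≤ E.B)
    (h0 : I 0 (σ.setWord x 0 0))
    (he : ∀ i σ', E.Ok σ' → Frame (.for x e p) σ σ' → I i σ' → σ'.word x 0 = i →
      e.eval E.inp σ' = N)
    (hb : ∀ i < N, ∀ σ', E.Ok σ' → Frame (.for x e p) σ σ' → I i σ' → σ'.word x 0 = i →
      wp E p (fun σ'' => σ''.word x 0 = i ∧ I (i + 1) (σ''.setWord x 0 (i + 1))) σ')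
    (hQ : ∀ σ', E.Ok σ' → Frame (.for x e p) σ σ' → I N σ' → σ'.word x 0 = N → Q σ') :
    wp E (.for x e p) Q σ := by
  have hwx : ∀ (a i : ℕ) (σ : State), (Cmd.for x e p).writesWord a = false →
      (σ.setWord x 0 i).word a = σ.word a := by
    intro a i σ ha
    apply State.setWord_word_of_ne
    rintro rfl
    simp [Cmd.for, Cmd.writesWord] at ha
  refine wp_seq (wp_setWord hx hL (Nat.zero_le _) ?_)
  refine wp_loop N (fun i σ' => i ≤ N ∧ I i σ' ∧ σ'.word x 0 = i) hN ⟨Nat.zero_le _, h0, by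
    simp [NExp.eval]⟩ ?_
  rintro i σ₁ hok hf ⟨hi, hI, hxi⟩
  have hf' : Frame (.for x e p) σ σ₁ := by
    refine ⟨fun a ha => (hf.word a ?_).trans (hwx a _ _ ha), fun a ha => hf.real a ?_⟩
    · exact ((Bool.or_eq_false_iff.1 ha).2)
    · simpa [Cmd.for, Cmd.writesReal] using ha
  have he' := he i σ₁ hok hf' hI hxi
  rcases hi.lt_or_eq with hi | rfl
  · refine Or.inl ⟨by simpa [BExp.Holds, NExp.eval, hxi, he'], hi, wp_seq ?_⟩
    refine (hb i hi σ₁ hok hf' hI hxi).conseq ?_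
    rintro σ₂ - - ⟨h1, h2⟩
    refine wp_setWord hx hL (by simp [NExp.eval, h1]; omega) ⟨hi, ?_, ?_⟩ <;>
      simp [NExp.eval, h1, h2]
  · exact Or.inr ⟨by simp [BExp.Holds, NExp.eval, hxi, he'], hQ σ₁ hok hf' hI hxi⟩

theorem wp_sum {acc x : ℕ} {e : NExp} {f : RExp} (N : ℕ) (g : ℕ → ℝ) (hx : x < E.m)
    (hacc : acc < E.m) (hL : 0 < E.L) (hN : N ≤ E.H) (hB : N ≤ E.B)
    (he : ∀ σ', Frame (.sum acc x e f) σ σ' → e.eval E.inp σ' = N)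
    (hf : ∀ i < N, ∀ σ', E.Ok σ' → Frame (.sum acc x e f) σ σ' → σ'.word x 0 = i →
      f.eval E.inp σ' = g i)
    (hQ : ∀ σ', E.Ok σ' → Frame (.sum acc x e f) σ σ' →
      σ'.real acc 0 = ∑ i ∈ Finset.range N, g i → Q σ') :
    wp E (.sum acc x e f) Q σ := by
  have key : ∀ σ', Frame (.for x e (.setR acc (.add (.var acc) f)))
      (σ.setReal acc 0 ((0 : ℕ) : ℝ)) σ' → Frame (.sum acc x e f) σ σ' := by
    intro σ' h
    refine ⟨fun a ha => h.word a (by simpa [Cmd.sum, Cmd.writesWord] using ha), fun a ha => ?_⟩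
    have h1 : acc ≠ a := by rintro rfl; simp [Cmd.sum, Cmd.writesReal] at ha
    rw [h.real a (by simpa [Cmd.for, Cmd.writesReal, ← Bool.not_eq_true] using h1), State.setReal_real_of_ne _ _ _ h1.symm]
  refine wp_seq (wp_setReal hacc hL ?_)
  refine wp_for N (fun i σ' => σ'.real acc 0 = ∑ i ∈ Finset.range i, g i) hx hL hN hB ?_ ?_ ?_ ?_
  · simp [RExp.eval, NExp.eval]
  · exact fun i σ' _ h _ _ => he σ' (key σ' h)
  · intro i hi σ' hok h hI hxi
    refine wp_setReal hacc hL ⟨by simpa using hxi, ?_⟩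
    have := hf i hi σ' hok (key σ' h) hxi
    simp [RExp.eval, NExp.eval, Finset.sum_range_succ, hI, this]
  · exact fun σ' hok h hI _ => hQ σ' hok (key σ' h) hI

theorem wp.computesWithin {c : Cmd} (h : wp E c Q σ) (hσ : E.Ok σ) {T : ℕ}
    (hT : c.cost E.H ≤ T) : ∃ σ', ComputesWithin (State.Fits E.m E.L E.B) T E.inp E.tape c σ σ' ∧
      E.Ok σ' ∧ Frame c σ σ' ∧ Q σ' := by
  obtain ⟨n, σ', h1, h2, h3, h4⟩ := h hσ []
  exact ⟨σ', ⟨n, h1.trans hT, h2.1, h2.2⟩, h2.ok, h3, h4⟩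

end rules

/-! ## Parameters of the algorithm -/

/-- number of sample points per center -/
def numSamples (q : ℕ) : ℕ := 16 * q
/-- number of rows in a group of the sketch -/
def groupSize (q : ℕ) : ℕ := 32768 * (q * q)
-- A median over `G` groups fails with probability at most 4⁻ᴳ; with `8 * l` groups this is (2 ^
-- l)⁻¹⁶, enough for a union bound over 2(nk)² vectors.
def numGroups (l : ℕ) : ℕ := 8 * l
/-- number of columns of `T` -/
def widthT (q l : ℕ) : ℕ := numGroups l * groupSize q
/-- number of rows of `S` -/
def heightS (k q : ℕ) : ℕ := 3072 * (k * q)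

namespace Prog

abbrev samples : NExp := .mul (.lit 16) (.var 1)
abbrev group : NExp := .mul (.lit 32768) (.mul (.var 1) (.var 1))
abbrev groups : NExp := .mul (.lit 8) (.var 2)
abbrev width : NExp := .mul groups group
abbrev height : NExp := .mul (.lit 3072) (.mul (.input 2) (.var 1))
/-- The word `1` if `x = y`, and `0` otherwise. -/
abbrev eqInd (x y : NExp) : NExp := .sub (.lit 1) (.add (.sub x y) (.sub y x))

end Prog

/-- The parameters, and bounds on memory and time that suffice for the programs below. -/
structure Setup (E : Env) (n d k q l : ℕ) : Prop where
  n_eq : E.inp.word 0 = n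
  d_eq : E.inp.word 1 = d
  k_eq : E.inp.word 2 = k
  n_pos : 1 ≤ n
  d_pos : 1 ≤ d
  k_pos : 1 ≤ k
  q_pos : 1 ≤ q
  arrays : 32 ≤ E.m
  L_pos : 1 ≤ E.L
  L_le_B : E.L ≤ E.B
  L_le_H : E.L ≤ E.H
  nt_le : n * widthT q l ≤ E.L
  b_le : groupSize q ≤ E.L
  G_le : numGroups l ≤ E.L
  n_le : n ≤ E.L
  sd_le : heightS k q * d ≤ E.L
  sk_le : heightS k q * k ≤ E.L
  kM_le : k * numSamples q ≤ E.L
  kd_le : k * d ≤ E.L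
  kk_le : k * k ≤ E.L
  pow_le : n ^ (k * numSamples q) ≤ E.H

namespace Setup
variable {E : Env} {n d k q l : ℕ}

theorem t_le (h : Setup E n d k q l) : widthT q l ≤ E.L :=
  (Nat.le_mul_of_pos_left _ h.n_pos).trans h.nt_le
theorem s_le (h : Setup E n d k q l) : heightS k q ≤ E.L :=
  (Nat.le_mul_of_pos_right _ h.d_pos).trans h.sd_le
theorem d_le (h : Setup E n d k q l) : d ≤ E.L :=
  (Nat.le_mul_of_pos_left _ h.k_pos).trans h.kd_le
theorem k_le (h : Setup E n d k q l) : k ≤ E.L :=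
  (Nat.le_mul_of_pos_left _ h.k_pos).trans h.kk_le
theorem M_le (h : Setup E n d k q l) : numSamples q ≤ E.L :=
  (Nat.le_mul_of_pos_left _ h.k_pos).trans h.kM_le

end Setup

/-- The arrays that hold parameters, random coefficients and sketches agree. -/
structure Prot (σ σ' : State) : Prop where
  w1 : σ'.word 1 = σ.word 1
  w2 : σ'.word 2 = σ.word 2
  w3 : σ'.word 3 = σ.word 3
  w4 : σ'.word 4 = σ.word 4
  r1 : σ'.real 1 = σ.real 1
  r2 : σ'.real 2 = σ.real 2

theorem Prot.refl (σ : State) : Prot σ σ := ⟨rfl, rfl, rfl, rfl, rfl, rfl⟩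

theorem Prot.trans {σ σ' σ'' : State} (h : Prot σ σ') (h' : Prot σ' σ'') : Prot σ σ'' :=
  ⟨h'.w1.trans h.w1, h'.w2.trans h.w2, h'.w3.trans h.w3, h'.w4.trans h.w4, h'.r1.trans h.r1,
    h'.r2.trans h.r2⟩

/-- What the program can read: the parameters `q` and `l`, the sketches `A T` and `S A` and the
sketching matrix `S`, given by expressions that depend on protected arrays only. -/
def Data (E : Env) (eA eS eSA : NExp → NExp → RExp) (q l : ℕ) (fA fS fSA : ℕ → ℕ → ℝ)
    (σ : State) : Prop :=
  ∀ σ', Prot σ σ' → σ'.word 1 0 = q ∧ σ'.word 2 0 = l ∧ ∀ x y,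
    (eA x y).eval E.inp σ' = fA (x.eval E.inp σ') (y.eval E.inp σ') ∧
    (eS x y).eval E.inp σ' = fS (x.eval E.inp σ') (y.eval E.inp σ') ∧
    (eSA x y).eval E.inp σ' = fSA (x.eval E.inp σ') (y.eval E.inp σ')

section Data
variable {E : Env} {eA eS eSA : NExp → NExp → RExp} {q l : ℕ} {fA fS fSA : ℕ → ℕ → ℝ}
  {σ σ' : State}

theorem Data.mono (h : Data E eA eS eSA q l fA fS fSA σ) (hp : Prot σ σ') :
    Data E eA eS eSA q l fA fS fSA σ' := fun σ'' h' => h σ'' (hp.trans h')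
theorem Data.q_eq (h : Data E eA eS eSA q l fA fS fSA σ) : σ.word 1 0 = q := (h σ (.refl _)).1
theorem Data.l_eq (h : Data E eA eS eSA q l fA fS fSA σ) : σ.word 2 0 = l := (h σ (.refl _)).2.1
theorem Data.evalA (h : Data E eA eS eSA q l fA fS fSA σ) (x y : NExp) :
    (eA x y).eval E.inp σ = fA (x.eval E.inp σ) (y.eval E.inp σ) := ((h σ (.refl _)).2.2 x y).1
theorem Data.evalS (h : Data E eA eS eSA q l fA fS fSA σ) (x y : NExp) :
    (eS x y).eval E.inp σ = fS (x.eval E.inp σ) (y.eval E.inp σ) := ((h σ (.refl _)).2.2 x y).2.1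
theorem Data.evalSA (h : Data E eA eS eSA q l fA fS fSA σ) (x y : NExp) :
    (eSA x y).eval E.inp σ = fSA (x.eval E.inp σ) (y.eval E.inp σ) := ((h σ (.refl _)).2.2 x y).2.2

end Data

/-! ## Medians of squared norms -/

/-- After the first `i` of the values `z 0, …, z (G - 1)` have been inspected: the smallest of them
that at least half of all values do not exceed (and the sum of all values if there is none). -/
noncomputable def medianAux (z : ℕ → ℝ) (G : ℕ) : ℕ → ℝ
  | 0 => ∑ g ∈ Finset.range G, z g
  | i + 1 => if G ≤ 2 * ((Finset.range G).filter fun g => z g ≤ z i).card ∧ z i < medianAux z G i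
      then z i else medianAux z G i

noncomputable def groupSum (b : ℕ) (x : ℕ → ℝ) (g : ℕ) : ℝ :=
  ∑ r ∈ Finset.range b, x (g * b + r) * x (g * b + r)

/-- The median over `G` groups of the sums of squares of the `b` entries of a group. -/
noncomputable def sqNormEst (G b : ℕ) (x : ℕ → ℝ) : ℝ := medianAux (groupSum b x) G G

theorem medianAux_congr {z z' : ℕ → ℝ} {G : ℕ} (h : ∀ g < G, z g = z' g) :
    ∀ i ≤ G, medianAux z G i = medianAux z' G i := by
  intro i
  induction i with
  | zero => exact fun _ => Finset.sum_congr rfl fun g hg => h g (Finset.mem_range.1 hg)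
  | succ i ih =>
    intro hi
    have : ((Finset.range G).filter fun g => z g ≤ z i) =
        (Finset.range G).filter fun g => z' g ≤ z' i :=
      Finset.filter_congr fun g hg => by rw [h g (Finset.mem_range.1 hg), h i hi]
    rw [medianAux, medianAux, this, h i hi, ih (by omega)]

theorem sqNormEst_congr {x x' : ℕ → ℝ} {G b : ℕ} (h : ∀ c < G * b, x c = x' c) :
    sqNormEst G b x = sqNormEst G b x' := by
  refine medianAux_congr (fun g hg => Finset.sum_congr rfl fun r hr => ?_) G le_rfl
  have hr' := Finset.mem_range.1 hr
  have : g * b + r < G * b := by nlinarith [Nat.mul_le_mul_right b (Nat.succ_le_of_lt hg)]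
  rw [h _ this]

namespace Prog

/-- Selecting the median by ranks avoids sorting, at the price of a number of comparisons quadratic
in the number of groups. -/
def rankCmd : Cmd :=
  .seq (.setN 15 (.lit 0)) (.for 14 groups
    (.branch (.realLt (.cell 4 (.var 12)) (.cell 4 (.var 14))) .skip
      (.setN 15 (.add (.var 15) (.lit 1)))))

def medianCmd : Cmd :=
  .seq (.for 12 groups (.seq
    (.sum 11 13 group (.mul (.cell 3 (.add (.mul (.var 12) group) (.var 13)))
      (.cell 3 (.add (.mul (.var 12) group) (.var 13)))))
    (.setReal 4 (.var 12) (.var 11))))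
  (.seq (.sum 5 12 groups (.cell 4 (.var 12)))
  (.for 12 groups (.seq rankCmd
    (.branch (.and (.not (.wordLt (.mul (.lit 2) (.var 15)) groups))
      (.realLt (.cell 4 (.var 12)) (.var 5)))
      (.setR 5 (.cell 4 (.var 12))) .skip))))

end Prog

/-! ### Correctness of the median program. -/

section median
variable {E : Env} {n d k q l : ℕ} {σ : State}

theorem eval_group (hq : σ.word 1 0 = q) : Prog.group.eval E.inp σ = groupSize q := by
  simp [NExp.eval, hq, groupSize]
theorem eval_groups (hl : σ.word 2 0 = l) : Prog.groups.eval E.inp σ = numGroups l := by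
  simp [NExp.eval, hl, numGroups]
theorem eval_width (hq : σ.word 1 0 = q) (hl : σ.word 2 0 = l) :
    Prog.width.eval E.inp σ = widthT q l := by
  simp [NExp.eval, hl, hq, widthT, numGroups, groupSize]
theorem eval_samples (hq : σ.word 1 0 = q) : Prog.samples.eval E.inp σ = numSamples q := by
  simp [NExp.eval, hq, numSamples]
theorem eval_height (h : Setup E n d k q l) (hq : σ.word 1 0 = q) :
    Prog.height.eval E.inp σ = heightS k q := by
  simp [NExp.eval, hq, heightS, h.k_eq]

theorem wp_rankCmd (h : Setup E n d k q l) (hl : σ.word 2 0 = l) :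
    wp E Prog.rankCmd (fun σ' => σ'.word 15 0 = ((Finset.range (numGroups l)).filter
      fun g => σ.real 4 g ≤ σ.real 4 (σ.word 12 0)).card) σ := by
  have hm := h.arrays
  refine wp_seq (wp_setWord (by omega) h.L_pos (Nat.zero_le _) ?_)
  refine wp_for (numGroups l) (fun i σ' => σ'.word 15 0 =
    ((Finset.range i).filter fun g => σ.real 4 g ≤ σ.real 4 (σ.word 12 0)).card) (by omega) h.L_pos
    (h.G_le.trans h.L_le_H) (h.G_le.trans h.L_le_B) ?_ ?_ ?_ ?_
  · simp [State.setWord_word, NExp.eval]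
  · intro i σ' _ hf _ _
    exact eval_groups ((congrFun (hf.word 2 rfl) 0).trans hl)
  · intro i hi σ' hok hf hI hx
    have e1 : σ'.real 4 = σ.real 4 := hf.real 4 rfl
    have e2 : σ'.word 12 = σ.word 12 := hf.word 12 rfl
    refine wp_branch (fun hb => wp_skip ?_) (fun hb => wp_setWord (by omega) h.L_pos ?_ ?_)
    · simp only [BExp.Holds, RExp.eval, NExp.eval, e1, e2, hx] at hb
      refine ⟨hx, ?_⟩
      simp [State.setWord_word, hI, Finset.range_add_one, Finset.filter_insert, not_le.2 hb]
    · have h1 := Finset.card_filter_le (Finset.range i)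
        fun g => σ.real 4 g ≤ σ.real 4 (σ.word 12 0)
      have h2 := h.G_le
      have h3 := h.L_le_B
      simp only [Finset.card_range] at h1
      simp [NExp.eval, hI]
      omega
    · simp only [BExp.Holds, RExp.eval, NExp.eval, e1, e2, hx, not_lt] at hb
      refine ⟨by simpa [State.setWord_word] using hx, ?_⟩
      simp [State.setWord_word, hI, NExp.eval, Finset.range_add_one, Finset.filter_insert, hb]
  · intro σ' _ _ hI _
    exact hI

theorem wp_medianCmd (h : Setup E n d k q l) (hq : σ.word 1 0 = q) (hl : σ.word 2 0 = l) :
    wp E Prog.medianCmd (fun σ' =>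
      σ'.real 5 0 = sqNormEst (numGroups l) (groupSize q) (σ.real 3)) σ := by
  have hm := h.arrays
  have hGH := h.G_le.trans h.L_le_H
  have hGB := h.G_le.trans h.L_le_B
  refine wp_seq' (fun σ' => ∀ g < numGroups l, σ'.real 4 g = groupSum (groupSize q) (σ.real 3) g)
    ?_ ?_
  · refine wp_for (numGroups l) (fun i σ' => ∀ g < i, σ'.real 4 g =
      groupSum (groupSize q) (σ.real 3) g) (by omega) h.L_pos hGH hGB ?_ ?_ ?_ ?_
    · intro g hg; omega
    · intro i σ' _ hf _ _
      exact eval_groups ((congrFun (hf.word 2 rfl) 0).trans hl)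
    · intro i hi σ' hok hf hI hx
      have hq' : σ'.word 1 0 = q := (congrFun (hf.word 1 rfl) 0).trans hq
      refine wp_seq' (fun σ'' => σ''.real 11 0 = groupSum (groupSize q) (σ.real 3) i) ?_ ?_
      · refine wp_sum (groupSize q) (fun r => σ.real 3 (i * groupSize q + r) *
          σ.real 3 (i * groupSize q + r)) (by omega) (by omega) h.L_pos (h.b_le.trans h.L_le_H)
          (h.b_le.trans h.L_le_B) ?_ ?_ ?_
        · intro σ'' hf'
          exact eval_group ((congrFun (hf'.word 1 rfl) 0).trans hq')
        · intro r hr σ'' hok' hf' hx'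
          have e1 : σ''.real 3 = σ.real 3 := (hf'.real 3 rfl).trans (hf.real 3 rfl)
          have e2 : σ''.word 12 0 = i := (congrFun (hf'.word 12 rfl) 0).trans hx
          have e3 : σ''.word 1 0 = q := (congrFun (hf'.word 1 rfl) 0).trans hq'
          simp [RExp.eval, NExp.eval, e1, e2, e3, hx', groupSize]
        · intro σ'' _ _ he
          exact he
      · intro σ'' hok' hf' he
        have e2 : σ''.word 12 0 = i := (congrFun (hf'.word 12 rfl) 0).trans hx
        have e4 : σ''.real 4 = σ'.real 4 := hf'.real 4 rfl
        have hGL := h.G_le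
        refine wp_setReal (by omega) (by simp [NExp.eval, e2]; omega) ⟨by simpa using e2, ?_⟩
        intro g hg
        simp only [State.setWord_real, State.setReal_real, NExp.eval, e2, RExp.eval, he, e4,
          true_and]
        split_ifs with h1
        · rw [h1]
        · exact hI g (by omega)
    · intro σ' _ _ hI _
      exact hI
  · intro σ₁ hok₁ hf₁ hz
    have hl₁ : σ₁.word 2 0 = l := (congrFun (hf₁.word 2 rfl) 0).trans hl
    refine wp_seq' (fun σ' => σ'.real 5 0 = medianAux (σ₁.real 4) (numGroups l) 0) ?_ ?_
    · refine wp_sum (numGroups l) (σ₁.real 4) (by omega) (by omega) h.L_pos hGH hGB ?_ ?_ ?_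
      · intro σ' hf
        exact eval_groups ((congrFun (hf.word 2 rfl) 0).trans hl₁)
      · intro i hi σ' _ hf hx
        have e : σ'.real 4 = σ₁.real 4 := hf.real 4 rfl
        simp [RExp.eval, NExp.eval, hx, e]
      · intro σ' _ _ he
        exact he
    · intro σ₂ hok₂ hf₂ h5
      have e₂ : σ₂.real 4 = σ₁.real 4 := hf₂.real 4 rfl
      have hl₂ : σ₂.word 2 0 = l := (congrFun (hf₂.word 2 rfl) 0).trans hl₁
      refine wp_for (numGroups l) (fun i σ' => σ'.real 5 0 =
        medianAux (σ₁.real 4) (numGroups l) i) (by omega) h.L_pos hGH hGB ?_ ?_ ?_ ?_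
      · simpa using h5
      · intro i σ' _ hf _ _
        exact eval_groups ((congrFun (hf.word 2 rfl) 0).trans hl₂)
      · intro i hi σ' hok hf hI hx
        have hl' : σ'.word 2 0 = l := (congrFun (hf.word 2 rfl) 0).trans hl₂
        have e4 : σ'.real 4 = σ₁.real 4 := (hf.real 4 rfl).trans e₂
        refine wp_seq' _ (wp_rankCmd h hl') ?_
        intro σ'' hok' hf' hc
        have e4' : σ''.real 4 = σ₁.real 4 := (hf'.real 4 rfl).trans e4
        have e2 : σ''.word 12 0 = i := (congrFun (hf'.word 12 rfl) 0).trans hx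
        have el : σ''.word 2 0 = l := (congrFun (hf'.word 2 rfl) 0).trans hl'
        have e5 : σ''.real 5 0 = medianAux (σ₁.real 4) (numGroups l) i :=
          (congrFun (hf'.real 5 rfl) 0).trans hI
        rw [e4, hx] at hc
        refine wp_branch (fun hb => wp_setReal (by omega) h.L_pos ⟨by simpa using e2, ?_⟩)
          (fun hb => wp_skip ⟨e2, ?_⟩)
        · have hb' : numGroups l ≤ 2 * ((Finset.range (numGroups l)).filter
              fun g => σ₁.real 4 g ≤ σ₁.real 4 i).card ∧
              σ₁.real 4 i < medianAux (σ₁.real 4) (numGroups l) i := by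
            simpa [BExp.Holds, NExp.eval, RExp.eval, el, e2, e4', e5, hc, numGroups] using hb
          rw [medianAux, if_pos hb']
          simp [NExp.eval, RExp.eval, e2, e4']
        · have hb' : ¬ (numGroups l ≤ 2 * ((Finset.range (numGroups l)).filter
              fun g => σ₁.real 4 g ≤ σ₁.real 4 i).card ∧
              σ₁.real 4 i < medianAux (σ₁.real 4) (numGroups l) i) := by
            simpa [BExp.Holds, NExp.eval, RExp.eval, el, e2, e4', e5, hc, numGroups] using hb
          rw [medianAux, if_neg hb']
          simpa using e5
      · intro σ' _ _ hI _
        rw [hI, sqNormEst]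
        exact medianAux_congr hz _ le_rfl

end median

/-! ## Exhaustive search over sampled centroids -/

/-- The first index at which `e 0, …, e (j - 1)` is smallest. -/
noncomputable def argminAux (e : ℕ → ℝ) : ℕ → ℕ
  | 0 => 0
  | j + 1 => if e j < e (argminAux e j) then j else argminAux e j

/-- The digit of `v` in base `n` at position `x`. -/
def digit (n v x : ℕ) : ℕ := v / n ^ x % n

theorem digit_lt {n : ℕ} (hn : 0 < n) (v x : ℕ) : digit n v x < n := Nat.mod_lt _ hn

/-- Maximal digits below position `K` are the situation in which adding 1 carries into position `K`.
-/
theorem mod_pow_of_digit {n v K : ℕ} (hn : 0 < n) (h : ∀ x < K, digit n v x = n - 1) :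
    v % n ^ K = n ^ K - 1 := by
  induction K with
  | zero => simp [Nat.mod_one]
  | succ K ih =>
    have h1 := h K (by omega)
    rw [digit] at h1
    rw [Nat.mod_pow_succ, ih fun x hx => h x (by omega), h1, pow_succ]
    have := Nat.one_le_pow K n hn
    obtain ⟨m, rfl⟩ : ∃ m, n = m + 1 := ⟨n - 1, by omega⟩
    simp only [Nat.add_sub_cancel, Nat.mul_add, Nat.mul_one]
    omega

theorem succ_eq_pow_of_digit {n v K : ℕ} (hn : 0 < n) (hv : v < n ^ K)
    (h : ∀ x < K, digit n v x = n - 1) : v + 1 = n ^ K := by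
  have := mod_pow_of_digit hn h
  rw [Nat.mod_eq_of_lt hv] at this
  omega

/-- The carry: v + 1 = nᴷ (v / nᴷ + 1), so the low digits vanish, and the higher ones are those of v
/ nᴷ + 1, whose last digit does not overflow. -/
theorem digit_succ {n v K : ℕ} (hn : 0 < n) (h : ∀ x < K, digit n v x = n - 1)
    (hK : digit n v K + 1 < n) (x : ℕ) :
    digit n (v + 1) x = if x < K then 0 else if x = K then digit n v K + 1 else digit n v x := by
  have h1 := mod_pow_of_digit hn h
  set w := v / n ^ K with hw
  have hp := Nat.one_le_pow K n hn
  have h2 : v + 1 = n ^ K * (w + 1) := by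
    have := Nat.div_add_mod v (n ^ K)
    rw [mul_add, mul_one, hw]
    omega
  have hdK : digit n v K = w % n := rfl
  have hw1 : (w + 1) % n = w % n + 1 := by
    rw [Nat.add_mod, Nat.mod_eq_of_lt (a := 1) (by omega), Nat.mod_eq_of_lt (by omega)]
  split_ifs with hx hx'
  · rw [digit, h2]
    obtain ⟨c, rfl⟩ := Nat.exists_eq_add_of_lt hx
    rw [show x + c + 1 = x + (c + 1) by ring, pow_add, mul_assoc,
      Nat.mul_div_cancel_left _ (Nat.pow_pos hn), pow_succ', mul_assoc, Nat.mul_mod_right]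
  · rw [hx', digit, h2, Nat.mul_div_cancel_left _ (Nat.pow_pos hn), hw1, hdK]
  · obtain ⟨c, rfl⟩ := Nat.exists_eq_add_of_lt (show K < x by omega)
    have e1 : (w + 1) / n = w / n := by
      rw [Nat.succ_div, if_neg, add_zero]
      intro hd
      rw [Nat.dvd_iff_mod_eq_zero] at hd
      omega
    rw [digit, digit, h2, show K + c + 1 = K + (1 + c) by ring, pow_add n K, ← Nat.div_div_eq_div_mul,
      ← Nat.div_div_eq_div_mul, Nat.mul_div_cancel_left _ (Nat.pow_pos hn), ← hw, pow_add, pow_one,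
      ← Nat.div_div_eq_div_mul, ← Nat.div_div_eq_div_mul, e1]

/-- Row `i` minus the centroid of the `j`-th group of `M` rows that is described by the digits of
`v`. -/
noncomputable def centroidDiff (fA : ℕ → ℕ → ℝ) (n M v i j : ℕ) (c : ℕ) : ℝ :=
  fA i c - (∑ u ∈ Finset.range M, fA (digit n v (j * M + u)) c) / M

noncomputable def centroidEst (q l : ℕ) (fA : ℕ → ℕ → ℝ) (n v i j : ℕ) : ℝ :=
  sqNormEst (numGroups l) (groupSize q) (centroidDiff fA n (numSamples q) v i j)

/-- The clustering that assigns all points to the sampled centroids that seem to be nearest. -/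
noncomputable def candidate (q l : ℕ) (fA : ℕ → ℕ → ℝ) (n k v i : ℕ) : ℕ :=
  argminAux (centroidEst q l fA n v i) k

noncomputable def pairEst (q l : ℕ) (fA : ℕ → ℕ → ℝ) (i i' : ℕ) : ℝ :=
  sqNormEst (numGroups l) (groupSize q) fun c => fA i c - fA i' c

noncomputable def clusterSize (n : ℕ) (f : ℕ → ℕ) (i : ℕ) : ℝ :=
  ∑ i' ∈ Finset.range n, if f i = f i' then 1 else 0

noncomputable def costTerm (q l : ℕ) (fA : ℕ → ℕ → ℝ) (n : ℕ) (f : ℕ → ℕ) (i i' : ℕ) : ℝ :=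
  (if f i = f i' then 1 else 0) * pairEst q l fA i i' / clusterSize n f i

/-- An estimate (up to a constant factor) of the cost of the clustering `f`. -/
noncomputable def costEst (q l : ℕ) (fA : ℕ → ℕ → ℝ) (n : ℕ) (f : ℕ → ℕ) : ℝ :=
  ∑ i ∈ Finset.range n, ∑ i' ∈ Finset.range n, costTerm q l fA n f i i'

noncomputable def candidateCost (q l : ℕ) (fA : ℕ → ℕ → ℝ) (n k v : ℕ) : ℝ :=
  costEst q l fA n (candidate q l fA n k v)

/-- The numbers below `n ^ (k * numSamples q)` are read in base `n`, so they run through all choices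
of `numSamples q` points for each of the `k` centers. -/
noncomputable def searchResult (q l : ℕ) (fA : ℕ → ℕ → ℝ) (n k : ℕ) : ℕ → ℕ :=
  candidate q l fA n k (argminAux (candidateCost q l fA n k) (n ^ (k * numSamples q)))

namespace Prog

def centroidCmd (eA : NExp → NExp → RExp) : Cmd :=
  .seq (.for 17 width (.seq
    (.sum 11 18 samples (eA (.cell 5 (.add (.mul (.var 11) samples) (.var 18))) (.var 17)))
    (.setReal 3 (.var 17)
      (.sub (eA (.var 10) (.var 17)) (.div (.var 11) (.ofWord samples))))))
  medianCmd

def takeCmd : Cmd := .seq (.setWord 6 (.var 10) (.var 11)) (.setR 6 (.var 5))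

def assignCmd (eA : NExp → NExp → RExp) : Cmd :=
  .for 10 (.input 0) (.for 11 (.input 2) (.seq (centroidCmd eA)
    -- For center 0 the stored minimum is left over from the previous point, so it is overwritten
    -- without comparison.
    (.branch (.and (.wordLt (.lit 0) (.var 11)) (.not (.realLt (.var 5) (.var 6)))) .skip takeCmd)))

abbrev sameInd : NExp := eqInd (.cell 6 (.var 10)) (.cell 6 (.var 19))

def costCmd (eA : NExp → NExp → RExp) : Cmd :=
  .seq (.setR 7 (.ofWord (.lit 0)))
  (.for 10 (.input 0) (.seq (.sum 14 19 (.input 0) (.ofWord sameInd))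
    (.for 19 (.input 0) (.seq
      (.for 17 width (.setReal 3 (.var 17) (.sub (eA (.var 10) (.var 17)) (eA (.var 19) (.var 17)))))
      (.seq medianCmd
        (.setR 7 (.add (.var 7) (.div (.mul (.ofWord sameInd) (.var 5)) (.var 14)))))))))

/-- Cell 0 of word array 8 is a flag that tells whether a best candidate has been stored at all; the
initial real value 0 must not be taken for a cost. -/
def saveCmd : Cmd :=
  .branch (.and (.wordLt (.lit 0) (.var 8)) (.not (.realLt (.var 7) (.var 8)))) .skip
    (.seq (.setR 8 (.var 7)) (.seq (.setN 8 (.lit 1))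
      (.for 10 (.input 0) (.setWord 0 (.var 10) (.cell 6 (.var 10))))))

abbrev numDigits : NExp := .mul (.input 2) samples

/-- A counter in base `n`: trailing digits equal to `n - 1` are reset and the next one is increased.
If there is no next one, cell 0 of word array 7 signals the end of the search. -/
def nextCmd : Cmd :=
  .seq (.setN 21 (.lit 0)) (.seq
    (.loop (.and (.wordLt (.var 21) numDigits)
        (.not (.wordLt (.add (.cell 5 (.var 21)) (.lit 1)) (.input 0))))
      (.seq (.setWord 5 (.var 21) (.lit 0)) (.setN 21 (.add (.var 21) (.lit 1)))))
    (.branch (.wordLt (.var 21) numDigits)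
      (.setWord 5 (.var 21) (.add (.cell 5 (.var 21)) (.lit 1))) (.setN 7 (.lit 1))))

def searchCmd (eA : NExp → NExp → RExp) : Cmd :=
  .loop (.wordLt (.var 7) (.lit 1)) (.seq (assignCmd eA) (.seq (costCmd eA) (.seq saveCmd nextCmd)))

end Prog

/-! ### Correctness of the search program. -/

section search
variable {E : Env} {n d k q l : ℕ} {eA eS eSA : NExp → NExp → RExp} {fA fS fSA : ℕ → ℕ → ℝ}
  {σ : State}

/-- `Frame` implies `Prot` if no protected array is written. -/
theorem Frame.prot {c : Cmd} {σ σ' : State} (h : Frame c σ σ') (h1 : c.writesWord 1 = false)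
    (h2 : c.writesWord 2 = false) (h3 : c.writesWord 3 = false) (h4 : c.writesWord 4 = false)
    (h5 : c.writesReal 1 = false) (h6 : c.writesReal 2 = false) : Prot σ σ' :=
  ⟨h.word 1 h1, h.word 2 h2, h.word 3 h3, h.word 4 h4, h.real 1 h5, h.real 2 h6⟩

/-- Both truncated differences vanish exactly when the words are equal. -/
theorem eval_eqInd (x y : NExp) : ((Prog.eqInd x y).eval E.inp σ : ℝ) =
    if x.eval E.inp σ = y.eval E.inp σ then 1 else 0 := by
  simp only [NExp.eval]
  split_ifs with h
  · simp [h]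
  · have : 1 - (x.eval E.inp σ - y.eval E.inp σ + (y.eval E.inp σ - x.eval E.inp σ)) = 0 := by omega
    simp [this]

theorem wp_centroidCmd (h : Setup E n d k q l) (hD : Data E eA eS eSA q l fA fS fSA σ)
    {v i j : ℕ} (hi : σ.word 10 0 = i) (hj : σ.word 11 0 = j) (hjk : j < k)
    (hdig : ∀ x < k * numSamples q, σ.word 5 x = digit n v x) :
    wp E (Prog.centroidCmd eA) (fun σ' => σ'.real 5 0 = centroidEst q l fA n v i j) σ := by
  have hm := h.arrays
  have hL := h.L_pos
  have htL := h.t_le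
  refine wp_seq' (fun σ' => ∀ c < widthT q l, σ'.real 3 c =
    centroidDiff fA n (numSamples q) v i j c) ?_ ?_
  · refine wp_for (widthT q l) (fun c' σ' => ∀ c < c', σ'.real 3 c =
      centroidDiff fA n (numSamples q) v i j c) (by omega) hL (htL.trans h.L_le_H)
      (htL.trans h.L_le_B) (by intro c hc; omega) ?_ ?_ ?_
    · intro c σ' _ hf _ _
      have hD' := hD.mono (hf.prot rfl rfl rfl rfl rfl rfl)
      exact eval_width hD'.q_eq hD'.l_eq
    · intro c hc σ₁ hok₁ hf₁ hI hx
      have hD₁ := hD.mono (hf₁.prot rfl rfl rfl rfl rfl rfl)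
      have hi₁ : σ₁.word 10 0 = i := (congrFun (hf₁.word 10 rfl) 0).trans hi
      have hj₁ : σ₁.word 11 0 = j := (congrFun (hf₁.word 11 rfl) 0).trans hj
      have hdig₁ : σ₁.word 5 = σ.word 5 := hf₁.word 5 rfl
      refine wp_seq' _ (wp_sum (numSamples q)
        (fun u => fA (digit n v (j * numSamples q + u)) c) (by omega) (by omega) hL
        (h.M_le.trans h.L_le_H) (h.M_le.trans h.L_le_B) ?_ ?_ (fun σ' _ _ he => he)) ?_
      · intro σ' hf
        exact eval_samples (hD₁.mono (hf.prot rfl rfl rfl rfl rfl rfl)).q_eq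
      · intro u hu σ' _ hf hxu
        have hD' := hD₁.mono (hf.prot rfl rfl rfl rfl rfl rfl)
        have e1 : σ'.word 11 0 = j := (congrFun (hf.word 11 rfl) 0).trans hj₁
        have e2 : σ'.word 17 0 = c := (congrFun (hf.word 17 rfl) 0).trans hx
        have e3 : σ'.word 5 = σ.word 5 := (hf.word 5 rfl).trans hdig₁
        have e4 := hD'.q_eq
        rw [hD'.evalA]
        simp only [NExp.eval, e1, e2, e3, e4, hxu]
        rw [hdig]
        · rfl
        · have := Nat.mul_le_mul_right (numSamples q) hjk
          simp only [Nat.succ_mul, numSamples] at this hu ⊢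
          omega
      · intro σ' _ hf he
        have hD' := hD₁.mono (hf.prot rfl rfl rfl rfl rfl rfl)
        have e1 : σ'.word 10 0 = i := (congrFun (hf.word 10 rfl) 0).trans hi₁
        have e2 : σ'.word 17 0 = c := (congrFun (hf.word 17 rfl) 0).trans hx
        have e3 : σ'.real 3 = σ₁.real 3 := hf.real 3 rfl
        refine wp_setReal (by omega) (by simp [NExp.eval, e2]; omega) ⟨e2, ?_⟩
        intro c' hc'
        have hev : (RExp.sub (eA (.var 10) (.var 17)) (.div (.var 11) (.ofWord Prog.samples))).eval
            E.inp σ' = centroidDiff fA n (numSamples q) v i j c := by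
          rw [RExp.eval, RExp.eval, RExp.eval, RExp.eval, hD'.evalA, eval_samples hD'.q_eq]
          simp only [NExp.eval, e1, e2, he]
          rfl
        rw [hev]
        simp only [State.setWord_real, State.setReal_real, NExp.eval, e2, e3, true_and]
        split_ifs with h1
        · rw [h1]
        · exact hI c' (by omega)
    · intro σ' _ _ hI _
      exact hI
  · intro σ' _ hf hI
    have hD' := hD.mono (hf.prot rfl rfl rfl rfl rfl rfl)
    refine (wp_medianCmd h hD'.q_eq hD'.l_eq).conseq fun σ'' _ _ he => ?_
    rw [he, centroidEst]
    exact sqNormEst_congr hI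

theorem wp_assignCmd (h : Setup E n d k q l) (hD : Data E eA eS eSA q l fA fS fSA σ) {v : ℕ}
    (hdig : ∀ x < k * numSamples q, σ.word 5 x = digit n v x) :
    wp E (Prog.assignCmd eA) (fun σ' => ∀ i < n, σ'.word 6 i = candidate q l fA n k v i) σ := by
  have hm := h.arrays
  have hL := h.L_pos
  have hn := h.n_le
  have hk := h.k_le
  have hLB := h.L_le_B
  refine wp_for n (fun i' σ' => ∀ i < i', σ'.word 6 i = candidate q l fA n k v i) (by omega) hL
    (hn.trans h.L_le_H) (hn.trans h.L_le_B) (by intro i hi; omega) ?_ ?_ ?_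
  · intro _ σ' _ _ _ _
    exact h.n_eq
  · intro i hi σ₁ hok₁ hf₁ hI hx
    have hD₁ := hD.mono (hf₁.prot rfl rfl rfl rfl rfl rfl)
    have hdig₁ : σ₁.word 5 = σ.word 5 := hf₁.word 5 rfl
    set e := centroidEst q l fA n v i with he
    refine wp_for k (fun j σ' => (∀ i' < i, σ'.word 6 i' = candidate q l fA n k v i') ∧
      (0 < j → σ'.word 6 i = argminAux e j ∧ σ'.real 6 0 = e (argminAux e j))) (by omega) hL
      (hk.trans h.L_le_H) (hk.trans h.L_le_B) ?_ ?_ ?_ ?_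
    · refine ⟨fun i' hi' => ?_, fun h => absurd h (by omega)⟩
      rw [State.setWord_word_of_ne _ _ _ (by decide)]
      exact hI i' hi'
    · intro _ σ' _ _ _ _
      exact h.k_eq
    · rintro j hj σ₂ hok₂ hf₂ ⟨hI₂, hI₃⟩ hxj
      have hD₂ := hD₁.mono (hf₂.prot rfl rfl rfl rfl rfl rfl)
      have hi₂ : σ₂.word 10 0 = i := (congrFun (hf₂.word 10 rfl) 0).trans hx
      have hdig₂ : σ₂.word 5 = σ.word 5 := (hf₂.word 5 rfl).trans hdig₁
      refine wp_seq' _ (wp_centroidCmd h hD₂ hi₂ hxj hj (by rwa [hdig₂])) ?_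
      intro σ₃ hok₃ hf₃ h5
      have e6 : σ₃.word 6 = σ₂.word 6 := hf₃.word 6 rfl
      have r6 : σ₃.real 6 = σ₂.real 6 := hf₃.real 6 rfl
      have e10 : σ₃.word 10 0 = i := (congrFun (hf₃.word 10 rfl) 0).trans hi₂
      have e11 : σ₃.word 11 0 = j := (congrFun (hf₃.word 11 rfl) 0).trans hxj
      rw [← he] at h5
      refine wp_branch (fun hb => wp_skip ⟨e11, ?_⟩) (fun hb => ?_)
      · simp only [BExp.Holds, NExp.eval, RExp.eval, e11, h5, r6] at hb
        obtain ⟨h61, h62⟩ := hI₃ hb.1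
        have : argminAux e (j + 1) = argminAux e j := by
          rw [argminAux, if_neg]
          rw [← h62]
          exact hb.2
        simp only [State.setWord_real, State.setWord_word, this, e6, r6]
        exact ⟨fun i' hi' => hI₂ i' hi', fun _ => ⟨h61, h62⟩⟩
      · simp only [BExp.Holds, NExp.eval, RExp.eval, e11, h5, r6, not_and, not_not] at hb
        have : argminAux e (j + 1) = j := by
          rw [argminAux]
          rcases Nat.eq_zero_or_pos j with rfl | hj0
          · simp [argminAux]
          · rw [if_pos]
            rw [← (hI₃ hj0).2]
            exact hb hj0
        refine wp_seq (wp_setWord (by omega) (by simp [NExp.eval, e10]; omega)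
          (by simp [NExp.eval, e11]; omega) (wp_setReal (by omega) hL ?_))
        simp only [State.setWord_real, State.setReal_real, State.setWord_word, this,
          State.setReal_word, NExp.eval, RExp.eval, e10, e11, h5]
        refine ⟨by simp, fun i' hi' => ?_, fun _ => by simp⟩
        rw [if_neg (by simp), if_neg (by omega), e6]
        exact hI₂ i' hi'
    · rintro σ' _ hf ⟨hI₂, hI₃⟩ _
      refine ⟨(congrFun (hf.word 10 rfl) 0).trans hx, fun i' hi' => ?_⟩
      rw [State.setWord_word_of_ne _ _ _ (by decide)]
      rcases Nat.lt_succ_iff_lt_or_eq.1 hi' with h' | rfl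
      · exact hI₂ i' h'
      · exact (hI₃ h.k_pos).1
  · intro σ' _ _ hI _
    exact hI

theorem clusterSize_congr {f f' : ℕ → ℕ} (hf : ∀ i < n, f i = f' i) {i : ℕ} (hi : i < n) :
    clusterSize n f i = clusterSize n f' i :=
  Finset.sum_congr rfl fun i' hi' => by rw [hf i hi, hf i' (Finset.mem_range.1 hi')]

theorem costEst_congr {f f' : ℕ → ℕ} (hf : ∀ i < n, f i = f' i) :
    costEst q l fA n f = costEst q l fA n f' :=
  Finset.sum_congr rfl fun i hi => Finset.sum_congr rfl fun i' hi' => by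
    rw [costTerm, costTerm, hf i (Finset.mem_range.1 hi), hf i' (Finset.mem_range.1 hi'),
      clusterSize_congr hf (Finset.mem_range.1 hi)]

theorem wp_costCmd (h : Setup E n d k q l) (hD : Data E eA eS eSA q l fA fS fSA σ) :
    wp E (Prog.costCmd eA) (fun σ' => σ'.real 7 0 = costEst q l fA n (σ.word 6)) σ := by
  have hm := h.arrays
  have hL := h.L_pos
  have hn := h.n_le
  have htL := h.t_le
  have hnH := hn.trans h.L_le_H
  have hnB := hn.trans h.L_le_B
  set f := σ.word 6 with hf6
  refine wp_seq (wp_setReal (by omega) hL ?_)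
  refine wp_for n (fun i σ' => σ'.real 7 0 = ∑ a ∈ Finset.range i, ∑ a' ∈ Finset.range n,
    costTerm q l fA n f a a') (by omega) hL hnH hnB (by simp [NExp.eval, RExp.eval]) ?_ ?_ ?_
  · intro _ σ' _ _ _ _
    exact h.n_eq
  · intro i hi σ₁ hok₁ hf₁ hI hx
    have hD₁ : Data E eA eS eSA q l fA fS fSA σ₁ := hD.mono (Prot.trans (σ' := σ.setReal 7
      0 ((0 : ℕ) : ℝ)) ⟨rfl, rfl, rfl, rfl, State.setReal_real_of_ne _ _ _ (by decide),
        State.setReal_real_of_ne _ _ _ (by decide)⟩ (hf₁.prot rfl rfl rfl rfl rfl rfl))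
    have e₁ : σ₁.word 6 = f := hf₁.word 6 rfl
    refine wp_seq' (fun σ' => σ'.real 14 0 = clusterSize n f i) ?_ ?_
    · refine wp_sum n (fun i' => if f i = f i' then 1 else 0) (by omega) (by omega) hL hnH hnB
        (fun _ _ => h.n_eq) ?_ (fun σ' _ _ he => he)
      intro i' hi' σ' _ hf hx'
      have e6 : σ'.word 6 = f := (hf.word 6 rfl).trans e₁
      have e10 : σ'.word 10 0 = i := (congrFun (hf.word 10 rfl) 0).trans hx
      rw [RExp.eval, eval_eqInd]
      simp only [NExp.eval, e6, e10, hx']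
    · intro σ₂ hok₂ hf₂ h14
      have hD₂ := hD₁.mono (hf₂.prot rfl rfl rfl rfl rfl rfl)
      have e₂ : σ₂.word 6 = f := (hf₂.word 6 rfl).trans e₁
      have i₂ : σ₂.word 10 0 = i := (congrFun (hf₂.word 10 rfl) 0).trans hx
      have r₂ : σ₂.real 7 = σ₁.real 7 := hf₂.real 7 rfl
      refine wp_for n (fun i' σ' => σ'.real 7 0 = (∑ a ∈ Finset.range i, ∑ a' ∈ Finset.range n,
        costTerm q l fA n f a a') + ∑ a' ∈ Finset.range i', costTerm q l fA n f i a') (by omega) hL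
        hnH hnB (by simp [r₂, hI]) ?_ ?_ ?_
      · intro _ σ' _ _ _ _
        exact h.n_eq
      · intro i' hi' σ₃ hok₃ hf₃ hI₃ hx₃
        have hD₃ := hD₂.mono (hf₃.prot rfl rfl rfl rfl rfl rfl)
        have e₃ : σ₃.word 6 = f := (hf₃.word 6 rfl).trans e₂
        have i₃ : σ₃.word 10 0 = i := (congrFun (hf₃.word 10 rfl) 0).trans i₂
        have z₃ : σ₃.real 14 0 = clusterSize n f i := (congrFun (hf₃.real 14 rfl) 0).trans h14
        refine wp_seq' (fun σ' => ∀ c < widthT q l, σ'.real 3 c = fA i c - fA i' c) ?_ ?_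
        · refine wp_for (widthT q l) (fun c' σ' => ∀ c < c', σ'.real 3 c = fA i c - fA i' c)
            (by omega) hL (htL.trans h.L_le_H) (htL.trans h.L_le_B) (by intro c hc; omega) ?_ ?_
            (fun σ' _ _ h _ => h)
          · intro c σ' _ hf _ _
            have hD' := hD₃.mono (hf.prot rfl rfl rfl rfl rfl rfl)
            exact eval_width hD'.q_eq hD'.l_eq
          · intro c hc σ' _ hf hI' hx'
            have hD' := hD₃.mono (hf.prot rfl rfl rfl rfl rfl rfl)
            have e10 : σ'.word 10 0 = i := (congrFun (hf.word 10 rfl) 0).trans i₃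
            have e19 : σ'.word 19 0 = i' := (congrFun (hf.word 19 rfl) 0).trans hx₃
            refine wp_setReal (by omega) (by simp [NExp.eval, hx']; omega) ⟨hx', ?_⟩
            intro c' hc'
            rw [RExp.eval, hD'.evalA, hD'.evalA]
            simp only [State.setWord_real, State.setReal_real, NExp.eval, hx', e10, e19, true_and]
            split_ifs with h1
            · rw [h1]
            · exact hI' c' (by omega)
        · intro σ₄ hok₄ hf₄ hdv
          have hD₄ := hD₃.mono (hf₄.prot rfl rfl rfl rfl rfl rfl)
          refine wp_seq' _ (wp_medianCmd h hD₄.q_eq hD₄.l_eq) ?_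
          intro σ₅ hok₅ hf₅ h5
          have e6 : σ₅.word 6 = f := (hf₅.word 6 rfl).trans ((hf₄.word 6 rfl).trans e₃)
          have e10 : σ₅.word 10 0 = i :=
            (congrFun ((hf₅.word 10 rfl).trans (hf₄.word 10 rfl)) 0).trans i₃
          have e19 : σ₅.word 19 0 = i' :=
            (congrFun ((hf₅.word 19 rfl).trans (hf₄.word 19 rfl)) 0).trans hx₃
          have e14 : σ₅.real 14 0 = clusterSize n f i :=
            (congrFun ((hf₅.real 14 rfl).trans (hf₄.real 14 rfl)) 0).trans z₃
          have e7 : σ₅.real 7 0 = _ :=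
            (congrFun ((hf₅.real 7 rfl).trans (hf₄.real 7 rfl)) 0).trans hI₃
          rw [sqNormEst_congr hdv] at h5
          refine wp_setReal (by omega) hL ⟨e19, ?_⟩
          rw [State.setWord_real, Finset.sum_range_succ, ← add_assoc, ← e7]
          rw [NExp.eval, State.setReal_real_self, RExp.eval, RExp.eval, RExp.eval, RExp.eval,
            RExp.eval, RExp.eval, eval_eqInd]
          simp only [NExp.eval, RExp.eval, e6, e10, e19, e14, h5]
          rfl
      · intro σ' _ hf hI' _
        refine ⟨(congrFun (hf.word 10 rfl) 0).trans i₂, ?_⟩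
        rw [State.setWord_real, hI', Finset.sum_range_succ]
  · intro σ' _ _ hI _
    exact hI

theorem wp_saveCmd (h : Setup E n d k q l) (h8 : σ.word 8 0 ≤ 1) :
    wp E Prog.saveCmd (fun σ' => σ'.word 8 0 = 1 ∧
      if 0 < σ.word 8 0 ∧ ¬ σ.real 7 0 < σ.real 8 0 then
        σ'.real 8 0 = σ.real 8 0 ∧ σ'.word 0 = σ.word 0
      else σ'.real 8 0 = σ.real 7 0 ∧ ∀ i < n, σ'.word 0 i = σ.word 6 i) σ := by
  have hm := h.arrays
  have hL := h.L_pos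
  have hn := h.n_le
  have hLB := h.L_le_B
  refine wp_ok fun hok => wp_branch (fun hb => wp_skip ?_) (fun hb => ?_)
  · simp only [BExp.Holds, NExp.eval, RExp.eval] at hb
    rw [if_pos hb]
    exact ⟨by omega, rfl, rfl⟩
  · simp only [BExp.Holds, NExp.eval, RExp.eval] at hb
    simp only [if_neg hb]
    refine wp_seq (wp_setReal (by omega) hL (wp_seq (wp_setWord (by omega) hL
      (by simp [NExp.eval]; omega) ?_)))
    refine wp_for n (fun i' σ' => ∀ i < i', σ'.word 0 i = σ.word 6 i) (by omega) hL
      (hn.trans h.L_le_H) (hn.trans h.L_le_B) (by intro i hi; omega) (fun _ _ _ _ _ _ => h.n_eq)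
      ?_ ?_
    · intro i hi σ' hok' hf hI hx
      have e6 : σ'.word 6 = σ.word 6 := hf.word 6 rfl
      refine wp_setWord (by omega) (by simp [NExp.eval, hx]; omega) (hok'.2 _ _) ⟨?_, ?_⟩
      · simpa [State.setWord_word] using hx
      · intro i' hi'
        simp only [State.setWord_word, NExp.eval, hx, e6]
        by_cases h1 : i' = i
        · simp [h1]
        · simpa [h1] using hI i' (by omega)
    · intro σ' _ hf hI _
      refine ⟨(congrFun (hf.word 8 rfl) 0).trans (State.setWord_word_self _ _ _ _),
        (congrFun (hf.real 8 rfl) 0).trans ?_, hI⟩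
      simp [NExp.eval, RExp.eval]

/-- The digits of the next candidate, or the signal that there is none. -/
theorem wp_nextCmd (h : Setup E n d k q l) (hq : σ.word 1 0 = q) {v : ℕ}
    (hv : v < n ^ (k * numSamples q)) (h7 : σ.word 7 0 = 0)
    (hdig : ∀ x < k * numSamples q, σ.word 5 x = digit n v x) :
    wp E Prog.nextCmd (fun σ' =>
      (σ'.word 7 0 = 0 ∧ v + 1 < n ^ (k * numSamples q) ∧
        ∀ x < k * numSamples q, σ'.word 5 x = digit n (v + 1) x) ∨
      (σ'.word 7 0 = 1 ∧ v + 1 = n ^ (k * numSamples q))) σ := by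
  have hm := h.arrays
  have hL := h.L_pos
  have hLB := h.L_le_B
  have hn := h.n_pos
  have hnL := h.n_le
  set K := k * numSamples q with hK
  have hKL : K ≤ E.L := h.kM_le
  have hev : ∀ σ' : State, σ'.word 1 0 = q → Prog.numDigits.eval E.inp σ' = K := by
    intro σ' hq'
    rw [NExp.eval, eval_samples hq', NExp.eval, h.k_eq]
  refine wp_seq (wp_setWord (by omega) hL (Nat.zero_le _) ?_)
  -- Here `y` is the position at which the carry stops; it equals `K` exactly if all digits are
  -- maximal.
  refine wp_seq' (fun σ' => ∃ y ≤ K, σ'.word 21 0 = y ∧ (∀ x < y, digit n v x = n - 1) ∧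
    (y < K → digit n v y + 1 < n) ∧
    ∀ x < K, σ'.word 5 x = if x < y then 0 else digit n v x) ?_ ?_
  · refine wp_loop K (fun y σ' => y ≤ K ∧ σ'.word 21 0 = y ∧ (∀ x < y, digit n v x = n - 1) ∧
      ∀ x < K, σ'.word 5 x = if x < y then 0 else digit n v x) (hKL.trans h.L_le_H) ?_ ?_
    · refine ⟨Nat.zero_le _, by simp [NExp.eval], by intro x hx; omega, fun x hx => ?_⟩
      rw [State.setWord_word_of_ne _ _ _ (by decide)]
      simpa using hdig x hx
    · rintro y σ' hok hf ⟨hy, hy', h1, h2⟩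
      have hq' : σ'.word 1 0 = q := (congrFun (hf.word 1 rfl) 0).trans hq
      by_cases hb : y < K ∧ digit n v y = n - 1
      · refine Or.inl ⟨?_, hb.1, ?_⟩
        · refine ⟨by rw [BExp.Holds, hev σ' hq', NExp.eval, NExp.eval, hy']; exact hb.1, ?_⟩
          simp only [BExp.Holds, NExp.eval, hy', h2 y hb.1, h.n_eq, lt_irrefl, if_false]
          omega
        · refine wp_seq (wp_setWord (by omega) (by simp only [NExp.eval, hy']; omega)
            (Nat.zero_le _) (wp_setWord (by omega) hL ?_ ?_))
          · simp [NExp.eval, State.setWord_word, hy']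
            omega
          · refine ⟨hb.1, by simp [NExp.eval, State.setWord_word, hy'], ?_, ?_⟩
            · intro x hx
              rcases Nat.lt_succ_iff_lt_or_eq.1 hx with h' | rfl
              exacts [h1 x h', hb.2]
            · intro x hx
              rw [State.setWord_word_of_ne _ _ _ (by decide), State.setWord_word, h2 x hx]
              simp only [NExp.eval, hy', true_and]
              split_ifs <;> first | rfl | omega
      · refine Or.inr ⟨?_, y, hy, hy', h1, fun hyK => ?_, h2⟩
        · rintro ⟨h3, h4⟩
          rw [BExp.Holds, hev σ' hq'] at h3
          simp only [NExp.eval, hy'] at h3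
          simp only [BExp.Holds, NExp.eval, hy', h2 y h3, h.n_eq, lt_irrefl, if_false] at h4
          have := digit_lt hn v y
          exact hb ⟨h3, by omega⟩
        · have := digit_lt hn v y
          by_contra h4
          exact hb ⟨hyK, by omega⟩
  · rintro σ' hok hf ⟨y, hy, hy', h1, h2, h3⟩
    have hq' : σ'.word 1 0 = q := (congrFun (hf.word 1 rfl) 0).trans hq
    have h7' : σ'.word 7 0 = 0 := (congrFun (hf.word 7 rfl) 0).trans h7
    refine wp_branch (fun hb => ?_) (fun hb => ?_)
    · rw [BExp.Holds, hev σ' hq'] at hb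
      simp only [NExp.eval, hy'] at hb
      have h4 := h2 hb
      have h5 : σ'.word 5 y = digit n v y := by simpa using h3 y hb
      refine wp_setWord (by omega) (by simp only [NExp.eval, hy']; omega)
        (by simp only [NExp.eval, hy', h5]; omega) (Or.inl ⟨?_, ?_, ?_⟩)
      · rw [State.setWord_word_of_ne _ _ _ (by decide), h7']
      · by_contra h6
        -- All digits of `n ^ K` below position `K` are 0, whereas the digit of `v + 1` at position
        -- `y` has just been increased.
        have h7 : v + 1 = n ^ K := by omega
        have h8 := digit_succ hn h1 h4 y
        rw [if_neg (lt_irrefl _), if_pos rfl, h7, digit,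
          Nat.pow_div hb.le hn] at h8
        obtain ⟨c, hc⟩ := Nat.exists_eq_add_of_lt hb
        rw [hc, show y + c + 1 - y = c + 1 by omega, pow_succ, Nat.mul_mod_left] at h8
        omega
      · intro x hx
        rw [State.setWord_word, digit_succ hn h1 h4, h3 x hx]
        simp only [NExp.eval, hy', h5, true_and]
        split_ifs <;> first | rfl | omega
    · rw [BExp.Holds, hev σ' hq'] at hb
      simp only [NExp.eval, hy'] at hb
      have : y = K := by omega
      subst this
      exact wp_setWord (by omega) hL (by simp [NExp.eval]; omega)
        (Or.inr ⟨by simp [NExp.eval], succ_eq_pow_of_digit hn hv h1⟩)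

theorem wp_searchCmd (h : Setup E n d k q l) (hD : Data E eA eS eSA q l fA fS fSA σ)
    (h5 : σ.word 5 = 0) (h7 : σ.word 7 = 0) (h8 : σ.word 8 = 0) :
    wp E (Prog.searchCmd eA) (fun σ' => ∀ i < n, σ'.word 0 i = searchResult q l fA n k i) σ := by
  have hn := h.n_pos
  set N := n ^ (k * numSamples q) with hN
  set e := candidateCost q l fA n k with he
  have hN0 : 0 < N := Nat.pow_pos hn
  -- After `v` rounds the digits are those of `v` (or the end is signalled and `v = N`), and the
  -- stored clustering is the first minimizer among the candidates before `v`. For `v = 0` nothing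
  -- is stored, which the flag records.
  refine wp_loop N (fun v σ' =>
    ((σ'.word 7 0 = 0 ∧ v < N ∧ ∀ x < k * numSamples q, σ'.word 5 x = digit n v x) ∨
      (σ'.word 7 0 = 1 ∧ v = N)) ∧ (v = 0 → σ'.word 8 0 = 0) ∧
    (0 < v → σ'.word 8 0 = 1 ∧ σ'.real 8 0 = e (argminAux e v) ∧
      ∀ i < n, σ'.word 0 i = candidate q l fA n k (argminAux e v) i)) h.pow_le ?_ ?_
  · refine ⟨Or.inl ⟨by simp [h7], hN0, fun x _ => ?_⟩, fun _ => by simp [h8],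
      fun h => absurd h (lt_irrefl _)⟩
    simp [h5, digit]
  · rintro v σ' hok hf ⟨h1 | h1, h2, h3⟩
    · obtain ⟨h17, hv, hdig⟩ := h1
      refine Or.inl ⟨by simp [BExp.Holds, NExp.eval, h17], hv, ?_⟩
      have hD' := hD.mono (hf.prot rfl rfl rfl rfl rfl rfl)
      refine wp_seq' _ (wp_assignCmd h hD' hdig) fun σ₁ _ hf₁ ha => ?_
      have hD₁ := hD'.mono (hf₁.prot rfl rfl rfl rfl rfl rfl)
      refine wp_seq' _ (wp_costCmd h hD₁) fun σ₂ _ hf₂ hc => ?_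
      have hD₂ := hD₁.mono (hf₂.prot rfl rfl rfl rfl rfl rfl)
      have h81 : σ₂.word 8 0 ≤ 1 := by
        rw [hf₂.word 8 rfl, hf₁.word 8 rfl]
        rcases Nat.eq_zero_or_pos v with hv0 | hv0
        · rw [h2 hv0]; omega
        · rw [(h3 hv0).1]
      refine wp_seq' _ (wp_saveCmd h h81) fun σ₃ _ hf₃ hs => ?_
      have hD₃ := hD₂.mono (hf₃.prot rfl rfl rfl rfl rfl rfl)
      have e5 : σ₃.word 5 = σ'.word 5 :=
        (hf₃.word 5 rfl).trans ((hf₂.word 5 rfl).trans (hf₁.word 5 rfl))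
      have e7 : σ₃.word 7 = σ'.word 7 :=
        (hf₃.word 7 rfl).trans ((hf₂.word 7 rfl).trans (hf₁.word 7 rfl))
      have e8 : σ₂.word 8 = σ'.word 8 := (hf₂.word 8 rfl).trans (hf₁.word 8 rfl)
      have r8 : σ₂.real 8 = σ'.real 8 := (hf₂.real 8 rfl).trans (hf₁.real 8 rfl)
      have e0 : σ₂.word 0 = σ'.word 0 := (hf₂.word 0 rfl).trans (hf₁.word 0 rfl)
      have e6 : σ₂.word 6 = σ₁.word 6 := hf₂.word 6 rfl
      have hc' : σ₂.real 7 0 = e v := by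
        rw [hc]
        exact costEst_congr ha
      refine (wp_nextCmd h hD₃.q_eq hv (by rw [e7, h17]) (by rwa [e5])).conseq ?_
      intro σ₄ _ hf₄ hnx
      have f8 : σ₄.word 8 = σ₃.word 8 := hf₄.word 8 rfl
      have g8 : σ₄.real 8 = σ₃.real 8 := hf₄.real 8 rfl
      have f0 : σ₄.word 0 = σ₃.word 0 := hf₄.word 0 rfl
      refine ⟨hnx, fun h => absurd h (Nat.succ_ne_zero v), fun _ => ?_⟩
      rw [f8, g8, f0]
      refine ⟨hs.1, ?_⟩
      have hs2 := hs.2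
      rw [e8, r8, e0, hc', e6] at hs2
      rcases Nat.eq_zero_or_pos v with rfl | hv0
      · rw [if_neg (by rw [h2 rfl]; simp)] at hs2
        have : argminAux e (0 + 1) = 0 := by simp [argminAux]
        rw [this]
        exact ⟨hs2.1, fun i hi => (hs2.2 i hi).trans (ha i hi)⟩
      · obtain ⟨h31, h32, h33⟩ := h3 hv0
        rw [argminAux]
        split_ifs at hs2 with hb
        · rw [h32] at hb
          rw [if_neg hb.2, hs2.1, hs2.2]
          exact ⟨h32, h33⟩
        · rw [h31, h32] at hb
          rw [if_pos (by simpa using hb)]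
          exact ⟨hs2.1, fun i hi => (hs2.2 i hi).trans (ha i hi)⟩
    · obtain ⟨h17, rfl⟩ := h1
      exact Or.inr ⟨by simp [BExp.Holds, NExp.eval, h17], (h3 hN0).2.2⟩

end search

/-! ## Least squares by the Gram–Schmidt process -/

theorem pair_lt {k s j r : ℕ} (hj : j < k) (hr : r < s) : j * s + r < k * s := by
  have := Nat.mul_le_mul_right s (Nat.succ_le_of_lt hj)
  rw [Nat.succ_mul] at this
  omega

theorem pair_inj {s j r j' r' : ℕ} (hr : r < s) (hr' : r' < s) :
    j * s + r = j' * s + r' ↔ j = j' ∧ r = r' := by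
  refine ⟨fun h => ?_, fun ⟨h, h'⟩ => by rw [h, h']⟩
  have h1 : j = j' := by
    rcases lt_trichotomy j j' with h2 | h2 | h2
    · have := pair_lt h2 hr
      omega
    · exact h2
    · have := pair_lt h2 hr'
      omega
  subst h1
  exact ⟨rfl, by omega⟩

def dotRange (s : ℕ) (x y : ℕ → ℝ) : ℝ := ∑ r ∈ Finset.range s, x r * y r

theorem dotRange_comm (s : ℕ) (x y : ℕ → ℝ) : dotRange s x y = dotRange s y x :=
  Finset.sum_congr rfl fun _ _ => mul_comm _ _

theorem dotRange_sub (s : ℕ) (x y z : ℕ → ℝ) (c : ℝ) :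
    dotRange s (fun r => x r - c * y r) z = dotRange s x z - c * dotRange s y z := by
  simp only [dotRange, sub_mul, Finset.sum_sub_distrib, Finset.mul_sum, mul_assoc]

theorem dotRange_congr {s : ℕ} {x x' y y' : ℕ → ℝ} (hx : ∀ r < s, x r = x' r)
    (hy : ∀ r < s, y r = y' r) : dotRange s x y = dotRange s x' y' :=
  Finset.sum_congr rfl fun r hr => by rw [hx r (Finset.mem_range.1 hr), hy r (Finset.mem_range.1 hr)]

/-- This makes the convention x / 0 = 0 harmless: a projection onto a vector of norm 0 is rightly
computed as 0. Such vectors occur for empty clusters and for linearly dependent sketches. -/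
theorem dotRange_eq_zero_of_self {s : ℕ} {x : ℕ → ℝ} (h : dotRange s x x = 0) (y : ℕ → ℝ) :
    dotRange s x y = 0 := by
  have h1 := (Finset.sum_eq_zero_iff_of_nonneg fun r _ => mul_self_nonneg (x r)).1 h
  refine Finset.sum_eq_zero fun r hr => ?_
  rw [mul_self_eq_zero.1 (h1 r hr), zero_mul]

/-- The vectors `V j` span the same space as the vectors `m j`, and `R` holds the coefficients of a
representation of the former by the latter. -/
structure SameSpan (s k : ℕ) (m V R : ℕ → ℕ → ℝ) : Prop where
  repr : ∀ j < k, ∀ r < s, V j r = ∑ a ∈ Finset.range k, R j a * m a r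
  span : ∀ w, (∀ j < k, dotRange s (V j) w = 0) → ∀ j < k, dotRange s (m j) w = 0

/-- Subtracting a multiple of another vector is invertible, since the vector `V l` itself survives;
so orthogonality to all new vectors still implies orthogonality to all old ones. -/
theorem SameSpan.step {s k : ℕ} {m V R V' R' : ℕ → ℕ → ℝ} (h : SameSpan s k m V R) {j l : ℕ}
    (hl : l < k) (hlj : l ≠ j) (c : ℝ)
    (hV : ∀ a < k, ∀ r < s, V' a r = if a = j then V a r - c * V l r else V a r)
    (hR : ∀ a < k, ∀ b < k, R' a b = if a = j then R a b - c * R l b else R a b) :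
    SameSpan s k m V' R' := by
  refine ⟨fun a ha r hr => ?_, fun w hw => h.span w fun a ha => ?_⟩
  · have hRs : ∑ b ∈ Finset.range k, R' a b * m b r = ∑ b ∈ Finset.range k,
        (if a = j then R a b - c * R l b else R a b) * m b r :=
      Finset.sum_congr rfl fun b hb => by rw [hR a ha b (Finset.mem_range.1 hb)]
    rw [hV a ha r hr, hRs]
    split_ifs
    · rw [h.repr a ha r hr, h.repr l hl r hr, Finset.mul_sum, ← Finset.sum_sub_distrib]
      exact Finset.sum_congr rfl fun b _ => by ring
    · exact h.repr a ha r hr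
  · have hVl : dotRange s (V l) w = 0 := by
      rw [← hw l hl]
      exact dotRange_congr (fun r hr => by rw [hV l hl r hr, if_neg hlj]) fun _ _ => rfl
    by_cases haj : a = j
    · have := hw a ha
      rw [dotRange_congr (x' := fun r => V a r - c * V l r) (fun r hr => by
        rw [hV a ha r hr, if_pos haj]) fun _ _ => rfl, dotRange_sub, hVl] at this
      simpa using this
    · rw [← hw a ha]
      exact dotRange_congr (fun r hr => by rw [hV a ha r hr, if_neg haj]) fun _ _ => rfl

/-- With orthogonal `V`, the coefficients `⟨V l, y⟩ / ⟨V l, V l⟩` solve the normal equations. -/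
theorem SameSpan.normal_equations {s k : ℕ} {m V R : ℕ → ℕ → ℝ} (h : SameSpan s k m V R)
    (ho : ∀ a < k, ∀ b < k, a ≠ b → dotRange s (V a) (V b) = 0) (y C : ℕ → ℝ)
    (hC : ∀ j < k, C j = ∑ l ∈ Finset.range k,
      R l j * (dotRange s (V l) y / dotRange s (V l) (V l))) :
    ∀ j < k, dotRange s (m j) (fun r => y r - ∑ a ∈ Finset.range k, m a r * C a) = 0 := by
  refine h.span _ fun j hj => ?_
  have key : ∀ r < s, ∑ a ∈ Finset.range k, m a r * C a =
      ∑ l ∈ Finset.range k, V l r * (dotRange s (V l) y / dotRange s (V l) (V l)) := by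
    intro r hr
    have h1 : ∀ l ∈ Finset.range k, V l r * (dotRange s (V l) y / dotRange s (V l) (V l)) =
        ∑ a ∈ Finset.range k, m a r * (R l a * (dotRange s (V l) y / dotRange s (V l) (V l))) := by
      intro l hl
      rw [h.repr l (Finset.mem_range.1 hl) r hr, Finset.sum_mul]
      exact Finset.sum_congr rfl fun a _ => by ring
    rw [Finset.sum_congr rfl h1, Finset.sum_comm]
    refine Finset.sum_congr rfl fun a ha => ?_
    rw [hC a (Finset.mem_range.1 ha), Finset.mul_sum]
  rw [dotRange_congr (fun _ _ => rfl) fun r hr => by rw [key r hr]]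
  have h2 : dotRange s (V j) (fun r => y r - ∑ l ∈ Finset.range k, V l r *
      (dotRange s (V l) y / dotRange s (V l) (V l))) = dotRange s (V j) y -
      ∑ l ∈ Finset.range k, dotRange s (V j) (V l) *
        (dotRange s (V l) y / dotRange s (V l) (V l)) := by
    simp only [dotRange, mul_sub, Finset.sum_sub_distrib, Finset.mul_sum, Finset.sum_mul]
    rw [Finset.sum_comm]
    simp only [mul_assoc]
  rw [h2, Finset.sum_eq_single_of_mem j (Finset.mem_range.2 hj)]
  -- A vanishing `V j` contributes nothing to either side, whatever the quotient is.
  · by_cases h0 : dotRange s (V j) (V j) = 0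
    · simp [h0, dotRange_eq_zero_of_self h0 y]
    · rw [mul_div_cancel₀ _ h0, sub_self]
  · intro l hl hlj
    rw [ho j hj l (Finset.mem_range.1 hl) hlj.symm, zero_mul]

namespace Prog

/-- cell of the array of the vectors that are orthogonalized -/
abbrev vCell (j r : ℕ) : RExp := .cell 9 (.add (.mul (.var j) height) (.var r))
/-- cell of the array of coefficients -/
abbrev rCell (j a : ℕ) : RExp := .cell 10 (.add (.mul (.var j) (.input 2)) (.var a))

def loadCmd (eS : NExp → NExp → RExp) : Cmd :=
  .for 11 (.input 2) (.seq
    (.for 13 height (.seq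
      (.sum 11 10 (.input 0)
        (.mul (eS (.var 13) (.var 10)) (.ofWord (eqInd (.cell 0 (.var 10)) (.var 11)))))
      (.setReal 9 (.add (.mul (.var 11) height) (.var 13)) (.var 11))))
    (.for 20 (.input 2)
      (.setReal 10 (.add (.mul (.var 11) (.input 2)) (.var 20))
        (.ofWord (eqInd (.var 11) (.var 20))))))

def stepCmd : Cmd :=
  .seq (.sum 11 13 height (.mul (vCell 11 13) (vCell 20 13)))
  (.seq (.sum 12 13 height (.mul (vCell 20 13) (vCell 20 13)))
  (.seq (.for 13 height (.setReal 9 (.add (.mul (.var 11) height) (.var 13))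
      (.sub (vCell 11 13) (.mul (.div (.var 11) (.var 12)) (vCell 20 13)))))
    (.for 13 (.input 2) (.setReal 10 (.add (.mul (.var 11) (.input 2)) (.var 13))
      (.sub (rCell 11 13) (.mul (.div (.var 11) (.var 12)) (rCell 20 13)))))))

/-- The modified Gram–Schmidt process: each projection coefficient is computed from the vector as
reduced so far. The vectors are not normalized, so no square roots are needed. -/
def gramSchmidtCmd : Cmd := .for 11 (.input 2) (.for 20 (.var 11) stepCmd)

def coeffCmd (eSA : NExp → NExp → RExp) : Cmd :=
  .for 20 (.input 2)
    (.seq (.sum 11 13 height (.mul (vCell 20 13) (eSA (.var 13) (.var 17))))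
    (.seq (.sum 12 13 height (.mul (vCell 20 13) (vCell 20 13)))
      (.setReal 13 (.var 20) (.div (.var 11) (.var 12)))))

def solveCmd (eSA : NExp → NExp → RExp) : Cmd :=
  .for 17 (.input 1) (.seq (coeffCmd eSA)
    (.for 11 (.input 2) (.seq
      (.sum 11 20 (.input 2) (.mul (rCell 20 11) (.cell 13 (.var 20))))
      (.setReal 0 (.add (.mul (.var 11) (.input 1)) (.var 17)) (.var 11)))))

def centersCmd (eS eSA : NExp → NExp → RExp) : Cmd :=
  .seq (loadCmd eS) (.seq gramSchmidtCmd (solveCmd eSA))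

end Prog

/-- The vector in which the sketched indicator vector of cluster `j` is stored. -/
def sketchedCluster (n : ℕ) (fS : ℕ → ℕ → ℝ) (f : ℕ → ℕ) (j r : ℕ) : ℝ :=
  ∑ i ∈ Finset.range n, fS r i * if f i = j then 1 else 0

def State.vec (s : ℕ) (σ : State) (j r : ℕ) : ℝ := σ.real 9 (j * s + r)
def State.coeff (k : ℕ) (σ : State) (j a : ℕ) : ℝ := σ.real 10 (j * k + a)

/-! ### Correctness of the least squares program. -/

section centers
variable {E : Env} {n d k q l : ℕ} {eA eS eSA : NExp → NExp → RExp} {fA fS fSA : ℕ → ℕ → ℝ}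
  {σ : State}

theorem wp_loadCmd (h : Setup E n d k q l) (hD : Data E eA eS eSA q l fA fS fSA σ) :
    wp E (Prog.loadCmd eS) (fun σ' =>
      (∀ j < k, ∀ r < heightS k q,
        σ'.vec (heightS k q) j r = sketchedCluster n fS (σ.word 0) j r) ∧
      ∀ j < k, ∀ a < k, σ'.coeff k j a = if j = a then 1 else 0) σ := by
  have hm := h.arrays
  have hL := h.L_pos
  have hkL := h.k_le
  have hsL := h.s_le
  have hsk := h.sk_le
  rw [mul_comm] at hsk
  have hkk := h.kk_le
  have hnL := h.n_le
  have hLB := h.L_le_B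
  have hLH := h.L_le_H
  set s := heightS k q with hs
  refine wp_for k (fun i σ' => (∀ j < i, ∀ r < s,
    σ'.vec s j r = sketchedCluster n fS (σ.word 0) j r) ∧
      ∀ j < i, ∀ a < k, σ'.coeff k j a = if j = a then 1 else 0) (by omega) hL (by omega)
    (by omega) ⟨by intro j hj; omega, by intro j hj; omega⟩ (fun _ _ _ _ _ _ => h.k_eq) ?_
    (fun σ' _ _ h _ => h)
  rintro j hj σ₁ hok₁ hf₁ ⟨hV₁, hR₁⟩ hx₁
  have hD₁ := hD.mono (hf₁.prot rfl rfl rfl rfl rfl rfl)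
  have e₁ : σ₁.word 0 = σ.word 0 := hf₁.word 0 rfl
  refine wp_seq' (fun σ' => (∀ j' < j + 1, ∀ r < s,
    σ'.vec s j' r = sketchedCluster n fS (σ.word 0) j' r)) ?_ ?_
  · refine wp_for s (fun r' σ' => ∀ j' ≤ j, ∀ r < s, (j' = j → r < r') →
      σ'.vec s j' r = sketchedCluster n fS (σ.word 0) j' r) (by omega) hL (by omega) (by omega) ?_
      ?_ ?_ ?_
    · intro j' hj' r hr h1
      exact hV₁ j' (by by_contra h2; exact absurd (h1 (by omega)) (by omega)) r hr
    · intro _ σ' _ hf _ _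
      exact eval_height h (hD₁.mono (hf.prot rfl rfl rfl rfl rfl rfl)).q_eq
    · intro r hr σ₂ hok₂ hf₂ hI₂ hx₂
      have hD₂ := hD₁.mono (hf₂.prot rfl rfl rfl rfl rfl rfl)
      have e₂ : σ₂.word 0 = σ.word 0 := (hf₂.word 0 rfl).trans e₁
      have j₂ : σ₂.word 11 0 = j := (congrFun (hf₂.word 11 rfl) 0).trans hx₁
      refine wp_seq' _ (wp_sum n (fun i => fS r i * if σ.word 0 i = j then 1 else 0) (by omega)
        (by omega) hL (by omega) (by omega) (fun _ _ => h.n_eq) ?_ (fun σ' _ _ he => he)) ?_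
      · intro i hi σ' _ hf hx
        have hD' := hD₂.mono (hf.prot rfl rfl rfl rfl rfl rfl)
        have e0 : σ'.word 0 = σ.word 0 := (hf.word 0 rfl).trans e₂
        have e11 : σ'.word 11 0 = j := (congrFun (hf.word 11 rfl) 0).trans j₂
        have e13 : σ'.word 13 0 = r := (congrFun (hf.word 13 rfl) 0).trans hx₂
        rw [RExp.eval, hD'.evalS, RExp.eval, eval_eqInd]
        simp only [NExp.eval, e0, e11, e13, hx]
      · intro σ' _ hf he
        have hD' := hD₂.mono (hf.prot rfl rfl rfl rfl rfl rfl)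
        have e11 : σ'.word 11 0 = j := (congrFun (hf.word 11 rfl) 0).trans j₂
        have e13 : σ'.word 13 0 = r := (congrFun (hf.word 13 rfl) 0).trans hx₂
        have e9 : σ'.real 9 = σ₂.real 9 := hf.real 9 rfl
        have hidx : (NExp.add (.mul (.var 11) Prog.height) (.var 13)).eval E.inp σ' = j * s + r := by
          change σ'.word 11 0 * Prog.height.eval E.inp σ' + σ'.word 13 0 = _
          rw [eval_height h hD'.q_eq, e11, e13]
        refine wp_setReal (by omega) ?_ ⟨e13, ?_⟩
        · rw [hidx]
          have := pair_lt hj hr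
          omega
        · intro j' hj' r' hr' h1
          rw [State.vec, State.setWord_real, State.setReal_real, hidx]
          simp only [true_and, pair_inj hr' hr, RExp.eval, NExp.eval, he]
          split_ifs with h2
          · rw [h2.1, h2.2]
            rfl
          · rw [e9]
            refine hI₂ j' hj' r' hr' fun h3 => ?_
            have := h1 h3
            omega
    · intro σ' _ _ hI _ j' hj' r hr
      exact hI j' (by omega) r hr fun _ => hr
  · intro σ₂ hok₂ hf₂ hV₂
    have j₂ : σ₂.word 11 0 = j := (congrFun (hf₂.word 11 rfl) 0).trans hx₁
    have e10 : σ₂.real 10 = σ₁.real 10 := hf₂.real 10 rfl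
    refine wp_for k (fun a' σ' => ∀ j' ≤ j, ∀ a < k, (j' = j → a < a') →
      σ'.coeff k j' a = if j' = a then 1 else 0) (by omega) hL (by omega) (by omega) ?_
      (fun _ _ _ _ _ _ => h.k_eq) ?_ ?_
    · intro j' hj' a ha h1
      rw [State.coeff, State.setWord_real, e10]
      exact hR₁ j' (by by_contra h2; exact absurd (h1 (by omega)) (by omega)) a ha
    · intro a ha σ' hok' hf hI hx
      have e11 : σ'.word 11 0 = j := (congrFun (hf.word 11 rfl) 0).trans j₂
      have hidx : (NExp.add (.mul (.var 11) (.input 2)) (.var 20)).eval E.inp σ' = j * k + a := by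
        simp only [NExp.eval, e11, hx, h.k_eq]
      refine wp_setReal (by omega) ?_ ⟨hx, ?_⟩
      · rw [hidx]
        have := pair_lt hj ha
        omega
      · intro j' hj' a' ha' h1
        rw [State.coeff, State.setWord_real, State.setReal_real, hidx]
        simp only [true_and, pair_inj ha' ha]
        split_ifs with h2 h3 h3
        · rw [RExp.eval, eval_eqInd]
          simp only [NExp.eval, e11, hx]
          rw [if_pos (by omega)]
        · rw [RExp.eval, eval_eqInd]
          simp only [NExp.eval, e11, hx]
          rw [if_neg (by omega)]
        · have := hI j' hj' a' ha' (fun h4 => by have := h1 h4; omega)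
          rwa [if_pos h3] at this
        · have := hI j' hj' a' ha' (fun h4 => by have := h1 h4; omega)
          rwa [if_neg h3] at this
    · intro σ' _ hf hI _
      refine ⟨(congrFun (hf.word 11 rfl) 0).trans j₂, ?_, fun j' hj' a ha => ?_⟩
      · intro j' hj' r hr
        rw [State.vec, State.setWord_real, hf.real 9 rfl]
        exact hV₂ j' hj' r hr
      · exact hI j' (by omega) a ha fun _ => ha

theorem eval_height_cell (h : Setup E n d k q l) {x y j r : ℕ} (hq : σ.word 1 0 = q)
    (hx : σ.word x 0 = j) (hy : σ.word y 0 = r) :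
    (NExp.add (.mul (.var x) Prog.height) (.var y)).eval E.inp σ = j * heightS k q + r := by
  change σ.word x 0 * Prog.height.eval E.inp σ + σ.word y 0 = _
  rw [eval_height h hq, hx, hy]

theorem wp_stepCmd (h : Setup E n d k q l) (hq : σ.word 1 0 = q) {m : ℕ → ℕ → ℝ} {j l' : ℕ}
    (hj : j < k) (hl : l' < j) (hxj : σ.word 11 0 = j) (hxl : σ.word 20 0 = l')
    (hS : SameSpan (heightS k q) k m (σ.vec (heightS k q)) (σ.coeff k)) :
    wp E Prog.stepCmd (fun σ' =>
      SameSpan (heightS k q) k m (σ'.vec (heightS k q)) (σ'.coeff k) ∧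
      (∀ a < k, a ≠ j → ∀ r < heightS k q, σ'.vec (heightS k q) a r = σ.vec (heightS k q) a r) ∧
      ∃ c, c = dotRange (heightS k q) (σ.vec (heightS k q) j) (σ.vec (heightS k q) l') /
        dotRange (heightS k q) (σ.vec (heightS k q) l') (σ.vec (heightS k q) l') ∧
      ∀ r < heightS k q, σ'.vec (heightS k q) j r =
        σ.vec (heightS k q) j r - c * σ.vec (heightS k q) l' r) σ := by
  have hm := h.arrays
  have hL := h.L_pos
  have hkL := h.k_le
  have hsL := h.s_le
  have hsk := h.sk_le
  rw [mul_comm] at hsk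
  have hkk := h.kk_le
  have hLB := h.L_le_B
  have hLH := h.L_le_H
  have hc := fun (σ' : State) (x y j r : ℕ) => eval_height_cell (σ := σ') (x := x) (y := y)
    (j := j) (r := r) h
  set s := heightS k q with hs
  refine wp_seq' _ (wp_sum s (fun r => σ.vec s j r * σ.vec s l' r) (by omega) (by omega) hL
    (by omega) (by omega) ?_ ?_ (fun σ' _ _ he => he)) ?_
  · intro σ' hf
    exact eval_height h ((congrFun (hf.word 1 rfl) 0).trans hq)
  · intro r hr σ' _ hf hx
    have q' : σ'.word 1 0 = q := (congrFun (hf.word 1 rfl) 0).trans hq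
    have j' : σ'.word 11 0 = j := (congrFun (hf.word 11 rfl) 0).trans hxj
    have l'' : σ'.word 20 0 = l' := (congrFun (hf.word 20 rfl) 0).trans hxl
    rw [RExp.eval, RExp.eval, RExp.eval, hc σ' _ _ _ _ q' j' hx, hc σ' _ _ _ _ q' l'' hx,
      hf.real 9 rfl]
    rfl
  intro σ₁ _ hf₁ hnum
  have q₁ : σ₁.word 1 0 = q := (congrFun (hf₁.word 1 rfl) 0).trans hq
  have j₁ : σ₁.word 11 0 = j := (congrFun (hf₁.word 11 rfl) 0).trans hxj
  have l₁ : σ₁.word 20 0 = l' := (congrFun (hf₁.word 20 rfl) 0).trans hxl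
  have v₁ : σ₁.real 9 = σ.real 9 := hf₁.real 9 rfl
  have c₁ : σ₁.real 10 = σ.real 10 := hf₁.real 10 rfl
  refine wp_seq' _ (wp_sum s (fun r => σ.vec s l' r * σ.vec s l' r) (by omega) (by omega) hL
    (by omega) (by omega) ?_ ?_ (fun σ' _ _ he => he)) ?_
  · intro σ' hf
    exact eval_height h ((congrFun (hf.word 1 rfl) 0).trans q₁)
  · intro r hr σ' _ hf hx
    have q' : σ'.word 1 0 = q := (congrFun (hf.word 1 rfl) 0).trans q₁
    have l'' : σ'.word 20 0 = l' := (congrFun (hf.word 20 rfl) 0).trans l₁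
    rw [RExp.eval, RExp.eval, hc σ' _ _ _ _ q' l'' hx, hf.real 9 rfl, v₁]
    rfl
  intro σ₂ _ hf₂ hden
  have q₂ : σ₂.word 1 0 = q := (congrFun (hf₂.word 1 rfl) 0).trans q₁
  have j₂ : σ₂.word 11 0 = j := (congrFun (hf₂.word 11 rfl) 0).trans j₁
  have l₂ : σ₂.word 20 0 = l' := (congrFun (hf₂.word 20 rfl) 0).trans l₁
  have v₂ : σ₂.real 9 = σ.real 9 := (hf₂.real 9 rfl).trans v₁
  have c₂ : σ₂.real 10 = σ.real 10 := (hf₂.real 10 rfl).trans c₁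
  have num₂ : σ₂.real 11 0 = dotRange s (σ.vec s j) (σ.vec s l') :=
    (congrFun (hf₂.real 11 rfl) 0).trans hnum
  change σ₂.real 12 0 = dotRange s (σ.vec s l') (σ.vec s l') at hden
  set c := dotRange s (σ.vec s j) (σ.vec s l') / dotRange s (σ.vec s l') (σ.vec s l') with hcdef
  refine wp_seq' (fun σ' => ∀ a < k, ∀ r < s, σ'.vec s a r =
    if a = j then σ.vec s a r - c * σ.vec s l' r else σ.vec s a r) ?_ ?_
  · refine wp_for s (fun r' σ' => ∀ a < k, ∀ r < s, σ'.vec s a r =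
      if a = j ∧ r < r' then σ.vec s a r - c * σ.vec s l' r else σ.vec s a r) (by omega) hL
      (by omega) (by omega) ?_ ?_ ?_ ?_
    · intro a ha r hr
      rw [if_neg (by omega), State.vec, State.setWord_real, v₂]
      rfl
    · intro _ σ' _ hf _ _
      exact eval_height h ((congrFun (hf.word 1 rfl) 0).trans q₂)
    · intro r hr σ' _ hf hI hx
      have q' : σ'.word 1 0 = q := (congrFun (hf.word 1 rfl) 0).trans q₂
      have j' : σ'.word 11 0 = j := (congrFun (hf.word 11 rfl) 0).trans j₂
      have l'' : σ'.word 20 0 = l' := (congrFun (hf.word 20 rfl) 0).trans l₂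
      have n' : σ'.real 11 0 = dotRange s (σ.vec s j) (σ.vec s l') :=
        (congrFun (hf.real 11 rfl) 0).trans num₂
      have d' : σ'.real 12 0 = dotRange s (σ.vec s l') (σ.vec s l') :=
        (congrFun (hf.real 12 rfl) 0).trans hden
      have hidx := hc σ' _ _ _ _ q' j' hx
      refine wp_setReal (by omega) ?_ ⟨hx, ?_⟩
      · rw [hidx]
        have := pair_lt hj hr
        omega
      · have hev : (RExp.sub (Prog.vCell 11 13)
            (.mul (.div (.var 11) (.var 12)) (Prog.vCell 20 13))).eval E.inp σ' =
            σ.vec s j r - c * σ.vec s l' r := by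
          -- Cell `r` of vector `j` has not been written yet, and vector `l'` is a different vector
          -- that is never written here; so both cells still hold the original values.
          have h1 := hI j hj r hr
          have h2 := hI l' (by omega) r hr
          rw [if_neg (by omega)] at h1 h2
          rw [RExp.eval, RExp.eval, RExp.eval, RExp.eval, RExp.eval, RExp.eval, RExp.eval, hidx,
            hc σ' _ _ _ _ q' l'' hx]
          simp only [NExp.eval, n', d']
          rw [← h1, ← h2]
          rfl
        intro a ha r' hr'
        rw [State.vec, State.setWord_real, State.setReal_real, hidx, hev]
        simp only [true_and, pair_inj hr' hr]
        by_cases h2 : a = j ∧ r' = r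
        · rw [if_pos h2, if_pos (by omega), h2.1, h2.2]
        · rw [if_neg h2]
          refine (hI a ha r' hr').trans (if_congr ?_ rfl rfl)
          omega
    · intro σ' _ _ hI _ a ha r hr
      rw [hI a ha r hr]
      simp [hr]
  intro σ₃ _ hf₃ hV
  have j₃ : σ₃.word 11 0 = j := (congrFun (hf₃.word 11 rfl) 0).trans j₂
  have l₃ : σ₃.word 20 0 = l' := (congrFun (hf₃.word 20 rfl) 0).trans l₂
  have c₃ : σ₃.real 10 = σ.real 10 := (hf₃.real 10 rfl).trans c₂
  have n₃ : σ₃.real 11 0 = dotRange s (σ.vec s j) (σ.vec s l') :=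
    (congrFun (hf₃.real 11 rfl) 0).trans num₂
  have d₃ : σ₃.real 12 0 = dotRange s (σ.vec s l') (σ.vec s l') :=
    (congrFun (hf₃.real 12 rfl) 0).trans hden
  refine wp_for k (fun b' σ' => ∀ a < k, ∀ b < k, σ'.coeff k a b =
    if a = j ∧ b < b' then σ.coeff k a b - c * σ.coeff k l' b else σ.coeff k a b) (by omega) hL
    (by omega) (by omega) ?_ (fun _ _ _ _ _ _ => h.k_eq) ?_ ?_
  · intro a ha b hb
    rw [if_neg (by omega), State.coeff, State.setWord_real, c₃]
    rfl
  · intro b hb σ' _ hf hI hx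
    have j' : σ'.word 11 0 = j := (congrFun (hf.word 11 rfl) 0).trans j₃
    have l'' : σ'.word 20 0 = l' := (congrFun (hf.word 20 rfl) 0).trans l₃
    have n' : σ'.real 11 0 = dotRange s (σ.vec s j) (σ.vec s l') :=
      (congrFun (hf.real 11 rfl) 0).trans n₃
    have d' : σ'.real 12 0 = dotRange s (σ.vec s l') (σ.vec s l') :=
      (congrFun (hf.real 12 rfl) 0).trans d₃
    have hidx : (NExp.add (.mul (.var 11) (.input 2)) (.var 13)).eval E.inp σ' = j * k + b := by
      simp only [NExp.eval, j', hx, h.k_eq]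
    have hidx' : (NExp.add (.mul (.var 20) (.input 2)) (.var 13)).eval E.inp σ' = l' * k + b := by
      simp only [NExp.eval, l'', hx, h.k_eq]
    refine wp_setReal (by omega) ?_ ⟨hx, ?_⟩
    · rw [hidx]
      have := pair_lt hj hb
      omega
    · have hev : (RExp.sub (Prog.rCell 11 13)
          (.mul (.div (.var 11) (.var 12)) (Prog.rCell 20 13))).eval E.inp σ' =
          σ.coeff k j b - c * σ.coeff k l' b := by
        have h1 := hI j hj b hb
        have h2 := hI l' (by omega) b hb
        rw [if_neg (by omega)] at h1 h2
        rw [RExp.eval, RExp.eval, RExp.eval, RExp.eval, RExp.eval, RExp.eval, RExp.eval, hidx,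
          hidx']
        simp only [NExp.eval, n', d']
        rw [← h1, ← h2]
        rfl
      intro a ha b' hb'
      rw [State.coeff, State.setWord_real, State.setReal_real, hidx, hev]
      simp only [true_and, pair_inj hb' hb]
      by_cases h2 : a = j ∧ b' = b
      · rw [if_pos h2, if_pos (by omega), h2.1, h2.2]
      · rw [if_neg h2]
        refine (hI a ha b' hb').trans (if_congr ?_ rfl rfl)
        omega
  · intro σ' _ hf hI _
    have hV' : ∀ a < k, ∀ r < s, σ'.vec s a r =
        if a = j then σ.vec s a r - c * σ.vec s l' r else σ.vec s a r := by
      intro a ha r hr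
      rw [← hV a ha r hr, State.vec, hf.real 9 rfl]
      rfl
    refine ⟨hS.step (hl.trans hj) hl.ne c hV' fun a ha b hb => ?_, fun a ha haj r hr => ?_,
      c, rfl, fun r hr => ?_⟩
    · rw [hI a ha b hb]
      simp [hb]
    · rw [hV' a ha r hr, if_neg haj]
    · rw [hV' j hj r hr, if_pos rfl]

/-- Making vector `j` orthogonal to vector `l'` does not disturb its orthogonality to the vectors
before `l'`, because the vectors before `j` are already orthogonal to one another. -/
theorem wp_gramSchmidtCmd (h : Setup E n d k q l) (hq : σ.word 1 0 = q) {m : ℕ → ℕ → ℝ}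
    (hS : SameSpan (heightS k q) k m (σ.vec (heightS k q)) (σ.coeff k)) :
    wp E Prog.gramSchmidtCmd (fun σ' =>
      SameSpan (heightS k q) k m (σ'.vec (heightS k q)) (σ'.coeff k) ∧
      ∀ a < k, ∀ b < k, a ≠ b →
        dotRange (heightS k q) (σ'.vec (heightS k q) a) (σ'.vec (heightS k q) b) = 0) σ := by
  have hm := h.arrays
  have hL := h.L_pos
  have hkL := h.k_le
  have hLB := h.L_le_B
  have hLH := h.L_le_H
  set s := heightS k q with hs
  refine wp_for k (fun j σ' => SameSpan s k m (σ'.vec s) (σ'.coeff k) ∧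
    ∀ b < j, ∀ a < b, dotRange s (σ'.vec s a) (σ'.vec s b) = 0) (by omega) hL (by omega)
    (by omega) ⟨hS, by intro b hb; omega⟩ (fun _ _ _ _ _ _ => h.k_eq) ?_ ?_
  · rintro j hj σ₁ _ hf₁ ⟨hS₁, ho₁⟩ hx₁
    have q₁ : σ₁.word 1 0 = q := (congrFun (hf₁.word 1 rfl) 0).trans hq
    refine wp_for j (fun l' σ' => SameSpan s k m (σ'.vec s) (σ'.coeff k) ∧
      (∀ b < j, ∀ a < b, dotRange s (σ'.vec s a) (σ'.vec s b) = 0) ∧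
      ∀ a < l', dotRange s (σ'.vec s a) (σ'.vec s j) = 0) (by omega) hL (by omega) (by omega)
      ⟨hS₁, ho₁, by intro a ha; omega⟩ ?_ ?_ ?_
    · intro _ σ' _ hf _ _
      simp only [NExp.eval]
      exact (congrFun (hf.word 11 rfl) 0).trans hx₁
    · rintro l' hl' σ₂ _ hf₂ ⟨hS₂, ho₂, hoj⟩ hx₂
      have q₂ : σ₂.word 1 0 = q := (congrFun (hf₂.word 1 rfl) 0).trans q₁
      have j₂ : σ₂.word 11 0 = j := (congrFun (hf₂.word 11 rfl) 0).trans hx₁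
      refine (wp_stepCmd h q₂ hj hl' j₂ hx₂ hS₂).conseq ?_
      rintro σ₃ _ hf₃ ⟨hS₃, hV₃, c, hc, hVj⟩
      refine ⟨(congrFun (hf₃.word 20 rfl) 0).trans hx₂, hS₃, fun b hb a ha => ?_, fun a ha => ?_⟩
      · rw [← ho₂ b hb a ha]
        exact dotRange_congr (hV₃ a (by omega) (by omega)) (hV₃ b (by omega) (by omega))
      · have h1 : dotRange s ((σ₃.setWord 20 0 (l' + 1)).vec s a)
            ((σ₃.setWord 20 0 (l' + 1)).vec s j) = dotRange s (σ₂.vec s j) (σ₂.vec s a) -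
              c * dotRange s (σ₂.vec s l') (σ₂.vec s a) := by
          rw [← dotRange_sub, dotRange_comm]
          exact dotRange_congr hVj (hV₃ a (by omega) (by omega))
        rw [h1]
        rcases Nat.lt_succ_iff_lt_or_eq.1 ha with h2 | rfl
        · rw [dotRange_comm, hoj a h2, dotRange_comm, ho₂ l' hl' a h2]
          ring
        · by_cases h0 : dotRange s (σ₂.vec s a) (σ₂.vec s a) = 0
          · rw [h0, dotRange_comm, dotRange_eq_zero_of_self h0]
            ring
          · rw [hc, div_mul_cancel₀ _ h0, sub_self]
    · rintro σ' _ hf ⟨hS', ho', hoj⟩ _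
      refine ⟨(congrFun (hf.word 11 rfl) 0).trans hx₁, hS', fun b hb a ha => ?_⟩
      rcases Nat.lt_succ_iff_lt_or_eq.1 hb with h2 | rfl
      exacts [ho' b h2 a ha, hoj a ha]
  · rintro σ' _ _ ⟨hS', ho⟩ _
    refine ⟨hS', fun a ha b hb hab => ?_⟩
    rcases lt_or_gt_of_ne hab with h1 | h1
    · exact ho b hb a h1
    · rw [dotRange_comm]
      exact ho a ha b h1

theorem wp_coeffCmd (h : Setup E n d k q l) (hD : Data E eA eS eSA q l fA fS fSA σ) {c : ℕ}
    (hc : σ.word 17 0 = c) :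
    wp E (Prog.coeffCmd eSA) (fun σ' => ∀ a < k, σ'.real 13 a =
      dotRange (heightS k q) (σ.vec (heightS k q) a) (fun r => fSA r c) /
      dotRange (heightS k q) (σ.vec (heightS k q) a) (σ.vec (heightS k q) a)) σ := by
  have hm := h.arrays
  have hL := h.L_pos
  have hkL := h.k_le
  have hsL := h.s_le
  have hLB := h.L_le_B
  have hLH := h.L_le_H
  have hcell := fun (σ' : State) (x y j r : ℕ) => eval_height_cell (σ := σ') (x := x) (y := y)
    (j := j) (r := r) h
  set s := heightS k q with hs
  refine wp_for k (fun a' σ' => ∀ a < a', σ'.real 13 a = dotRange s (σ.vec s a) (fun r => fSA r c) /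
    dotRange s (σ.vec s a) (σ.vec s a)) (by omega) hL (by omega) (by omega)
    (by intro a ha; omega) (fun _ _ _ _ _ _ => h.k_eq) ?_ (fun _ _ _ h _ => h)
  intro a ha σ₁ _ hf₁ hI hx
  have hD₁ := hD.mono (hf₁.prot rfl rfl rfl rfl rfl rfl)
  have c₁ : σ₁.word 17 0 = c := (congrFun (hf₁.word 17 rfl) 0).trans hc
  have v₁ : σ₁.real 9 = σ.real 9 := hf₁.real 9 rfl
  refine wp_seq' _ (wp_sum s (fun r => σ.vec s a r * fSA r c) (by omega) (by omega) hL
    (by omega) (by omega) ?_ ?_ (fun σ' _ _ he => he)) ?_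
  · intro σ' hf
    exact eval_height h (hD₁.mono (hf.prot rfl rfl rfl rfl rfl rfl)).q_eq
  · intro r hr σ' _ hf hx'
    have hD' := hD₁.mono (hf.prot rfl rfl rfl rfl rfl rfl)
    have e20 : σ'.word 20 0 = a := (congrFun (hf.word 20 rfl) 0).trans hx
    have e17 : σ'.word 17 0 = c := (congrFun (hf.word 17 rfl) 0).trans c₁
    rw [RExp.eval, RExp.eval, hD'.evalSA, hcell σ' _ _ _ _ hD'.q_eq e20 hx', hf.real 9 rfl, v₁]
    simp only [NExp.eval, hx', e17]
    rfl
  intro σ₂ _ hf₂ hnum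
  have hD₂ := hD₁.mono (hf₂.prot rfl rfl rfl rfl rfl rfl)
  have a₂ : σ₂.word 20 0 = a := (congrFun (hf₂.word 20 rfl) 0).trans hx
  have v₂ : σ₂.real 9 = σ.real 9 := (hf₂.real 9 rfl).trans v₁
  refine wp_seq' _ (wp_sum s (fun r => σ.vec s a r * σ.vec s a r) (by omega) (by omega) hL
    (by omega) (by omega) ?_ ?_ (fun σ' _ _ he => he)) ?_
  · intro σ' hf
    exact eval_height h (hD₂.mono (hf.prot rfl rfl rfl rfl rfl rfl)).q_eq
  · intro r hr σ' _ hf hx'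
    have hD' := hD₂.mono (hf.prot rfl rfl rfl rfl rfl rfl)
    have e20 : σ'.word 20 0 = a := (congrFun (hf.word 20 rfl) 0).trans a₂
    rw [RExp.eval, RExp.eval, hcell σ' _ _ _ _ hD'.q_eq e20 hx', hf.real 9 rfl, v₂]
    rfl
  intro σ₃ _ hf₃ hden
  have a₃ : σ₃.word 20 0 = a := (congrFun (hf₃.word 20 rfl) 0).trans a₂
  have n₃ : σ₃.real 11 0 = dotRange s (σ.vec s a) (fun r => fSA r c) :=
    (congrFun (hf₃.real 11 rfl) 0).trans hnum
  have e13 : σ₃.real 13 = σ₁.real 13 := (hf₃.real 13 rfl).trans (hf₂.real 13 rfl)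
  refine wp_setReal (by omega) (by simp only [NExp.eval, a₃]; omega) ⟨a₃, fun a' ha' => ?_⟩
  simp only [State.setWord_real, State.setReal_real, NExp.eval, RExp.eval, a₃, n₃, hden, true_and,
    e13]
  split_ifs with h1
  · rw [h1]
    rfl
  · exact hI a' (by omega)

theorem wp_solveCmd (h : Setup E n d k q l) (hD : Data E eA eS eSA q l fA fS fSA σ) :
    wp E (Prog.solveCmd eSA) (fun σ' => ∀ j < k, ∀ c < d, σ'.real 0 (j * d + c) =
      ∑ a ∈ Finset.range k, σ.coeff k a j *
        (dotRange (heightS k q) (σ.vec (heightS k q) a) (fun r => fSA r c) /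
        dotRange (heightS k q) (σ.vec (heightS k q) a) (σ.vec (heightS k q) a))) σ := by
  have hm := h.arrays
  have hL := h.L_pos
  have hkL := h.k_le
  have hdL := h.d_le
  have hkd := h.kd_le
  have hLB := h.L_le_B
  have hLH := h.L_le_H
  set s := heightS k q with hs
  set Z : ℕ → ℕ → ℝ := fun a c => dotRange s (σ.vec s a) (fun r => fSA r c) /
        dotRange s (σ.vec s a) (σ.vec s a) with hZ
  refine wp_for d (fun c' σ' => ∀ j < k, ∀ c < c', σ'.real 0 (j * d + c) =
    ∑ a ∈ Finset.range k, σ.coeff k a j * Z a c) (by omega) hL (by omega) (by omega)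
    (by intro j hj c hc; omega) (fun _ _ _ _ _ _ => h.d_eq) ?_ (fun _ _ _ h _ => h)
  intro c hc σ₁ _ hf₁ hI hx
  have hD₁ := hD.mono (hf₁.prot rfl rfl rfl rfl rfl rfl)
  have v₁ : σ₁.real 9 = σ.real 9 := hf₁.real 9 rfl
  have c₁ : σ₁.real 10 = σ.real 10 := hf₁.real 10 rfl
  have hv₁ : σ₁.vec s = σ.vec s := by
    funext j r
    rw [State.vec, v₁]
    rfl
  refine wp_seq' _ (wp_coeffCmd h hD₁ hx) fun σ₂ _ hf₂ hz => ?_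
  rw [← hs, hv₁] at hz
  have x₂ : σ₂.word 17 0 = c := (congrFun (hf₂.word 17 rfl) 0).trans hx
  have c₂ : σ₂.real 10 = σ.real 10 := (hf₂.real 10 rfl).trans c₁
  have o₂ : σ₂.real 0 = σ₁.real 0 := hf₂.real 0 rfl
  refine wp_for k (fun j' σ' => ∀ j < k, ∀ c' < c + 1, (c' = c → j < j') →
    σ'.real 0 (j * d + c') = ∑ a ∈ Finset.range k, σ.coeff k a j * Z a c') (by omega) hL (by omega)
    (by omega) ?_ (fun _ _ _ _ _ _ => h.k_eq) ?_ ?_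
  · intro j hj c' hc' h1
    rw [State.setWord_real, o₂]
    exact hI j hj c' (by by_contra h2; exact absurd (h1 (by omega)) (by omega))
  · intro j hj σ₃ _ hf₃ hI₃ hx₃
    have x₃ : σ₃.word 17 0 = c := (congrFun (hf₃.word 17 rfl) 0).trans x₂
    refine wp_seq' _ (wp_sum k (fun a => σ.coeff k a j * Z a c) (by omega) (by omega) hL
      (by omega) (by omega) (fun _ _ => h.k_eq) ?_ (fun σ' _ _ he => he)) ?_
    · intro a ha σ' _ hf hxa
      have e11 : σ'.word 11 0 = j := (congrFun (hf.word 11 rfl) 0).trans hx₃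
      have r10 : σ'.real 10 = σ.real 10 := (hf.real 10 rfl).trans ((hf₃.real 10 rfl).trans c₂)
      have r13 : σ'.real 13 = σ₂.real 13 := (hf.real 13 rfl).trans (hf₃.real 13 rfl)
      simp only [RExp.eval, NExp.eval, e11, r10, r13, hxa, h.k_eq, hz a ha]
      rfl
    · intro σ' _ hf he
      have e11 : σ'.word 11 0 = j := (congrFun (hf.word 11 rfl) 0).trans hx₃
      have e17 : σ'.word 17 0 = c := (congrFun (hf.word 17 rfl) 0).trans x₃
      have r0 : σ'.real 0 = σ₃.real 0 := hf.real 0 rfl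
      have hidx : (NExp.add (.mul (.var 11) (.input 1)) (.var 17)).eval E.inp σ' = j * d + c := by
        simp only [NExp.eval, e11, e17, h.d_eq]
      refine wp_setReal (by omega) ?_ ⟨e11, ?_⟩
      · rw [hidx]
        have := pair_lt hj hc
        omega
      · intro j' hj' c' hc' h1
        rw [State.setWord_real, State.setReal_real, hidx]
        simp only [true_and, pair_inj (show c' < d by omega) hc, RExp.eval, NExp.eval, he]
        split_ifs with h2
        · rw [h2.1, h2.2]
        · rw [r0]
          refine hI₃ j' hj' c' hc' fun h3 => ?_
          have := h1 h3
          omega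
  · intro σ' _ hf hI' _
    refine ⟨(congrFun (hf.word 17 rfl) 0).trans x₂, fun j hj c' hc' => ?_⟩
    exact hI' j hj c' hc' fun _ => hj

/-- The computed centers satisfy the normal equations of the sketched least squares problem. -/
theorem wp_centersCmd (h : Setup E n d k q l) (hD : Data E eA eS eSA q l fA fS fSA σ) :
    wp E (Prog.centersCmd eS eSA) (fun σ' => ∀ j < k, ∀ c < d,
      dotRange (heightS k q) (sketchedCluster n fS (σ.word 0) j) (fun r => fSA r c -
        ∑ a ∈ Finset.range k, sketchedCluster n fS (σ.word 0) a r * σ'.real 0 (a * d + c)) = 0)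
      σ := by
  set s := heightS k q with hs
  refine wp_seq' _ (wp_loadCmd h hD) ?_
  rintro σ₁ _ hf₁ ⟨hV, hR⟩
  have hD₁ := hD.mono (hf₁.prot rfl rfl rfl rfl rfl rfl)
  have hS₁ : SameSpan s k (sketchedCluster n fS (σ.word 0)) (σ₁.vec s) (σ₁.coeff k) := by
    refine ⟨fun j hj r hr => ?_, fun w hw j hj => ?_⟩
    · rw [Finset.sum_congr rfl fun a ha => by rw [hR j hj a (Finset.mem_range.1 ha)], hV j hj r hr]
      simp [hj]
    · rw [← hw j hj]
      exact dotRange_congr (fun r hr => (hV j hj r hr).symm) fun _ _ => rfl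
  refine wp_seq' _ (wp_gramSchmidtCmd h hD₁.q_eq hS₁) ?_
  rintro σ₂ _ hf₂ ⟨hS₂, ho⟩
  have hD₂ := hD₁.mono (hf₂.prot rfl rfl rfl rfl rfl rfl)
  refine (wp_solveCmd h hD₂).conseq ?_
  intro σ' _ _ hC j hj c hc
  exact hS₂.normal_equations ho (fun r => fSA r c) (fun a => σ'.real 0 (a * d + c))
    (fun a ha => hC a ha c hc) j hj

end centers

/-! ## The reconstruction from the sketches -/

def Prog.reconstructCmd (eA eS eSA : NExp → NExp → RExp) : Cmd :=
  .seq (searchCmd eA) (centersCmd eS eSA)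

theorem wp_reconstructCmd {E : Env} {n d k q l : ℕ} {eA eS eSA : NExp → NExp → RExp}
    {fA fS fSA : ℕ → ℕ → ℝ} {σ : State} (h : Setup E n d k q l)
    (hD : Data E eA eS eSA q l fA fS fSA σ)
    (h5 : σ.word 5 = 0) (h7 : σ.word 7 = 0) (h8 : σ.word 8 = 0) :
    wp E (Prog.reconstructCmd eA eS eSA) (fun σ' =>
      (∀ i < n, σ'.word 0 i = searchResult q l fA n k i) ∧
      ∀ j < k, ∀ c < d,
        dotRange (heightS k q) (sketchedCluster n fS (searchResult q l fA n k) j) (fun r => fSA r c -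
          ∑ a ∈ Finset.range k, sketchedCluster n fS (searchResult q l fA n k) a r *
            σ'.real 0 (a * d + c)) = 0) σ := by
  refine wp_seq' _ (wp_searchCmd h hD h5 h7 h8) fun σ₁ _ hf₁ hs => ?_
  have hD₁ := hD.mono (hf₁.prot rfl rfl rfl rfl rfl rfl)
  refine (wp_centersCmd h hD₁).conseq fun σ₂ _ hf₂ hc => ?_
  have e0 : σ₂.word 0 = σ₁.word 0 := hf₂.word 0 rfl
  have : sketchedCluster n fS (σ₁.word 0) = sketchedCluster n fS (searchResult q l fA n k) := by
    funext j r
    exact Finset.sum_congr rfl fun i hi => by rw [hs i (Finset.mem_range.1 hi)]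
  rw [this] at hc
  exact ⟨fun i hi => by rw [e0, hs i hi], hc⟩

/-! ## Initialization -/

/-- The least prime that is at least `N`. -/
def nextPrime (N : ℕ) : ℕ := Nat.find (Nat.exists_infinite_primes N)

theorem nextPrime_prime (N : ℕ) : (nextPrime N).Prime := (Nat.find_spec (Nat.exists_infinite_primes N)).2
theorem le_nextPrime (N : ℕ) : N ≤ nextPrime N := (Nat.find_spec (Nat.exists_infinite_primes N)).1
theorem nextPrime_le {N p : ℕ} (h : N ≤ p) (hp : p.Prime) : nextPrime N ≤ p := Nat.find_min' _ ⟨h, hp⟩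
theorem nextPrime_le_two_mul {N : ℕ} (hN : N ≠ 0) : nextPrime N ≤ 2 * N := by
  obtain ⟨p, hp, h1, h2⟩ := Nat.exists_prime_lt_and_le_two_mul N hN
  exact (nextPrime_le h1.le hp).trans h2

/-- The modulus of the hash functions. -/
def hashPrime (n d : ℕ) : ℕ := nextPrime (n + d + 5)

/-- The number of random coefficients. -/
def numCoeffs (k q l : ℕ) : ℕ := 4 * (widthT q l + heightS k q)

namespace Prog

/-- The machine cannot convert reals to words, so ⌈1/ε⌉ is found by counting up until the counter
times ε reaches 1; the logarithm is found by doubling. -/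
def paramCmd : Cmd :=
  .seq (.loop (.realLt (.mul (.ofWord (.var 1)) (.input 0 (.lit 0) (.lit 0))) (.ofWord (.lit 1)))
    (.setN 1 (.add (.var 1) (.lit 1))))
  (.seq (.setN 22 (.lit 1))
    (.loop (.wordLt (.var 22) (.mul (.input 0) (.input 2)))
      (.seq (.setN 22 (.mul (.var 22) (.lit 2))) (.setN 2 (.add (.var 2) (.lit 1))))))

def primeCmd : Cmd :=
  .seq (.setN 3 (.add (.add (.input 0) (.input 1)) (.lit 5)))
  (.seq (.setN 23 (.lit 2))
    (.loop (.wordLt (.var 23) (.var 3))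
      (.branch (.wordLt (.lit 0) (.mod (.var 3) (.var 23)))
        (.setN 23 (.add (.var 23) (.lit 1)))
        (.seq (.setN 3 (.add (.var 3) (.lit 1))) (.setN 23 (.lit 2))))))

def drawCmd : Cmd :=
  .for 24 (.mul (.lit 4) (.add width height)) (.draw 4 (.var 24) (.sub (.var 3) (.lit 1)))

def initCmd : Cmd := .seq paramCmd (.seq primeCmd drawCmd)

end Prog

section init
variable {E : Env} {n d k q l : ℕ} {σ : State} {ε : ℝ}

theorem wp_paramCmd (h : Setup E n d k q l) (hε : 0 < ε) (he : E.inp.real 0 0 0 = ε)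
    (hq : q = ⌈1 / ε⌉₊) (hl : l = Nat.clog 2 (n * k)) (hB : 2 * (n * k) ≤ E.B)
    (h1 : σ.word 1 0 = 0) (h2 : σ.word 2 0 = 0) :
    wp E Prog.paramCmd (fun σ' => σ'.word 1 0 = q ∧ σ'.word 2 0 = l ∧ σ'.draws = σ.draws) σ := by
  have hm := h.arrays
  have hL := h.L_pos
  have hLB := h.L_le_B
  have hLH := h.L_le_H
  have hqL : q ≤ E.L := (Nat.le_mul_of_pos_left _ (by norm_num)).trans h.M_le
  have hlL : l ≤ E.L := (Nat.le_mul_of_pos_left _ (by norm_num)).trans h.G_le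
  have hnk : 0 < n * k := Nat.mul_pos h.n_pos h.k_pos
  refine wp_seq' (fun σ' => σ'.word 1 0 = q ∧ σ'.draws = σ.draws) ?_ ?_
  · refine wp_loop q (fun i σ' => i ≤ q ∧ σ'.word 1 0 = i ∧ σ'.draws = σ.draws) (by omega)
      ⟨Nat.zero_le _, h1, rfl⟩ ?_
    rintro i σ' _ _ ⟨hi, hi', hd⟩
    have hb : BExp.Holds E.inp σ' (.realLt (.mul (.ofWord (.var 1)) (.input 0 (.lit 0) (.lit 0)))
        (.ofWord (.lit 1))) ↔ i < q := by
      simp only [BExp.Holds, RExp.eval, NExp.eval, hi', he, hq, Nat.lt_ceil, lt_div_iff₀ hε,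
        Nat.cast_one]
    rcases hi.lt_or_eq with h3 | rfl
    · refine Or.inl ⟨hb.2 h3, h3, wp_setWord (by omega) hL (by simp only [NExp.eval, hi']; omega) ?_⟩
      exact ⟨h3, by simp [NExp.eval, hi'], hd⟩
    · exact Or.inr ⟨fun h4 => lt_irrefl _ (hb.1 h4), hi', hd⟩
  · rintro σ₁ _ hf₁ ⟨hq₁, hd₁⟩
    refine wp_seq (wp_setWord (by omega) hL (by simp only [NExp.eval]; omega) ?_)
    refine wp_loop l (fun i σ' => i ≤ l ∧ σ'.word 22 0 = 2 ^ i ∧ σ'.word 1 0 = q ∧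
      σ'.word 2 0 = i ∧ σ'.draws = σ.draws) (by omega) ⟨Nat.zero_le _, by simp [NExp.eval], ?_, ?_,
        hd₁⟩ ?_
    · rw [State.setWord_word_of_ne _ _ _ (by decide), hq₁]
    · rw [State.setWord_word_of_ne _ _ _ (by decide), hf₁.word 2 rfl, h2]
    rintro i σ' _ _ ⟨hi, hp, hq', hi', hd⟩
    have hb : BExp.Holds E.inp σ' (.wordLt (.var 22) (.mul (.input 0) (.input 2))) ↔ i < l := by
      simp only [BExp.Holds, NExp.eval, hp, h.n_eq, h.k_eq, hl]
      rw [← not_le, ← not_le, Nat.clog_le_iff_le_pow (by norm_num)]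
    rcases hi.lt_or_eq with h3 | rfl
    · refine Or.inl ⟨hb.2 h3, h3, ?_⟩
      have h4 := hb.2 h3
      simp only [BExp.Holds, NExp.eval, hp, h.n_eq, h.k_eq] at h4
      refine wp_seq (wp_setWord (by omega) hL (by simp only [NExp.eval, hp]; omega)
        (wp_setWord (by omega) hL ?_ ?_))
      · simp [NExp.eval, State.setWord_word, hi']
        omega
      · exact ⟨h3, by simp [NExp.eval, State.setWord_word, hp, pow_succ],
          by simp [State.setWord_word, hq'], by simp [NExp.eval, State.setWord_word, hi'], hd⟩
    · exact Or.inr ⟨fun h4 => lt_irrefl _ (hb.1 h4), hq', hi', hd⟩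

theorem wp_primeCmd (h : Setup E n d k q l) (hB : 2 * (n + d + 5) ≤ E.B)
    (hH : (2 * (n + d + 5) + 1) * (2 * (n + d + 5) + 1) ≤ E.H) :
    wp E Prog.primeCmd (fun σ' => σ'.word 3 0 = hashPrime n d ∧ σ'.draws = σ.draws) σ := by
  have hm := h.arrays
  have hL := h.L_pos
  set N := n + d + 5 with hN
  have hP := nextPrime_le_two_mul (show N ≠ 0 by omega)
  have hPp := nextPrime_prime N
  refine wp_seq (wp_setWord (by omega) hL (by simp only [NExp.eval, h.n_eq, h.d_eq]; omega) ?_)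
  refine wp_seq (wp_setWord (by omega) hL (by simp only [NExp.eval]; omega) ?_)
  -- The iteration counter is bounded by (p - N) · 2N + x. A larger trial divisor increases x by 1,
  -- and passing to p + 1 gains 2N, which pays for the reset of x because x < p ≤ 2N by Bertrand's
  -- postulate.
  refine wp_loop ((2 * N + 1) * (2 * N + 1)) (fun i σ' => ∃ p x, σ'.word 3 0 = p ∧ σ'.word 23 0 = x ∧
    N ≤ p ∧ p ≤ nextPrime N ∧ 2 ≤ x ∧ x ≤ p ∧ (∀ y, 2 ≤ y → y < x → ¬ y ∣ p) ∧
    i ≤ (p - N) * (2 * N) + x ∧ σ'.draws = σ.draws) hH ?_ ?_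
  · refine ⟨N, 2, ?_, by simp [NExp.eval], le_rfl, le_nextPrime N, le_rfl, by omega,
      by intro y h1 h2; omega, by omega, rfl⟩
    simp [State.setWord_word, NExp.eval, h.n_eq, h.d_eq, hN]
  · rintro i σ' _ _ ⟨p, x, hp, hx, h1, h2, h3, h4, h5, h6, h7⟩
    rcases h4.lt_or_eq with hxp | rfl
    · refine Or.inl ⟨by simpa only [BExp.Holds, NExp.eval, hp, hx], ?_, ?_⟩
      · have : (p - N) * (2 * N) ≤ N * (2 * N) := Nat.mul_le_mul_right _ (by omega)
        nlinarith
      refine wp_branch (fun hb => ?_) (fun hb => ?_)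
      · simp only [BExp.Holds, NExp.eval, hp, hx] at hb
        refine wp_setWord (by omega) hL (by simp only [NExp.eval, hx]; omega)
          ⟨p, x + 1, by simp [State.setWord_word, hp], by simp [NExp.eval, hx], h1, h2, by omega,
            hxp, fun y hy hy' => ?_, by omega, h7⟩
        rcases Nat.lt_succ_iff_lt_or_eq.1 hy' with h8 | rfl
        · exact h5 y hy h8
        · rw [Nat.dvd_iff_mod_eq_zero]
          omega
      · simp only [BExp.Holds, NExp.eval, hp, hx, not_lt, Nat.le_zero] at hb
        have hdvd : x ∣ p := Nat.dvd_of_mod_eq_zero hb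
        have hne : p ≠ nextPrime N := by
          rintro rfl
          rcases (Nat.dvd_prime hPp).1 hdvd with h8 | h8 <;> omega
        refine wp_seq (wp_setWord (by omega) hL (by simp only [NExp.eval, hp]; omega)
          (wp_setWord (by omega) hL (by simp only [NExp.eval]; omega)
          ⟨p + 1, 2, by simp [State.setWord_word, NExp.eval, hp], by simp [NExp.eval],
            by omega, by omega, le_rfl, by omega, by intro y h1 h2; omega, ?_, h7⟩))
        rw [show p + 1 - N = p - N + 1 by omega, Nat.add_one_mul]
        omega
    · refine Or.inr ⟨by simp only [BExp.Holds, NExp.eval, hp, hx]; omega, ?_, h7⟩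
      rw [hp]
      refine le_antisymm h2 (nextPrime_le h1 (Nat.prime_def.2 ⟨h3, fun y hy => ?_⟩))
      by_contra hc
      push Not at hc
      have := Nat.le_of_dvd (by omega) hy
      have h0 : y ≠ 0 := by rintro rfl; simp at hy; omega
      exact h5 y (by omega) (by omega) hy

/-- The random coefficients as they are kept in memory. -/
def coeffArray (ω : Tape) (p N : ℕ) (x : ℕ) : ℕ := if x < N then (ω (x, p - 1)).val else 0

theorem wp_drawCmd (h : Setup E n d k q l) (hN : numCoeffs k q l ≤ E.L) (hq : σ.word 1 0 = q)
    (hl : σ.word 2 0 = l) {p : ℕ} (hp : σ.word 3 0 = p) (hpB : p ≤ E.B) (h4 : σ.word 4 = 0)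
    (hd : σ.draws = 0) :
    wp E Prog.drawCmd (fun σ' => σ'.word 4 = coeffArray E.tape p (numCoeffs k q l)) σ := by
  have hm := h.arrays
  have hL := h.L_pos
  have hLB := h.L_le_B
  have hLH := h.L_le_H
  -- The number of draws and the loop counter agree, so cell `i` receives the tape entry at `(i, p -
  -- 1)`.
  refine wp_for (numCoeffs k q l) (fun i σ' => σ'.draws = i ∧ σ'.word 4 = coeffArray E.tape p i)
    (by omega) hL (by omega) (by omega) ⟨by simpa using hd, ?_⟩ ?_ ?_ ?_
  · rw [State.setWord_word_of_ne _ _ _ (by decide), h4]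
    funext x
    simp [coeffArray]
  · intro _ σ' _ hf _ _
    have q' : σ'.word 1 0 = q := (congrFun (hf.word 1 rfl) 0).trans hq
    have l' : σ'.word 2 0 = l := (congrFun (hf.word 2 rfl) 0).trans hl
    change 4 * (Prog.width.eval E.inp σ' + Prog.height.eval E.inp σ') = _
    rw [eval_width q' l', eval_height h q']
    rfl
  · rintro i hi σ' _ hf ⟨hd', hI⟩ hx
    have p' : σ'.word 3 0 = p := (congrFun (hf.word 3 rfl) 0).trans hp
    refine wp_draw (by omega) (by simp only [NExp.eval, hx]; omega)
      (by simp only [NExp.eval, p']; omega) ⟨?_, ?_, ?_⟩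
    · change (σ'.setWord 4 ((NExp.var 24).eval E.inp σ')
        (E.tape (σ'.draws, (NExp.sub (.var 3) (.lit 1)).eval E.inp σ'))).word 24 0 = _
      rw [State.setWord_word_of_ne _ _ _ (by decide), hx]
    · simp [hd']
    · rw [State.setWord_word_of_ne _ _ _ (by decide)]
      funext x
      change (σ'.setWord 4 ((NExp.var 24).eval E.inp σ')
        (E.tape (σ'.draws, (NExp.sub (.var 3) (.lit 1)).eval E.inp σ'))).word 4 x = _
      rw [State.setWord_word, hI, hd']
      subst p'
      simp only [NExp.eval, hx, true_and, coeffArray]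
      by_cases h1 : x = i
      · subst h1
        simp
      · rw [if_neg h1]
        exact if_congr (by omega) rfl rfl
  · rintro σ' _ _ ⟨_, hI⟩ _
    exact hI

end init

/-! ## Hashing -/

/-- The centered value at `x` of the random cubic polynomial modulo `p` whose coefficients start at
position `b`. -/
noncomputable def hashVal (p : ℕ) (a : ℕ → ℕ) (b x : ℕ) : ℝ :=
  ((2 * ((a b + (a (b + 1) * x + (a (b + 2) * (x * x) + a (b + 3) * (x * (x * x))))) % p) : ℕ) : ℝ) -
    ((p - 1 : ℕ) : ℝ)

theorem abs_hashVal_le {p : ℕ} (hp : 0 < p) (a : ℕ → ℕ) (b x : ℕ) : |hashVal p a b x| ≤ p := by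
  obtain ⟨P, rfl⟩ : ∃ P, p = P + 1 := ⟨p - 1, by omega⟩
  have := Nat.mod_lt
    (a b + (a (b + 1) * x + (a (b + 2) * (x * x) + a (b + 3) * (x * (x * x))))) hp
  rw [hashVal, abs_le]
  set m := (a b + (a (b + 1) * x + (a (b + 2) * (x * x) + a (b + 3) * (x * (x * x))))) % (P + 1)
  have h1 : (m : ℝ) ≤ P := by exact_mod_cast Nat.lt_succ_iff.1 this
  have h2 : (0 : ℝ) ≤ m := Nat.cast_nonneg _
  push_cast
  constructor <;> linarith

theorem exists_int_hashVal (p : ℕ) (a : ℕ → ℕ) (b x : ℕ) : ∃ z : ℤ, hashVal p a b x = z :=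
  ⟨((2 * ((a b + (a (b + 1) * x + (a (b + 2) * (x * x) + a (b + 3) * (x * (x * x))))) % p) : ℕ) : ℤ) -
    ((p - 1 : ℕ) : ℤ), by rw [hashVal]; norm_cast⟩

namespace Prog

/-- An entry of a sketching matrix is recomputed from four stored coefficients whenever it is
needed, so the matrices themselves occupy no memory. -/
abbrev hashExp (b x : NExp) : RExp :=
  .sub (.ofWord (.mul (.lit 2) (.mod (.add (.cell 4 b) (.add (.mul (.cell 4 (.add b (.lit 1))) x)
    (.add (.mul (.cell 4 (.add b (.lit 2))) (.mul x x))
      (.mul (.cell 4 (.add b (.lit 3))) (.mul x (.mul x x)))))) (.var 3))))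
    (.ofWord (.sub (.var 3) (.lit 1)))

abbrev entryT (c j : NExp) : RExp := hashExp (.mul (.lit 4) c) j
abbrev entryS (r i : NExp) : RExp := hashExp (.mul (.lit 4) (.add width r)) i

def updateT : Cmd :=
  .for 13 width (.setReal 1 (.add (.mul (.input 3) width) (.var 13))
    (.add (.cell 1 (.add (.mul (.input 3) width) (.var 13)))
      (.mul (.input 1 (.lit 0) (.lit 0)) (entryT (.var 13) (.input 4)))))

def updateS : Cmd :=
  .for 13 height (.setReal 2 (.add (.mul (.var 13) (.input 1)) (.input 4))
    (.add (.cell 2 (.add (.mul (.var 13) (.input 1)) (.input 4)))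
      (.mul (.input 1 (.lit 0) (.lit 0)) (entryS (.var 13) (.input 3)))))

def updateCmd : Cmd := .seq updateT updateS

def finishCmd : Cmd :=
  reconstructCmd (fun x y => .cell 1 (.add (.mul x width) y)) entryS
    (fun x y => .cell 2 (.add (.mul x (.input 1)) y))

end Prog

/-- The streaming algorithm. -/
def kMeansStream : StreamAlg := ⟨Prog.initCmd, Prog.updateCmd, Prog.finishCmd⟩

/-- The sketch `A T` as it is kept in memory; `T` is given by its columns. -/
noncomputable def sketchRight {n d : ℕ} (A : Matrix (Fin n) (Fin d) ℝ) (t : ℕ) (T : ℕ → ℕ → ℝ)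
    (x : ℕ) : ℝ :=
  ∑ j ∈ Finset.range d, matrixArray A (x / t) j * T (x % t) j

/-- The sketch `S A` as it is kept in memory. -/
noncomputable def sketchLeft {n d : ℕ} (A : Matrix (Fin n) (Fin d) ℝ) (s : ℕ) (S : ℕ → ℕ → ℝ)
    (x : ℕ) : ℝ :=
  -- The guard matters: beyond the last row all coefficients read as 0, but the centered hash value
  -- is then `-(p - 1)`, while unused cells must hold 0.
  if x / d < s then ∑ i ∈ Finset.range n, S (x / d) i * matrixArray A i (x % d) else 0

/-- The memory while the stream is read. -/
structure StreamMem {n d : ℕ} (A : Matrix (Fin n) (Fin d) ℝ) (k q l : ℕ) (ω : Tape) (σ : State) :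
    Prop where
  w1 : σ.word 1 0 = q
  w2 : σ.word 2 0 = l
  w3 : σ.word 3 0 = hashPrime n d
  w4 : σ.word 4 = coeffArray ω (hashPrime n d) (numCoeffs k q l)
  w5 : σ.word 5 = 0
  w7 : σ.word 7 = 0
  w8 : σ.word 8 = 0
  real : ∀ a, a ≠ 1 → a ≠ 2 → σ.real a = 0
  r1 : ∀ x, σ.real 1 x = sketchRight A (widthT q l) (fun c j =>
    hashVal (hashPrime n d) (coeffArray ω (hashPrime n d) (numCoeffs k q l)) (4 * c) j) x
  r2 : ∀ x, σ.real 2 x = sketchLeft A (heightS k q) (fun r i =>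
    hashVal (hashPrime n d) (coeffArray ω (hashPrime n d) (numCoeffs k q l))
      (4 * (widthT q l + r)) i) x

section stream
variable {E : Env} {n d k q l : ℕ} {σ : State} {ε : ℝ}

theorem eval_hashExp {p : ℕ} {a : ℕ → ℕ} (h3 : σ.word 3 0 = p) (h4 : σ.word 4 = a) (b x : NExp) :
    (Prog.hashExp b x).eval E.inp σ = hashVal p a (b.eval E.inp σ) (x.eval E.inp σ) := by
  simp only [RExp.eval, NExp.eval, h3, h4, hashVal]

theorem matrixArray_add_single (A : Matrix (Fin n) (Fin d) ℝ) (i : Fin n) (j : Fin d) (c : ℝ)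
    (x y : ℕ) : matrixArray (A + Matrix.single i j c) x y =
      matrixArray A x y + if x = i ∧ y = j then c else 0 := by
  by_cases h : x < n ∧ y < d
  · simp only [matrixArray, h, and_self, dif_pos, Matrix.add_apply, Matrix.single_apply, Fin.ext_iff,
      eq_comm]
  · rw [matrixArray, matrixArray, dif_neg h, dif_neg h, if_neg, add_zero]
    rintro ⟨rfl, rfl⟩
    exact h ⟨i.2, j.2⟩

theorem sketchRight_add_single (A : Matrix (Fin n) (Fin d) ℝ) (i : Fin n) (j : Fin d) (c : ℝ)
    (t : ℕ) (T : ℕ → ℕ → ℝ) (x : ℕ) : sketchRight (A + Matrix.single i j c) t T x =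
      sketchRight A t T x + if x / t = i then c * T (x % t) j else 0 := by
  simp only [sketchRight, matrixArray_add_single, add_mul, Finset.sum_add_distrib]
  congr 1
  split_ifs with h
  · rw [Finset.sum_eq_single_of_mem (j : ℕ) (Finset.mem_range.2 j.2)]
    · simp [h]
    · intro b _ hb
      simp [hb]
  · simp [h]

theorem sketchLeft_add_single (A : Matrix (Fin n) (Fin d) ℝ) (i : Fin n) (j : Fin d) (c : ℝ)
    (s : ℕ) (S : ℕ → ℕ → ℝ) (x : ℕ) : sketchLeft (A + Matrix.single i j c) s S x =
      sketchLeft A s S x + if x / d < s ∧ x % d = j then c * S (x / d) i else 0 := by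
  simp only [sketchLeft]
  by_cases hs : x / d < s
  · simp only [hs, if_true, matrixArray_add_single, mul_add, Finset.sum_add_distrib, true_and]
    congr 1
    split_ifs with h
    · rw [Finset.sum_eq_single_of_mem (i : ℕ) (Finset.mem_range.2 i.2)]
      · simp [h, mul_comm]
      · intro b _ hb
        simp [hb]
    · simp [h]
  · simp [hs]

theorem eq_pair_iff {t x i r : ℕ} (hr : r < t) : x = i * t + r ↔ x / t = i ∧ x % t = r := by
  constructor
  · rintro rfl
    rw [mul_comm, Nat.mul_add_div (by omega), Nat.div_eq_of_lt hr, Nat.mul_add_mod,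
      Nat.mod_eq_of_lt hr]
    exact ⟨rfl, rfl⟩
  · rintro ⟨rfl, rfl⟩
    rw [mul_comm]
    exact (Nat.div_add_mod x t).symm

/-- By linearity, a change of one entry of the data changes one row of the sketch from the right and
one column of the sketch from the left. -/
theorem wp_updateCmd (h : Setup E n d k q l) {u : Update n d} (hrow : E.inp.word 3 = u.row)
    (hcol : E.inp.word 4 = u.col) (hdelta : E.inp.real 1 0 0 = u.delta)
    {A : Matrix (Fin n) (Fin d) ℝ} (hl1 : 1 ≤ l) (hA : StreamMem A k q l E.tape σ) :
    wp E Prog.updateCmd (StreamMem (A + Matrix.single u.row u.col u.delta) k q l E.tape) σ := by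
  have hm := h.arrays
  have hL := h.L_pos
  have hLB := h.L_le_B
  have hLH := h.L_le_H
  have htL := h.t_le
  have hsL := h.s_le
  have hnt := h.nt_le
  have hsd := h.sd_le
  -- Without columns, `x % t` would be `x` and the row and column of a cell could not be read off
  -- its index.
  have ht0 : 0 < widthT q l :=
    Nat.mul_pos (Nat.mul_pos (by norm_num) hl1)
      (Nat.mul_pos (by norm_num) (Nat.mul_pos h.q_pos h.q_pos))
  set p := hashPrime n d with hp
  set a := coeffArray E.tape p (numCoeffs k q l) with ha
  set t := widthT q l with ht
  set s := heightS k q with hs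
  set T : ℕ → ℕ → ℝ := fun c j => hashVal p a (4 * c) j with hT
  set S : ℕ → ℕ → ℝ := fun r i => hashVal p a (4 * (t + r)) i with hS
  refine wp_seq' (fun σ' => ∀ x, σ'.real 1 x = sketchRight A t T x +
    if x / t = u.row then u.delta * T (x % t) u.col else 0) ?_ ?_
  · refine wp_for t (fun r σ' => ∀ x, σ'.real 1 x = sketchRight A t T x +
      if x / t = u.row ∧ x % t < r then u.delta * T (x % t) u.col else 0) (by omega) hL (by omega)
      (by omega) ?_ ?_ ?_ ?_
    · intro x
      simpa using hA.r1 x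
    · intro _ σ' _ hf _ _
      exact eval_width ((congrFun (hf.word 1 rfl) 0).trans hA.w1)
        ((congrFun (hf.word 2 rfl) 0).trans hA.w2)
    · intro r hr σ' _ hf hI hx
      have hidx : (NExp.add (.mul (.input 3) Prog.width) (.var 13)).eval E.inp σ' =
          u.row * t + r := by
        change E.inp.word 3 * Prog.width.eval E.inp σ' + σ'.word 13 0 = _
        rw [eval_width ((congrFun (hf.word 1 rfl) 0).trans hA.w1)
          ((congrFun (hf.word 2 rfl) 0).trans hA.w2), hrow, hx]
      refine wp_setReal (by omega) ?_ ⟨hx, ?_⟩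
      · rw [hidx]
        have := pair_lt u.row.2 hr
        omega
      · intro x
        have hev : (RExp.add (.cell 1 (.add (.mul (.input 3) Prog.width) (.var 13)))
            (.mul (.input 1 (.lit 0) (.lit 0)) (Prog.entryT (.var 13) (.input 4)))).eval E.inp σ' =
            σ'.real 1 (u.row * t + r) + u.delta * T r u.col := by
          rw [RExp.eval, RExp.eval, RExp.eval, eval_hashExp
            ((congrFun (hf.word 3 rfl) 0).trans hA.w3) ((hf.word 4 rfl).trans hA.w4), hidx]
          simp only [RExp.eval, NExp.eval, hx, hcol, hdelta]
          rfl
        rw [State.setWord_real, State.setReal_real, hidx, hev]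
        simp only [true_and, eq_pair_iff hr]
        by_cases h1 : x / t = u.row ∧ x % t = r
        · have h2 : x = u.row * t + r := (eq_pair_iff hr).2 h1
          rw [if_pos h1, if_pos ⟨h1.1, by omega⟩, ← h2, hI x, if_neg (by omega), h1.2, add_zero]
        · rw [if_neg h1, hI x]
          congr 1
          exact if_congr (by omega) rfl rfl
    · intro σ' _ _ hI _ x
      rw [hI x]
      simp [Nat.mod_lt x ht0]
  · intro σ₁ _ hf₁ hr1
    have p₁ : σ₁.word 3 0 = p := (congrFun (hf₁.word 3 rfl) 0).trans hA.w3
    have a₁ : σ₁.word 4 = a := (hf₁.word 4 rfl).trans hA.w4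
    have q₁ : σ₁.word 1 0 = q := (congrFun (hf₁.word 1 rfl) 0).trans hA.w1
    have l₁ : σ₁.word 2 0 = l := (congrFun (hf₁.word 2 rfl) 0).trans hA.w2
    have s₁ : σ₁.real 2 = σ.real 2 := hf₁.real 2 rfl
    refine wp_for s (fun r σ' => ∀ x, σ'.real 2 x = sketchLeft A s S x +
      if x / d < r ∧ x % d = u.col then u.delta * S (x / d) u.row else 0) (by omega) hL (by omega)
      (by omega) ?_ ?_ ?_ ?_
    · intro x
      simpa [s₁] using hA.r2 x
    · intro _ σ' _ hf _ _
      exact eval_height h ((congrFun (hf.word 1 rfl) 0).trans q₁)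
    · intro r hr σ' _ hf hI hx
      have hidx : (NExp.add (.mul (.var 13) (.input 1)) (.input 4)).eval E.inp σ' =
          r * d + u.col := by
        simp only [NExp.eval, hx, h.d_eq, hcol]
      refine wp_setReal (by omega) ?_ ⟨hx, ?_⟩
      · rw [hidx]
        have := pair_lt hr u.col.2
        omega
      · intro x
        have hev : (RExp.add (.cell 2 (.add (.mul (.var 13) (.input 1)) (.input 4)))
            (.mul (.input 1 (.lit 0) (.lit 0)) (Prog.entryS (.var 13) (.input 3)))).eval E.inp σ' =
            σ'.real 2 (r * d + u.col) + u.delta * S r u.row := by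
          have hb : (NExp.mul (.lit 4) (.add Prog.width (.var 13))).eval E.inp σ' = 4 * (t + r) := by
            change 4 * (Prog.width.eval E.inp σ' + σ'.word 13 0) = _
            rw [eval_width ((congrFun (hf.word 1 rfl) 0).trans q₁)
              ((congrFun (hf.word 2 rfl) 0).trans l₁), hx]
          rw [RExp.eval, RExp.eval, RExp.eval, eval_hashExp
            ((congrFun (hf.word 3 rfl) 0).trans p₁) ((hf.word 4 rfl).trans a₁), hidx, hb]
          simp only [RExp.eval, NExp.eval, hrow, hdelta]
          rfl
        rw [State.setWord_real, State.setReal_real, hidx, hev]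
        simp only [true_and, eq_pair_iff u.col.2]
        by_cases h1 : x / d = r ∧ x % d = u.col
        · have h2 : x = r * d + u.col := (eq_pair_iff u.col.2).2 h1
          rw [if_pos h1, if_pos ⟨by omega, h1.2⟩, ← h2, hI x, if_neg (by omega), h1.1, add_zero]
        · rw [if_neg h1, hI x]
          congr 1
          exact if_congr (by omega) rfl rfl
    · intro σ' _ hf hI _
      have e := fun b (hb : Prog.updateS.writesWord b = false)
        (hb' : Prog.updateT.writesWord b = false) => (hf.word b hb).trans (hf₁.word b hb')
      refine ⟨(congrFun (e 1 rfl rfl) 0).trans hA.w1, (congrFun (e 2 rfl rfl) 0).trans hA.w2,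
        (congrFun (e 3 rfl rfl) 0).trans hA.w3, (e 4 rfl rfl).trans hA.w4,
        (e 5 rfl rfl).trans hA.w5, (e 7 rfl rfl).trans hA.w7, (e 8 rfl rfl).trans hA.w8, ?_, ?_, ?_⟩
      · intro b hb1 hb2
        rw [hf.real b (by simpa [Cmd.for, Cmd.writesReal, ← Bool.not_eq_true] using hb2.symm),
          hf₁.real b (by
            simpa [Prog.updateT, Cmd.for, Cmd.writesReal, ← Bool.not_eq_true] using hb1.symm),
          hA.real b hb1 hb2]
      · intro x
        rw [hf.real 1 rfl, hr1 x, sketchRight_add_single]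
      · intro x
        rw [hI x, sketchLeft_add_single]

theorem wp_initCmd (h : Setup E n d k q l) (hε : 0 < ε) (he : E.inp.real 0 0 0 = ε)
    (hq : q = ⌈1 / ε⌉₊) (hl : l = Nat.clog 2 (n * k)) (hB : 2 * (n * k) ≤ E.B)
    (hB' : 2 * (n + d + 5) ≤ E.B)
    (hH : (2 * (n + d + 5) + 1) * (2 * (n + d + 5) + 1) ≤ E.H) (hN : numCoeffs k q l ≤ E.L) :
    wp E Prog.initCmd (StreamMem (0 : Matrix (Fin n) (Fin d) ℝ) k q l E.tape) State.blank := by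
  refine wp_seq' _ (wp_paramCmd h hε he hq hl hB rfl rfl) ?_
  rintro σ₁ _ hf₁ ⟨h1, h2, h3⟩
  refine wp_seq' _ (wp_primeCmd h hB' hH) ?_
  rintro σ₂ _ hf₂ ⟨h4, h5⟩
  have hp : hashPrime n d ≤ E.B := (nextPrime_le_two_mul (by omega)).trans hB'
  have q₂ : σ₂.word 1 0 = q := (congrFun (hf₂.word 1 rfl) 0).trans h1
  have l₂ : σ₂.word 2 0 = l := (congrFun (hf₂.word 2 rfl) 0).trans h2
  refine (wp_drawCmd h hN q₂ l₂ h4 hp ((hf₂.word 4 rfl).trans (hf₁.word 4 rfl)) (h5.trans h3)).conseq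
    fun σ₃ _ hf₃ h6 => ?_
  have e := fun b (hb : Prog.drawCmd.writesWord b = false)
    (hb' : Prog.primeCmd.writesWord b = false) => (hf₃.word b hb).trans (hf₂.word b hb')
  have e' := fun b => (hf₃.real b rfl).trans ((hf₂.real b rfl).trans (hf₁.real b rfl))
  have hz : ∀ x y, matrixArray (0 : Matrix (Fin n) (Fin d) ℝ) x y = 0 := by
    intro x y
    simp [matrixArray]
  refine ⟨(congrFun (hf₃.word 1 rfl) 0).trans q₂, (congrFun (hf₃.word 2 rfl) 0).trans l₂,
    (congrFun (hf₃.word 3 rfl) 0).trans h4, h6, (e 5 rfl rfl).trans (hf₁.word 5 rfl),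
    (e 7 rfl rfl).trans (hf₁.word 7 rfl), (e 8 rfl rfl).trans (hf₁.word 8 rfl),
    fun a _ _ => e' a, fun x => ?_, fun x => ?_⟩
  · rw [e' 1]
    simp [sketchRight, hz, State.blank]
  · rw [e' 2]
    simp [sketchLeft, hz, State.blank]

theorem StreamMem.data {A : Matrix (Fin n) (Fin d) ℝ} (h : Setup E n d k q l)
    (hA : StreamMem A k q l E.tape σ) :
    Data E (fun x y => .cell 1 (.add (.mul x Prog.width) y)) Prog.entryS
      (fun x y => .cell 2 (.add (.mul x (.input 1)) y)) q l
      (fun x y => σ.real 1 (x * widthT q l + y))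
      (fun x y => hashVal (hashPrime n d) (coeffArray E.tape (hashPrime n d) (numCoeffs k q l))
        (4 * (widthT q l + x)) y)
      (fun x y => σ.real 2 (x * d + y)) σ := by
  intro σ' hp
  have q' : σ'.word 1 0 = q := (congrFun hp.w1 0).trans hA.w1
  have l' : σ'.word 2 0 = l := (congrFun hp.w2 0).trans hA.w2
  refine ⟨q', l', fun x y => ⟨?_, ?_, ?_⟩⟩
  · change σ'.real 1 (x.eval E.inp σ' * Prog.width.eval E.inp σ' + y.eval E.inp σ') = _
    rw [eval_width q' l', hp.r1]
  · rw [eval_hashExp ((congrFun hp.w3 0).trans hA.w3) (hp.w4.trans hA.w4)]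
    change hashVal _ _ (4 * (Prog.width.eval E.inp σ' + x.eval E.inp σ')) _ = _
    rw [eval_width q' l']
  · change σ'.real 2 (x.eval E.inp σ' * E.inp.word 1 + y.eval E.inp σ') = _
    rw [h.d_eq, hp.r2]

end stream

/-! ## Averages over finite types -/

/-- The average of a function on a finite type. -/
noncomputable def avg {Ω : Type*} [Fintype Ω] (f : Ω → ℝ) : ℝ := (∑ ω, f ω) / Fintype.card Ω

open Classical in
/-- The fraction of the elements of a finite type that have a property. -/
noncomputable def prob {Ω : Type*} [Fintype Ω] (p : Ω → Prop) : ℝ :=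
  avg fun ω => if p ω then 1 else 0

section avg
variable {Ω Ω' ι : Type*} [Fintype Ω] [Fintype Ω'] [Fintype ι]

theorem avg_add (f g : Ω → ℝ) : avg (fun ω => f ω + g ω) = avg f + avg g := by
  simp [avg, Finset.sum_add_distrib, add_div]

theorem avg_sub (f g : Ω → ℝ) : avg (fun ω => f ω - g ω) = avg f - avg g := by
  simp [avg, Finset.sum_sub_distrib, sub_div]

theorem avg_const_mul (c : ℝ) (f : Ω → ℝ) : avg (fun ω => c * f ω) = c * avg f := by
  simp [avg, ← Finset.mul_sum, mul_div_assoc]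

theorem avg_sum {κ : Type*} (s : Finset κ) (f : κ → Ω → ℝ) :
    avg (fun ω => ∑ i ∈ s, f i ω) = ∑ i ∈ s, avg (f i) := by
  simp only [avg]
  rw [Finset.sum_comm, Finset.sum_div]

theorem avg_const [Nonempty Ω] (c : ℝ) : avg (fun _ : Ω => c) = c := by
  have : (Fintype.card Ω : ℝ) ≠ 0 := by exact_mod_cast Fintype.card_ne_zero
  simp [avg, this]

theorem avg_mono {f g : Ω → ℝ} (h : ∀ ω, f ω ≤ g ω) : avg f ≤ avg g :=
  div_le_div_of_nonneg_right (Finset.sum_le_sum fun ω _ => h ω) (Nat.cast_nonneg _)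

theorem avg_nonneg {f : Ω → ℝ} (h : ∀ ω, 0 ≤ f ω) : 0 ≤ avg f :=
  div_nonneg (Finset.sum_nonneg fun ω _ => h ω) (Nat.cast_nonneg _)

theorem avg_comp_bijective {e : Ω → Ω'} (he : Function.Bijective e) (f : Ω' → ℝ) :
    avg (fun ω => f (e ω)) = avg f := by
  rw [avg, avg, Fintype.card_of_bijective he, he.sum_comp f]

/-- Independence of the coordinates of a uniformly random function, in the form from which the other
independence statements are derived. -/
theorem avg_pi_prod [DecidableEq ι] (f : ι → Ω → ℝ) :
    avg (fun ω : ι → Ω => ∏ i, f i (ω i)) = ∏ i, avg (f i) := by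
  simp only [avg, Finset.prod_div_distrib, Finset.prod_const, Fintype.card_fun, Finset.card_univ,
    Fintype.prod_sum, Nat.cast_pow]

theorem avg_eval [Nonempty Ω] [DecidableEq ι] (i : ι) (f : Ω → ℝ) :
    avg (fun ω : ι → Ω => f (ω i)) = avg f := by
  have h := avg_pi_prod (fun j : ι => if j = i then f else fun _ => 1)
  rw [Finset.prod_eq_single_of_mem i (Finset.mem_univ _) (by
    intro j _ hj
    rw [if_neg hj, avg_const]), if_pos rfl] at h
  rw [← h]
  congr 1
  funext ω
  rw [Finset.prod_eq_single_of_mem i (Finset.mem_univ _) (by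
    intro j _ hj
    rw [if_neg hj]), if_pos rfl]

theorem avg_eval_mul [Nonempty Ω] [DecidableEq ι] {i j : ι} (hij : i ≠ j) (f g : Ω → ℝ) :
    avg (fun ω : ι → Ω => f (ω i) * g (ω j)) = avg f * avg g := by
  have h := avg_pi_prod (fun a : ι => if a = i then f else if a = j then g else fun _ => 1)
  rw [← Finset.prod_subset (Finset.subset_univ {i, j}), Finset.prod_pair hij, if_pos rfl,
    if_neg hij.symm, if_pos rfl] at h
  · rw [← h]
    congr 1
    funext ω
    rw [← Finset.prod_subset (Finset.subset_univ {i, j}), Finset.prod_pair hij, if_pos rfl,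
      if_neg hij.symm, if_pos rfl]
    intro a _ ha
    simp only [Finset.mem_insert, Finset.mem_singleton, not_or] at ha
    rw [if_neg ha.1, if_neg ha.2]
  · intro a _ ha
    simp only [Finset.mem_insert, Finset.mem_singleton, not_or] at ha
    rw [if_neg ha.1, if_neg ha.2, avg_const]

theorem avg_prod (f : Ω × Ω' → ℝ) : avg f = avg fun ω => avg fun ω' => f (ω, ω') := by
  simp only [avg, Fintype.sum_prod_type, Fintype.card_prod, Nat.cast_mul, ← Finset.sum_div]
  rw [div_div, mul_comm (Fintype.card Ω' : ℝ)]

/-- The second moment of a sum of independent centered variables. -/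
theorem avg_sum_sq [Nonempty Ω] [DecidableEq ι] (f : ι → Ω → ℝ) (h : ∀ i, avg (f i) = 0) :
    avg (fun ω : ι → Ω => (∑ i, f i (ω i)) ^ 2) = ∑ i, avg fun ω => f i ω ^ 2 := by
  have : ∀ ω : ι → Ω, (∑ i, f i (ω i)) ^ 2 = ∑ i, ∑ j, f i (ω i) * f j (ω j) := by
    intro ω
    rw [sq, Finset.sum_mul_sum]
  simp only [this, avg_sum]
  refine Finset.sum_congr rfl fun i _ => ?_
  rw [Finset.sum_eq_single_of_mem i (Finset.mem_univ _)]
  · rw [← avg_eval i fun ω => f i ω ^ 2]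
    simp only [sq]
  · intro j _ hj
    rw [avg_eval_mul hj.symm, h, zero_mul]

theorem prob_mono {p p' : Ω → Prop} (h : ∀ ω, p ω → p' ω) : prob p ≤ prob p' := by
  refine avg_mono fun ω => ?_
  by_cases h1 : p ω
  · simp [h1, h ω h1]
  · simp only [h1, if_false]
    split_ifs <;> norm_num

theorem prob_nonneg (p : Ω → Prop) : 0 ≤ prob p := by
  refine avg_nonneg fun ω => ?_
  split_ifs <;> norm_num

theorem prob_or_le (p p' : Ω → Prop) : prob (fun ω => p ω ∨ p' ω) ≤ prob p + prob p' := by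
  rw [prob, prob, prob, ← avg_add]
  refine avg_mono fun ω => ?_
  by_cases h1 : p ω <;> by_cases h2 : p' ω <;> simp [h1, h2]

theorem prob_exists_le {κ : Type*} (s : Finset κ) (p : κ → Ω → Prop) :
    prob (fun ω => ∃ i ∈ s, p i ω) ≤ ∑ i ∈ s, prob (p i) := by
  classical
  simp only [prob]
  rw [← avg_sum]
  refine avg_mono fun ω => ?_
  split_ifs with h
  · obtain ⟨i, hi, hp⟩ := h
    refine le_trans ?_ (Finset.single_le_sum (f := fun i => if p i ω then (1 : ℝ) else 0)
      (fun j _ => by split_ifs <;> norm_num) hi)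
    simp [hp]
  · exact Finset.sum_nonneg fun j _ => by split_ifs <;> norm_num

theorem prob_not [Nonempty Ω] (p : Ω → Prop) : prob (fun ω => ¬ p ω) = 1 - prob p := by
  have h := avg_const (Ω := Ω) 1
  rw [← h, prob, prob, ← avg_sub]
  congr 1
  funext ω
  by_cases h1 : p ω <;> simp [h1]

/-- Markov's inequality. -/
theorem mul_prob_le {f : Ω → ℝ} (h : ∀ ω, 0 ≤ f ω) (c : ℝ) :
    c * prob (fun ω => c ≤ f ω) ≤ avg f := by
  rw [prob, ← avg_const_mul]
  refine avg_mono fun ω => ?_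
  split_ifs with h1
  · simpa using h1
  · simpa using h ω

theorem prob_le_div {f : Ω → ℝ} (h : ∀ ω, 0 ≤ f ω) {c : ℝ} (hc : 0 < c) :
    prob (fun ω => c ≤ f ω) ≤ avg f / c := by
  rw [le_div_iff₀ hc, mul_comm]
  exact mul_prob_le h c

/-- Independent events. -/
theorem prob_pi_forall [Nonempty Ω] [DecidableEq ι] (s : Finset ι) (p : Ω → Prop) :
    prob (fun ω : ι → Ω => ∀ i ∈ s, p (ω i)) = prob p ^ s.card := by
  classical
  have h := avg_pi_prod (fun (i : ι) (ω : Ω) => if i ∈ s then (if p ω then (1 : ℝ) else 0) else 1)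
  have h1 : ∀ i : ι, avg (fun ω : Ω => if i ∈ s then (if p ω then (1 : ℝ) else 0) else 1) =
      if i ∈ s then prob p else 1 := by
    intro i
    split_ifs with hi
    · simp only [prob]
    · exact avg_const 1
  simp only [h1, Finset.prod_ite_mem, Finset.univ_inter, Finset.prod_const] at h
  rw [← h, prob]
  congr 1
  funext ω
  split_ifs with h2
  · rw [Finset.prod_eq_one]
    intro i hi
    rw [if_pos (h2 i hi)]
  · push Not at h2
    obtain ⟨i, hi, hp⟩ := h2
    rw [Finset.prod_eq_zero hi]
    rw [if_neg hp]

end avg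

/-! ## Four-wise independent hash values -/

section hash
variable {P : ℕ}

/-- A centered integer in `{-P, …, P}`. -/
noncomputable def centered (y : ZMod (P + 1)) : ℝ := 2 * (y.val : ℝ) - P

def cubic (a : Fin 4 → ZMod (P + 1)) (x : ZMod (P + 1)) : ZMod (P + 1) :=
  a 0 + (a 1 * x + (a 2 * (x * x) + a 3 * (x * (x * x))))

/-- The variance of `centered`. -/
noncomputable def hashVar (P : ℕ) : ℝ := P * (P + 2) / 3

theorem sum_zmod (f : ℕ → ℝ) : ∑ y : ZMod (P + 1), f y.val = ∑ i ∈ Finset.range (P + 1), f i :=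
  Fin.sum_univ_eq_sum_range f (P + 1)

/-- The reflection i ↦ P - i of the values changes the sign. -/
theorem avg_centered : avg (centered (P := P)) = 0 := by
  have h : ∑ y : ZMod (P + 1), centered y = 0 := by
    simp only [centered]
    rw [sum_zmod (fun i => 2 * (i : ℝ) - P)]
    have h2 := Finset.sum_range_reflect (fun i => 2 * (i : ℝ) - P) (P + 1)
    have h3 : ∑ j ∈ Finset.range (P + 1), (2 * ((P + 1 - 1 - j : ℕ) : ℝ) - P) =
        -∑ j ∈ Finset.range (P + 1), (2 * (j : ℝ) - P) := by
      rw [← Finset.sum_neg_distrib]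
      refine Finset.sum_congr rfl fun j hj => ?_
      have := Finset.mem_range.1 hj
      rw [Nat.add_sub_cancel, Nat.cast_sub (by omega)]
      ring
    rw [h3] at h2
    linarith
  rw [avg, h, zero_div]

theorem avg_centered_sq : avg (fun y : ZMod (P + 1) => centered y ^ 2) = hashVar P := by
  -- The shift `c` is decoupled from the number of terms so that induction on `N` applies.
  have key : ∀ N : ℕ, ∀ c : ℝ, ∑ i ∈ Finset.range N, (2 * (i : ℝ) - c) ^ 2 =
      N * (2 * (N - 1) * (2 * N - 1) / 3 - 2 * c * (N - 1) + c ^ 2) := by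
    intro N c
    induction N with
    | zero => simp
    | succ N ih =>
      rw [Finset.sum_range_succ, ih]
      push_cast
      ring
  simp only [centered, avg]
  rw [sum_zmod (fun i => (2 * (i : ℝ) - P) ^ 2), key, ZMod.card, hashVar]
  have : ((P + 1 : ℕ) : ℝ) ≠ 0 := by positivity
  field_simp
  push_cast
  ring

/-- Squares are at most P², and P² ≤ P(P + 2) = 3 `hashVar P`. So the fourth moment is at most that
of a Gaussian of the same variance, which fixes the sign of the correction term in `avg_pi_four`. -/
theorem avg_centered_pow_four_le :
    avg (fun y : ZMod (P + 1) => centered y ^ 4) ≤ 3 * hashVar P ^ 2 := by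
  have h : avg (fun y : ZMod (P + 1) => centered y ^ 4) ≤
      avg (fun y : ZMod (P + 1) => (P : ℝ) ^ 2 * centered y ^ 2) := by
    refine avg_mono fun y => ?_
    have h1 : (y.val : ℝ) ≤ P := by exact_mod_cast Nat.lt_succ_iff.1 (ZMod.val_lt y)
    have h2 : (0 : ℝ) ≤ y.val := Nat.cast_nonneg _
    have h3 : centered y ^ 2 ≤ (P : ℝ) ^ 2 := by
      exact sq_le_sq' (by rw [centered]; linarith) (by rw [centered]; linarith)
    calc centered y ^ 4 = centered y ^ 2 * centered y ^ 2 := by ring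
      _ ≤ P ^ 2 * centered y ^ 2 := mul_le_mul_of_nonneg_right h3 (sq_nonneg _)
  rw [avg_const_mul, avg_centered_sq] at h
  refine h.trans ?_
  have hP : (0 : ℝ) ≤ P := Nat.cast_nonneg _
  simp only [hashVar]
  nlinarith [mul_nonneg hP (mul_nonneg hP hP), mul_nonneg hP hP]

/-- Coincidences among the four points are allowed, so they are extended to exactly four distinct
points; this gives an invertible Vandermonde matrix in all cases at once. -/
theorem exists_injective_cover (hP : 4 ≤ P) (i j k l : ZMod (P + 1)) :
    ∃ (x : Fin 4 → ZMod (P + 1)) (a b c d : Fin 4), Function.Injective x ∧ x a = i ∧ x b = j ∧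
      x c = k ∧ x d = l := by
  obtain ⟨t, ht, htc⟩ := Finset.exists_superset_card_eq (s := {i, j, k, l}) (n := 4)
    Finset.card_le_four (by rw [ZMod.card]; omega)
  let e := (t.equivFinOfCardEq htc).symm
  refine ⟨fun c => e c, e.symm ⟨i, ht (by simp)⟩, e.symm ⟨j, ht (by simp)⟩,
    e.symm ⟨k, ht (by simp)⟩, e.symm ⟨l, ht (by simp)⟩, ?_, by simp, by simp, by simp, by simp⟩
  exact Subtype.val_injective.comp e.injective

/-- The number of ways to match equal indices. -/
def pairings {κ : Type*} [DecidableEq κ] (a b c d : κ) : ℝ :=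
  (if a = b then 1 else 0) * (if c = d then 1 else 0) +
  (if a = c then 1 else 0) * (if b = d then 1 else 0) +
  (if a = d then 1 else 0) * (if b = c then 1 else 0)

/-- A factor whose index occurs only once averages to 0 independently of the others. -/
theorem avg_pi_four_eq_zero {a b c d : Fin 4} (hb : a ≠ b) (hc : a ≠ c) (hd : a ≠ d) :
    avg (fun y : Fin 4 → ZMod (P + 1) => centered (y a) * centered (y b) * centered (y c) *
      centered (y d)) = 0 := by
  have h := avg_pi_prod (fun (e : Fin 4) (v : ZMod (P + 1)) =>
    (if e = a then centered v else 1) * (if e = b then centered v else 1) *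
    (if e = c then centered v else 1) * (if e = d then centered v else 1))
  rw [Finset.prod_eq_zero (i := a) (Finset.mem_univ _)] at h
  · rw [← h]
    congr 1
    funext y
    simp only [Finset.prod_mul_distrib, Finset.prod_ite_eq', Finset.mem_univ, if_true]
  · simp [hb, hc, hd]
    exact avg_centered

/-- Wick's formula with a correction: for four equal indices the three pairings count 3 `hashVar P ^
2` instead of the true fourth moment. -/
theorem avg_pi_four (a b c d : Fin 4) :
    avg (fun y : Fin 4 → ZMod (P + 1) => centered (y a) * centered (y b) * centered (y c) *
      centered (y d)) = hashVar P ^ 2 * pairings a b c d +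
      (avg (fun y : ZMod (P + 1) => centered y ^ 4) - 3 * hashVar P ^ 2) *
        (if a = b ∧ b = c ∧ c = d then 1 else 0) := by
  have hB : ∀ {a c : Fin 4}, a ≠ c → avg (fun y : Fin 4 → ZMod (P + 1) =>
      centered (y a) ^ 2 * centered (y c) ^ 2) = hashVar P ^ 2 := by
    intro a c hac
    rw [avg_eval_mul hac (fun v => centered v ^ 2) (fun v => centered v ^ 2), avg_centered_sq, sq]
  by_cases hab : a = b
  · subst hab
    by_cases hcd : c = d
    · subst hcd
      by_cases hac : a = c
      · subst hac
        rw [← avg_eval a fun v : ZMod (P + 1) => centered v ^ 4]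
        simp [pairings]
        ring_nf
      · rw [← hB hac]
        simp [pairings, hac]
        congr 1
        funext y
        ring
    · by_cases hac : a = c
      · subst hac
        simp only [pairings, hcd]
        simp
        refine Eq.trans ?_ (avg_pi_four_eq_zero (P := P) (a := d) (b := a) (c := a) (d := a)
          (Ne.symm hcd) (Ne.symm hcd) (Ne.symm hcd))
        congr 1
        funext y
        ring
      · simp only [pairings, hcd, hac]
        simp
        refine Eq.trans ?_ (avg_pi_four_eq_zero (P := P) (a := c) (b := a) (c := a) (d := d)
          (Ne.symm hac) (Ne.symm hac) hcd)
        congr 1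
        funext y
        ring
  · by_cases hac : a = c
    · subst hac
      by_cases hbd : b = d
      · subst hbd
        rw [← hB hab]
        simp [pairings, hab]
        congr 1
        funext y
        ring
      · simp only [pairings, hab, hbd]
        simp [Ne.symm hab]
        refine Eq.trans ?_ (avg_pi_four_eq_zero (P := P) (a := b) (b := a) (c := a) (d := d)
          (Ne.symm hab) (Ne.symm hab) hbd)
        congr 1
        funext y
        ring
    · by_cases had : a = d
      · subst had
        by_cases hbc : b = c
        · subst hbc
          rw [← hB hab]
          simp [pairings, hab]
          congr 1
          funext y
          ring
        · simp only [pairings, hab, hbc, hac]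
          simp
          refine Eq.trans ?_ (avg_pi_four_eq_zero (P := P) (a := b) (b := a) (c := c) (d := a)
            (Ne.symm hab) hbc (Ne.symm hab))
          congr 1
          funext y
          ring
      · simp only [pairings, hab, hac, had]
        simp
        exact avg_pi_four_eq_zero (P := P) hab hac had

variable [Fact (P + 1).Prime]

/-- Evaluation at four distinct points is multiplication by an invertible Vandermonde matrix. Thus
uniform coefficients give independent uniform values at any four points. -/
theorem cubic_bijective {x : Fin 4 → ZMod (P + 1)} (hx : Function.Injective x) :
    Function.Bijective fun (a : Fin 4 → ZMod (P + 1)) (c : Fin 4) => cubic a (x c) := by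
  have h : (fun (a : Fin 4 → ZMod (P + 1)) (c : Fin 4) => cubic a (x c)) =
      (Matrix.vandermonde x).mulVec := by
    funext a c
    simp only [cubic, Matrix.mulVec, dotProduct, Matrix.vandermonde_apply, Fin.sum_univ_four]
    simp
    ring
  rw [h]
  exact Finite.injective_iff_bijective.1
    (Matrix.mulVec_injective_of_det_ne_zero (Matrix.det_vandermonde_ne_zero_iff.2 hx))

/-- The value at `x` of the random cubic polynomial with coefficients `a`, centered. -/
noncomputable def hashEntry (a : Fin 4 → ZMod (P + 1)) (x : ℕ) : ℝ := centered (cubic a x)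

/-- The product of a random row with a vector. -/
noncomputable def rowDot {N : ℕ} (a : Fin 4 → ZMod (P + 1)) (x : Fin N → ℝ) : ℝ :=
  ∑ i : Fin N, x i * hashEntry a i

variable {N : ℕ}

/-- Indices below `N ≤ P` are distinct residues, so equality of indices means equality of positions
in the cover, and `avg_pi_four` carries over. -/
theorem avg_hash_four (hP : 4 ≤ P) (hN : N ≤ P) (i j k l : Fin N) :
    avg (fun a : Fin 4 → ZMod (P + 1) => hashEntry a i * hashEntry a j * hashEntry a k *
      hashEntry a l) = hashVar P ^ 2 * pairings i j k l +
      (avg (fun y : ZMod (P + 1) => centered y ^ 4) - 3 * hashVar P ^ 2) *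
        (if i = j ∧ j = k ∧ k = l then 1 else 0) := by
  obtain ⟨x, a, b, c, d, hx, ha, hb, hc, hd⟩ := exists_injective_cover hP
    ((i : ℕ) : ZMod (P + 1)) ((j : ℕ) : ZMod (P + 1)) ((k : ℕ) : ZMod (P + 1))
    ((l : ℕ) : ZMod (P + 1))
  have h := avg_comp_bijective (cubic_bijective hx) (fun y : Fin 4 → ZMod (P + 1) =>
    centered (y a) * centered (y b) * centered (y c) * centered (y d))
  simp only [ha, hb, hc, hd] at h
  have hcast : ∀ i j : Fin N, ((i : ℕ) : ZMod (P + 1)) = ((j : ℕ) : ZMod (P + 1)) ↔ i = j := by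
    intro i j
    rw [ZMod.natCast_eq_natCast_iff', Nat.mod_eq_of_lt (by omega), Nat.mod_eq_of_lt (by omega),
      Fin.ext_iff]
  have hiff : ∀ {a b : Fin 4} {i j : Fin N}, x a = ((i : ℕ) : ZMod (P + 1)) →
      x b = ((j : ℕ) : ZMod (P + 1)) → (a = b ↔ i = j) := by
    intro a b i j h1 h2
    rw [← hcast, ← h1, ← h2, hx.eq_iff]
  rw [avg_pi_four] at h
  simp only [pairings, hiff ha hb, hiff hc hd, hiff ha hc, hiff hb hd, hiff ha hd, hiff hb hc] at h
  exact h

theorem avg_hash_two (hP : 4 ≤ P) (hN : N ≤ P) (i j : Fin N) :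
    avg (fun a : Fin 4 → ZMod (P + 1) => hashEntry a i * hashEntry a j) =
      hashVar P * if i = j then 1 else 0 := by
  obtain ⟨x, a, b, -, -, hx, ha, hb, -, -⟩ := exists_injective_cover hP
    ((i : ℕ) : ZMod (P + 1)) ((j : ℕ) : ZMod (P + 1)) 0 0
  have h := avg_comp_bijective (cubic_bijective hx) (fun y : Fin 4 → ZMod (P + 1) =>
    centered (y a) * centered (y b))
  simp only [ha, hb] at h
  refine h.trans ?_
  have hab : a = b ↔ i = j := by
    rw [← hx.eq_iff, ha, hb, ZMod.natCast_eq_natCast_iff', Nat.mod_eq_of_lt (by omega),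
      Nat.mod_eq_of_lt (by omega), Fin.ext_iff]
  by_cases hij : i = j
  · obtain rfl := hab.2 hij
    rw [if_pos hij, mul_one, ← avg_centered_sq,
      ← avg_eval a fun v : ZMod (P + 1) => centered v ^ 2]
    simp only [sq]
  · rw [if_neg hij, mul_zero, avg_eval_mul (fun h => hij (hab.1 h)), avg_centered, zero_mul]

theorem avg_rowDot_mul (hP : 4 ≤ P) (hN : N ≤ P) (x y : Fin N → ℝ) :
    avg (fun a : Fin 4 → ZMod (P + 1) => rowDot a x * rowDot a y) =
      hashVar P * ∑ i, x i * y i := by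
  have h : ∀ a : Fin 4 → ZMod (P + 1), rowDot a x * rowDot a y =
      ∑ i, ∑ j, x i * y j * (hashEntry a i * hashEntry a j) := by
    intro a
    rw [rowDot, rowDot, Finset.sum_mul_sum]
    exact Finset.sum_congr rfl fun i _ => Finset.sum_congr rfl fun j _ => by ring
  simp only [h, avg_sum, avg_const_mul, avg_hash_two hP hN, Finset.mul_sum]
  refine Finset.sum_congr rfl fun i _ => ?_
  rw [Finset.sum_eq_single_of_mem i (Finset.mem_univ _)]
  · simp
    ring
  · intro j _ hj
    simp [hj.symm]

/-- After expansion, the three pairings sum to 2⟨x, y⟩² + ‖x‖²‖y‖², as for Gaussian rows; the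
remaining diagonal term is a nonpositive multiple of ∑ xᵢ² yᵢ². -/
theorem avg_rowDot_mul_sq (hP : 4 ≤ P) (hN : N ≤ P) (x y : Fin N → ℝ) :
    avg (fun a : Fin 4 → ZMod (P + 1) => (rowDot a x * rowDot a y) ^ 2) ≤
      hashVar P ^ 2 * (2 * (∑ i, x i * y i) ^ 2 + (∑ i, x i ^ 2) * ∑ i, y i ^ 2) := by
  have h : ∀ a : Fin 4 → ZMod (P + 1), (rowDot a x * rowDot a y) ^ 2 =
      ∑ i, ∑ j, ∑ k, ∑ l, x i * y j * x k * y l *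
        (hashEntry a i * hashEntry a j * hashEntry a k * hashEntry a l) := by
    intro a
    have : (rowDot a x * rowDot a y) ^ 2 =
      rowDot a y * (rowDot a x * (rowDot a y * rowDot a x)) := by ring
    rw [this]
    simp only [rowDot, Finset.mul_sum, Finset.sum_mul]
    refine Finset.sum_congr rfl fun i _ => Finset.sum_congr rfl fun j _ =>
      Finset.sum_congr rfl fun k _ => Finset.sum_congr rfl fun l _ => by ring
  simp only [h, avg_sum, avg_const_mul, avg_hash_four hP hN]
  set μ := avg (fun y : ZMod (P + 1) => centered y ^ 4) - 3 * hashVar P ^ 2 with hμ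
  -- The excess of the fourth moment over the Gaussian one is not positive, so the diagonal term may
  -- be dropped.
  have hμ0 : μ ≤ 0 := sub_nonpos.2 avg_centered_pow_four_le
  have h1 : ∑ i, ∑ j, ∑ k, ∑ l, x i * y j * x k * y l * (hashVar P ^ 2 * pairings i j k l +
      μ * (if i = j ∧ j = k ∧ k = l then 1 else 0)) =
      hashVar P ^ 2 * ∑ i, ∑ j, ∑ k, ∑ l, x i * y j * x k * y l * pairings i j k l +
      μ * ∑ i, ∑ j, ∑ k, ∑ l, x i * y j * x k * y l *
        (if i = j ∧ j = k ∧ k = l then 1 else 0) := by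
    simp only [Finset.mul_sum, ← Finset.sum_add_distrib]
    refine Finset.sum_congr rfl fun i _ => Finset.sum_congr rfl fun j _ =>
      Finset.sum_congr rfl fun k _ => Finset.sum_congr rfl fun l _ => by ring
  have h2 : 0 ≤ ∑ i, ∑ j, ∑ k, ∑ l, x i * y j * x k * y l *
      (if i = j ∧ j = k ∧ k = l then (1 : ℝ) else 0) := by
    refine Finset.sum_nonneg fun i _ => Finset.sum_nonneg fun j _ => Finset.sum_nonneg fun k _ =>
      Finset.sum_nonneg fun l _ => ?_
    split_ifs with h
    · obtain ⟨rfl, rfl, rfl⟩ := h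
      nlinarith [sq_nonneg (x i * y i)]
    · simp
  have h3 : ∑ i, ∑ j, ∑ k, ∑ l, x i * y j * x k * y l * pairings i j k l =
      2 * (∑ i, x i * y i) ^ 2 + (∑ i, x i ^ 2) * ∑ i, y i ^ 2 := by
    simp only [pairings, mul_add, Finset.sum_add_distrib]
    have e1 : ∑ i, ∑ j, ∑ k, ∑ l, x i * y j * x k * y l *
        ((if i = j then (1 : ℝ) else 0) * (if k = l then 1 else 0)) = (∑ i, x i * y i) ^ 2 := by
      rw [sq, Finset.sum_mul_sum]
      refine Finset.sum_congr rfl fun i _ => ?_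
      rw [Finset.sum_eq_single_of_mem i (Finset.mem_univ _) (by
        intro j _ hj; simp [hj.symm])]
      refine Finset.sum_congr rfl fun k _ => ?_
      rw [Finset.sum_eq_single_of_mem k (Finset.mem_univ _) (by
        intro j _ hj; simp [hj.symm])]
      simp
      ring
    have e2 : ∑ i, ∑ j, ∑ k, ∑ l, x i * y j * x k * y l *
        ((if i = k then (1 : ℝ) else 0) * (if j = l then 1 else 0)) =
          (∑ i, x i ^ 2) * ∑ i, y i ^ 2 := by
      rw [Finset.sum_mul_sum]
      refine Finset.sum_congr rfl fun i _ => Finset.sum_congr rfl fun j _ => ?_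
      rw [Finset.sum_eq_single_of_mem i (Finset.mem_univ _) (by
        intro k _ hk; simp [hk.symm])]
      rw [Finset.sum_eq_single_of_mem j (Finset.mem_univ _) (by
        intro k _ hk; simp [hk.symm])]
      simp
      ring
    have e3 : ∑ i, ∑ j, ∑ k, ∑ l, x i * y j * x k * y l *
        ((if i = l then (1 : ℝ) else 0) * (if j = k then 1 else 0)) = (∑ i, x i * y i) ^ 2 := by
      rw [sq, Finset.sum_mul_sum]
      refine Finset.sum_congr rfl fun i _ => Finset.sum_congr rfl fun j _ => ?_
      rw [Finset.sum_eq_single_of_mem j (Finset.mem_univ _) (by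
        intro k _ hk; simp [hk.symm])]
      rw [Finset.sum_eq_single_of_mem i (Finset.mem_univ _) (by
        intro k _ hk; simp [hk.symm])]
      simp
      ring
    rw [e1, e2, e3]
    ring
  rw [h1, h3]
  nlinarith [mul_nonneg (neg_nonneg.2 hμ0) h2]

end hash

/-! ## Estimates of norms -/

theorem medianAux_eq_zero {z : ℕ → ℝ} {G : ℕ} (h : ∀ g < G, z g = 0) : medianAux z G G = 0 := by
  have : ∀ i ≤ G, medianAux z G i = 0 := by
    intro i
    induction i with
    | zero => exact fun _ => Finset.sum_eq_zero fun g hg => h g (Finset.mem_range.1 hg)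
    | succ i ih =>
      intro hi
      rw [medianAux, ih (by omega), h i hi, if_neg (by simp)]
  exact this G le_rfl

theorem medianAux_antitone (z : ℕ → ℝ) (G : ℕ) : Antitone (medianAux z G) := by
  refine antitone_nat_of_succ_le fun i => ?_
  rw [medianAux]
  split_ifs with h
  · exact h.2.le
  · exact le_rfl

/-- If more than half of the values lie in an interval, then so does their median. -/
theorem medianAux_mem_Icc {z : ℕ → ℝ} {G : ℕ} {lo hi : ℝ} (hz : ∀ g, 0 ≤ z g)
    (h : G < 2 * ((Finset.range G).filter fun g => lo ≤ z g ∧ z g ≤ hi).card) :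
    lo ≤ medianAux z G G ∧ medianAux z G G ≤ hi := by
  set good := (Finset.range G).filter fun g => lo ≤ z g ∧ z g ≤ hi with hgood
  have hne : good.Nonempty := Finset.card_pos.1 (by omega)
  constructor
  · have : ∀ i ≤ G, lo ≤ medianAux z G i := by
      intro i
      induction i with
      | zero =>
        intro _
        obtain ⟨g, hg⟩ := hne
        have h1 := (Finset.mem_filter.1 hg)
        exact h1.2.1.trans (Finset.single_le_sum (fun g _ => hz g) h1.1)
      | succ i ih =>
        intro hi'
        rw [medianAux]
        split_ifs with h1
        -- More than half of the values are good and at least half do not exceed `z i`, so some good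
        -- value lies below `z i`.
        · have h2 : ¬ Disjoint good ((Finset.range G).filter fun g => z g ≤ z i) := by
            intro hd
            have h3 := Finset.card_union_of_disjoint hd
            have h4 : (good ∪ (Finset.range G).filter fun g => z g ≤ z i).card ≤ G := by
              refine (Finset.card_le_card (Finset.union_subset (Finset.filter_subset _ _)
                (Finset.filter_subset _ _))).trans (by simp)
            omega
          obtain ⟨g, hg, hg'⟩ := Finset.not_disjoint_iff.1 h2
          exact (Finset.mem_filter.1 hg).2.1.trans (Finset.mem_filter.1 hg').2
        · exact ih (by omega)
    exact this G le_rfl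
  -- The largest good value is exceeded by no good value, hence passes the rank test; the result is
  -- at most this value.
  · obtain ⟨i, hi', hmax⟩ := Finset.exists_max_image good z hne
    have h1 := Finset.mem_filter.1 hi'
    have h2 : good ⊆ (Finset.range G).filter fun g => z g ≤ z i := by
      intro g hg
      exact Finset.mem_filter.2 ⟨(Finset.mem_filter.1 hg).1, hmax g hg⟩
    have h3 := Finset.card_le_card h2
    refine (medianAux_antitone z G (Finset.mem_range.1 h1.1 : i + 1 ≤ G)).trans ?_
    rw [medianAux]
    split_ifs with h4
    · exact h1.2.2
    · push Not at h4
      exact (h4 (by omega)).trans h1.2.2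

theorem hashVar_pos {P : ℕ} (hP : 4 ≤ P) : 0 < hashVar P := by
  have : (4 : ℝ) ≤ P := by exact_mod_cast hP
  rw [hashVar]
  positivity

/-! ### Accuracy of group sums and of their medians. -/

section rows
variable {P N : ℕ} [Fact (P + 1).Prime]

theorem avg_rowDot_sq (hP : 4 ≤ P) (hN : N ≤ P) (x : Fin N → ℝ) :
    avg (fun a : Fin 4 → ZMod (P + 1) => rowDot a x ^ 2) = hashVar P * ∑ i, x i ^ 2 := by
  simp only [sq]
  exact avg_rowDot_mul hP hN x x

theorem rowDot_zero {x : Fin N → ℝ} (hx : ∑ i, x i ^ 2 = 0) (a : Fin 4 → ZMod (P + 1)) :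
    rowDot a x = 0 := by
  have := (Finset.sum_eq_zero_iff_of_nonneg fun i _ => sq_nonneg (x i)).1 hx
  exact Finset.sum_eq_zero fun i hi => by rw [pow_eq_zero_iff two_ne_zero |>.1 (this i hi), zero_mul]

/-- The estimate of one group is accurate up to the factor `1 ± 1 / (16 q)`. -/
def GroupGood (P q : ℕ) [Fact (P + 1).Prime] (x : Fin N → ℝ)
    (u : Fin (groupSize q) → Fin 4 → ZMod (P + 1)) : Prop :=
  (1 - 1 / (16 * q : ℝ)) * (groupSize q * (hashVar P * ∑ i, x i ^ 2)) ≤ ∑ r, rowDot (u r) x ^ 2 ∧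
    ∑ r, rowDot (u r) x ^ 2 ≤ (1 + 1 / (16 * q : ℝ)) * (groupSize q * (hashVar P * ∑ i, x i ^ 2))

/-- Chebyshev's inequality. One squared product has mean m and variance at most 2m², so the sum of b
= 32768q² of them deviates by bm/(16q) with probability at most 2 · 256q²/b = 1/64. -/
theorem prob_not_groupGood_le {q : ℕ} (hq : 1 ≤ q) (hP : 4 ≤ P) (hN : N ≤ P) (x : Fin N → ℝ) :
    prob (fun u => ¬ GroupGood P q x u) ≤ 1 / 64 := by
  have hv := hashVar_pos hP
  set m := hashVar P * ∑ i, x i ^ 2 with hm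
  have hx0 : 0 ≤ ∑ i, x i ^ 2 := Finset.sum_nonneg fun i _ => sq_nonneg _
  have hq0 : (0 : ℝ) < q := by exact_mod_cast hq
  rcases hx0.eq_or_lt with hx | hx
  · have : ∀ u, GroupGood P q x u := by
      intro u
      simp [GroupGood, ← hx, rowDot_zero hx.symm]
    simp [prob, this, avg]
  · have hm0 : 0 < m := mul_pos hv hx
    have hb : (groupSize q : ℝ) = 32768 * (q * q) := by
      simp [groupSize]
    have hb0 : (0 : ℝ) < groupSize q := by rw [hb]; positivity
    have h1 : avg (fun u : Fin (groupSize q) → Fin 4 → ZMod (P + 1) =>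
        (∑ r, (rowDot (u r) x ^ 2 - m)) ^ 2) ≤ groupSize q * (2 * m ^ 2) := by
      rw [avg_sum_sq (fun _ a => rowDot a x ^ 2 - m)]
      · have h2 : avg (fun a : Fin 4 → ZMod (P + 1) => (rowDot a x ^ 2 - m) ^ 2) ≤ 2 * m ^ 2 := by
          have e : ∀ a : Fin 4 → ZMod (P + 1), (rowDot a x ^ 2 - m) ^ 2 =
              (rowDot a x * rowDot a x) ^ 2 - 2 * m * rowDot a x ^ 2 + m ^ 2 := fun a => by ring
          simp only [e]
          rw [avg_add, avg_sub, avg_const_mul, avg_const, avg_rowDot_sq hP hN]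
          have h3 := avg_rowDot_mul_sq hP hN x x
          have h4 : ∑ i, x i * x i = ∑ i, x i ^ 2 := Finset.sum_congr rfl fun i _ => (sq _).symm
          rw [h4] at h3
          rw [← hm]
          nlinarith
        rw [Finset.sum_const, Finset.card_univ, Fintype.card_fin, nsmul_eq_mul]
        exact mul_le_mul_of_nonneg_left h2 hb0.le
      · intro _
        rw [avg_sub, avg_const, avg_rowDot_sq hP hN, sub_self]
    have hc : 0 < (1 / (16 * q : ℝ) * (groupSize q * m)) ^ 2 := by positivity
    have h2 := prob_le_div (fun u : Fin (groupSize q) → Fin 4 → ZMod (P + 1) =>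
      sq_nonneg (∑ r, (rowDot (u r) x ^ 2 - m))) hc
    refine (prob_mono fun u hu => ?_).trans (h2.trans ?_)
    · have e : ∑ r, (rowDot (u r) x ^ 2 - m) = ∑ r, rowDot (u r) x ^ 2 - groupSize q * m := by
        rw [Finset.sum_sub_distrib]
        simp
      rw [e, ← sq_abs (∑ r, rowDot (u r) x ^ 2 - groupSize q * m)]
      refine pow_le_pow_left₀ (by positivity) ?_ 2
      by_contra! h3
      rw [abs_lt] at h3
      exact hu ⟨by rw [← hm]; linarith [h3.1], by rw [← hm]; linarith [h3.2]⟩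
    · rw [div_le_iff₀ hc]
      refine h1.trans (le_of_eq ?_)
      rw [hb]
      field_simp
      norm_num

/-- Union bound over the at most 2ᴳ sets of at least G/2 groups; all groups of such a set are bad
with probability at most 64^(-G/2) = 8⁻ᴳ. -/
theorem prob_half_bad_le {Ω : Type*} [Fintype Ω] [Nonempty Ω] {p : Ω → Prop} (hp : prob p ≤ 1 / 64)
    (G : ℕ) : prob (fun ω : Fin G → Ω => ∃ s : Finset (Fin G), G ≤ 2 * s.card ∧ ∀ i ∈ s, p (ω i)) ≤
      (1 / 4) ^ G := by
  classical
  have h := prob_exists_le ((Finset.univ : Finset (Finset (Fin G))).filter fun s => G ≤ 2 * s.card)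
    (fun s (ω : Fin G → Ω) => ∀ i ∈ s, p (ω i))
  refine (prob_mono fun ω => ?_).trans (h.trans ?_)
  · rintro ⟨s, hs, hs'⟩
    exact ⟨s, by simpa using hs, hs'⟩
  · have h1 : ∀ s ∈ (Finset.univ : Finset (Finset (Fin G))).filter fun s => G ≤ 2 * s.card,
        prob (fun ω : Fin G → Ω => ∀ i ∈ s, p (ω i)) ≤ (1 / 8) ^ G := by
      intro s hs
      rw [prob_pi_forall]
      calc prob p ^ s.card ≤ (1 / 64) ^ s.card := pow_le_pow_left₀ (prob_nonneg p) hp _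
        _ = (1 / 8 : ℝ) ^ (2 * s.card) := by rw [pow_mul]; norm_num
        _ ≤ (1 / 8) ^ G := pow_le_pow_of_le_one (by norm_num) (by norm_num)
            (Finset.mem_filter.1 hs).2
    refine (Finset.sum_le_sum h1).trans ?_
    rw [Finset.sum_const, nsmul_eq_mul]
    have h2 : (((Finset.univ : Finset (Finset (Fin G))).filter fun s => G ≤ 2 * s.card).card : ℝ) ≤
        2 ^ G := by
      have := Finset.card_filter_le (Finset.univ : Finset (Finset (Fin G))) fun s => G ≤ 2 * s.card
      rw [Finset.card_univ, Fintype.card_finset, Fintype.card_fin] at this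
      exact_mod_cast this
    refine (mul_le_mul_of_nonneg_right h2 (by positivity)).trans (le_of_eq ?_)
    rw [← mul_pow]
    norm_num

/-- The rows of all groups as one sequence. -/
def flatRows {G b : ℕ} {R : Type*} [Zero R] (u : Fin G → Fin b → R) (c : ℕ) : R :=
  if h : c / b < G ∧ c % b < b then u ⟨c / b, h.1⟩ ⟨c % b, h.2⟩ else 0

theorem flatRows_apply {G b : ℕ} {R : Type*} [Zero R] (u : Fin G → Fin b → R) (g : Fin G)
    (r : Fin b) : flatRows u (g * b + r) = u g r := by
  have h1 : (g * b + r : ℕ) / b = g := by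
    rw [mul_comm, Nat.mul_add_div (by have := r.2; omega), Nat.div_eq_of_lt r.2, add_zero]
  have h2 : (g * b + r : ℕ) % b = r := by
    rw [mul_comm, Nat.mul_add_mod, Nat.mod_eq_of_lt r.2]
  rw [flatRows, dif_pos ⟨by rw [h1]; exact g.2, by rw [h2]; exact r.2⟩]
  congr 1 <;> exact Fin.ext (by assumption)

/-- The scale of the estimates of squared norms. -/
noncomputable def estScale (P q : ℕ) : ℝ := groupSize q * hashVar P

/-- The median estimate for `x` is accurate up to the factor `1 ± 1 / (16 q)`. -/
def EstGood (P q l : ℕ) [Fact (P + 1).Prime] (U : ℕ → Fin 4 → ZMod (P + 1)) (x : Fin N → ℝ) : Prop :=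
  (1 - 1 / (16 * q : ℝ)) * (estScale P q * ∑ i, x i ^ 2) ≤
      sqNormEst (numGroups l) (groupSize q) (fun c => rowDot (U c) x) ∧
    sqNormEst (numGroups l) (groupSize q) (fun c => rowDot (U c) x) ≤
      (1 + 1 / (16 * q : ℝ)) * (estScale P q * ∑ i, x i ^ 2)

theorem estGood_zero {q l : ℕ} (U : ℕ → Fin 4 → ZMod (P + 1)) {x : Fin N → ℝ}
    (hx : ∑ i, x i ^ 2 = 0) : EstGood P q l U x := by
  have : sqNormEst (numGroups l) (groupSize q) (fun c => rowDot (U c) x) = 0 := by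
    refine medianAux_eq_zero fun g _ => Finset.sum_eq_zero fun r _ => ?_
    simp only [rowDot_zero hx, mul_zero]
  rw [EstGood, this, hx]
  simp

/-- The median can leave the interval only if at least half of the independent groups do. -/
theorem prob_not_estGood_le {q : ℕ} (l : ℕ) (hq : 1 ≤ q) (hP : 4 ≤ P) (hN : N ≤ P) (x : Fin N → ℝ) :
    prob (fun u : Fin (numGroups l) → Fin (groupSize q) → Fin 4 → ZMod (P + 1) =>
      ¬ EstGood P q l (flatRows u) x) ≤ (1 / 4) ^ numGroups l := by
  classical
  refine (prob_mono fun u hu => ?_).trans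
    (prob_half_bad_le (prob_not_groupGood_le hq hP hN x) (numGroups l))
  by_contra hcon
  refine hu ?_
  set bad := (Finset.univ : Finset (Fin (numGroups l))).filter fun g => ¬ GroupGood P q x (u g)
  have hbad : 2 * bad.card < numGroups l := by
    by_contra! h
    exact hcon ⟨bad, h, fun g hg => (Finset.mem_filter.1 hg).2⟩
  have hsum : ∀ g : Fin (numGroups l), groupSum (groupSize q)
      (fun c => rowDot (flatRows u c) x) g = ∑ r, rowDot (u g r) x ^ 2 := by
    intro g
    rw [groupSum, Finset.sum_range]
    exact Finset.sum_congr rfl fun r _ => by rw [flatRows_apply, sq]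
  refine medianAux_mem_Icc (fun g => Finset.sum_nonneg fun r _ => mul_self_nonneg _) ?_
  have h1 := Finset.card_filter_add_card_filter_not (s := (Finset.univ : Finset (Fin (numGroups l))))
    (fun g => GroupGood P q x (u g))
  rw [Finset.card_univ, Fintype.card_fin] at h1
  have h2 : ((Finset.univ : Finset (Fin (numGroups l))).filter fun g =>
      GroupGood P q x (u g)).card ≤ ((Finset.range (numGroups l)).filter fun g =>
        (1 - 1 / (16 * q : ℝ)) * (estScale P q * ∑ i, x i ^ 2) ≤
          groupSum (groupSize q) (fun c => rowDot (flatRows u c) x) g ∧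
        groupSum (groupSize q) (fun c => rowDot (flatRows u c) x) g ≤
          (1 + 1 / (16 * q : ℝ)) * (estScale P q * ∑ i, x i ^ 2)).card := by
    refine Finset.card_le_card_of_injOn (fun g => (g : ℕ)) ?_ (Fin.val_injective.injOn)
    intro g hg
    have := (Finset.mem_filter.1 hg).2
    simp only [Finset.coe_filter, Finset.mem_range, Set.mem_ofPred_eq, g.2, true_and, hsum]
    rw [estScale, mul_assoc]
    exact this
  have h3 : bad.card = ((Finset.univ : Finset (Fin (numGroups l))).filter fun g =>
    ¬ GroupGood P q x (u g)).card := rfl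
  omega

/-- With probability at least `5 / 6` all of at most `2 N²` estimates are accurate. -/
theorem prob_not_forall_estGood_le {κ : Type*} {q l m : ℕ} (s : Finset κ) (x : κ → Fin N → ℝ)
    (hl : l = Nat.clog 2 m) (hs : s.card ≤ 2 * m ^ 2) (hm : m = 1 → ∀ i ∈ s, ∑ c, x i c ^ 2 = 0)
    (hm0 : 1 ≤ m) (hq : 1 ≤ q) (hP : 4 ≤ P) (hN : N ≤ P) :
    prob (fun u : Fin (numGroups l) → Fin (groupSize q) → Fin 4 → ZMod (P + 1) =>
      ¬ ∀ i ∈ s, EstGood P q l (flatRows u) (x i)) ≤ 1 / 6 := by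
  -- For `m = 1` there are no groups at all and every estimate is 0, which is right because the
  -- vectors vanish.
  rcases hm0.eq_or_lt with h1 | h1
  · have : ∀ u : Fin (numGroups l) → Fin (groupSize q) → Fin 4 → ZMod (P + 1),
        ∀ i ∈ s, EstGood P q l (flatRows u) (x i) :=
      fun u i hi => estGood_zero _ (hm h1.symm i hi)
    have h2 : prob (fun u : Fin (numGroups l) → Fin (groupSize q) → Fin 4 → ZMod (P + 1) =>
      ¬ ∀ i ∈ s, EstGood P q l (flatRows u) (x i)) ≤ 0 := by
      have h3 := avg_const (Ω := Fin (numGroups l) → Fin (groupSize q) → Fin 4 → ZMod (P + 1)) 0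
      rw [← h3]
      exact avg_mono fun u => by rw [if_neg (not_not.2 (this u))]
    linarith
  · have h2 := prob_exists_le s
      (fun i (u : Fin (numGroups l) → Fin (groupSize q) → Fin 4 → ZMod (P + 1)) =>
        ¬ EstGood P q l (flatRows u) (x i))
    refine (prob_mono fun u hu => ?_).trans (h2.trans ((Finset.sum_le_sum fun i _ =>
      prob_not_estGood_le l hq hP hN (x i)).trans ?_))
    · push Not at hu
      exact hu
    · rw [Finset.sum_const, nsmul_eq_mul]
      have h3 : m ≤ 2 ^ l := hl ▸ Nat.le_pow_clog (by norm_num) m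
      -- With 8l groups each failure has probability at most (2ˡ)⁻¹⁶ ≤ m⁻¹⁶, so all 2m² of them have
      -- at most 2m⁻¹⁴.
      have h4 : ((1 : ℝ) / 4) ^ numGroups l = 1 / ((2 : ℝ) ^ l) ^ 16 := by
        rw [numGroups, ← pow_mul, one_div, one_div, inv_pow, show (4 : ℝ) = 2 ^ 2 by norm_num,
          ← pow_mul]
        congr 2
        ring
      have h5 : (m : ℝ) ≤ 2 ^ l := by exact_mod_cast h3
      have h6 : (2 : ℝ) ≤ m := by exact_mod_cast h1
      have h7 : (s.card : ℝ) ≤ 2 * m ^ 2 := by exact_mod_cast hs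
      have h8 : (0 : ℝ) < m := by linarith
      rw [h4]
      calc (s.card : ℝ) * (1 / ((2 : ℝ) ^ l) ^ 16) ≤ 2 * m ^ 2 * (1 / (m : ℝ) ^ 16) := by
            gcongr
        _ = 2 / (m : ℝ) ^ 14 := by field_simp
        _ ≤ 2 / 2 ^ 14 := by gcongr
        _ ≤ 1 / 6 := by norm_num

end rows

/-! ## Random projections of a subspace -/

/-- The product (1 + x + x²/2)(1 - x + x²/2) equals 1 + x⁴/4 ≥ 1, and the first factor is at most
exp x. -/
theorem Real.exp_neg_le_quadratic {x : ℝ} (hx : 0 ≤ x) : Real.exp (-x) ≤ 1 - x + x ^ 2 / 2 := by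
  have h := Real.quadratic_le_exp_of_nonneg hx
  have h1 : 0 < 1 + x + x ^ 2 / 2 := by positivity
  rw [Real.exp_neg, inv_le_comm₀ (Real.exp_pos x) (by nlinarith [sq_nonneg (x - 1)])]
  refine le_trans ?_ h
  rw [inv_le_iff_one_le_mul₀ (by nlinarith [sq_nonneg (x - 1)])]
  nlinarith [sq_nonneg (x ^ 2)]

/-! ### The lower tail of the squared norm of a projection. -/

section rows
variable {P N : ℕ} [Fact (P + 1).Prime]

/-- Replacing the exponential by its quadratic upper bound leaves only the second and fourth
moments, m and at most 3m²: the average is at most 1 - 1/6 + 1/24 = 1 - 1/8. -/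
theorem avg_exp_le (hP : 4 ≤ P) (hN : N ≤ P) {x : Fin N → ℝ} (hx : 0 < ∑ i, x i ^ 2) :
    avg (fun a : Fin 4 → ZMod (P + 1) =>
      Real.exp (-(rowDot a x ^ 2 / (6 * (hashVar P * ∑ i, x i ^ 2))))) ≤ Real.exp (-(1 / 8)) := by
  have hv := hashVar_pos hP
  set m := hashVar P * ∑ i, x i ^ 2 with hm
  have hm0 : 0 < m := mul_pos hv hx
  have h1 : avg (fun a : Fin 4 → ZMod (P + 1) => Real.exp (-(rowDot a x ^ 2 / (6 * m)))) ≤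
      avg (fun a : Fin 4 → ZMod (P + 1) => 1 - 1 / (6 * m) * rowDot a x ^ 2 +
        1 / (72 * m ^ 2) * (rowDot a x * rowDot a x) ^ 2) := by
    refine avg_mono fun a => (Real.exp_neg_le_quadratic (by positivity)).trans (le_of_eq ?_)
    field_simp
    ring
  refine h1.trans ?_
  rw [avg_add, avg_sub, avg_const_mul, avg_const_mul, avg_const, avg_rowDot_sq hP hN, ← hm]
  have h3 := avg_rowDot_mul_sq hP hN x x
  have h4 : ∑ i, x i * x i = ∑ i, x i ^ 2 := Finset.sum_congr rfl fun i _ => (sq _).symm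
  rw [h4] at h3
  have h5 : avg (fun a : Fin 4 → ZMod (P + 1) => (rowDot a x * rowDot a x) ^ 2) ≤ 3 * m ^ 2 := by
    rw [hm]
    refine h3.trans (le_of_eq ?_)
    ring
  have h6 : 1 / (72 * m ^ 2) * avg (fun a : Fin 4 → ZMod (P + 1) =>
      (rowDot a x * rowDot a x) ^ 2) ≤ 1 / (72 * m ^ 2) * (3 * m ^ 2) :=
    mul_le_mul_of_nonneg_left h5 (by positivity)
  have h7 : 1 / (72 * m ^ 2) * (3 * m ^ 2) = 1 / 24 := by field_simp; norm_num
  have h8 : 1 / (6 * m) * m = 1 / 6 := by field_simp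
  have h9 := Real.add_one_le_exp (-(1 / 8 : ℝ))
  rw [h8]
  linarith

/-- Chernoff's method with independent rows: e^(s/12) · e^(-s/8) = e^(-s/24). Exponential decay is
available only for the lower tail, since no moments beyond the fourth are controlled. -/
theorem prob_sum_sq_lt_le (s : ℕ) (hP : 4 ≤ P) (hN : N ≤ P) (x : Fin N → ℝ) :
    prob (fun u : Fin s → Fin 4 → ZMod (P + 1) =>
      ∑ r, rowDot (u r) x ^ 2 < 1 / 2 * (s * hashVar P) * ∑ i, x i ^ 2) ≤ Real.exp (-(s / 24)) := by
  have hx0 : 0 ≤ ∑ i, x i ^ 2 := Finset.sum_nonneg fun i _ => sq_nonneg _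
  rcases hx0.eq_or_lt with hx | hx
  · have : ∀ u : Fin s → Fin 4 → ZMod (P + 1),
        ¬ ∑ r, rowDot (u r) x ^ 2 < 1 / 2 * (s * hashVar P) * ∑ i, x i ^ 2 := by
      intro u
      simp [← hx, rowDot_zero hx.symm]
    simp only [prob, this, if_false, avg_const]
    exact (Real.exp_pos _).le
  · have hv := hashVar_pos hP
    set m := hashVar P * ∑ i, x i ^ 2 with hm
    have hm0 : 0 < m := mul_pos hv hx
    have h1 := prob_le_div (f := fun u : Fin s → Fin 4 → ZMod (P + 1) =>
      ∏ r, Real.exp (-(rowDot (u r) x ^ 2 / (6 * m))))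
      (fun u => Finset.prod_nonneg fun r _ => (Real.exp_pos _).le) (Real.exp_pos (-(s / 12)))
    refine (prob_mono fun u hu => ?_).trans (h1.trans ?_)
    · rw [← Real.exp_sum, Real.exp_le_exp, Finset.sum_neg_distrib, ← Finset.sum_div, neg_le_neg_iff,
        div_le_iff₀ (by positivity)]
      refine hu.le.trans (le_of_eq ?_)
      rw [hm]
      ring
    · rw [avg_pi_prod (fun (_ : Fin s) (a : Fin 4 → ZMod (P + 1)) =>
        Real.exp (-(rowDot a x ^ 2 / (6 * m)))), Finset.prod_const, Finset.card_univ,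
        Fintype.card_fin, div_le_iff₀ (Real.exp_pos _), ← Real.exp_add]
      refine (pow_le_pow_left₀ (avg_nonneg fun a => (Real.exp_pos _).le) (avg_exp_le hP hN hx) s).trans
        (le_of_eq ?_)
      rw [← Real.exp_nat_mul]
      congr 1
      ring

end rows

/-- Rounding to a grid increases the norm of a combination of vectors only a little. -/
theorem exists_int_round {ι κ : Type*} [Fintype κ] {h : ℝ} (hh : 0 < h) (L : ι → κ → ℝ) (y : ι → ℝ)
    (t : Finset ι) : ∀ a : κ → ℝ, ∃ z : ι → ℤ, (∀ j, |h * z j - y j| ≤ h) ∧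
      ∑ r, (a r + ∑ j ∈ t, h * z j * L j r) ^ 2 ≤
        ∑ r, (a r + ∑ j ∈ t, y j * L j r) ^ 2 + h ^ 2 / 4 * ∑ j ∈ t, ∑ r, L j r ^ 2 := by
  classical
  induction t using Finset.induction_on with
  | empty =>
    refine fun a => ⟨fun j => ⌊y j / h⌋, fun j => ?_, by simp⟩
    have h1 := Int.floor_le (y j / h)
    have h2 := Int.lt_floor_add_one (y j / h)
    rw [le_div_iff₀ hh] at h1
    rw [div_lt_iff₀ hh] at h2
    rw [abs_le]
    constructor <;> nlinarith
  | insert j t hj ih =>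
    intro a
    set c : κ → ℝ := fun r => a r + ∑ i ∈ insert j t, y i * L i r with hc
    have hsq : ∀ e : ℝ, ∑ r, (c r + e * L j r) ^ 2 =
        ∑ r, c r ^ 2 + e * (2 * ∑ r, c r * L j r) + e ^ 2 * ∑ r, L j r ^ 2 := by
      intro e
      rw [Finset.mul_sum, Finset.mul_sum, Finset.mul_sum, ← Finset.sum_add_distrib,
        ← Finset.sum_add_distrib]
      exact Finset.sum_congr rfl fun r _ => by ring
    obtain ⟨m, hm, hm'⟩ : ∃ m : ℤ, |h * m - y j| ≤ h ∧ ∑ r, (c r + (h * m - y j) * L j r) ^ 2 ≤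
        ∑ r, c r ^ 2 + h ^ 2 / 4 * ∑ r, L j r ^ 2 := by
      have h1 := Int.floor_le (y j / h)
      have h2 := Int.lt_floor_add_one (y j / h)
      rw [le_div_iff₀ hh] at h1
      rw [div_lt_iff₀ hh] at h2
      have hL : 0 ≤ ∑ r, L j r ^ 2 := Finset.sum_nonneg fun r _ => sq_nonneg _
      set f : ℝ := (⌊y j / h⌋ : ℝ) with hf
      -- Rounding `y j` up or down at random with mean `y j` would add e(h - e)‖L j‖² ≤ (h²/4)‖L j‖²
      -- on average, the linear term cancelling. So if rounding down exceeds this bound, rounding up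
      -- does not.
      by_cases hcase : (h * f - y j) * (2 * ∑ r, c r * L j r) + (h * f - y j) ^ 2 * ∑ r, L j r ^ 2 ≤
          h ^ 2 / 4 * ∑ r, L j r ^ 2
      · refine ⟨⌊y j / h⌋, ?_, ?_⟩
        · rw [abs_le]
          constructor <;> nlinarith
        · rw [hsq]
          linarith
      · refine ⟨⌊y j / h⌋ + 1, ?_, ?_⟩
        · push_cast
          rw [← hf, abs_le]
          constructor <;> nlinarith
        · rw [hsq]
          push_cast
          rw [← hf]
          push Not at hcase
          set X := 2 * ∑ r, c r * L j r
          set F := ∑ r, L j r ^ 2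
          set e := y j - h * f with he
          have he0 : 0 ≤ e := by rw [he]; linarith
          have he1 : e ≤ h := by rw [he]; linarith
          have e1 : h * f - y j = -e := by rw [he]; ring
          have e2 : h * (f + 1) - y j = h - e := by rw [he]; ring
          rw [e1] at hcase
          rw [e2]
          rcases he0.eq_or_lt with h0 | h0
          · rw [← h0] at hcase
            exfalso
            nlinarith [mul_nonneg (sq_nonneg h) hL]
          · have h3 : (h - e) * (e * X) ≤ (h - e) * ((e ^ 2 - h ^ 2 / 4) * F) :=
              mul_le_mul_of_nonneg_left (by nlinarith) (by linarith)
            have h4 : e * ((h - e) * X + (h - e) ^ 2 * F) ≤ e * (h ^ 2 / 4 * F) := by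
              have h5 : 0 ≤ (h - 2 * e) ^ 2 * F := mul_nonneg (sq_nonneg _) hL
              nlinarith [mul_nonneg hh.le h5]
            have := le_of_mul_le_mul_left h4 h0
            linarith
    obtain ⟨z, hz, hz'⟩ := ih fun r => a r + h * m * L j r
    refine ⟨Function.update z j m, fun i => ?_, ?_⟩
    · by_cases hi : i = j
      · subst hi
        simpa using hm
      · simpa [hi] using hz i
    · have e1 : ∀ r, a r + ∑ i ∈ insert j t, h * (Function.update z j m i : ℤ) * L i r =
          (a r + h * m * L j r) + ∑ i ∈ t, h * z i * L i r := by
        intro r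
        rw [Finset.sum_insert hj, Function.update_self, add_assoc]
        congr 2
        exact Finset.sum_congr rfl fun i hi => by
          rw [Function.update_of_ne (fun h => hj (by rwa [h] at hi))]
      have e2 : ∀ r, (a r + h * m * L j r) + ∑ i ∈ t, y i * L i r = c r + (h * m - y j) * L j r := by
        intro r
        rw [hc]
        simp only [Finset.sum_insert hj]
        ring
      simp only [e1]
      simp only [e2] at hz'
      rw [Finset.sum_insert hj]
      calc _ ≤ _ := hz'
        _ ≤ _ := by linarith

/-- A lower bound on grid points yields a lower bound everywhere. -/
theorem lower_bound_of_grid {ι κ : Type*} [Fintype ι] [Fintype κ] {L : ι → κ → ℝ} {m : ℝ}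
    (hm : 0 ≤ m)
    (hgrid : ∀ z : ι → ℤ, ∑ j, |z j| ≤ 9 * Fintype.card ι →
      1 / 2 * m * ∑ j, (z j : ℝ) ^ 2 ≤ ∑ r, (∑ j, z j * L j r) ^ 2)
    (hF : ∑ j, ∑ r, L j r ^ 2 ≤ 24 * m * Fintype.card ι) (w : ι → ℝ) :
    m / 4 * ∑ j, w j ^ 2 ≤ ∑ r, (∑ j, w j * L j r) ^ 2 := by
  have hW0 : 0 ≤ ∑ j, w j ^ 2 := Finset.sum_nonneg fun j _ => sq_nonneg _
  rcases hW0.eq_or_lt with hW | hW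
  · rw [← hW, mul_zero]
    exact Finset.sum_nonneg fun j _ => sq_nonneg _
  set n := Real.sqrt (∑ j, w j ^ 2) with hn
  have hn0 : 0 < n := Real.sqrt_pos.2 hW
  have hn2 : n ^ 2 = ∑ j, w j ^ 2 := Real.sq_sqrt hW0
  have hι : Nonempty ι := by
    by_contra h
    rw [not_nonempty_iff] at h
    simp at hW
  set K : ℝ := (Fintype.card ι : ℝ) with hK
  have hK0 : 0 < K := by rw [hK]; exact_mod_cast Fintype.card_pos
  set c := Real.sqrt K with hc
  have hc0 : 0 < c := Real.sqrt_pos.2 hK0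
  have hc2 : c ^ 2 = K := Real.sq_sqrt hK0.le
  -- The grid width is ‖w‖ / (8√K) for dimension K. The rounded vector then has integer coordinates
  -- of ℓ¹-norm at most 8K + K, and rounding moves `w` by at most ‖w‖/8.
  set h : ℝ := n / (8 * c) with hh
  have hh0 : 0 < h := by positivity
  have hhc : 8 * (h * c) = n := by rw [hh]; field_simp
  have hhK : 64 * (h ^ 2 * K) = n ^ 2 := by rw [← hhc, ← hc2]; ring
  obtain ⟨z, hz, hz'⟩ := exists_int_round hh0 L w Finset.univ 0
  simp only [Pi.zero_apply, zero_add] at hz'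
  have hl1 : ∑ j, |w j| ≤ c * n := by
    have h1 := Finset.sum_mul_sq_le_sq_mul_sq Finset.univ (fun _ : ι => (1 : ℝ)) fun j => |w j|
    simp only [one_mul, one_pow, sq_abs, Finset.sum_const, Finset.card_univ, nsmul_eq_mul,
      mul_one] at h1
    rw [← hn2, ← hK, ← hc2, ← mul_pow] at h1
    exact le_of_sq_le_sq h1 (by positivity)
  have h1 : ∑ j, |z j| ≤ 9 * (Fintype.card ι : ℤ) := by
    have h2 : h * ∑ j, |(z j : ℝ)| ≤ h * (9 * K) := by
      calc h * ∑ j, |(z j : ℝ)| = ∑ j, |h * z j| := by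
            rw [Finset.mul_sum]
            exact Finset.sum_congr rfl fun j _ => by rw [abs_mul, abs_of_pos hh0]
        _ ≤ ∑ j, (|w j| + h) := Finset.sum_le_sum fun j _ => by
            have := abs_sub_abs_le_abs_sub (h * z j) (w j)
            linarith [hz j]
        _ = ∑ j, |w j| + K * h := by
            rw [Finset.sum_add_distrib, Finset.sum_const, Finset.card_univ, nsmul_eq_mul]
        _ ≤ c * n + K * h := by linarith
        _ = h * (9 * K) := by rw [← hhc, ← hc2]; ring
    have h3 := le_of_mul_le_mul_left h2 hh0
    rw [hK] at h3
    exact_mod_cast h3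
  have h2 := hgrid z h1
  -- the rounded vector is not much shorter
  have h3 : 7 / 8 * n ≤ Real.sqrt (∑ j, (h * z j) ^ 2) := by
    have h4 : n ≤ Real.sqrt (∑ j, (h * z j) ^ 2) + Real.sqrt (∑ j, (h * z j - w j) ^ 2) := by
      have := norm_sub_le (WithLp.toLp 2 fun j => h * z j : EuclideanSpace ℝ ι)
        (WithLp.toLp 2 fun j => h * z j - w j)
      simpa [EuclideanSpace.norm_eq, hn, -abs_mul, -norm_mul] using this
    have h5 : Real.sqrt (∑ j, (h * z j - w j) ^ 2) ≤ n / 8 := by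
      refine Real.sqrt_le_sqrt (y := ∑ _j : ι, h ^ 2) (Finset.sum_le_sum fun j _ => ?_) |>.trans ?_
      · rw [← sq_abs]
        exact pow_le_pow_left₀ (abs_nonneg _) (hz j) 2
      · rw [Finset.sum_const, Finset.card_univ, nsmul_eq_mul]
        refine Real.sqrt_le_iff.2 ⟨by positivity, le_of_eq ?_⟩
        rw [← hK]
        linarith
    linarith
  have h4 : 49 / 64 * n ^ 2 ≤ ∑ j, (h * z j) ^ 2 := by
    have h5 := pow_le_pow_left₀ (by positivity) h3 2
    rw [Real.sq_sqrt (Finset.sum_nonneg fun j _ => sq_nonneg _)] at h5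
    linarith
  have e1 : ∑ j, (h * z j) ^ 2 = h ^ 2 * ∑ j, (z j : ℝ) ^ 2 := by
    rw [Finset.mul_sum]
    exact Finset.sum_congr rfl fun j _ => by ring
  have e2 : ∑ r, (∑ j, h * z j * L j r) ^ 2 = h ^ 2 * ∑ r, (∑ j, z j * L j r) ^ 2 := by
    rw [Finset.mul_sum]
    refine Finset.sum_congr rfl fun r _ => ?_
    rw [← mul_pow, Finset.mul_sum]
    congr 1
    exact Finset.sum_congr rfl fun j _ => by ring
  rw [e2] at hz'
  rw [e1] at h4
  have h5 : 1 / 2 * m * (49 / 64 * n ^ 2) ≤ h ^ 2 * ∑ r, (∑ j, z j * L j r) ^ 2 := by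
    calc 1 / 2 * m * (49 / 64 * n ^ 2) ≤ 1 / 2 * m * (h ^ 2 * ∑ j, (z j : ℝ) ^ 2) :=
          mul_le_mul_of_nonneg_left h4 (by positivity)
      _ = h ^ 2 * (1 / 2 * m * ∑ j, (z j : ℝ) ^ 2) := by ring
      _ ≤ _ := mul_le_mul_of_nonneg_left h2 (sq_nonneg h)
  have h6 : h ^ 2 / 4 * ∑ j, ∑ r, L j r ^ 2 ≤ h ^ 2 / 4 * (24 * m * K) :=
    mul_le_mul_of_nonneg_left hF (by positivity)
  have h7 : h ^ 2 / 4 * (24 * m * K) = 6 / 64 * (m * n ^ 2) := by rw [← hhK]; ring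
  -- It remains that 49/128 - 6/64 = 37/128 ≥ 1/4.
  rw [← hn2]
  nlinarith [mul_nonneg hm (sq_nonneg n)]

theorem sum_two_pow_neg_abs_le (K : ℕ) :
    ∑ m ∈ Finset.Icc (-(K : ℤ)) K, (1 / 2 : ℝ) ^ m.natAbs ≤ 3 - 2 * (1 / 2) ^ K := by
  induction K with
  | zero => norm_num
  | succ K ih =>
    have h : Finset.Icc (-((K + 1 : ℕ) : ℤ)) ((K + 1 : ℕ) : ℤ) =
        insert ((K + 1 : ℕ) : ℤ) (insert (-((K + 1 : ℕ) : ℤ)) (Finset.Icc (-(K : ℤ)) K)) := by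
      ext x
      simp only [Finset.mem_Icc, Finset.mem_insert]
      omega
    rw [h, Finset.sum_insert, Finset.sum_insert]
    · rw [Int.natAbs_neg, Int.natAbs_natCast, pow_succ]
      linarith
    · simp only [Finset.mem_Icc]
      omega
    · simp only [Finset.mem_Icc, Finset.mem_insert]
      omega

/-- The integer points in an `ℓ¹`-ball. -/
theorem exists_finset_int_points (ι : Type*) [Fintype ι] : ∃ Z : Finset (ι → ℤ),
    (∀ z : ι → ℤ, ∑ j, |z j| ≤ 9 * Fintype.card ι → z ∈ Z) ∧
      (Z.card : ℝ) ≤ 1536 ^ Fintype.card ι := by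
  classical
  set κ := Fintype.card ι with hκ
  set box : Finset (ι → ℤ) := Fintype.piFinset fun _ => Finset.Icc (-((9 * κ : ℕ) : ℤ)) (9 * κ : ℕ)
  set Z : Finset (ι → ℤ) := box.filter fun z : ι → ℤ => ∑ j, |z j| ≤ 9 * (κ : ℤ)
  refine ⟨Z, fun z hz => ?_, ?_⟩
  · refine Finset.mem_filter.2 ⟨Fintype.mem_piFinset.2 fun j => ?_, hz⟩
    have h1 := Finset.single_le_sum (f := fun j => |z j|) (fun j _ => abs_nonneg _) (Finset.mem_univ j)
    have h2 := abs_le.1 (h1.trans hz)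
    rw [Finset.mem_Icc]
    push_cast
    exact h2
  -- Weighted counting: every point of the ball has weight 2^(9κ) ∏ 2^(-|zⱼ|) ≥ 1, and the sum of
  -- the weights over the box is a product of geometric sums, each at most 3. Altogether (2⁹ · 3)^κ
  -- = 1536^κ.
  · have h1 : ∀ z ∈ Z,
        (1 : ℝ) ≤ 2 ^ (9 * κ) * ∏ j, (1 / 2 : ℝ) ^ (z j).natAbs := by
      intro z hz
      have h2 := (Finset.mem_filter.1 hz).2
      have h3 : ∑ j, (z j).natAbs ≤ 9 * κ := by
        zify
        simpa using h2
      rw [Finset.prod_pow_eq_pow_sum, one_div, inv_pow, ← div_eq_mul_inv,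
        one_le_div (by positivity)]
      exact pow_le_pow_right₀ (by norm_num) h3
    calc (Z.card : ℝ)
        = ∑ z ∈ Z, (1 : ℝ) := by simp
      _ ≤ ∑ z ∈ Z,
          2 ^ (9 * κ) * ∏ j, (1 / 2 : ℝ) ^ (z j).natAbs := Finset.sum_le_sum h1
      _ ≤ ∑ z ∈ box, 2 ^ (9 * κ) * ∏ j, (1 / 2 : ℝ) ^ (z j).natAbs :=
          Finset.sum_le_sum_of_subset_of_nonneg (Finset.filter_subset _ _) fun z _ _ => by positivity
      _ = 2 ^ (9 * κ) * ∏ _j : ι, ∑ m ∈ Finset.Icc (-((9 * κ : ℕ) : ℤ)) (9 * κ : ℕ),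
          (1 / 2 : ℝ) ^ m.natAbs := by
          rw [← Finset.mul_sum, Finset.prod_univ_sum]
      _ ≤ 2 ^ (9 * κ) * ∏ _j : ι, (3 : ℝ) := by
          refine mul_le_mul_of_nonneg_left (Finset.prod_le_prod (fun j _ => ?_) fun j _ => ?_)
            (by positivity)
          · exact Finset.sum_nonneg fun m _ => by positivity
          · refine (sum_two_pow_neg_abs_le _).trans ?_
            have : (0 : ℝ) ≤ (1 / 2) ^ (9 * κ) := by positivity
            linarith
      _ = 1536 ^ κ := by
          rw [Finset.prod_const, Finset.card_univ, ← hκ, pow_mul, ← mul_pow]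
          norm_num

section rows
variable {P N : ℕ} [Fact (P + 1).Prime]

theorem rowDot_sum {ι : Type*} (t : Finset ι) (w : ι → ℝ) (x : ι → Fin N → ℝ)
    (a : Fin 4 → ZMod (P + 1)) :
    rowDot a (fun i => ∑ j ∈ t, w j * x j i) = ∑ j ∈ t, w j * rowDot a (x j) := by
  simp only [rowDot, Finset.sum_mul, Finset.mul_sum]
  rw [Finset.sum_comm]
  exact Finset.sum_congr rfl fun j _ => Finset.sum_congr rfl fun i _ => by ring

/-- A random projection does not shrink the vectors of a subspace too much. -/
theorem prob_not_lower_bound_le {ι : Type*} [Fintype ι] [DecidableEq ι] {k s : ℕ} (hP : 4 ≤ P)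
    (hN : N ≤ P) (x : ι → Fin N → ℝ)
    (hx : ∀ a b, ∑ i, x a i * x b i = if a = b then 1 else 0)
    (hk : Fintype.card ι ≤ k) (hk1 : 1 ≤ k) (hs : 3072 * k ≤ s) :
    prob (fun u : Fin s → Fin 4 → ZMod (P + 1) => ¬ ∀ w : ι → ℝ,
      s * hashVar P / 4 * ∑ j, w j ^ 2 ≤ ∑ r, (∑ j, w j * rowDot (u r) (x j)) ^ 2) ≤ 1 / 12 := by
  have hv := hashVar_pos hP
  have hs0 : (0 : ℝ) < s := by
    have : 0 < s := by omega
    exact_mod_cast this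
  have hm0 : 0 < s * hashVar P := by positivity
  set m := s * hashVar P with hm
  obtain ⟨Z, hZ, hZc⟩ := exists_finset_int_points ι
  have hnorm : ∀ z : ι → ℝ, ∑ i, (∑ j, z j * x j i) ^ 2 = ∑ j, z j ^ 2 := by
    intro z
    have h1 : ∀ i, (∑ j, z j * x j i) ^ 2 = ∑ j, ∑ j', z j * z j' * (x j i * x j' i) := by
      intro i
      rw [sq, Finset.sum_mul_sum]
      exact Finset.sum_congr rfl fun j _ => Finset.sum_congr rfl fun j' _ => by ring
    simp only [h1]
    rw [Finset.sum_comm]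
    refine Finset.sum_congr rfl fun j _ => ?_
    rw [Finset.sum_comm]
    simp only [← Finset.mul_sum, hx]
    simp [sq]
  -- Union bound over the grid: at most 1536ᵏ ≤ e^(8k) points, each failing with probability at most
  -- e^(-s/24) ≤ e^(-128k).
  have hA : prob (fun u : Fin s → Fin 4 → ZMod (P + 1) => ∃ z ∈ Z,
      ∑ r, (∑ j, z j * rowDot (u r) (x j)) ^ 2 < 1 / 2 * m * ∑ j, (z j : ℝ) ^ 2) ≤ 1 / 24 := by
    refine (prob_exists_le Z _).trans ?_
    have h1 : ∀ z ∈ Z, prob (fun u : Fin s → Fin 4 → ZMod (P + 1) =>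
        ∑ r, (∑ j, z j * rowDot (u r) (x j)) ^ 2 < 1 / 2 * m * ∑ j, (z j : ℝ) ^ 2) ≤
        Real.exp (-(s / 24)) := by
      intro z _
      have h2 := prob_sum_sq_lt_le s hP hN fun i => ∑ j, (z j : ℝ) * x j i
      simpa only [rowDot_sum, hnorm] using h2
    refine (Finset.sum_le_sum h1).trans ?_
    rw [Finset.sum_const, nsmul_eq_mul]
    have h2 : (Z.card : ℝ) ≤ Real.exp (8 * k) := by
      refine hZc.trans ((pow_le_pow_right₀ (by norm_num) hk).trans ?_)
      rw [mul_comm, Real.exp_nat_mul]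
      refine pow_le_pow_left₀ (by norm_num) ?_ k
      have h3 := Real.exp_one_gt_d9
      have h4 : (2.7 : ℝ) ^ 8 ≤ Real.exp 1 ^ 8 := pow_le_pow_left₀ (by norm_num) (by linarith) 8
      rw [← Real.exp_nat_mul] at h4
      norm_num at h4 ⊢
      linarith
    calc (Z.card : ℝ) * Real.exp (-(s / 24)) ≤ Real.exp (8 * k) * Real.exp (-(s / 24)) :=
          mul_le_mul_of_nonneg_right h2 (Real.exp_pos _).le
      _ = Real.exp (8 * k - s / 24) := by rw [← Real.exp_add]; ring_nf
      _ ≤ Real.exp (-23) := by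
          have h3 : (3072 : ℝ) * k ≤ s := by exact_mod_cast hs
          have h4 : (1 : ℝ) ≤ k := by exact_mod_cast hk1
          exact Real.exp_le_exp.2 (by linarith)
      _ ≤ 1 / 24 := by
          rw [Real.exp_neg, inv_eq_one_div]
          refine one_div_le_one_div_of_le (by norm_num) ?_
          have := Real.add_one_le_exp (23 : ℝ)
          linarith
  -- The images of the orthonormal vectors have total squared norm m · card ι on average; Markov's
  -- inequality with the factor 24 bounds the rounding error.
  have hB : prob (fun u : Fin s → Fin 4 → ZMod (P + 1) =>
      24 * m * Fintype.card ι < ∑ j, ∑ r, rowDot (u r) (x j) ^ 2) ≤ 1 / 24 := by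
    have havg : avg (fun u : Fin s → Fin 4 → ZMod (P + 1) => ∑ j, ∑ r, rowDot (u r) (x j) ^ 2) =
        m * Fintype.card ι := by
      rw [avg_sum]
      have h1 : ∀ j, avg (fun u : Fin s → Fin 4 → ZMod (P + 1) => ∑ r, rowDot (u r) (x j) ^ 2) = m := by
        intro j
        rw [avg_sum]
        have h2 : ∀ r : Fin s, avg (fun u : Fin s → Fin 4 → ZMod (P + 1) => rowDot (u r) (x j) ^ 2) =
            hashVar P := by
          intro r
          rw [avg_eval r fun a => rowDot a (x j) ^ 2, avg_rowDot_sq hP hN]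
          have h3 := hx j j
          simp only [← sq, if_true] at h3
          rw [h3, mul_one]
        simp only [h2, Finset.sum_const, Finset.card_univ, Fintype.card_fin, nsmul_eq_mul, hm]
      simp only [h1, Finset.sum_const, Finset.card_univ, nsmul_eq_mul, mul_comm]
    rcases isEmpty_or_nonempty ι with hι | hι
    · simp [prob, avg]
    · have hc : (0 : ℝ) < Fintype.card ι := by exact_mod_cast Fintype.card_pos
      have hc' : 0 < 24 * m * Fintype.card ι := by positivity
      refine (prob_mono fun u hu => hu.le).trans ((prob_le_div (fun u => Finset.sum_nonneg fun j _ =>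
        Finset.sum_nonneg fun r _ => sq_nonneg _) hc').trans (le_of_eq ?_))
      rw [havg]
      field_simp
  refine (prob_mono fun u hu => ?_).trans ((prob_or_le _ _).trans (add_le_add hA hB)) |>.trans
    (by norm_num)
  by_contra! hcon
  refine hu fun w => ?_
  exact lower_bound_of_grid (L := fun j r => rowDot (u r) (x j)) hm0.le
    (fun z hz => hcon.1 z (hZ z hz)) hcon.2 w

end rows

/-! ## Partitions and their centers -/

section partition
variable {n d k : ℕ}

/-- The indicator vector of the cluster `j`. -/
def clusterInd (f : Fin n → Fin k) (j : Fin k) (i : Fin n) : ℝ := if f i = j then 1 else 0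

def clusterCard (f : Fin n → Fin k) (j : Fin k) : ℝ := ∑ i, clusterInd f j i

/-- An empty cluster gets centroid 0 through division by 0; its weight `clusterCard` is 0 wherever
it enters. -/
noncomputable def centroid (A : Matrix (Fin n) (Fin d) ℝ) (f : Fin n → Fin k) (j : Fin k)
    (c : Fin d) : ℝ := (∑ i, clusterInd f j i * A i c) / clusterCard f j

noncomputable def resid (A : Matrix (Fin n) (Fin d) ℝ) (f : Fin n → Fin k) (c : Fin d)
    (i : Fin n) : ℝ := A i c - centroid A f (f i) c

/-- The cost of a partition with its centroids as centers. -/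
noncomputable def partCost (A : Matrix (Fin n) (Fin d) ℝ) (f : Fin n → Fin k) : ℝ :=
  ∑ c, ∑ i, resid A f c i ^ 2

variable (f : Fin n → Fin k)

theorem clusterInd_nonneg (j : Fin k) (i : Fin n) : 0 ≤ clusterInd f j i := by
  rw [clusterInd]; split_ifs <;> norm_num

theorem clusterInd_sq (j : Fin k) (i : Fin n) : clusterInd f j i ^ 2 = clusterInd f j i := by
  rw [clusterInd]; split_ifs <;> norm_num

theorem clusterCard_nonneg (j : Fin k) : 0 ≤ clusterCard f j :=
  Finset.sum_nonneg fun i _ => clusterInd_nonneg f j i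

theorem clusterInd_eq_zero {j : Fin k} (h : clusterCard f j = 0) (i : Fin n) :
    clusterInd f j i = 0 :=
  (Finset.sum_eq_zero_iff_of_nonneg fun i _ => clusterInd_nonneg f j i).1 h i (Finset.mem_univ i)

theorem clusterCard_pos (i : Fin n) : 0 < clusterCard f (f i) := by
  refine lt_of_lt_of_le (by rw [clusterInd, if_pos rfl]; norm_num)
    (Finset.single_le_sum (fun i' _ => clusterInd_nonneg f (f i) i') (Finset.mem_univ i))

theorem sum_fiberwise_mul (g : Fin k → ℝ) (h : Fin n → ℝ) :
    ∑ i, g (f i) * h i = ∑ j, g j * ∑ i, clusterInd f j i * h i := by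
  simp only [Finset.mul_sum]
  rw [Finset.sum_comm]
  refine Finset.sum_congr rfl fun i _ => ?_
  rw [Finset.sum_eq_single_of_mem (f i) (Finset.mem_univ _)]
  · simp [clusterInd]
  · intro j _ hj
    simp [clusterInd, hj.symm]

theorem sum_fiberwise (g : Fin k → ℝ) : ∑ i, g (f i) = ∑ j, clusterCard f j * g j := by
  have := sum_fiberwise_mul f g fun _ => 1
  simp only [mul_one] at this
  rw [this]
  exact Finset.sum_congr rfl fun j _ => mul_comm _ _

/-- The residual of the centroids is orthogonal to all clusters. The Pythagorean identity for the
cost, the centered sketch correlations and the pairwise formula all rest on this. -/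
theorem sum_clusterInd_mul_resid (A : Matrix (Fin n) (Fin d) ℝ) (j : Fin k) (c : Fin d) :
    ∑ i, clusterInd f j i * resid A f c i = 0 := by
  have h : ∀ i, clusterInd f j i * resid A f c i =
      clusterInd f j i * A i c - clusterInd f j i * centroid A f j c := by
    intro i
    by_cases hi : f i = j
    · rw [resid, hi]; ring
    · simp [clusterInd, hi]
  simp only [h, Finset.sum_sub_distrib, ← Finset.sum_mul]
  change _ - clusterCard f j * _ = 0
  by_cases h0 : clusterCard f j = 0
  · simp [clusterInd_eq_zero f h0, h0]
  · rw [centroid, mul_div_cancel₀ _ h0, sub_self]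

theorem partCost_nonneg (A : Matrix (Fin n) (Fin d) ℝ) : 0 ≤ partCost A f :=
  Finset.sum_nonneg fun _ _ => Finset.sum_nonneg fun _ _ => sq_nonneg _

/-- The cost of other centers exceeds that of the centroids by their weighted distance. -/
theorem sum_sq_sub_eq (A : Matrix (Fin n) (Fin d) ℝ) (C : Fin k → Fin d → ℝ) :
    ∑ c, ∑ i, (C (f i) c - A i c) ^ 2 =
      partCost A f + ∑ c, ∑ j, clusterCard f j * (C j c - centroid A f j c) ^ 2 := by
  rw [partCost, ← Finset.sum_add_distrib]
  refine Finset.sum_congr rfl fun c _ => ?_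
  have h : ∀ i, (C (f i) c - A i c) ^ 2 = resid A f c i ^ 2 +
      (C (f i) c - centroid A f (f i) c) ^ 2 -
      2 * ((C (f i) c - centroid A f (f i) c) * resid A f c i) := by
    intro i
    rw [resid]; ring
  simp only [h, Finset.sum_sub_distrib, Finset.sum_add_distrib, ← Finset.mul_sum]
  rw [sum_fiberwise_mul f (fun j => C j c - centroid A f j c),
    sum_fiberwise f (fun j => (C j c - centroid A f j c) ^ 2)]
  simp [sum_clusterInd_mul_resid]

/-! ### Least squares centers computed from a sketch. -/

section rows
variable {P : ℕ} [Fact (P + 1).Prime]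

/-- The centers `C` are a least squares solution for the sketched clusters. -/
def NormalEquations {s : ℕ} (u : Fin s → Fin 4 → ZMod (P + 1)) (A : Matrix (Fin n) (Fin d) ℝ)
    (C : Fin k → Fin d → ℝ) : Prop :=
  ∀ j c, ∑ r, rowDot (u r) (clusterInd f j) * (rowDot (u r) (fun i => A i c) -
    ∑ a, rowDot (u r) (clusterInd f a) * C a c) = 0

/-- A column of the data is its residual plus the combination of cluster indicators with the
centroids as coefficients. So the normal equations involve only the residual and the deviation of
the centers from the centroids. -/
theorem rowDot_col (A : Matrix (Fin n) (Fin d) ℝ) (C : Fin k → Fin d → ℝ) (c : Fin d)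
    (a : Fin 4 → ZMod (P + 1)) :
    rowDot a (fun i => A i c) - ∑ j, rowDot a (clusterInd f j) * C j c =
      rowDot a (resid A f c) - ∑ j, (C j c - centroid A f j c) * rowDot a (clusterInd f j) := by
  have h : rowDot a (fun i => A i c) =
      rowDot a (resid A f c) + ∑ j, centroid A f j c * rowDot a (clusterInd f j) := by
    rw [← rowDot_sum]
    simp only [rowDot]
    rw [← Finset.sum_add_distrib]
    refine Finset.sum_congr rfl fun i _ => ?_
    have : ∑ j, centroid A f j c * clusterInd f j i = centroid A f (f i) c := by
      rw [Finset.sum_eq_single_of_mem (f i) (Finset.mem_univ _)]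
      · simp [clusterInd]
      · intro j _ hj
        simp [clusterInd, hj.symm]
    rw [this, resid]
    ring
  rw [h, add_sub_assoc, ← Finset.sum_sub_distrib, sub_eq_add_neg (rowDot a (resid A f c)),
    ← Finset.sum_neg_distrib]
  congr 1
  exact Finset.sum_congr rfl fun j _ => by ring

/-- The correlation of cluster and residual in the sketch. -/
noncomputable def sketchCorr {s : ℕ} (u : Fin s → Fin 4 → ZMod (P + 1))
    (A : Matrix (Fin n) (Fin d) ℝ) (j : Fin k) (c : Fin d) : ℝ :=
  ∑ r, rowDot (u r) (clusterInd f j) * rowDot (u r) (resid A f c)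

theorem rowDot_clusterInd_eq_zero {j : Fin k} (h : clusterCard f j = 0) (a : Fin 4 → ZMod (P + 1)) :
    rowDot a (clusterInd f j) = 0 :=
  Finset.sum_eq_zero fun i _ => by rw [clusterInd_eq_zero f h, zero_mul]

/-- By orthogonality of cluster and residual each summand has mean 0, so the second moment of the
sum over independent rows is the sum of the second moments, each at most v² |cluster| ‖residual‖²
with v = `hashVar P`. -/
theorem avg_sketchCorr_le (s : ℕ) (hP : 4 ≤ P) (hN : n ≤ P) (A : Matrix (Fin n) (Fin d) ℝ) :
    avg (fun u : Fin s → Fin 4 → ZMod (P + 1) =>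
      ∑ c, ∑ j, sketchCorr f u A j c ^ 2 / clusterCard f j) ≤
      s * hashVar P ^ 2 * k * partCost A f := by
  have h1 : ∀ c j, avg (fun u : Fin s → Fin 4 → ZMod (P + 1) =>
      sketchCorr f u A j c ^ 2 / clusterCard f j) ≤
      s * hashVar P ^ 2 * ∑ i, resid A f c i ^ 2 := by
    intro c j
    have hr : 0 ≤ ∑ i, resid A f c i ^ 2 := Finset.sum_nonneg fun i _ => sq_nonneg _
    have h2 : avg (fun u : Fin s → Fin 4 → ZMod (P + 1) => sketchCorr f u A j c ^ 2) ≤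
        s * hashVar P ^ 2 * (clusterCard f j * ∑ i, resid A f c i ^ 2) := by
      simp only [sketchCorr]
      rw [avg_sum_sq (fun _ a => rowDot a (clusterInd f j) * rowDot a (resid A f c))]
      · rw [Finset.sum_const, Finset.card_univ, Fintype.card_fin, nsmul_eq_mul, mul_assoc]
        refine mul_le_mul_of_nonneg_left ((avg_rowDot_mul_sq hP hN _ _).trans (le_of_eq ?_))
          (Nat.cast_nonneg s)
        rw [sum_clusterInd_mul_resid]
        simp only [clusterInd_sq]
        rw [clusterCard]
        ring
      · intro _
        rw [avg_rowDot_mul hP hN, sum_clusterInd_mul_resid, mul_zero]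
    have h3 : avg (fun u : Fin s → Fin 4 → ZMod (P + 1) =>
        sketchCorr f u A j c ^ 2 / clusterCard f j) = (clusterCard f j)⁻¹ *
        avg (fun u : Fin s → Fin 4 → ZMod (P + 1) => sketchCorr f u A j c ^ 2) := by
      rw [← avg_const_mul]
      simp only [div_eq_inv_mul]
    rw [h3]
    have hc := clusterCard_nonneg f j
    rcases hc.eq_or_lt with h0 | h0
    · rw [← h0, inv_zero, zero_mul]
      positivity
    · rw [inv_mul_le_iff₀ h0]
      refine h2.trans (le_of_eq ?_)
      ring
  rw [avg_sum]
  simp only [avg_sum]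
  rw [partCost, Finset.mul_sum]
  refine Finset.sum_le_sum fun c _ => (Finset.sum_le_sum fun j _ => h1 c j).trans (le_of_eq ?_)
  rw [Finset.sum_const, Finset.card_univ, Fintype.card_fin, nsmul_eq_mul]
  ring

theorem prob_sketchCorr_le {s : ℕ} (hs : 1 ≤ s) (hk : 1 ≤ k) (hP : 4 ≤ P) (hN : n ≤ P)
    (A : Matrix (Fin n) (Fin d) ℝ) :
    prob (fun u : Fin s → Fin 4 → ZMod (P + 1) => 12 * (s * hashVar P ^ 2 * k * partCost A f) <
      ∑ c, ∑ j, sketchCorr f u A j c ^ 2 / clusterCard f j) ≤ 1 / 12 := by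
  have hv := hashVar_pos hP
  have hs0 : (0 : ℝ) < s := by exact_mod_cast hs
  have hk0 : (0 : ℝ) < k := by exact_mod_cast hk
  rcases (partCost_nonneg f A).eq_or_lt with h0 | h0
  -- At cost 0 Markov's inequality has no positive threshold, but then all residuals vanish and the
  -- strict inequality never holds.
  · have hres : ∀ c, ∑ i, resid A f c i ^ 2 = 0 := fun c =>
      (Finset.sum_eq_zero_iff_of_nonneg fun c _ => Finset.sum_nonneg fun i _ => sq_nonneg _).1
        h0.symm c (Finset.mem_univ c)
    have : ∀ (u : Fin s → Fin 4 → ZMod (P + 1)) j c, sketchCorr f u A j c = 0 := by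
      intro u j c
      simp [sketchCorr, rowDot_zero (hres c)]
    simp [this, ← h0, prob, avg]
  · have hc : 0 < 12 * (s * hashVar P ^ 2 * k * partCost A f) := by positivity
    refine (prob_mono fun u hu => hu.le).trans ((prob_le_div (fun u => Finset.sum_nonneg fun c _ =>
      Finset.sum_nonneg fun j _ => div_nonneg (sq_nonneg _) (clusterCard_nonneg f j)) hc).trans ?_)
    rw [div_le_iff₀ hc]
    refine (avg_sketchCorr_le f s hP hN A).trans (le_of_eq ?_)
    ring

/-- The Cauchy–Schwarz inequality after weighting the two factors by the square root of the cluster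
size and by its inverse; empty clusters drop out because `G` vanishes there. -/
theorem weighted_cauchy {E G : Fin k → ℝ} (hG : ∀ j, clusterCard f j = 0 → G j = 0) :
    (∑ j, E j * G j) ^ 2 ≤ (∑ j, clusterCard f j * E j ^ 2) * ∑ j, G j ^ 2 / clusterCard f j := by
  have h := Finset.sum_mul_sq_le_sq_mul_sq Finset.univ
    (fun j => Real.sqrt (clusterCard f j) * E j) fun j => G j / Real.sqrt (clusterCard f j)
  simp only [mul_pow, div_pow, Real.sq_sqrt (clusterCard_nonneg f _)] at h
  refine le_trans (le_of_eq ?_) h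
  congr 1
  refine Finset.sum_congr rfl fun j _ => ?_
  by_cases h0 : clusterCard f j = 0
  · simp [h0, hG j h0]
  · have : Real.sqrt (clusterCard f j) ≠ 0 :=
      (Real.sqrt_pos.2 ((clusterCard_nonneg f j).lt_of_ne' h0)).ne'
    field_simp

/-- Least squares centers computed from a sketch are nearly optimal for a given partition. -/
theorem prob_not_centers_good_le {s q : ℕ} (hs : s = heightS k q) (hk : 1 ≤ k) (hq : 1 ≤ q)
    (hP : 4 ≤ P) (hN : n ≤ P) (A : Matrix (Fin n) (Fin d) ℝ) :
    prob (fun u : Fin s → Fin 4 → ZMod (P + 1) => ¬ ∀ C : Fin k → Fin d → ℝ,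
      NormalEquations f u A C →
        ∑ c, ∑ i, (C (f i) c - A i c) ^ 2 ≤ (1 + 1 / (16 * q : ℝ)) * partCost A f) ≤ 1 / 6 := by
  classical
  have hv := hashVar_pos hP
  have hkq : k ≤ k * q := Nat.le_mul_of_pos_right _ hq
  have hs3 : 3072 * k ≤ s := by rw [hs, heightS]; omega
  have hs0 : (0 : ℝ) < s := by exact_mod_cast (show 0 < s by omega)
  have hk0 : (0 : ℝ) < k := by exact_mod_cast hk
  have hq0 : (0 : ℝ) < q := by exact_mod_cast hq
  have hs' : (s : ℝ) = 3072 * (k * q) := by rw [hs, heightS]; push_cast; ring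
  -- Divided by the square roots of their sizes, the indicators of the nonempty clusters are
  -- orthonormal, as the lower bound for projections requires.
  let ι := {j : Fin k // clusterCard f j ≠ 0}
  have hι : Fintype.card ι ≤ k := (Fintype.card_subtype_le _).trans (by simp)
  have hsq : ∀ j : ι, 0 < Real.sqrt (clusterCard f j) := fun j =>
    Real.sqrt_pos.2 ((clusterCard_nonneg f j).lt_of_ne' j.2)
  let x : ι → Fin n → ℝ := fun j i => clusterInd f j i / Real.sqrt (clusterCard f j)
  have hx : ∀ a b, ∑ i, x a i * x b i = if a = b then 1 else 0 := by
    intro a b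
    split_ifs with hab
    · subst hab
      have : ∀ i, x a i * x a i = clusterInd f a i / clusterCard f a := by
        intro i
        rw [← sq, div_pow, clusterInd_sq, Real.sq_sqrt (clusterCard_nonneg f a)]
      simp only [this, ← Finset.sum_div]
      exact div_self a.2
    · refine Finset.sum_eq_zero fun i _ => ?_
      have : clusterInd f a i * clusterInd f b i = 0 := by
        simp only [clusterInd]
        split_ifs with h1 h2
        · exact absurd (Subtype.ext (h1.symm.trans h2)) hab
        all_goals simp
      simp only [x]
      rw [div_mul_div_comm, this, zero_div]
  refine (prob_mono fun u hu => ?_).trans ((prob_or_le _ _).trans (add_le_add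
    (prob_not_lower_bound_le (s := s) hP hN x hx hι hk hs3)
    (prob_sketchCorr_le f (s := s) (by omega) hk hP hN A))) |>.trans (by norm_num)
  by_contra! hcon
  obtain ⟨hlow, hcorr⟩ := hcon
  refine hu fun C hC => ?_
  rw [sum_sq_sub_eq]
  have hxdot : ∀ (a : Fin 4 → ZMod (P + 1)) (j : ι),
      rowDot a (x j) = rowDot a (clusterInd f j) / Real.sqrt (clusterCard f j) := by
    intro a j
    simp only [rowDot, x, Finset.sum_div]
    exact Finset.sum_congr rfl fun i _ => by ring
  set m := s * hashVar P with hm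
  have hm0 : 0 < m := by positivity
  -- For each column, with X the weighted squared deviation from the centroids and H the weighted
  -- squared correlations, (m/4) X ≤ ⟨E, G⟩ and ⟨E, G⟩² ≤ X H; dividing by X gives the claim.
  have hcol : ∀ c, m / 4 * (m / 4) * ∑ j, clusterCard f j * (C j c - centroid A f j c) ^ 2 ≤
      ∑ j, sketchCorr f u A j c ^ 2 / clusterCard f j := by
    intro c
    set E : Fin k → ℝ := fun j => C j c - centroid A f j c with hE
    set X := ∑ j, clusterCard f j * E j ^ 2 with hX
    have hX0 : 0 ≤ X := Finset.sum_nonneg fun j _ => mul_nonneg (clusterCard_nonneg f j) (sq_nonneg _)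
    -- The normal equations tested against the deviation `E` itself.
    have h1 : ∑ r, (∑ j, E j * rowDot (u r) (clusterInd f j)) ^ 2 =
        ∑ j, E j * sketchCorr f u A j c := by
      have h2 : ∑ j, E j * ∑ r, rowDot (u r) (clusterInd f j) * (rowDot (u r) (resid A f c) -
          ∑ a, E a * rowDot (u r) (clusterInd f a)) = 0 := by
        refine Finset.sum_eq_zero fun j _ => ?_
        have := hC j c
        simp only [rowDot_col] at this
        rw [this, mul_zero]
      have h3 : ∑ j, E j * ∑ r, rowDot (u r) (clusterInd f j) * (rowDot (u r) (resid A f c) -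
          ∑ a, E a * rowDot (u r) (clusterInd f a)) = ∑ j, E j * sketchCorr f u A j c -
          ∑ r, (∑ j, E j * rowDot (u r) (clusterInd f j)) ^ 2 := by
        simp only [sketchCorr, mul_sub, Finset.sum_sub_distrib]
        congr 1
        simp only [Finset.mul_sum (s := Finset.univ (α := Fin s))]
        rw [Finset.sum_comm]
        refine Finset.sum_congr rfl fun r _ => ?_
        rw [sq, Finset.sum_mul]
        exact Finset.sum_congr rfl fun j _ => by ring
      linarith
    have h4 : m / 4 * X ≤ ∑ r, (∑ j, E j * rowDot (u r) (clusterInd f j)) ^ 2 := by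
      have h5 := hlow fun j : ι => Real.sqrt (clusterCard f j) * E j
      have h6 : ∀ g : Fin k → ℝ, (∀ j, clusterCard f j = 0 → g j = 0) →
          ∑ j : ι, g j = ∑ j, g j := by
        intro g hg
        rw [← Finset.sum_subtype (Finset.univ.filter fun j => clusterCard f j ≠ 0) (by simp) g,
          Finset.sum_filter_of_ne]
        intro j _ hj h0
        exact hj (hg j h0)
      have h7 : ∑ j : ι, (Real.sqrt (clusterCard f j) * E j) ^ 2 = X := by
        rw [hX, ← h6 (fun j => clusterCard f j * E j ^ 2) fun j h0 => by simp [h0]]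
        exact Finset.sum_congr rfl fun j _ => by
          rw [mul_pow, Real.sq_sqrt (clusterCard_nonneg f j)]
      have h8 : ∀ r, ∑ j : ι, Real.sqrt (clusterCard f j) * E j * rowDot (u r) (x j) =
          ∑ j, E j * rowDot (u r) (clusterInd f j) := by
        intro r
        rw [← h6 (fun j => E j * rowDot (u r) (clusterInd f j)) fun j h0 => by
          rw [rowDot_clusterInd_eq_zero f h0, mul_zero]]
        refine Finset.sum_congr rfl fun j _ => ?_
        have := (hsq j).ne'
        rw [hxdot]
        field_simp
      rw [h7] at h5
      simpa only [h8] using h5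
    rw [h1] at h4
    have h9 := weighted_cauchy f (E := E) (G := fun j => sketchCorr f u A j c) fun j h0 => by
      simp [sketchCorr, rowDot_clusterInd_eq_zero f h0]
    set H := ∑ j, sketchCorr f u A j c ^ 2 / clusterCard f j
    rw [← hX] at h9
    rcases hX0.eq_or_lt with h0 | h0
    · rw [← h0, mul_zero]
      exact Finset.sum_nonneg fun j _ => div_nonneg (sq_nonneg _) (clusterCard_nonneg f j)
    · have h10 : (m / 4 * X) ^ 2 ≤ X * H :=
        (pow_le_pow_left₀ (by positivity) h4 2).trans h9
      have h11 : X * (m / 4 * (m / 4) * X) ≤ X * H := by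
        refine le_trans (le_of_eq ?_) h10
        ring
      exact le_of_mul_le_mul_left h11 h0
  have htot : m / 4 * (m / 4) * ∑ c, ∑ j, clusterCard f j * (C j c - centroid A f j c) ^ 2 ≤
      12 * (s * hashVar P ^ 2 * k * partCost A f) := by
    rw [Finset.mul_sum]
    exact (Finset.sum_le_sum fun c _ => hcol c).trans hcorr
  set Y := ∑ c, ∑ j, clusterCard f j * (C j c - centroid A f j c) ^ 2
  have hfin : Y ≤ 1 / (16 * q) * partCost A f := by
    -- This fixes the height of S: with s = 3072kq rows, 16 · 12 · k/s = 1/(16q).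
    have h1 : m / 4 * (m / 4) * (1 / (16 * q) * partCost A f) =
        12 * (s * hashVar P ^ 2 * k * partCost A f) := by
      rw [hm, hs']
      field_simp
      ring
    rw [← h1] at htot
    exact le_of_mul_le_mul_left htot (by positivity)
  linarith

end rows

end partition

/-! ## Sampled centroids and the exhaustive search -/

theorem argminAux_lt (e : ℕ → ℝ) {k : ℕ} (hk : 1 ≤ k) : argminAux e k < k := by
  induction k with
  | zero => omega
  | succ k ih =>
    rw [argminAux]
    split_ifs
    · omega
    · rcases Nat.eq_zero_or_pos k with rfl | h
      · simp [argminAux]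
      · exact (ih h).trans (by omega)

theorem argminAux_le (e : ℕ → ℝ) {k j : ℕ} (hj : j < k) : e (argminAux e k) ≤ e j := by
  induction k with
  | zero => omega
  | succ k ih =>
    rw [argminAux]
    split_ifs with h
    · rcases Nat.lt_succ_iff_lt_or_eq.1 hj with h1 | rfl
      · exact h.le.trans (ih h1)
      · exact le_rfl
    · push Not at h
      rcases Nat.lt_succ_iff_lt_or_eq.1 hj with h1 | rfl
      · exact ih h1
      · exact h

theorem exists_digits {n : ℕ} (hn : 1 ≤ n) (K : ℕ) : ∀ g : ℕ → ℕ, (∀ x, g x < n) →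
    ∃ v < n ^ K, ∀ x < K, digit n v x = g x := by
  induction K with
  | zero => exact fun g _ => ⟨0, by simp, by omega⟩
  | succ K ih =>
    intro g hg
    obtain ⟨v, hv, hv'⟩ := ih (fun x => g (x + 1)) fun x => hg _
    refine ⟨g 0 + n * v, ?_, fun x hx => ?_⟩
    · have h1 := hg 0
      have h2 : n * (v + 1) ≤ n * n ^ K := Nat.mul_le_mul_left n hv
      rw [pow_succ']
      rw [mul_add] at h2
      omega
    · cases x with
      | zero => simp [digit, Nat.mod_eq_of_lt (hg 0)]
      | succ x =>
        rw [← hv' x (by omega), digit, digit, pow_succ', ← Nat.div_div_eq_div_mul,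
          Nat.add_mul_div_left _ _ (by omega), Nat.div_eq_of_lt (hg 0), zero_add]

section kmeans
variable {n d k : ℕ}

/-- Some sample of points of a cluster has a mean close to the centroid. -/
theorem exists_sample (A : Matrix (Fin n) (Fin d) ℝ) (f : Fin n → Fin k) {j : Fin k}
    (hj : 0 < clusterCard f j) (M : ℕ) : ∃ p : ℕ → Fin n, (∀ u, f (p u) = j) ∧
      clusterCard f j * ∑ c, (∑ u ∈ Finset.range M, resid A f c (p u)) ^ 2 ≤
        M * ∑ i, clusterInd f j i * ∑ c, resid A f c i ^ 2 := by
  obtain ⟨i₀, hi₀⟩ : ∃ i, f i = j := by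
    by_contra! h
    simp [clusterCard, clusterInd, h] at hj
  induction M with
  | zero => exact ⟨fun _ => i₀, fun _ => hi₀, by simp⟩
  | succ M ih =>
    obtain ⟨p, hp, hp'⟩ := ih
    set S : Fin d → ℝ := fun c => ∑ u ∈ Finset.range M, resid A f c (p u) with hS
    set V := ∑ i, clusterInd f j i * ∑ c, resid A f c i ^ 2 with hV
    -- Averaged over the cluster, the cross term vanishes because the residuals sum to 0. Hence some
    -- point of the cluster keeps the squared norm of the partial sum at or below its average: a
    -- derandomized sampling step.
    have hmean : ∑ i, clusterInd f j i * ∑ c, (S c + resid A f c i) ^ 2 =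
        clusterCard f j * ∑ c, S c ^ 2 + V := by
      have h1 : ∀ i, clusterInd f j i * ∑ c, (S c + resid A f c i) ^ 2 =
          clusterInd f j i * (∑ c, S c ^ 2) + clusterInd f j i * (∑ c, resid A f c i ^ 2) +
          ∑ c, 2 * S c * (clusterInd f j i * resid A f c i) := by
        intro i
        rw [← mul_add, ← Finset.sum_add_distrib, Finset.mul_sum, Finset.mul_sum,
          ← Finset.sum_add_distrib]
        exact Finset.sum_congr rfl fun c _ => by ring
      simp only [h1, Finset.sum_add_distrib, ← Finset.sum_mul]
      rw [Finset.sum_comm (f := fun i c => 2 * S c * (clusterInd f j i * resid A f c i))]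
      simp only [← Finset.mul_sum, sum_clusterInd_mul_resid]
      simp [clusterCard, hV]
    obtain ⟨i, hi, hi'⟩ : ∃ i, f i = j ∧ clusterCard f j * ∑ c, (S c + resid A f c i) ^ 2 ≤
        clusterCard f j * ∑ c, S c ^ 2 + V := by
      by_contra! hcon
      have h2 : ∑ i, clusterInd f j i * (clusterCard f j * ∑ c, S c ^ 2 + V) <
          ∑ i, clusterInd f j i * (clusterCard f j * ∑ c, (S c + resid A f c i) ^ 2) := by
        refine Finset.sum_lt_sum (fun i _ => ?_) ⟨i₀, Finset.mem_univ _, ?_⟩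
        · by_cases h : f i = j
          · exact mul_le_mul_of_nonneg_left (hcon i h).le (clusterInd_nonneg f j i)
          · simp [clusterInd, h]
        · simpa [clusterInd, hi₀] using hcon i₀ hi₀
      have h3 : ∀ i, clusterInd f j i * (clusterCard f j * ∑ c, (S c + resid A f c i) ^ 2) =
          clusterCard f j * (clusterInd f j i * ∑ c, (S c + resid A f c i) ^ 2) := fun i => by ring
      simp only [h3, ← Finset.mul_sum, ← Finset.sum_mul, hmean] at h2
      exact lt_irrefl _ h2
    refine ⟨Function.update p M i, fun u => ?_, ?_⟩
    · by_cases hu : u = M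
      · subst hu; simpa using hi
      · simpa [hu] using hp u
    · have h4 : ∀ c, ∑ u ∈ Finset.range (M + 1), resid A f c (Function.update p M i u) =
          S c + resid A f c i := by
        intro c
        rw [Finset.sum_range_succ, Function.update_self]
        congr 1
        exact Finset.sum_congr rfl fun u hu => by
          rw [Function.update_of_ne (Finset.mem_range.1 hu).ne]
      simp only [h4]
      push_cast
      linarith

/-- The mean of a sample. -/
noncomputable def sampleMean (A : Matrix (Fin n) (Fin d) ℝ) (M : ℕ) (p : ℕ → Fin n) (c : Fin d) : ℝ :=
  (∑ u ∈ Finset.range M, A (p u) c) / M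

/-- The mean of the M chosen residuals has squared length at most 1/M times the average over the
cluster, and by `sum_sq_sub_eq` the weighted sum of these lengths is the excess cost. For an empty
cluster any sample will do. -/
theorem exists_sample_means (A : Matrix (Fin n) (Fin d) ℝ) (f : Fin n → Fin k) {M : ℕ} (hM : 1 ≤ M)
    (hn : 1 ≤ n) : ∃ p : Fin k → ℕ → Fin n,
      ∑ c, ∑ i, (sampleMean A M (p (f i)) c - A i c) ^ 2 ≤ (1 + 1 / (M : ℝ)) * partCost A f := by
  have hM0 : (0 : ℝ) < M := by exact_mod_cast hM
  have h : ∀ j, ∃ p : ℕ → Fin n, clusterCard f j * ∑ c, (sampleMean A M p c - centroid A f j c) ^ 2 ≤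
      1 / M * ∑ i, clusterInd f j i * ∑ c, resid A f c i ^ 2 := by
    intro j
    rcases (clusterCard_nonneg f j).eq_or_lt with h0 | h0
    · refine ⟨fun _ => ⟨0, hn⟩, ?_⟩
      rw [← h0, zero_mul]
      exact mul_nonneg (by positivity) (Finset.sum_nonneg fun i _ =>
        mul_nonneg (clusterInd_nonneg f j i) (Finset.sum_nonneg fun c _ => sq_nonneg _))
    · obtain ⟨p, hp, hp'⟩ := exists_sample A f h0 M
      refine ⟨p, ?_⟩
      have h1 : ∀ c, sampleMean A M p c - centroid A f j c =
          (∑ u ∈ Finset.range M, resid A f c (p u)) / M := by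
        intro c
        simp only [resid, hp, Finset.sum_sub_distrib, Finset.sum_const, Finset.card_range,
          nsmul_eq_mul]
        rw [sampleMean]
        field_simp
      simp only [h1, div_pow, ← Finset.sum_div]
      rw [← mul_div_assoc, div_le_iff₀ (by positivity)]
      refine hp'.trans (le_of_eq ?_)
      field_simp
  choose p hp using h
  refine ⟨p, ?_⟩
  rw [sum_sq_sub_eq f A (fun j c => sampleMean A M (p j) c)]
  have h2 : ∑ c, ∑ j, clusterCard f j * (sampleMean A M (p j) c - centroid A f j c) ^ 2 ≤
      1 / M * partCost A f := by
    rw [Finset.sum_comm]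
    simp only [← Finset.mul_sum]
    refine (Finset.sum_le_sum fun j _ => hp j).trans (le_of_eq ?_)
    rw [← Finset.mul_sum]
    congr 1
    have h3 := sum_fiberwise_mul f (fun _ => 1) fun i => ∑ c, resid A f c i ^ 2
    simp only [one_mul] at h3
    rw [← h3, partCost, Finset.sum_comm]
  linarith

theorem partCost_le (A : Matrix (Fin n) (Fin d) ℝ) (f : Fin n → Fin k) (C : Fin k → Fin d → ℝ) :
    partCost A f ≤ ∑ c, ∑ i, (C (f i) c - A i c) ^ 2 := by
  rw [sum_sq_sub_eq]
  have : 0 ≤ ∑ c, ∑ j, clusterCard f j * (C j c - centroid A f j c) ^ 2 :=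
    Finset.sum_nonneg fun c _ => Finset.sum_nonneg fun j _ =>
      mul_nonneg (clusterCard_nonneg f j) (sq_nonneg _)
  linarith

/-- The cost of a partition in terms of the pairwise distances. -/
theorem sum_pairs_eq (A : Matrix (Fin n) (Fin d) ℝ) (f : Fin n → Fin k) :
    ∑ i, ∑ i', clusterInd f (f i) i' * (∑ c, (A i c - A i' c) ^ 2) / clusterCard f (f i) =
      2 * partCost A f := by
  have h1 : ∀ i, ∑ i', clusterInd f (f i) i' * (∑ c, (A i c - A i' c) ^ 2) / clusterCard f (f i) =
      ∑ c, (resid A f c i ^ 2 + (∑ i', clusterInd f (f i) i' * resid A f c i' ^ 2) /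
        clusterCard f (f i)) := by
    intro i
    have hc := (clusterCard_pos f i).ne'
    simp only [mul_div_assoc, Finset.sum_div, Finset.mul_sum]
    rw [Finset.sum_comm]
    refine Finset.sum_congr rfl fun c _ => ?_
    -- Within a cluster both residuals refer to the same centroid, so the difference of two points
    -- is the difference of their residuals.
    have h2 : ∀ i', clusterInd f (f i) i' * ((A i c - A i' c) ^ 2 / clusterCard f (f i)) =
        clusterInd f (f i) i' * (resid A f c i ^ 2 / clusterCard f (f i)) +
        clusterInd f (f i) i' * (resid A f c i' ^ 2 / clusterCard f (f i)) -
        2 * resid A f c i / clusterCard f (f i) * (clusterInd f (f i) i' * resid A f c i') := by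
      intro i'
      by_cases h : f i' = f i
      · simp only [resid, h]
        field_simp
        ring
      · simp [clusterInd, h]
    simp only [h2, Finset.sum_sub_distrib, Finset.sum_add_distrib, ← Finset.mul_sum,
      sum_clusterInd_mul_resid, ← Finset.sum_mul]
    change clusterCard f (f i) * _ + _ - _ = _
    rw [mul_zero, sub_zero, mul_div_cancel₀ _ hc]
  simp only [h1]
  rw [Finset.sum_comm, partCost, Finset.mul_sum]
  refine Finset.sum_congr rfl fun c _ => ?_
  rw [Finset.sum_add_distrib, sum_fiberwise f (fun j =>
    (∑ i', clusterInd f j i' * resid A f c i' ^ 2) / clusterCard f j)]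
  have h3 : ∀ j, clusterCard f j * ((∑ i', clusterInd f j i' * resid A f c i' ^ 2) /
      clusterCard f j) = 1 * ∑ i', clusterInd f j i' * resid A f c i' ^ 2 := by
    intro j
    by_cases h0 : clusterCard f j = 0
    · simp [h0, clusterInd_eq_zero f h0]
    · rw [mul_div_cancel₀ _ h0, one_mul]
  simp only [h3]
  rw [← sum_fiberwise_mul f (fun _ => 1)]
  simp only [one_mul]
  ring

theorem estScale_pos {P q : ℕ} (hq : 1 ≤ q) (hP : 4 ≤ P) : 0 < estScale P q := by
  have := hashVar_pos hP
  have hb : 0 < groupSize q := Nat.mul_pos (by norm_num) (Nat.mul_pos hq hq)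
  have hb' : (0 : ℝ) < groupSize q := by exact_mod_cast hb
  exact mul_pos hb' this

/-! ### The guarantee for the exhaustive search. -/

section search
variable {P : ℕ} [Fact (P + 1).Prime]

theorem rowDot_sub {N : ℕ} (a : Fin 4 → ZMod (P + 1)) (x y : Fin N → ℝ) :
    rowDot a (fun c => x c - y c) = rowDot a x - rowDot a y := by
  simp only [rowDot, sub_mul, Finset.sum_sub_distrib]

theorem rowDot_sampleMean (A : Matrix (Fin n) (Fin d) ℝ) (M : ℕ) (p : ℕ → Fin n)
    (a : Fin 4 → ZMod (P + 1)) :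
    rowDot a (sampleMean A M p) = (∑ u ∈ Finset.range M, rowDot a (A (p u))) / M := by
  simp only [rowDot, sampleMean, div_mul_eq_mul_div, Finset.sum_mul, ← Finset.sum_div]
  rw [Finset.sum_comm]

/-- The clustering `candidate` as a function into `Fin k`. -/
noncomputable def candidateFin (q l : ℕ) (fA : ℕ → ℕ → ℝ) (hk : 1 ≤ k) (v : ℕ) (i : Fin n) : Fin k :=
  ⟨candidate q l fA n k v i, argminAux_lt _ hk⟩

variable {q l : ℕ} {U : ℕ → Fin 4 → ZMod (P + 1)} {fA : ℕ → ℕ → ℝ} {A : Matrix (Fin n) (Fin d) ℝ}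

/-- If all pairwise estimates are good, the estimated cost of a partition is good. -/
theorem costEst_bounds (hA : ∀ i : Fin n, ∀ c < widthT q l, fA i c = rowDot (U c) (A i))
    (hpair : ∀ i i', EstGood P q l U (fun c => A i c - A i' c)) (f : ℕ → ℕ) (g : Fin n → Fin k)
    (hfg : ∀ i : Fin n, f i = g i) :
    (1 - 1 / (16 * q : ℝ)) * (estScale P q * (2 * partCost A g)) ≤ costEst q l fA n f ∧
      costEst q l fA n f ≤ (1 + 1 / (16 * q : ℝ)) * (estScale P q * (2 * partCost A g)) := by
  have hind : ∀ i i' : Fin n, (if f i = f i' then (1 : ℝ) else 0) = clusterInd g (g i) i' := by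
    intro i i'
    rw [hfg, hfg, clusterInd]
    exact if_congr (by rw [Fin.val_inj, eq_comm]) rfl rfl
  have hsize : ∀ i : Fin n, clusterSize n f i = clusterCard g (g i) := by
    intro i
    rw [clusterSize, Finset.sum_range, clusterCard]
    exact Finset.sum_congr rfl fun i' _ => hind i i'
  have hcost : costEst q l fA n f = ∑ i : Fin n, ∑ i' : Fin n,
      clusterInd g (g i) i' * pairEst q l fA i i' / clusterCard g (g i) := by
    rw [costEst, Finset.sum_range]
    refine Finset.sum_congr rfl fun i _ => ?_
    rw [Finset.sum_range]
    exact Finset.sum_congr rfl fun i' _ => by rw [costTerm, hsize, hind]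
  have hest : ∀ i i' : Fin n, pairEst q l fA i i' =
      sqNormEst (numGroups l) (groupSize q) fun c => rowDot (U c) fun c => A i c - A i' c := by
    intro i i'
    refine sqNormEst_congr fun c hc => ?_
    rw [hA i c hc, hA i' c hc, rowDot_sub]
  rw [hcost, ← sum_pairs_eq, Finset.mul_sum, Finset.mul_sum, Finset.mul_sum]
  constructor <;> refine Finset.sum_le_sum fun i _ => ?_ <;>
    rw [Finset.mul_sum, Finset.mul_sum] <;> refine Finset.sum_le_sum fun i' _ => ?_ <;>
    rw [← mul_div_assoc, ← mul_div_assoc]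
  · refine div_le_div_of_nonneg_right ?_ (clusterCard_nonneg _ _)
    have := mul_le_mul_of_nonneg_left (hpair i i').1 (clusterInd_nonneg g (g i) i')
    rw [hest]
    linarith
  · refine div_le_div_of_nonneg_right ?_ (clusterCard_nonneg _ _)
    have := mul_le_mul_of_nonneg_left (hpair i i').2 (clusterInd_nonneg g (g i) i')
    rw [hest]
    linarith

/-- The vectors whose norms have to be estimated. -/
noncomputable def estVector (A : Matrix (Fin n) (Fin d) ℝ) (M : ℕ) (p : Fin k → ℕ → Fin n) :
    (Fin n × Fin n) ⊕ (Fin n × Fin k) → Fin d → ℝ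
  | .inl x => fun c => A x.1 c - A x.2 c
  | .inr x => fun c => A x.1 c - sampleMean A M (p x.2) c

/-- The assignment minimizes the estimated distance point by point, so against any other assignment
`f` to the same means it loses only the two estimation factors; passing from the means to the
centroids can only help. -/
theorem partCost_candidate_le (hA : ∀ i : Fin n, ∀ c < widthT q l, fA i c = rowDot (U c) (A i))
    (hq : 1 ≤ q) (hP : 4 ≤ P) (hk : 1 ≤ k) (p : Fin k → ℕ → Fin n)
    (hp : ∀ i j, EstGood P q l U (fun c => A i c - sampleMean A (numSamples q) (p j) c)) {v : ℕ}
    (hv : ∀ j : Fin k, ∀ u < numSamples q, digit n v (j * numSamples q + u) = p j u)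
    (f : Fin n → Fin k) :
    (1 - 1 / (16 * q : ℝ)) * partCost A (candidateFin q l fA hk v) ≤ (1 + 1 / (16 * q : ℝ)) *
      ∑ c, ∑ i, (sampleMean A (numSamples q) (p (f i)) c - A i c) ^ 2 := by
  have hs := estScale_pos hq hP
  have hq0 : (1 : ℝ) ≤ q := by exact_mod_cast hq
  have hest : ∀ (i : Fin n) (j : Fin k), centroidEst q l fA n v i j =
      sqNormEst (numGroups l) (groupSize q) fun c => rowDot (U c)
        fun c => A i c - sampleMean A (numSamples q) (p j) c := by
    intro i j
    refine sqNormEst_congr fun c hc => ?_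
    rw [rowDot_sub, rowDot_sampleMean, centroidDiff, hA i c hc]
    congr 2
    exact Finset.sum_congr rfl fun u hu => by rw [hv j u (Finset.mem_range.1 hu), hA _ c hc]
  set g := candidateFin q l fA hk v (n := n) with hg
  have hδ : 0 ≤ 1 - 1 / (16 * q : ℝ) := by
    rw [sub_nonneg, div_le_one (by positivity)]
    linarith
  refine (mul_le_mul_of_nonneg_left
    (partCost_le A g fun j => sampleMean A (numSamples q) (p j)) hδ).trans ?_
  rw [Finset.sum_comm, Finset.sum_comm (f := fun c i =>
    (sampleMean A (numSamples q) (p (f i)) c - A i c) ^ 2), Finset.mul_sum, Finset.mul_sum]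
  refine Finset.sum_le_sum fun i _ => ?_
  have h1 : centroidEst q l fA n v i (g i) ≤ centroidEst q l fA n v i (f i) :=
    argminAux_le _ (f i).2
  rw [hest, hest] at h1
  have h2 := (hp i (g i)).1.trans (h1.trans (hp i (f i)).2)
  have h3 : ∀ j, ∑ c, (A i c - sampleMean A (numSamples q) (p j) c) ^ 2 =
      ∑ c, (sampleMean A (numSamples q) (p j) c - A i c) ^ 2 := fun j =>
    Finset.sum_congr rfl fun c _ => by ring
  rw [h3, h3] at h2
  rw [← mul_le_mul_iff_right₀ hs]
  linarith

theorem exists_optimal_partition (A : Matrix (Fin n) (Fin d) ℝ) (hk : 1 ≤ k) :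
    ∃ f : Fin n → Fin k, ∀ g : Fin n → Fin k, partCost A f ≤ partCost A g := by
  have : Nonempty (Fin k) := ⟨⟨0, hk⟩⟩
  exact Finite.exists_min fun g : Fin n → Fin k => partCost A g

theorem searchResult_lt (q l : ℕ) (fA : ℕ → ℕ → ℝ) (n : ℕ) (hk : 1 ≤ k) (i : ℕ) :
    searchResult q l fA n k i < k := argminAux_lt _ hk

/-- The result of the search as a function into `Fin k`. -/
noncomputable def searchFin (q l : ℕ) (fA : ℕ → ℕ → ℝ) (hk : 1 ≤ k) (i : Fin n) : Fin k :=
  ⟨searchResult q l fA n k i, searchResult_lt q l fA n hk i⟩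

/-- The order of quantifiers is essential: the samples `p` come from an optimal partition before the
coefficients `U` are known, so accuracy is required for one fixed finite family of vectors only. The
selection by estimated cost needs just the pairwise distances, for whatever partitions occur. One
factor 1 + δ comes from sampling; the two comparisons each lose (1 + δ)/(1 - δ). -/
theorem partCost_searchFin_le (A : Matrix (Fin n) (Fin d) ℝ) (hq : 1 ≤ q) (hP : 4 ≤ P) (hk : 1 ≤ k)
    (hn : 1 ≤ n) : ∃ p : Fin k → ℕ → Fin n, ∀ (U : ℕ → Fin 4 → ZMod (P + 1)) (fA : ℕ → ℕ → ℝ),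
      (∀ i : Fin n, ∀ c < widthT q l, fA i c = rowDot (U c) (A i)) →
      (∀ x, EstGood P q l U (estVector A (numSamples q) p x)) → ∀ g : Fin n → Fin k,
      (1 - 1 / (16 * q : ℝ)) ^ 2 * partCost A (searchFin (n := n) q l fA hk) ≤
        (1 + 1 / (16 * q : ℝ)) ^ 3 * partCost A g := by
  obtain ⟨f, hf⟩ := exists_optimal_partition A hk
  have hM : 1 ≤ numSamples q := by rw [numSamples]; omega
  obtain ⟨p, hp⟩ := exists_sample_means A f hM hn
  refine ⟨p, fun U fA hA hU g => ?_⟩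
  have hs := estScale_pos hq hP
  have hq0 : (1 : ℝ) ≤ q := by exact_mod_cast hq
  have hMq : (numSamples q : ℝ) = 16 * q := by simp [numSamples]
  -- The candidate that encodes the samples `p`: sample `u` of center `j` is the digit at position
  -- `j * numSamples q + u`. The default digit 0 lies outside the positions in use.
  obtain ⟨v, hv, hv'⟩ := exists_digits hn (k * numSamples q)
    (fun x => if h : x / numSamples q < k then p ⟨x / numSamples q, h⟩ (x % numSamples q) else 0)
    fun x => by
      split_ifs
      · exact Fin.is_lt _
      · exact hn
  have hdig : ∀ j : Fin k, ∀ u < numSamples q, digit n v (j * numSamples q + u) = p j u := by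
    intro j u hu
    have h1 : (j * numSamples q + u) / numSamples q = j := by
      rw [mul_comm, Nat.mul_add_div (by omega), Nat.div_eq_of_lt hu, add_zero]
    have h2 : (j * numSamples q + u) % numSamples q = u := by
      rw [mul_comm, Nat.mul_add_mod, Nat.mod_eq_of_lt hu]
    have h3 : j * numSamples q + u < k * numSamples q := by
      have := Nat.mul_le_mul_right (numSamples q) (show (j : ℕ) + 1 ≤ k from j.2)
      rw [add_mul, one_mul] at this
      omega
    rw [hv' _ h3]
    simp only [h1, h2, j.2, dif_pos, Fin.eta]
  have hpair : ∀ i i', EstGood P q l U (fun c => A i c - A i' c) := fun i i' => hU (.inl (i, i'))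
  have hcent : ∀ i j, EstGood P q l U (fun c => A i c - sampleMean A (numSamples q) (p j) c) :=
    fun i j => hU (.inr (i, j))
  have h1 := partCost_candidate_le hA hq hP hk p hcent hdig f
  rw [hMq] at hp
  set δ := 1 / (16 * q : ℝ) with hδ
  have hδ0 : 0 < δ := by positivity
  have hδ1 : δ ≤ 1 := by
    rw [hδ, div_le_one (by positivity)]
    linarith
  have h2 := (costEst_bounds hA hpair (searchResult q l fA n k) (searchFin q l fA hk) fun i => rfl).1
  have h3 := (costEst_bounds hA hpair (candidate q l fA n k v) (candidateFin q l fA hk v)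
    fun i => rfl).2
  have h4 : costEst q l fA n (searchResult q l fA n k) ≤ costEst q l fA n (candidate q l fA n k v) :=
    argminAux_le (candidateCost q l fA n k) hv
  have h5 := h2.trans (h4.trans h3)
  rw [← hδ] at h5
  have h6 : (1 - δ) * partCost A (searchFin (n := n) q l fA hk) ≤
      (1 + δ) * partCost A (candidateFin (n := n) q l fA hk v) := by
    rw [← mul_le_mul_iff_right₀ (show 0 < estScale P q * 2 by positivity)]
    linarith
  calc (1 - δ) ^ 2 * partCost A (searchFin (n := n) q l fA hk)
      = (1 - δ) * ((1 - δ) * partCost A (searchFin (n := n) q l fA hk)) := by ring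
    _ ≤ (1 - δ) * ((1 + δ) * partCost A (candidateFin (n := n) q l fA hk v)) :=
        mul_le_mul_of_nonneg_left h6 (by linarith)
    _ = (1 + δ) * ((1 - δ) * partCost A (candidateFin (n := n) q l fA hk v)) := by ring
    _ ≤ (1 + δ) * ((1 + δ) * ((1 + δ) * partCost A g)) := by
        refine mul_le_mul_of_nonneg_left (h1.trans (mul_le_mul_of_nonneg_left (hp.trans ?_)
          (by linarith))) (by linarith)
        exact mul_le_mul_of_nonneg_left (hf g) (by linarith)
    _ = (1 + δ) ^ 3 * partCost A g := by ring

end search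

/-! ## Approximate solutions -/

theorem kMeansCost_eq (A : Matrix (Fin n) (Fin d) ℝ) {X : Matrix (Fin n) (Fin k) ℝ}
    {f : Fin n → Fin k} (hX : ∀ i, X i = Pi.single (f i) 1) (C : Matrix (Fin k) (Fin d) ℝ) :
    kMeansCost A X C = ∑ c, ∑ i, (C (f i) c - A i c) ^ 2 := by
  rw [kMeansCost, Finset.sum_comm]
  refine Finset.sum_congr rfl fun c _ => Finset.sum_congr rfl fun i _ => ?_
  rw [Matrix.sub_apply, Matrix.mul_apply, hX i]
  congr 2
  rw [Finset.sum_eq_single_of_mem (f i) (Finset.mem_univ _)]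
  · simp
  · intro j _ hj
    simp [hj]

theorem isApproxKMeans_of_partCost {A : Matrix (Fin n) (Fin d) ℝ} {ε : ℝ}
    {X : Matrix (Fin n) (Fin k) ℝ} {C : Matrix (Fin k) (Fin d) ℝ} {f : Fin n → Fin k}
    (hX : ∀ i, X i = Pi.single (f i) 1) (hε : 0 ≤ 1 + ε)
    (h : ∀ g : Fin n → Fin k, ∑ c, ∑ i, (C (f i) c - A i c) ^ 2 ≤ (1 + ε) * partCost A g) :
    IsApproxKMeans A ε X C := by
  refine ⟨fun i => ⟨f i, hX i⟩, fun X' C' hX' => ?_⟩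
  choose g hg using hX'
  rw [kMeansCost_eq A hX, kMeansCost_eq A hg]
  exact (h g).trans (mul_le_mul_of_nonneg_left (partCost_le A g C') hε)

/-- With δ ≤ 1/16 the losses fit into 1 + 16δ, and 16δ = 1/q ≤ ε. This is where the constant 16 in
the accuracy 1/(16q) comes from. -/
theorem approx_factor {q : ℕ} {ε : ℝ} (hq : 1 ≤ q) (hε : 1 ≤ q * ε) :
    (1 + 1 / (16 * q : ℝ)) ^ 4 ≤ (1 + ε) * (1 - 1 / (16 * q : ℝ)) ^ 2 := by
  have hq0 : (1 : ℝ) ≤ q := by exact_mod_cast hq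
  set δ := 1 / (16 * q : ℝ) with hδ
  have hδ0 : 0 < δ := by positivity
  have hδ1 : δ ≤ 1 / 16 := by
    rw [hδ]
    exact one_div_le_one_div_of_le (by norm_num) (by linarith)
  have h1 : 16 * δ ≤ ε := by
    rw [hδ]
    field_simp
    linarith
  calc (1 + δ) ^ 4 ≤ (1 + 16 * δ) * (1 - δ) ^ 2 := by
        nlinarith [mul_pos hδ0 hδ0, mul_pos hδ0 (mul_pos hδ0 hδ0), mul_nonneg hδ0.le (sub_nonneg.2 hδ1),
          mul_nonneg (mul_pos hδ0 hδ0).le (sub_nonneg.2 hδ1),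
          mul_nonneg (mul_pos hδ0 (mul_pos hδ0 hδ0)).le (sub_nonneg.2 hδ1)]
    _ ≤ _ := mul_le_mul_of_nonneg_right (by linarith) (sq_nonneg _)

end kmeans

/-! ## Success probability of the sketch-and-solve algorithm -/

theorem prob_fst {Ω Ω' : Type*} [Fintype Ω] [Fintype Ω'] [Nonempty Ω'] (p : Ω → Prop) :
    prob (fun ω : Ω × Ω' => p ω.1) = prob p := by
  simp only [prob]
  rw [avg_prod]
  refine congrArg avg (funext fun u => ?_)
  by_cases h : p u <;> simp [h, avg_const]

open Classical in
theorem prob_comp_bijective {Ω Ω' : Type*} [Fintype Ω] [Fintype Ω'] {e : Ω → Ω'}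
    (he : Function.Bijective e) (p : Ω' → Prop) : prob (fun ω => p (e ω)) = prob p :=
  avg_comp_bijective he fun ω => if p ω then (1 : ℝ) else 0

section success
variable {n d k q l P : ℕ} [Fact (P + 1).Prime] {ε : ℝ}

/-- The random coefficients of `T`, by groups of columns. -/
abbrev CoeffT (P q l : ℕ) : Type := Fin (numGroups l) → Fin (groupSize q) → Fin 4 → ZMod (P + 1)

/-- The random coefficients of `S`. -/
abbrev CoeffS (P k q : ℕ) : Type := Fin (heightS k q) → Fin 4 → ZMod (P + 1)

/-- Every least squares solution for the clusters found by the search is a good clustering. -/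
def Success (A : Matrix (Fin n) (Fin d) ℝ) (ε : ℝ) (hk : 1 ≤ k) (q l : ℕ) (fA : ℕ → ℕ → ℝ)
    (u : CoeffS P k q) : Prop :=
  ∀ C : Fin k → Fin d → ℝ, NormalEquations (searchFin (n := n) q l fA hk) u A C →
    ∀ g : Fin n → Fin k, ∑ c, ∑ i, (C (searchFin q l fA hk i) c - A i c) ^ 2 ≤ (1 + ε) * partCost A g

theorem card_estVector_le (hk : 1 ≤ k) :
    Fintype.card ((Fin n × Fin n) ⊕ (Fin n × Fin k)) ≤ 2 * (n * k) ^ 2 := by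
  simp only [Fintype.card_sum, Fintype.card_prod, Fintype.card_fin]
  have h1 : n * n ≤ (n * k) ^ 2 := by
    rw [sq]
    exact Nat.mul_le_mul (Nat.le_mul_of_pos_right _ hk) (Nat.le_mul_of_pos_right _ hk)
  have h2 : n * k ≤ (n * k) ^ 2 := Nat.le_self_pow two_ne_zero _
  omega

/-- The degenerate case of one point and one center, in which the logarithm is 0 and the sketch has
no columns. -/
theorem estVector_eq_zero (A : Matrix (Fin n) (Fin d) ℝ) {M : ℕ} (hM : 1 ≤ M)
    (p : Fin k → ℕ → Fin n) (hnk : n * k = 1) (x : (Fin n × Fin n) ⊕ (Fin n × Fin k)) :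
    ∑ c, estVector A M p x c ^ 2 = 0 := by
  obtain rfl := Nat.eq_one_of_mul_eq_one_right hnk
  obtain rfl := Nat.eq_one_of_mul_eq_one_left hnk
  have hM0 : (M : ℝ) ≠ 0 := by exact_mod_cast (show M ≠ 0 by omega)
  refine Finset.sum_eq_zero fun c _ => ?_
  rcases x with x | x
  · simp [estVector, Subsingleton.elim x.1 x.2]
  · simp [estVector, sampleMean, Subsingleton.elim (p x.2 _) x.1, hM0]

/-- Two failure events of probability at most 1/6 each: an inaccurate estimate, which depends on T
only, and bad centers for the partition that was found. -/
theorem two_thirds_le_prob_success (A : Matrix (Fin n) (Fin d) ℝ) (hn : 1 ≤ n) (hk : 1 ≤ k)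
    (hq : 1 ≤ q) (hl : l = Nat.clog 2 (n * k)) (hP : 4 ≤ P) (hnP : n ≤ P) (hdP : d ≤ P)
    (hε : 1 ≤ q * ε) (F : CoeffT P q l → ℕ → ℕ → ℝ)
    (hF : ∀ u, ∀ i : Fin n, ∀ c < widthT q l, F u i c = rowDot (flatRows u c) (A i)) :
    2 / 3 ≤ prob fun ω : CoeffT P q l × CoeffS P k q => Success A ε hk q l (F ω.1) ω.2 := by
  obtain ⟨p, hp⟩ := partCost_searchFin_le (q := q) (l := l) (P := P) A hq hP hk hn
  have hq0 : (1 : ℝ) ≤ q := by exact_mod_cast hq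
  have hM : 1 ≤ numSamples q := by rw [numSamples]; omega
  have h1 : prob (fun ω : CoeffT P q l × CoeffS P k q =>
      ¬ ∀ x ∈ Finset.univ, EstGood P q l (flatRows ω.1) (estVector A (numSamples q) p x)) ≤ 1 / 6 := by
    refine le_trans (le_of_eq ?_) (prob_not_forall_estGood_le Finset.univ
      (estVector A (numSamples q) p) hl (card_estVector_le hk)
      (fun h x _ => estVector_eq_zero A hM p h x) (Nat.mul_pos hn hk) hq hP hdP)
    exact prob_fst fun u : CoeffT P q l =>
      ¬ ∀ x ∈ Finset.univ, EstGood P q l (flatRows u) (estVector A (numSamples q) p x)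
  have h2 : prob (fun ω : CoeffT P q l × CoeffS P k q => ¬ ∀ C : Fin k → Fin d → ℝ,
      NormalEquations (searchFin (n := n) q l (F ω.1) hk) ω.2 A C →
        ∑ c, ∑ i, (C (searchFin q l (F ω.1) hk i) c - A i c) ^ 2 ≤
          (1 + 1 / (16 * q : ℝ)) * partCost A (searchFin (n := n) q l (F ω.1) hk)) ≤ 1 / 6 := by
    -- The coefficients of T are fixed first. The partition is then fixed as well, and the bound for
    -- a given partition applies to the independent coefficients of S.
    rw [prob, avg_prod]
    rw [← avg_const (Ω := CoeffT P q l) (1 / 6 : ℝ)]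
    refine avg_mono fun u => ?_
    exact prob_not_centers_good_le (searchFin (n := n) q l (F u) hk) rfl hk hq hP hnP A
  have h3 : prob (fun ω : CoeffT P q l × CoeffS P k q => ¬ Success A ε hk q l (F ω.1) ω.2) ≤ 1 / 3 := by
    refine (prob_mono fun ω hω => ?_).trans ((prob_or_le _ _).trans (add_le_add h1 h2)) |>.trans
      (by norm_num)
    by_contra! hcon
    refine hω fun C hC g => ?_
    have h4 := hcon.2 C hC
    have h5 := hp (flatRows ω.1) (F ω.1) (hF ω.1) (fun x => hcon.1 x (Finset.mem_univ x)) g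
    have h6 := approx_factor hq hε
    set δ := 1 / (16 * q : ℝ) with hδ
    have hδ0 : 0 < δ := by positivity
    have hδ1 : δ ≤ 1 / 16 := by
      rw [hδ]
      exact one_div_le_one_div_of_le (by norm_num) (by linarith)
    have h7 : 0 < (1 - δ) ^ 2 := pow_pos (by linarith) 2
    rw [← mul_le_mul_iff_right₀ h7]
    calc (1 - δ) ^ 2 * ∑ c, ∑ i, (C (searchFin q l (F ω.1) hk i) c - A i c) ^ 2
        ≤ (1 - δ) ^ 2 * ((1 + δ) * partCost A (searchFin (n := n) q l (F ω.1) hk)) :=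
          mul_le_mul_of_nonneg_left h4 h7.le
      _ = (1 + δ) * ((1 - δ) ^ 2 * partCost A (searchFin (n := n) q l (F ω.1) hk)) := by ring
      _ ≤ (1 + δ) * ((1 + δ) ^ 3 * partCost A g) := mul_le_mul_of_nonneg_left h5 (by linarith)
      _ = (1 + δ) ^ 4 * partCost A g := by ring
      _ ≤ (1 + ε) * (1 - δ) ^ 2 * partCost A g :=
          mul_le_mul_of_nonneg_right h6 (partCost_nonneg g A)
      _ = (1 - δ) ^ 2 * ((1 + ε) * partCost A g) := by ring
  rw [prob_not] at h3
  linarith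

theorem Success.isApproxKMeans {A : Matrix (Fin n) (Fin d) ℝ} {hk : 1 ≤ k} {fA fS fSA : ℕ → ℕ → ℝ}
    {u : CoeffS P k q} (h : Success A ε hk q l fA u) (hε : 0 ≤ 1 + ε)
    (hS : ∀ (r : Fin (heightS k q)) (i : Fin n), fS r i = hashEntry (u r) i)
    (hSA : ∀ (r : Fin (heightS k q)) (c : Fin d), fSA r c = rowDot (u r) fun i => A i c) {σ : State}
    (h0 : ∀ i < n, σ.word 0 i = searchResult q l fA n k i)
    (hc : ∀ j < k, ∀ c < d, dotRange (heightS k q) (sketchedCluster n fS (searchResult q l fA n k) j)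
      (fun r => fSA r c - ∑ a ∈ Finset.range k, sketchedCluster n fS (searchResult q l fA n k) a r *
        σ.real 0 (a * d + c)) = 0) :
    IsApproxKMeans A ε (outAssignment n k σ) (outCenters k d σ) := by
  refine isApproxKMeans_of_partCost (f := searchFin q l fA hk) (fun i => ?_) hε
    (h (fun j c => σ.real 0 (j * d + c)) fun j c => ?_)
  · funext j
    have : (j : ℕ) = searchResult q l fA n k i ↔ j = searchFin q l fA hk i := by
      rw [Fin.ext_iff]
      rfl
    simp only [outAssignment, Matrix.of_apply, h0 i i.2, Pi.single_apply, ← this, eq_comm]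
  · have hcl : ∀ (r : Fin (heightS k q)) (j : Fin k),
        sketchedCluster n fS (searchResult q l fA n k) j r =
          rowDot (u r) (clusterInd (searchFin (n := n) q l fA hk) j) := by
      intro r j
      rw [sketchedCluster, Finset.sum_range, rowDot]
      refine Finset.sum_congr rfl fun i _ => ?_
      rw [hS, clusterInd, mul_comm]
      congr 1
      exact if_congr (by rw [Fin.ext_iff]; rfl) rfl rfl
    have h1 := hc j j.2 c c.2
    rw [dotRange, Finset.sum_range] at h1
    rw [← h1]
    refine Finset.sum_congr rfl fun r _ => ?_
    rw [hcl, hSA, Finset.sum_range]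
    simp only [hcl]

end success

/-! ## Random matrices with finitely many values -/

section unif
variable {Ω Ω' β γ : Type*} [Fintype Ω] [Fintype Ω'] [MeasurableSpace β] [MeasurableSpace γ]

/-- The distribution of `f ω` for a uniformly random `ω`. -/
noncomputable def unifMeasure (f : Ω → β) : Measure β :=
  (Fintype.card Ω : ENNReal)⁻¹ • Measure.sum fun ω => Measure.dirac (f ω)

instance [Nonempty Ω] (f : Ω → β) : IsProbabilityMeasure (unifMeasure f) := by
  constructor
  rw [unifMeasure, Measure.smul_apply, Measure.sum_apply _ MeasurableSet.univ]
  simp only [measure_univ, tsum_fintype, Finset.sum_const, Finset.card_univ, nsmul_eq_mul, mul_one,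
    smul_eq_mul]
  exact ENNReal.inv_mul_cancel (by simp) (ENNReal.natCast_ne_top _)

theorem unifMeasure_prod (f : Ω → β) (g : Ω' → γ) :
    (unifMeasure f).prod (unifMeasure g) = unifMeasure fun ω : Ω × Ω' => (f ω.1, g ω.2) := by
  simp only [unifMeasure]
  rw [Measure.prod_smul_left, Measure.prod_smul_right, Measure.prod_sum, smul_smul,
    Fintype.card_prod, Nat.cast_mul, ENNReal.mul_inv (by simp) (by simp)]
  simp only [Measure.dirac_prod_dirac]

open Classical in
-- An inequality for arbitrary sets, by the outer measure, so that measurability of the success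
-- event need not be discussed.
theorem ofReal_prob_le [Nonempty Ω] (f : Ω → β) (s : Set β) :
    ENNReal.ofReal (prob fun ω => f ω ∈ s) ≤ unifMeasure f s := by
  have h : ENNReal.ofReal (prob fun ω => f ω ∈ s) =
      (Fintype.card Ω : ENNReal)⁻¹ * ∑ ω, if f ω ∈ s then 1 else 0 := by
    rw [prob, avg, ENNReal.ofReal_div_of_pos (by exact_mod_cast Fintype.card_pos),
      ENNReal.ofReal_natCast, div_eq_mul_inv, mul_comm, Finset.sum_boole, Finset.sum_boole,
      ENNReal.ofReal_natCast]
  rw [h, unifMeasure, Measure.smul_apply, smul_eq_mul]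
  gcongr
  refine le_trans ?_ (Measure.le_sum_apply _ s)
  rw [tsum_fintype]
  refine Finset.sum_le_sum fun ω _ => le_trans (le_of_eq ?_) Measure.le_dirac_apply
  simp [Set.indicator_apply]

end unif

/-! ## Bounds on the parameters -/

theorem clog_le_log {m : ℕ} (hm : 1 ≤ m) : (Nat.clog 2 m : ℝ) ≤ 4 * Real.log m := by
  rcases hm.eq_or_lt with rfl | h
  · simp
  · have h1 := Nat.pow_pred_clog_lt_self (b := 2) (by norm_num) h
    have h2 := Nat.clog_pos (b := 2) (by norm_num) h
    obtain ⟨l, hl⟩ : ∃ l, Nat.clog 2 m = l + 1 := ⟨Nat.clog 2 m - 1, by omega⟩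
    rw [hl] at h1 ⊢
    have h3 : (2 : ℝ) ^ l ≤ m := by exact_mod_cast h1.le
    have h4 := Real.log_le_log (by positivity) h3
    have h5 : Real.log 2 ≤ Real.log m := Real.log_le_log (by norm_num) (by exact_mod_cast h)
    have h6 := Real.log_two_gt_d9
    rw [Real.log_pow] at h4
    push_cast
    nlinarith [(Nat.cast_nonneg l : (0 : ℝ) ≤ l)]

theorem ceil_le_two_div {ε : ℝ} (h0 : 0 < ε) (h1 : ε < 1) : (⌈1 / ε⌉₊ : ℝ) ≤ 2 / ε := by
  have h2 := Nat.ceil_lt_add_one (show 0 ≤ 1 / ε by positivity)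
  have h3 : 1 ≤ 1 / ε := by
    rw [le_div_iff₀ h0]
    linarith
  have h4 : 2 / ε = 1 / ε + 1 / ε := by ring
  linarith

theorem one_le_ceil {ε : ℝ} (h0 : 0 < ε) : 1 ≤ ⌈1 / ε⌉₊ := Nat.ceil_pos.2 (by positivity)

theorem one_le_ceil_mul {ε : ℝ} (h0 : 0 < ε) : 1 ≤ ⌈1 / ε⌉₊ * ε := by
  have := Nat.le_ceil (1 / ε)
  rwa [div_le_iff₀ h0] at this

theorem widthT_le {n k : ℕ} {ε : ℝ} (hn : 1 ≤ n) (hk : 1 ≤ k) (h0 : 0 < ε) (h1 : ε < 1) :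
    (widthT ⌈1 / ε⌉₊ (Nat.clog 2 (n * k)) : ℝ) ≤ 4194304 * (Real.log (n * k) / ε ^ 2) := by
  have h2 := clog_le_log (Nat.mul_pos hn hk)
  have h3 := ceil_le_two_div h0 h1
  have h4 : (0 : ℝ) ≤ ⌈1 / ε⌉₊ := Nat.cast_nonneg _
  push_cast at h2
  have h5 : (⌈1 / ε⌉₊ : ℝ) * ⌈1 / ε⌉₊ ≤ 2 / ε * (2 / ε) := mul_le_mul h3 h3 h4 (by positivity)
  have h6 : (widthT ⌈1 / ε⌉₊ (Nat.clog 2 (n * k)) : ℝ) =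
      262144 * (Nat.clog 2 (n * k) * (⌈1 / ε⌉₊ * ⌈1 / ε⌉₊)) := by
    simp only [widthT, numGroups, groupSize]
    push_cast
    ring
  rw [h6]
  calc _ ≤ 262144 * (4 * Real.log (n * k) * (2 / ε * (2 / ε))) :=
        mul_le_mul_of_nonneg_left (mul_le_mul h2 h5 (by positivity)
          ((Nat.cast_nonneg _).trans h2)) (by norm_num)
    _ = _ := by field_simp; ring

theorem heightS_le {k : ℕ} {ε : ℝ} (h0 : 0 < ε) (h1 : ε < 1) :
    (heightS k ⌈1 / ε⌉₊ : ℝ) ≤ 6144 * (k / ε) := by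
  have h3 := ceil_le_two_div h0 h1
  rw [heightS]
  push_cast
  calc (3072 : ℝ) * (k * ⌈1 / ε⌉₊) ≤ 3072 * (k * (2 / ε)) := by gcongr
    _ = _ := by ring

/-! ## Recovery from sketches -/

/-- The program that computes a clustering from the sketches. -/
def recoverCmd : Cmd :=
  .seq Prog.paramCmd (Prog.reconstructCmd (.input 5) (.input 2) (.input 4))

theorem State.fits_blank (m L B : ℕ) : State.blank.Fits m L B :=
  ⟨fun _ _ _ => ⟨rfl, rfl⟩, fun _ _ => Nat.zero_le _⟩

theorem wp_recoverCmd {E : Env} {n d k q l : ℕ} {ε : ℝ} (h : Setup E n d k q l) (hε : 0 < ε)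
    (he : E.inp.real 0 0 0 = ε) (hq : q = ⌈1 / ε⌉₊) (hl : l = Nat.clog 2 (n * k))
    (hB : 2 * (n * k) ≤ E.B) :
    wp E recoverCmd (fun σ' =>
      (∀ i < n, σ'.word 0 i = searchResult q l (E.inp.real 5) n k i) ∧
      ∀ j < k, ∀ c < d, dotRange (heightS k q)
        (sketchedCluster n (E.inp.real 2) (searchResult q l (E.inp.real 5) n k) j)
        (fun r => E.inp.real 4 r c - ∑ a ∈ Finset.range k,
          sketchedCluster n (E.inp.real 2) (searchResult q l (E.inp.real 5) n k) a r *
            σ'.real 0 (a * d + c)) = 0) State.blank := by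
  refine wp_seq' _ (wp_paramCmd h hε he hq hl hB rfl rfl) ?_
  rintro σ₁ _ hf₁ ⟨h1, h2, -⟩
  refine wp_reconstructCmd (fA := E.inp.real 5) (fS := E.inp.real 2) (fSA := E.inp.real 4) h ?_
    (hf₁.word 5 rfl) (hf₁.word 7 rfl) (hf₁.word 8 rfl)
  intro σ' hp
  exact ⟨(congrFun hp.w1 0).trans h1, (congrFun hp.w2 0).trans h2, fun x y => ⟨rfl, rfl, rfl⟩⟩

/-- Recovery comes without resource bounds, so the sum of all quantities that have to fit serves as
a bound for everything. -/
theorem exists_setup (inp : Inputs) (ω : Tape) {n d k q l : ℕ} (hn : inp.word 0 = n)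
    (hd : inp.word 1 = d) (hk : inp.word 2 = k) (hn1 : 1 ≤ n) (hd1 : 1 ≤ d) (hk1 : 1 ≤ k)
    (hq : 1 ≤ q) : ∃ E : Env, E.inp = inp ∧ E.tape = ω ∧ Setup E n d k q l ∧ 2 * (n * k) ≤ E.B := by
  set N := 1 + 2 * (n * k) + n * widthT q l + groupSize q + numGroups l + n + heightS k q * d +
    heightS k q * k + k * numSamples q + k * d + k * k + n ^ (k * numSamples q) with hN
  refine ⟨⟨inp, ω, 32, N, N, N⟩, rfl, rfl, ⟨hn, hd, hk, hn1, hd1, hk1, hq, le_rfl, ?_, le_rfl, le_rfl,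
    ?_, ?_, ?_, ?_, ?_, ?_, ?_, ?_, ?_, ?_⟩, ?_⟩ <;> dsimp only <;> omega

section recovery
variable {n d k q l P : ℕ} [Fact (P + 1).Prime]

noncomputable def matrixT (d t : ℕ) {G b : ℕ} (u : Fin G → Fin b → Fin 4 → ZMod (P + 1)) :
    Matrix (Fin d) (Fin t) ℝ :=
  Matrix.of fun j c => hashEntry (flatRows u c) j

noncomputable def matrixS (n : ℕ) {s : ℕ} (u : Fin s → Fin 4 → ZMod (P + 1)) :
    Matrix (Fin s) (Fin n) ℝ :=
  Matrix.of fun r i => hashEntry (u r) i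

theorem matrixArray_apply {m n : ℕ} (M : Matrix (Fin m) (Fin n) ℝ) (i : Fin m) (j : Fin n) :
    matrixArray M i j = M i j := by
  rw [matrixArray, dif_pos ⟨i.2, j.2⟩]

theorem mul_matrixT (A : Matrix (Fin n) (Fin d) ℝ) {t G b : ℕ}
    (u : Fin G → Fin b → Fin 4 → ZMod (P + 1)) (i : Fin n) (c : Fin t) :
    (A * matrixT d t u) i c = rowDot (flatRows u c) (A i) := rfl

theorem matrixS_mul (A : Matrix (Fin n) (Fin d) ℝ) {s : ℕ} (u : Fin s → Fin 4 → ZMod (P + 1))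
    (r : Fin s) (c : Fin d) : (matrixS n u * A) r c = rowDot (u r) fun i => A i c := by
  rw [Matrix.mul_apply, rowDot]
  exact Finset.sum_congr rfl fun i _ => mul_comm _ _

end recovery

/-- The matrix W is taken with 0 rows: AT already determines the estimated cost of every partition.
T and S consist of polynomial hash values, exactly as in the streaming algorithm. -/
theorem exists_recovery :
    ∃ (C : ℝ) (recover : Cmd), 0 < C ∧
      ∀ (n d k : ℕ) (ε : ℝ), 1 ≤ n → 1 ≤ d → 1 ≤ k → 0 < ε → ε < 1 →
      ∃ t s w : ℕ,
        (t : ℝ) ≤ C * (Real.log (n * k) / ε ^ 2) ∧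
        (s : ℝ) ≤ C * (k / ε) ∧
        (w : ℝ) ≤ C * (k ^ 2 / ε ^ 3 * Real.log n) ∧
        ∃ (μT : Measure (Matrix (Fin d) (Fin t) ℝ)) (μS : Measure (Matrix (Fin s) (Fin n) ℝ))
          (μW : Measure (Matrix (Fin w) (Fin (n * d)) ℝ)),
          IsProbabilityMeasure μT ∧ IsProbabilityMeasure μS ∧ IsProbabilityMeasure μW ∧
          ∀ A : Matrix (Fin n) (Fin d) ℝ,
            2 / 3 ≤ (μT.prod (μS.prod μW)) {M | ∀ ω : Tape, ∃ out : State,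
              Computes
                (recoveryInput k ε M.1 M.2.1 M.2.2
                  (M.2.1 * A) (A * M.1) (M.2.2.mulVec (flatten A)))
                ω recover State.blank out ∧
              IsApproxKMeans A ε (outAssignment n k out) (outCenters k d out)} := by
  refine ⟨4194304, recoverCmd, by norm_num, fun n d k ε hn hd hk h0 h1 => ?_⟩
  set q := ⌈1 / ε⌉₊ with hq
  set l := Nat.clog 2 (n * k) with hl
  have hq1 : 1 ≤ q := one_le_ceil h0
  have hk0 : (0 : ℝ) < k := by exact_mod_cast hk
  refine ⟨widthT q l, heightS k q, 0, widthT_le hn hk h0 h1,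
    (heightS_le h0 h1).trans (by gcongr; norm_num), ?_, ?_⟩
  · have := Real.log_natCast_nonneg n
    push_cast
    positivity
  obtain ⟨P, hP⟩ : ∃ P, hashPrime n d = P + 1 :=
    ⟨hashPrime n d - 1, by have := le_nextPrime (n + d + 5); rw [hashPrime]; omega⟩
  have hP' := le_nextPrime (n + d + 5)
  rw [← hashPrime, hP] at hP'
  have : Fact (P + 1).Prime := ⟨hP ▸ nextPrime_prime (n + d + 5)⟩
  refine ⟨unifMeasure fun u : CoeffT P q l => matrixT d (widthT q l) u,
    unifMeasure fun u : CoeffS P k q => matrixS n u, unifMeasure fun _ : Unit => 0,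
    inferInstance, inferInstance, inferInstance, fun A => ?_⟩
  rw [unifMeasure_prod, unifMeasure_prod]
  have hmain := two_thirds_le_prob_success (P := P) A hn hk hq1 hl (by omega) (by omega) (by omega)
    (one_le_ceil_mul h0) (fun u => matrixArray (A * matrixT d (widthT q l) u)) fun u i c hc => by
      rw [matrixArray_apply _ i ⟨c, hc⟩, mul_matrixT]
  refine le_trans ?_ (ofReal_prob_le _ _)
  have h3 : (2 / 3 : ENNReal) = ENNReal.ofReal (2 / 3) := by
    rw [ENNReal.ofReal_div_of_pos (by norm_num)]
    simp
  rw [h3]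
  refine ENNReal.ofReal_le_ofReal ?_
  -- The one-point distribution of the empty matrix W does not change the probability.
  have hproj : prob (fun ω : CoeffT P q l × CoeffS P k q × Unit => Success A ε hk q l
      (matrixArray (A * matrixT d (widthT q l) ω.1)) ω.2.1) =
      prob fun ω : CoeffT P q l × CoeffS P k q => Success A ε hk q l
        (matrixArray (A * matrixT d (widthT q l) ω.1)) ω.2 :=
    prob_comp_bijective (e := fun ω : CoeffT P q l × CoeffS P k q × Unit => (ω.1, ω.2.1))
      ⟨fun x y hxy => by
        simp only [Prod.mk.injEq] at hxy
        exact Prod.ext hxy.1 (Prod.ext hxy.2 rfl), fun y => ⟨(y.1, y.2, ()), rfl⟩⟩ fun ω => Success A ε hk q l (matrixArray (A * matrixT d (widthT q l) ω.1)) ω.2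
  rw [← hproj] at hmain
  refine hmain.trans (prob_mono fun u hu => ?_)
  intro ω
  obtain ⟨E, hE, hE', hS, hB⟩ := exists_setup (q := q) (l := l)
    (recoveryInput k ε (matrixT d (widthT q l) u.1) (matrixS n u.2.1) (0 : Matrix (Fin 0) _ ℝ)
      (matrixS n u.2.1 * A) (A * matrixT d (widthT q l) u.1)
      ((0 : Matrix (Fin 0) _ ℝ).mulVec (flatten A))) ω (n := n) (d := d) (k := k) rfl rfl rfl hn hd hk
      hq1
  obtain ⟨σ, hσ, -, -, hout, hc⟩ := (wp_recoverCmd hS h0 (by rw [hE]; rfl) hq hl hB).computesWithin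
    (State.fits_blank _ _ _) le_rfl
  rw [hE, hE'] at hσ
  rw [hE] at hout hc
  refine ⟨σ, ?_, ?_⟩
  · obtain ⟨N, _, hN, _⟩ := hσ
    exact ⟨N, hN⟩
  · exact hu.isApproxKMeans (by linarith) (fun r i => matrixArray_apply (matrixS n u.2.1) r i)
      (fun r c => (matrixArray_apply (matrixS n u.2.1 * A) r c).trans (matrixS_mul A _ r c)) hout hc

/-! ## The random tape -/

section tape

theorem tapeMeasure_cylinder {N P : ℕ} (z : Fin N → Fin (P + 1)) :
    tapeMeasure {ω | ∀ x : Fin N, ω ((x : ℕ), P) = z x} = ((P + 1 : ℕ) : ENNReal)⁻¹ ^ N := by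
  set s : Finset (ℕ × ℕ) := Finset.univ.image fun x : Fin N => ((x : ℕ), P)
  set t : (q : ℕ × ℕ) → Set (Fin (q.2 + 1)) := fun q => {v | ∀ x : Fin N, q = ((x : ℕ), P) →
    (v : ℕ) = z x}
  have h1 : {ω : Tape | ∀ x : Fin N, ω ((x : ℕ), P) = z x} = Set.pi (s : Set (ℕ × ℕ)) t := by
    ext ω
    simp only [Set.mem_ofPred_eq, Set.mem_pi, Finset.mem_coe, s, t, Finset.mem_image,
      Finset.mem_univ, true_and]
    constructor
    · rintro h _ ⟨x, rfl⟩ y hy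
      obtain rfl : x = y := Fin.ext (Prod.ext_iff.1 hy).1
      rw [h x]
    · intro h x
      exact Fin.ext (h _ ⟨x, rfl⟩ x rfl)
  rw [h1, tapeMeasure, Measure.infinitePi_pi _ fun _ _ => MeasurableSet.of_discrete,
    Finset.prod_image fun x _ y _ h => Fin.ext (Prod.ext_iff.1 h).1]
  have h2 : ∀ x : Fin N, (PMF.uniformOfFintype (Fin (P + 1))).toMeasure (t ((x : ℕ), P)) =
      ((P + 1 : ℕ) : ENNReal)⁻¹ := by
    intro x
    have : t ((x : ℕ), P) = {z x} := by
      ext v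
      simp only [t, Set.mem_ofPred_eq, Set.mem_singleton_iff]
      constructor
      · exact fun h => Fin.ext (h x rfl)
      · rintro rfl y hy
        rw [Fin.ext (Prod.ext_iff.1 hy).1]
    rw [this, PMF.toMeasure_apply_singleton _ _ MeasurableSet.of_discrete,
      PMF.uniformOfFintype_apply, Fintype.card_fin]
  rw [Finset.prod_congr rfl fun x _ => h2 x, Finset.prod_const, Finset.card_univ, Fintype.card_fin]

/-- An event that depends on the tape entries at (0, P), …, (N - 1, P) only is a finite disjoint
union of cylinders of mass (P + 1)⁻ᴺ, so its measure is computed by counting. -/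
theorem ofReal_prob_le_tapeMeasure {N P : ℕ} (p : (Fin N → Fin (P + 1)) → Prop) :
    ENNReal.ofReal (prob p) ≤ tapeMeasure {ω | p fun x => ω ((x : ℕ), P)} := by
  classical
  have h : {ω : Tape | p fun x => ω ((x : ℕ), P)} =
      ⋃ z ∈ Finset.univ.filter p, {ω : Tape | ∀ x : Fin N, ω ((x : ℕ), P) = z x} := by
    ext ω
    simp only [Set.mem_ofPred_eq, Set.mem_iUnion, Finset.mem_filter, Finset.mem_univ, true_and,
      exists_prop]
    constructor
    · exact fun h => ⟨_, h, fun x => rfl⟩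
    · rintro ⟨z, hz, hz'⟩
      rwa [show (fun x : Fin N => ω ((x : ℕ), P)) = z from funext hz']
  rw [h, measure_biUnion_finset]
  · simp only [tapeMeasure_cylinder, Finset.sum_const, nsmul_eq_mul]
    have h1 : prob p = ((Finset.univ.filter p).card : ℝ) / ((P + 1 : ℕ) : ℝ) ^ N := by
      rw [prob, avg, Fintype.card_fun, Fintype.card_fin, Fintype.card_fin]
      rw [show (∑ ω, if p ω then (1 : ℝ) else 0) = ((Finset.univ.filter p).card : ℝ) by
        rw [← Finset.sum_boole]]
      push_cast
      rfl
    rw [h1, ENNReal.ofReal_div_of_pos (by positivity), ENNReal.ofReal_natCast,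
      ENNReal.ofReal_pow (Nat.cast_nonneg _), ENNReal.ofReal_natCast, div_eq_mul_inv, ENNReal.inv_pow]
  · intro z _ z' _ hzz'
    rw [Function.onFun, Set.disjoint_left]
    intro ω h1 h2
    exact hzz' (funext fun x => (h1 x).symm.trans (h2 x))
  · intro z _
    have : {ω : Tape | ∀ x : Fin N, ω ((x : ℕ), P) = z x} =
        ⋂ x : Fin N, (fun ω : Tape => ω ((x : ℕ), P)) ⁻¹' {z x} := by
      ext ω
      simp
    rw [this]
    exact MeasurableSet.iInter fun x => measurable_pi_apply _ MeasurableSet.of_discrete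

theorem hashVal_eq {P : ℕ} [Fact (P + 1).Prime] (a : ℕ → ℕ) (b x : ℕ) :
    hashVal (P + 1) a b x = hashEntry (fun e : Fin 4 => (a (b + e) : ZMod (P + 1))) x := by
  have h : cubic (fun e : Fin 4 => (a (b + e) : ZMod (P + 1))) (x : ZMod (P + 1)) =
      ((a b + (a (b + 1) * x + (a (b + 2) * (x * x) + a (b + 3) * (x * (x * x)))) : ℕ) :
        ZMod (P + 1)) := by
    simp only [cubic]
    push_cast
    rfl
  rw [hashEntry, h, centered, ZMod.val_natCast, hashVal]
  push_cast
  simp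

end tape

/-! ### From the draws to the coefficients of the sketching matrices. -/

section decode
variable {k q l P : ℕ}

/-- The coefficients of `T` and `S` in the order in which they are drawn. -/
def decode (z : Fin (numCoeffs k q l) → ZMod (P + 1)) : CoeffT P q l × CoeffS P k q :=
  (fun g r e => z ⟨4 * (g * groupSize q + r) + e, by
      have := pair_lt g.2 r.2
      have := e.2
      rw [numCoeffs, widthT]
      omega⟩,
    fun r e => z ⟨4 * (widthT q l + r) + e, by
      have := r.2
      have := e.2
      rw [numCoeffs]
      omega⟩)

/-- Each draw is used exactly once, so uniform draws yield uniform coefficients, with T and S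
independent. -/
theorem decode_bijective : Function.Bijective (decode (k := k) (q := q) (l := l) (P := P)) := by
  rw [Fintype.bijective_iff_injective_and_card]
  constructor
  · intro z z' h
    funext x
    have hx : (x : ℕ) < 4 * (widthT q l + heightS k q) := x.2
    by_cases h1 : (x : ℕ) / 4 < widthT q l
    · have hb : 0 < groupSize q := by
        by_contra h0
        rw [widthT, Nat.eq_zero_of_not_pos h0] at h1
        simp at h1
      have h2 : (x : ℕ) / 4 / groupSize q < numGroups l := Nat.div_lt_of_lt_mul (by
        rw [mul_comm]; exact h1)
      have h3 := congrFun (congrFun (congrFun (Prod.ext_iff.1 h).1 ⟨_, h2⟩)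
        ⟨(x : ℕ) / 4 % groupSize q, Nat.mod_lt _ hb⟩) ⟨(x : ℕ) % 4, Nat.mod_lt _ (by norm_num)⟩
      have h4 : 4 * ((x : ℕ) / 4 / groupSize q * groupSize q + (x : ℕ) / 4 % groupSize q) +
          (x : ℕ) % 4 = x := by
        rw [Nat.div_add_mod', Nat.div_add_mod]
      simp only [decode, h4] at h3
      exact h3
    · have h2 : (x : ℕ) / 4 - widthT q l < heightS k q := by omega
      have h3 := congrFun (congrFun (Prod.ext_iff.1 h).2 ⟨_, h2⟩)
        ⟨(x : ℕ) % 4, Nat.mod_lt _ (by norm_num)⟩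
      have h4 : 4 * (widthT q l + ((x : ℕ) / 4 - widthT q l)) + (x : ℕ) % 4 = x := by omega
      simp only [decode, h4] at h3
      exact h3
  · simp only [Fintype.card_prod, Fintype.card_fun, Fintype.card_fin, ZMod.card, ← pow_mul, ← pow_add]
    rw [show numCoeffs k q l = 4 * groupSize q * numGroups l + 4 * heightS k q by
      simp only [numCoeffs, widthT]
      ring]

variable {n d : ℕ} {ε : ℝ}

/-- The coefficients that are drawn from the tape. -/
def tapeCoeffs (k q l P : ℕ) (ω : Tape) : CoeffT P q l × CoeffS P k q :=
  decode fun x => (ω ((x : ℕ), P) : Fin (P + 1))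

theorem tapeCoeffs_fst (ω : Tape) {c : ℕ} (hc : c < widthT q l) (e : Fin 4) :
    flatRows (tapeCoeffs k q l P ω).1 c e = (ω (4 * c + e, P) : Fin (P + 1)) := by
  have hb : 0 < groupSize q := by
    by_contra h0
    rw [widthT, Nat.eq_zero_of_not_pos h0] at hc
    simp at hc
  have h1 : c / groupSize q < numGroups l := Nat.div_lt_of_lt_mul (by rw [mul_comm]; exact hc)
  rw [flatRows, dif_pos ⟨h1, Nat.mod_lt _ hb⟩]
  have key : ∀ y, y = c → (ω (4 * y + e, P) : Fin (P + 1)) = (ω (4 * c + e, P) : Fin (P + 1)) := by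
    rintro _ rfl
    rfl
  exact key _ (Nat.div_add_mod' c (groupSize q))

theorem tapeCoeffs_snd (ω : Tape) (r : Fin (heightS k q)) (e : Fin 4) :
    (tapeCoeffs k q l P ω).2 r e = (ω (4 * (widthT q l + r) + e, P) : Fin (P + 1)) := rfl

variable [Fact (P + 1).Prime]

theorem hashVal_coeffArray {ω : Tape} {N b : ℕ} (hb : b + 4 ≤ N) (x : ℕ) :
    hashVal (P + 1) (coeffArray ω (P + 1) N) b x =
      hashEntry (fun e : Fin 4 => (ω (b + e, P) : ZMod (P + 1))) x := by
  rw [hashVal_eq]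
  congr 1
  funext e
  rw [coeffArray, if_pos (by have := e.2; omega)]
  exact ZMod.natCast_zmod_val (n := P + 1) _

theorem sketchRight_eq (A : Matrix (Fin n) (Fin d) ℝ) {t : ℕ} (U : ℕ → Fin 4 → ZMod (P + 1))
    (i : Fin n) {c : ℕ} (hc : c < t) :
    sketchRight A t (fun c j => hashEntry (U c) j) (i * t + c) = rowDot (U c) (A i) := by
  obtain ⟨h1, h2⟩ := (eq_pair_iff hc).1 (rfl : (i * t + c : ℕ) = i * t + c)
  rw [sketchRight, h1, h2, Finset.sum_range, rowDot]
  exact Finset.sum_congr rfl fun j _ => by rw [matrixArray_apply]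

/-- The stored sketch `A T` as a matrix. -/
noncomputable def sketchRows (A : Matrix (Fin n) (Fin d) ℝ) (u : CoeffT P q l) (x y : ℕ) : ℝ :=
  sketchRight A (widthT q l) (fun c j => hashEntry (flatRows u c) j) (x * widthT q l + y)

/-- The success of the streaming algorithm with the random tape `ω`. -/
theorem two_thirds_le_tapeMeasure (A : Matrix (Fin n) (Fin d) ℝ) (hn : 1 ≤ n) (hk : 1 ≤ k)
    (hq : 1 ≤ q) (hl : l = Nat.clog 2 (n * k)) (hP : 4 ≤ P) (hnP : n ≤ P) (hdP : d ≤ P)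
    (hε : 1 ≤ q * ε) :
    2 / 3 ≤ tapeMeasure {ω | Success A ε hk q l (sketchRows A (tapeCoeffs k q l P ω).1)
      (tapeCoeffs k q l P ω).2} := by
  have h := two_thirds_le_prob_success (P := P) A hn hk hq hl hP hnP hdP hε (sketchRows A)
    fun u i c hc => sketchRight_eq A (flatRows u) i hc
  rw [← prob_comp_bijective decode_bijective] at h
  refine le_trans ?_ (ofReal_prob_le_tapeMeasure (N := numCoeffs k q l) (P := P) fun z =>
    Success A ε hk q l (sketchRows A (decode z).1) (decode (l := l) (P := P) z).2)
  have h3 : (2 / 3 : ENNReal) = ENNReal.ofReal (2 / 3) := by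
    rw [ENNReal.ofReal_div_of_pos (by norm_num)]
    simp
  rw [h3]
  exact ENNReal.ofReal_le_ofReal h

end decode

/-! ## Runs of the streaming algorithm -/

section run
variable {n d k q l L B H : ℕ} {ε : ℝ} {ω : Tape}

theorem Setup.of_inputs {inp inp' : Inputs} {ω ω' : Tape} {m : ℕ}
    (h : Setup ⟨inp, ω, m, L, B, H⟩ n d k q l) (h0 : inp'.word 0 = n) (h1 : inp'.word 1 = d)
    (h2 : inp'.word 2 = k) : Setup ⟨inp', ω', m, L, B, H⟩ n d k q l :=
  { h with n_eq := h0, d_eq := h1, k_eq := h2 }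

theorem exists_processes {T : ℕ} (h : Setup ⟨paramInput n d k ε, ω, 32, L, B, H⟩ n d k q l)
    (hl : 1 ≤ l) (hT : Prog.updateCmd.cost H ≤ T) (us : List (Update n d)) :
    ∀ (A : Matrix (Fin n) (Fin d) ℝ) (σ : State), σ.Fits 32 L B → StreamMem A k q l ω σ →
      ∃ σ', Processes (State.Fits 32 L B) T Prog.updateCmd k ε ω us σ σ' ∧ σ'.Fits 32 L B ∧
        StreamMem (us.foldl (fun A u => A + Matrix.single u.row u.col u.delta) A) k q l ω σ' := by
  induction us with
  | nil => exact fun A σ hσ hA => ⟨σ, rfl, hσ, hA⟩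
  | cons u us ih =>
    intro A σ hσ hA
    obtain ⟨τ, hτ, hok, _, hmem⟩ := (wp_updateCmd (E := ⟨updateInput k ε u, ω, 32, L, B, H⟩)
      (h.of_inputs rfl rfl rfl) (u := u) rfl rfl rfl hl hA).computesWithin hσ hT
    obtain ⟨σ', h1, h2, h3⟩ := ih _ τ hok hmem
    exact ⟨σ', ⟨τ, hτ, h1⟩, h2, h3⟩

theorem exists_runs {T : ℕ} (h : Setup ⟨paramInput n d k ε, ω, 32, L, B, H⟩ n d k q l)
    (hl1 : 1 ≤ l) (hε : 0 < ε) (hq : q = ⌈1 / ε⌉₊) (hl : l = Nat.clog 2 (n * k))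
    (hB : 2 * (n * k) ≤ B) (hB' : 2 * (n + d + 5) ≤ B)
    (hH : (2 * (n + d + 5) + 1) * (2 * (n + d + 5) + 1) ≤ H) (hN : numCoeffs k q l ≤ L)
    (hT : kMeansStream.init.cost H ≤ T) (hT' : kMeansStream.update.cost H ≤ T)
    (hT'' : kMeansStream.finish.cost H ≤ T) (us : List (Update n d)) :
    ∃ mid out : State, kMeansStream.Runs (State.Fits 32 L B) T k ε ω us mid out ∧
      StreamMem (streamMatrix us) k q l ω mid ∧ ∀ (fA fS fSA : ℕ → ℕ → ℝ),
        fA = (fun x y => mid.real 1 (x * widthT q l + y)) →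
        fS = (fun x y => hashVal (hashPrime n d) (coeffArray ω (hashPrime n d) (numCoeffs k q l))
          (4 * (widthT q l + x)) y) →
        fSA = (fun x y => mid.real 2 (x * d + y)) →
        (∀ i < n, out.word 0 i = searchResult q l fA n k i) ∧
        ∀ j < k, ∀ c < d, dotRange (heightS k q)
          (sketchedCluster n fS (searchResult q l fA n k) j) (fun r => fSA r c -
            ∑ a ∈ Finset.range k, sketchedCluster n fS (searchResult q l fA n k) a r *
              out.real 0 (a * d + c)) = 0 := by
  obtain ⟨σ, h1, hok, _, hmem⟩ := (wp_initCmd h hε rfl hq hl hB hB' hH hN).computesWithin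
    (State.fits_blank _ _ _) hT
  obtain ⟨mid, h2, hok', hmem'⟩ := exists_processes h hl1 hT' us 0 σ hok hmem
  obtain ⟨out, h3, _, _, h4⟩ := (wp_reconstructCmd h (hmem'.data h) hmem'.w5 hmem'.w7
    hmem'.w8).computesWithin hok' hT''
  refine ⟨mid, out, ⟨σ, h1, h2, h3⟩, hmem', ?_⟩
  rintro _ _ _ rfl rfl rfl
  exact h4

theorem StreamMem.isApproxKMeans {P : ℕ} [Fact (P + 1).Prime] (hP : hashPrime n d = P + 1)
    {A : Matrix (Fin n) (Fin d) ℝ} {hk : 1 ≤ k} (hε : 0 ≤ 1 + ε) (ht : 0 < widthT q l)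
    {mid out : State} (hA : StreamMem A k q l ω mid)
    (hs : Success A ε hk q l (sketchRows A (tapeCoeffs k q l P ω).1) (tapeCoeffs k q l P ω).2)
    (h : ∀ (fA fS fSA : ℕ → ℕ → ℝ), fA = (fun x y => mid.real 1 (x * widthT q l + y)) →
        fS = (fun x y => hashVal (hashPrime n d) (coeffArray ω (hashPrime n d) (numCoeffs k q l))
          (4 * (widthT q l + x)) y) →
        fSA = (fun x y => mid.real 2 (x * d + y)) →
        (∀ i < n, out.word 0 i = searchResult q l fA n k i) ∧
        ∀ j < k, ∀ c < d, dotRange (heightS k q)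
          (sketchedCluster n fS (searchResult q l fA n k) j) (fun r => fSA r c -
            ∑ a ∈ Finset.range k, sketchedCluster n fS (searchResult q l fA n k) a r *
              out.real 0 (a * d + c)) = 0) :
    IsApproxKMeans A ε (outAssignment n k out) (outCenters k d out) := by
  have hS : ∀ (r : Fin (heightS k q)) (x : ℕ), hashVal (hashPrime n d)
      (coeffArray ω (hashPrime n d) (numCoeffs k q l)) (4 * (widthT q l + r)) x =
      hashEntry ((tapeCoeffs k q l P ω).2 r) x := by
    intro r x
    rw [hP, hashVal_coeffArray (by have := r.2; rw [numCoeffs]; omega)]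
    exact congrArg (hashEntry · x) (funext fun e => (tapeCoeffs_snd ω r e).symm)
  have hT : ∀ c < widthT q l, ∀ x, hashVal (hashPrime n d)
      (coeffArray ω (hashPrime n d) (numCoeffs k q l)) (4 * c) x =
      hashEntry (flatRows (tapeCoeffs k q l P ω).1 c) x := by
    intro c hc x
    rw [hP, hashVal_coeffArray (by rw [numCoeffs]; omega)]
    exact congrArg (hashEntry · x) (funext fun e => (tapeCoeffs_fst ω hc e).symm)
  have hfA : sketchRows A (tapeCoeffs k q l P ω).1 =
      fun x y => mid.real 1 (x * widthT q l + y) := by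
    funext x y
    rw [hA.r1, sketchRows, sketchRight, sketchRight]
    exact Finset.sum_congr rfl fun j _ => by rw [hT _ (Nat.mod_lt _ ht)]
  rw [hfA] at hs
  obtain ⟨h1, h2⟩ := h _ _ _ rfl rfl rfl
  refine hs.isApproxKMeans hε (fun r i => hS r i) (fun r c => ?_) h1 h2
  obtain ⟨e1, e2⟩ := (eq_pair_iff c.2).1 (rfl : (r * d + c : ℕ) = r * d + c)
  rw [hA.r2, sketchLeft, e1, e2, if_pos r.2, Finset.sum_range, rowDot]
  exact Finset.sum_congr rfl fun i _ => by rw [hS, matrixArray_apply, mul_comm]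

/-- On integral data the sketches are integral and small. -/
theorem StreamMem.integral {A : Matrix (Fin n) (Fin d) ℝ} {mid : State}
    (hA : StreamMem A k q l ω mid) (hint : ∀ i j, ∃ z : ℤ, A i j = z) {M : ℝ} (hM : 0 ≤ M)
    (hAM : ∀ i j, |A i j| ≤ M) (a x : ℕ) :
    ∃ z : ℤ, mid.real a x = z ∧ |(z : ℝ)| ≤ (n + d) * (M * hashPrime n d) := by
  have hp : 0 < hashPrime n d := (nextPrime_prime _).pos
  have hint' : ∀ x y, ∃ z : ℤ, matrixArray A x y = z := by
    intro x y
    rw [matrixArray]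
    split_ifs with h
    · exact hint _ _
    · exact ⟨0, by simp⟩
  have hAM' : ∀ x y, |matrixArray A x y| ≤ M := by
    intro x y
    rw [matrixArray]
    split_ifs with h
    · exact hAM _ _
    · simpa using hM
  have hsum : ∀ (N : ℕ) (f g : ℕ → ℝ), (∀ i, ∃ z : ℤ, f i = z) → (∀ i, ∃ z : ℤ, g i = z) →
      (∀ i, |f i| ≤ M) → (∀ i, |g i| ≤ hashPrime n d) →
      ∃ z : ℤ, ∑ i ∈ Finset.range N, f i * g i = z ∧ |(z : ℝ)| ≤ N * (M * hashPrime n d) := by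
    intro N f g hf hg hf' hg'
    choose zf hzf using hf
    choose zg hzg using hg
    have he : ∑ i ∈ Finset.range N, f i * g i = ((∑ i ∈ Finset.range N, zf i * zg i : ℤ) : ℝ) := by
      push_cast
      exact Finset.sum_congr rfl fun i _ => by rw [hzf, hzg]
    refine ⟨_, he, ?_⟩
    rw [← he]
    refine (Finset.abs_sum_le_sum_abs _ _).trans ((Finset.sum_le_sum fun i _ => ?_).trans (le_of_eq
      (by rw [Finset.sum_const, Finset.card_range, nsmul_eq_mul])))
    rw [abs_mul]
    exact mul_le_mul (hf' i) (hg' i) (abs_nonneg _) hM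
  have hMp : 0 ≤ M * hashPrime n d := by positivity
  have hn0 : (0 : ℝ) ≤ n := Nat.cast_nonneg n
  have hd0 : (0 : ℝ) ≤ d := Nat.cast_nonneg d
  by_cases h1 : a = 1
  · subst h1
    rw [hA.r1, sketchRight]
    obtain ⟨z, hz, hz'⟩ := hsum d _ _ (fun j => hint' (x / widthT q l) j)
      (fun j => exists_int_hashVal (hashPrime n d) (coeffArray ω (hashPrime n d) (numCoeffs k q l))
        (4 * (x % widthT q l)) j) (fun j => hAM' _ j) fun j => abs_hashVal_le hp _ _ _
    exact ⟨z, hz, hz'.trans (mul_le_mul_of_nonneg_right (by linarith) hMp)⟩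
  by_cases h2 : a = 2
  · subst h2
    rw [hA.r2, sketchLeft]
    split_ifs
    · obtain ⟨z, hz, hz'⟩ := hsum n _ _ (fun i => hint' i (x % d))
        (fun i => exists_int_hashVal (hashPrime n d) (coeffArray ω (hashPrime n d) (numCoeffs k q l))
          (4 * (widthT q l + x / d)) i) (fun i => hAM' i _) fun i => abs_hashVal_le hp _ _ _
      refine ⟨z, ?_, hz'.trans (mul_le_mul_of_nonneg_right (by linarith) hMp)⟩
      rw [← hz]
      exact Finset.sum_congr rfl fun i _ => mul_comm _ _
    · exact ⟨0, by simp, by simpa using by positivity⟩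
  · rw [hA.real a h1 h2]
    exact ⟨0, by simp, by simpa using by positivity⟩

theorem streamMatrix_integral (us : List (Update n d)) (h : ∀ u ∈ us, ∃ z : ℤ, u.delta = z) :
    ∀ i j, ∃ z : ℤ, streamMatrix us i j = z := by
  induction us using List.reverseRecOn with
  | nil => exact fun i j => ⟨0, by simp [streamMatrix]⟩
  | append_singleton us u ih =>
    intro i j
    obtain ⟨z, hz⟩ := ih (fun v hv => h v (by simp [hv])) i j
    obtain ⟨z', hz'⟩ := h u (by simp)
    rw [streamMatrix] at hz
    rw [streamMatrix, List.foldl_append, List.foldl_cons, List.foldl_nil, Matrix.add_apply, hz,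
      Matrix.single_apply, hz']
    split_ifs
    · exact ⟨z + z', by push_cast; rfl⟩
    · exact ⟨z, by simp⟩

end run

/-! ## Resource bounds -/

/-- The number of cells of every array of the streaming algorithm. -/
def memCells (n d k q l : ℕ) : ℕ :=
  5 * (n * widthT q l + heightS k q * d) + groupSize q + numGroups l + n

/-- A bound on the words of the streaming algorithm. -/
def wordBound (n d k q l : ℕ) : ℕ := memCells n d k q l + 2 * (n * k) + 2 * (n + d + 5)

/-- A bound on the number of iterations of every loop of the streaming algorithm. -/
def loopBound (n d k q l : ℕ) : ℕ :=
  n ^ (k * numSamples q) + memCells n d k q l + (2 * (n + d + 5) + 1) * (2 * (n + d + 5) + 1)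

section bounds
variable {n d k q l : ℕ} {ε : ℝ}

/-- The assumption k ≤ d absorbs the k × k coefficients of the Gram–Schmidt process and the images
of the k clusters under S into the space for the sketch SA. -/
theorem memCells_setup (ω : Tape) {inp : Inputs} (h0 : inp.word 0 = n) (h1 : inp.word 1 = d)
    (h2 : inp.word 2 = k) (hn : 1 ≤ n) (hk : 1 ≤ k) (hkd : k ≤ d) (hq : 1 ≤ q) :
    Setup ⟨inp, ω, 32, memCells n d k q l, wordBound n d k q l, loopBound n d k q l⟩ n d k q l := by
  have hd : 1 ≤ d := hk.trans hkd
  have e1 : k * q ≤ heightS k q := by rw [heightS]; omega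
  have e2 : k ≤ k * q := Nat.le_mul_of_pos_right k hq
  have e3 : heightS k q * k ≤ heightS k q * d := Nat.mul_le_mul_left _ hkd
  have e4 : heightS k q ≤ heightS k q * d := Nat.le_mul_of_pos_right _ hd
  have e5 : k * numSamples q ≤ heightS k q := by
    rw [numSamples, heightS, show k * (16 * q) = 16 * (k * q) by ring]
    omega
  have e6 : k * d ≤ heightS k q * d := Nat.mul_le_mul_right _ (e2.trans e1)
  have e7 : k * k ≤ k * d := Nat.mul_le_mul_left _ hkd
  exact ⟨h0, h1, h2, hn, hd, hk, hq, le_rfl, by dsimp only; rw [memCells]; omega,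
    by dsimp only; rw [wordBound]; omega, by dsimp only; rw [loopBound]; omega,
    by dsimp only; rw [memCells]; omega, by dsimp only; rw [memCells]; omega,
    by dsimp only; rw [memCells]; omega, by dsimp only; rw [memCells]; omega,
    by dsimp only; rw [memCells]; omega, by dsimp only; rw [memCells]; omega,
    by dsimp only; rw [memCells]; omega, by dsimp only; rw [memCells]; omega,
    by dsimp only; rw [memCells]; omega, by dsimp only; rw [loopBound]; omega⟩

theorem numCoeffs_le_memCells (hn : 1 ≤ n) (hd : 1 ≤ d) : numCoeffs k q l ≤ memCells n d k q l := by
  have e1 : heightS k q ≤ heightS k q * d := Nat.le_mul_of_pos_right _ hd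
  have e2 : widthT q l ≤ n * widthT q l := Nat.le_mul_of_pos_left _ hn
  rw [numCoeffs, memCells]
  omega

theorem one_le_size (hn : 1 ≤ n) (hd : 1 ≤ d) (hk : 1 ≤ k) (h0 : 0 < ε) (h1 : ε < 1) :
    (n : ℝ) * k ≤ n * d * k / ε ∧ (n : ℝ) * d ≤ n * d * k / ε ∧ 1 ≤ (n : ℝ) * d * k / ε := by
  have hn' : (1 : ℝ) ≤ n := by exact_mod_cast hn
  have hd' : (1 : ℝ) ≤ d := by exact_mod_cast hd
  have hk' : (1 : ℝ) ≤ k := by exact_mod_cast hk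
  have e0 : (n : ℝ) * d * k ≤ n * d * k / ε := by
    rw [le_div_iff₀ h0]
    exact mul_le_of_le_one_right (by positivity) h1.le
  have e1 : (1 : ℝ) ≤ n * k := one_le_mul_of_one_le_of_one_le hn' hk'
  refine ⟨le_trans ?_ e0, le_trans ?_ e0, le_trans ?_ e0⟩
  · nlinarith
  · exact le_mul_of_one_le_right (by positivity) hk'
  · nlinarith

theorem memCells_le (hn : 1 ≤ n) (hd : 1 ≤ d) (hk : 1 ≤ k) (h0 : 0 < ε) (h1 : ε < 1) :
    (memCells n d k ⌈1 / ε⌉₊ (Nat.clog 2 (n * k)) : ℝ) ≤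
      30000000 * ((n / ε ^ 2 + d * k / ε) * (1 + Real.log (n * d * k / ε))) := by
  have hn' : (1 : ℝ) ≤ n := by exact_mod_cast hn
  have hd' : (1 : ℝ) ≤ d := by exact_mod_cast hd
  have hk' : (1 : ℝ) ≤ k := by exact_mod_cast hk
  have hY := one_le_size hn hd hk h0 h1
  have hnk : (1 : ℝ) ≤ n * k := one_le_mul_of_one_le_of_one_le hn' hk'
  set Λ := Real.log (n * d * k / ε)
  have hlog : Real.log (n * k) ≤ Λ := Real.log_le_log (by positivity) hY.1
  have hlog0 : 0 ≤ Real.log (n * k) := Real.log_nonneg hnk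
  have ht := widthT_le hn hk h0 h1
  have hs := heightS_le (k := k) h0 h1
  have hq := ceil_le_two_div h0 h1
  have hl := clog_le_log (Nat.mul_pos hn hk)
  push_cast at hl
  have hε2 : 1 ≤ 1 / ε ^ 2 := by
    rw [le_div_iff₀ (by positivity)]
    nlinarith
  have hu : (n : ℝ) / ε ^ 2 = n * (1 / ε ^ 2) := by ring
  set u := (n : ℝ) / ε ^ 2
  set v := (d : ℝ) * k / ε with hv
  have hv0 : 0 ≤ v := by positivity
  have hnu : (n : ℝ) ≤ u := by rw [hu]; exact le_mul_of_one_le_right (by positivity) hε2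
  have hiu : 1 / ε ^ 2 ≤ u := by rw [hu]; exact le_mul_of_one_le_left (by positivity) hn'
  have e1 : (n : ℝ) * widthT ⌈1 / ε⌉₊ (Nat.clog 2 (n * k)) ≤ 4194304 * (u * Λ) := by
    calc (n : ℝ) * widthT ⌈1 / ε⌉₊ (Nat.clog 2 (n * k)) ≤
        n * (4194304 * (Real.log (n * k) / ε ^ 2)) := by gcongr
      _ = 4194304 * (u * Real.log (n * k)) := by rw [hu]; ring
      _ ≤ _ := by gcongr
  have e2 : (heightS k ⌈1 / ε⌉₊ : ℝ) * d ≤ 6144 * v := by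
    calc (heightS k ⌈1 / ε⌉₊ : ℝ) * d ≤ 6144 * (k / ε) * d := by gcongr
      _ = _ := by rw [hv]; ring
  have e3 : (groupSize ⌈1 / ε⌉₊ : ℝ) ≤ 131072 * u := by
    rw [groupSize]
    push_cast
    calc (32768 : ℝ) * (⌈1 / ε⌉₊ * ⌈1 / ε⌉₊) ≤ 32768 * (2 / ε * (2 / ε)) := by gcongr
      _ = 131072 * (1 / ε ^ 2) := by field_simp; norm_num
      _ ≤ _ := by gcongr
  have e4 : (numGroups (Nat.clog 2 (n * k)) : ℝ) ≤ 32 * (u * Λ) := by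
    rw [numGroups]
    push_cast
    have : Λ ≤ u * Λ := le_mul_of_one_le_left (hlog0.trans hlog) (hn'.trans hnu)
    linarith
  have e5 : 0 ≤ v * Λ := mul_nonneg hv0 (hlog0.trans hlog)
  have e6 : 0 ≤ u * Λ := mul_nonneg (by linarith) (hlog0.trans hlog)
  have hu0 : 0 ≤ u := by linarith
  rw [memCells]
  push_cast
  rw [show (u + v) * (1 + Λ) = u + v + u * Λ + v * Λ by ring]
  linarith

theorem wordBound_le (hn : 1 ≤ n) (hd : 1 ≤ d) (hk : 1 ≤ k) (h0 : 0 < ε) (h1 : ε < 1) :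
    (wordBound n d k ⌈1 / ε⌉₊ (Nat.clog 2 (n * k)) : ℝ) ≤ 60000016 * (n * d * k / ε) ^ 3 := by
  have hn' : (1 : ℝ) ≤ n := by exact_mod_cast hn
  have hd' : (1 : ℝ) ≤ d := by exact_mod_cast hd
  have hk' : (1 : ℝ) ≤ k := by exact_mod_cast hk
  have hY := one_le_size hn hd hk h0 h1
  have hL := memCells_le hn hd hk h0 h1
  set Y := (n : ℝ) * d * k / ε with hYdef
  have hY1 := hY.2.2
  have hlog : 1 + Real.log Y ≤ Y := by
    have := Real.log_le_sub_one_of_pos (show 0 < Y by linarith)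
    linarith
  have hlog0 : 0 ≤ Real.log Y := Real.log_nonneg hY1
  have hu : (n : ℝ) / ε ^ 2 ≤ Y ^ 2 := by
    rw [hYdef, div_pow]
    gcongr
    have : (1 : ℝ) ≤ d * k := one_le_mul_of_one_le_of_one_le hd' hk'
    have h2 : (n : ℝ) ≤ n * d * k := by
      rw [mul_assoc]
      exact le_mul_of_one_le_right (by positivity) this
    nlinarith
  have hv : (d : ℝ) * k / ε ≤ Y ^ 2 := by
    have : (d : ℝ) * k / ε ≤ Y := by
      rw [hYdef, mul_assoc (n : ℝ)]
      exact div_le_div_of_nonneg_right (le_mul_of_one_le_left (by positivity) hn') h0.le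
    nlinarith
  have e1 : ((n : ℝ) / ε ^ 2 + d * k / ε) * (1 + Real.log Y) ≤ 2 * Y ^ 2 * Y :=
    mul_le_mul (by linarith) hlog (by linarith) (by positivity)
  have e2 : Y ≤ Y ^ 3 := le_self_pow₀ hY1 (by norm_num)
  have e3 : (n : ℝ) + d + 5 ≤ 7 * Y := by nlinarith [hY.2.1]
  rw [wordBound]
  push_cast
  nlinarith [hY.1]

/-- Memory cells and prime search contribute 60000016 and 225 multiples of n⁶d³; with the
enumeration and the added 1 the total factor stays below 70000000 ≤ n and is paid for by a seventh
power of n. -/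
theorem loopBound_le (hn : 70000000 ≤ n) (hk : 1 ≤ k) (hkn : k / ε ≤ n) (hkd : k ≤ d) (h0 : 0 < ε)
    (h1 : ε < 1) :
    (loopBound n d k ⌈1 / ε⌉₊ (Nat.clog 2 (n * k)) : ℝ) + 1 ≤
      n ^ (k * numSamples ⌈1 / ε⌉₊ + 7) * d ^ 3 := by
  have hd : 1 ≤ d := hk.trans hkd
  have hn1 : 1 ≤ n := by omega
  have hn' : (70000000 : ℝ) ≤ n := by exact_mod_cast hn
  have hn1' : (1 : ℝ) ≤ n := by linarith
  have hd' : (1 : ℝ) ≤ d := by exact_mod_cast hd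
  have hB := wordBound_le hn1 hd hk h0 h1
  have hY : (n : ℝ) * d * k / ε ≤ n ^ 2 * d := by
    calc (n : ℝ) * d * k / ε = n * d * (k / ε) := by ring
      _ ≤ n * d * n := by gcongr
      _ = _ := by ring
  have hY0 : 0 ≤ (n : ℝ) * d * k / ε := by positivity
  have hY3 : ((n : ℝ) * d * k / ε) ^ 3 ≤ n ^ 6 * d ^ 3 := by
    calc ((n : ℝ) * d * k / ε) ^ 3 ≤ (n ^ 2 * d) ^ 3 := pow_le_pow_left₀ hY0 hY 3
      _ = _ := by ring
  have hL : (memCells n d k ⌈1 / ε⌉₊ (Nat.clog 2 (n * k)) : ℝ) ≤ 60000016 * (n ^ 6 * d ^ 3) := by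
    refine le_trans ?_ (hB.trans (mul_le_mul_of_nonneg_left hY3 (by norm_num)))
    rw [wordBound]
    push_cast
    have : (0 : ℝ) ≤ n * k := by positivity
    linarith
  have hnd : (1 : ℝ) ≤ n * d := one_le_mul_of_one_le_of_one_le hn1' hd'
  have e1 : 2 * ((n : ℝ) + d + 5) + 1 ≤ 15 * (n * d) := by nlinarith
  have e2 : (2 * ((n : ℝ) + d + 5) + 1) * (2 * ((n : ℝ) + d + 5) + 1) ≤ 225 * (n ^ 6 * d ^ 3) := by
    calc _ ≤ (15 * (n * d : ℝ)) * (15 * (n * d)) := mul_le_mul e1 e1 (by positivity) (by positivity)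
      _ = 225 * (n ^ 2 * d ^ 2) := by ring
      _ ≤ 225 * (n ^ 6 * d ^ 3) := by
        gcongr <;> first | assumption | norm_num
  have e3 : (1 : ℝ) ≤ n ^ 6 * d ^ 3 :=
    one_le_mul_of_one_le_of_one_le (one_le_pow₀ hn1') (one_le_pow₀ hd')
  set N := k * numSamples ⌈1 / ε⌉₊ with hN
  have e4 : (n : ℝ) ^ N ≤ n ^ N * (n ^ 6 * d ^ 3) := le_mul_of_one_le_right (by positivity) e3
  have e5 : (n : ℝ) ^ 6 * d ^ 3 ≤ n ^ N * (n ^ 6 * d ^ 3) :=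
    le_mul_of_one_le_left (by positivity) (one_le_pow₀ hn1')
  have e6 : (70000000 : ℝ) * (n ^ N * (n ^ 6 * d ^ 3)) ≤ n * (n ^ N * (n ^ 6 * d ^ 3)) :=
    mul_le_mul_of_nonneg_right hn' (by positivity)
  rw [loopBound]
  push_cast
  calc _ ≤ (n : ℝ) * (n ^ N * (n ^ 6 * d ^ 3)) := by linarith
    _ = _ := by ring

/-- A factor n absorbs K. The exponent of n becomes 1 + D(N + 7) with N ≤ 32k²/ε, whence 39 = 32 +
7. -/
theorem steps_le {K D C : ℕ} (hn : 70000000 ≤ n) (hk : 1 ≤ k) (hkn : k / ε ≤ n) (hkd : k ≤ d)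
    (h0 : 0 < ε) (h1 : ε < 1) (hKn : K ≤ n) (hC : 1 + 39 * D ≤ C) :
    ((K * (loopBound n d k ⌈1 / ε⌉₊ (Nat.clog 2 (n * k)) + 1) ^ D : ℕ) : ℝ) ≤
      (d : ℝ) ^ C * (n : ℝ) ^ ((C : ℝ) * (k ^ 2 / ε) * (1 + Real.log (k / ε)) ^ C) := by
  have hn1' : (1 : ℝ) ≤ n := by exact_mod_cast (show 1 ≤ n by omega)
  have hd' : (1 : ℝ) ≤ d := by exact_mod_cast hk.trans hkd
  have hk' : (1 : ℝ) ≤ k := by exact_mod_cast hk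
  have hH := loopBound_le hn hk hkn hkd h0 h1
  set N := k * numSamples ⌈1 / ε⌉₊ with hN
  have hR : 1 ≤ (k : ℝ) ^ 2 / ε := by
    rw [le_div_iff₀ h0]
    nlinarith
  have hNR : (N : ℝ) ≤ 32 * (k ^ 2 / ε) := by
    have h3 := ceil_le_two_div h0 h1
    rw [hN, numSamples]
    push_cast
    calc (k : ℝ) * (16 * ⌈1 / ε⌉₊) ≤ k * (16 * (2 / ε)) := by gcongr
      _ = 32 * (k / ε) := by ring
      _ ≤ 32 * (k ^ 2 / ε) := by
        gcongr
        nlinarith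
  have hlog : 1 ≤ (1 + Real.log (k / ε)) ^ C := by
    refine one_le_pow₀ ?_
    have : 0 ≤ Real.log (k / ε) := Real.log_nonneg (by rw [le_div_iff₀ h0]; linarith)
    linarith
  have hexp : ((1 + D * (N + 7) : ℕ) : ℝ) ≤
      (C : ℝ) * (k ^ 2 / ε) * (1 + Real.log (k / ε)) ^ C := by
    have hC' : (1 : ℝ) + 39 * D ≤ C := by exact_mod_cast hC
    have hD : (0 : ℝ) ≤ D := Nat.cast_nonneg D
    push_cast
    calc (1 : ℝ) + D * (N + 7) ≤ (1 + 39 * D) * (k ^ 2 / ε) := by nlinarith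
      _ ≤ C * (k ^ 2 / ε) := by gcongr
      _ ≤ _ := le_mul_of_one_le_right (by positivity) hlog
  push_cast
  calc (K : ℝ) * (loopBound n d k ⌈1 / ε⌉₊ (Nat.clog 2 (n * k)) + 1) ^ D
      ≤ n * (n ^ (N + 7) * d ^ 3) ^ D := by
        gcongr
    _ = d ^ (3 * D) * n ^ (1 + D * (N + 7)) := by ring
    _ ≤ d ^ C * n ^ (1 + D * (N + 7)) := by
        gcongr
        omega
    _ = (d : ℝ) ^ C * (n : ℝ) ^ ((1 + D * (N + 7) : ℕ) : ℝ) := by rw [Real.rpow_natCast]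
    _ ≤ _ := by
        gcongr

/-- The constant 28 is the product of n + d ≤ 2nd and p ≤ 2(n + d + 5) ≤ 14nd. -/
theorem integral_bound {C M : ℕ} (hn : 1 ≤ n) (hd : 1 ≤ d) (hk : 1 ≤ k) (h0 : 0 < ε) (h1 : ε < 1)
    (hM : 1 ≤ M) (hC : 28 ≤ C) :
    ((n : ℝ) + d) * (M * hashPrime n d) ≤ C * (n * d * k * M / ε) ^ C := by
  have hn' : (1 : ℝ) ≤ n := by exact_mod_cast hn
  have hd' : (1 : ℝ) ≤ d := by exact_mod_cast hd
  have hM' : (1 : ℝ) ≤ M := by exact_mod_cast hM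
  have hY := one_le_size hn hd hk h0 h1
  have hC' : (28 : ℝ) ≤ C := by exact_mod_cast hC
  have hp : (hashPrime n d : ℝ) ≤ 14 * (n * d) := by
    have h2 : hashPrime n d ≤ 2 * (n + d + 5) := nextPrime_le_two_mul (by omega)
    have h3 : (hashPrime n d : ℝ) ≤ 2 * (n + d + 5) := by exact_mod_cast h2
    nlinarith
  have hnd : (n : ℝ) + d ≤ 2 * (n * d) := by nlinarith
  have hnd1 : (1 : ℝ) ≤ n * d := one_le_mul_of_one_le_of_one_le hn' hd'
  set Z := (n : ℝ) * d * k * M / ε with hZ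
  have hZ' : Z = n * d * k / ε * M := by rw [hZ]; ring
  have hZ1 : n * d * (M : ℝ) ≤ Z := by rw [hZ']; gcongr; exact hY.2.1
  have hZ0 : 1 ≤ Z := le_trans (one_le_mul_of_one_le_of_one_le hnd1 hM') hZ1
  calc ((n : ℝ) + d) * (M * hashPrime n d) ≤ 2 * (n * d) * (M * (14 * (n * d))) := by gcongr
    _ = 28 * ((n * d * M) * (n * d)) := by ring
    _ ≤ 28 * (Z * Z) := by
        have : (n : ℝ) * d ≤ Z := le_trans (le_mul_of_one_le_right (by positivity) hM') hZ1
        gcongr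
    _ = 28 * Z ^ 2 := by ring
    _ ≤ C * Z ^ C := by
        gcongr
        omega

end bounds

theorem mainTheorem4 :
    -- (1) recovery from the three linear sketches
    (∃ (C : ℝ) (recover : Cmd), 0 < C ∧
      ∀ (n d k : ℕ) (ε : ℝ), 1 ≤ n → 1 ≤ d → 1 ≤ k → 0 < ε → ε < 1 →
      ∃ t s w : ℕ,
        (t : ℝ) ≤ C * (Real.log (n * k) / ε ^ 2) ∧
        (s : ℝ) ≤ C * (k / ε) ∧
        (w : ℝ) ≤ C * (k ^ 2 / ε ^ 3 * Real.log n) ∧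
        ∃ (μT : Measure (Matrix (Fin d) (Fin t) ℝ)) (μS : Measure (Matrix (Fin s) (Fin n) ℝ))
          (μW : Measure (Matrix (Fin w) (Fin (n * d)) ℝ)),
          IsProbabilityMeasure μT ∧ IsProbabilityMeasure μS ∧ IsProbabilityMeasure μW ∧
          ∀ A : Matrix (Fin n) (Fin d) ℝ,
            2 / 3 ≤ (μT.prod (μS.prod μW)) {M | ∀ ω : Tape, ∃ out : State,
              Computes
                (recoveryInput k ε M.1 M.2.1 M.2.2
                  (M.2.1 * A) (A * M.1) (M.2.2.mulVec (flatten A)))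
                ω recover State.blank out ∧
              IsApproxKMeans A ε (outAssignment n k out) (outCenters k d out)}) ∧
    -- (2) the turnstile streaming algorithm
    (∃ (P : StreamAlg) (m C : ℕ),
      ∀ (n d k : ℕ) (ε : ℝ), 1 ≤ k → 0 < ε → ε < 1 →
      C * ((k : ℝ) / ε) ^ C < n → C * ((k : ℝ) / ε) ^ C < d →
      ∃ L B T : ℕ,
        -- space: number of cells, and size of the words
        ((2 * m * L : ℕ) : ℝ) ≤
          C * (n / ε ^ 2 + d * k / ε) * (1 + Real.log (n * d * k / ε)) ^ C ∧
        (B : ℝ) ≤ C * (n * d * k / ε) ^ C ∧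
        -- time
        (T : ℝ) ≤ (d : ℝ) ^ C *
          (n : ℝ) ^ ((C : ℝ) * (k ^ 2 / ε) * (1 + Real.log (k / ε)) ^ C) ∧
        ∀ us : List (Update n d),
          -- the resource bounds hold for every outcome of the random choices
          (∀ ω : Tape, ∃ mid out : State, P.Runs (State.Fits m L B) T k ε ω us mid out ∧
            -- on integral streams the memory carried along the stream is integral
            ∀ M : ℕ, 1 ≤ M → (∀ u ∈ us, ∃ z : ℤ, u.delta = z) →
              (∀ vs, vs <+: us → ∀ i j, |streamMatrix vs i j| ≤ M) →
              ∀ a x, ∃ z : ℤ, mid.real a x = z ∧ |(z : ℝ)| ≤ C * (n * d * k * M / ε) ^ C) ∧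
          2 / 3 ≤ tapeMeasure {ω | ∃ mid out : State,
            P.Runs (State.Fits m L B) T k ε ω us mid out ∧
            IsApproxKMeans (streamMatrix us) ε (outAssignment n k out) (outCenters k d out)}) := by
  refine ⟨exists_recovery, kMeansStream, 32, ?_⟩
  obtain ⟨K₁, D₁, hc₁⟩ := kMeansStream.init.cost_le_pow
  obtain ⟨K₂, D₂, hc₂⟩ := kMeansStream.update.cost_le_pow
  obtain ⟨K₃, D₃, hc₃⟩ := kMeansStream.finish.cost_le_pow
  have hcost : ∀ (K D : ℕ), K ≤ K₁ + K₂ + K₃ → D ≤ D₁ + D₂ + D₃ → ∀ H,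
      K * (H + 1) ^ D ≤ (K₁ + K₂ + K₃) * (H + 1) ^ (D₁ + D₂ + D₃) := fun K D hK hD H =>
    Nat.mul_le_mul hK (Nat.pow_le_pow_right (by omega) hD)
  have hcost₁ := fun H => (hc₁ H).trans (hcost K₁ D₁ (by omega) (by omega) H)
  have hcost₂ := fun H => (hc₂ H).trans (hcost K₂ D₂ (by omega) (by omega) H)
  have hcost₃ := fun H => (hc₃ H).trans (hcost K₃ D₃ (by omega) (by omega) H)
  -- These constants are fixed by the program text, before n, d, k and ε enter.
  generalize K₁ + K₂ + K₃ = K at hcost₁ hcost₂ hcost₃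
  generalize D₁ + D₂ + D₃ = D at hcost₁ hcost₂ hcost₃
  -- The number 2000000000 exceeds 64 · 30000000 from the space bound, the constant 60000016 for the
  -- words and the threshold 70000000 for n.
  obtain ⟨C, hCK, hCD, hC⟩ : ∃ C : ℕ, K ≤ C ∧ 1 + 39 * D ≤ C ∧ 2000000000 ≤ C :=
    ⟨K + (1 + 39 * D) + 2000000000, by omega, by omega, by omega⟩
  refine ⟨C, fun n d k ε hk h0 h1 hn hd => ?_⟩
  have hC' : (2000000000 : ℝ) ≤ C := by exact_mod_cast hC
  have hk' : (1 : ℝ) ≤ k := by exact_mod_cast hk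
  have hkε : (k : ℝ) ≤ k / ε := by
    rw [le_div_iff₀ h0]
    nlinarith
  have hkε1 : 1 ≤ (k : ℝ) / ε := hk'.trans hkε
  have hp1 : (1 : ℝ) ≤ (k / ε) ^ C := one_le_pow₀ hkε1
  have hp2 : (k : ℝ) / ε ≤ (k / ε) ^ C := le_self_pow₀ hkε1 (by omega)
  have hCn : (C : ℝ) < n := lt_of_le_of_lt (le_mul_of_one_le_right (by linarith) hp1) hn
  -- Largeness of n and d is used in these forms: k/ε ≤ n, k ≤ d and C < n.
  have hkn : (k : ℝ) / ε ≤ n :=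
    (hp2.trans (le_mul_of_one_le_left (by linarith) (by linarith))).trans hn.le
  have hkd : (k : ℝ) ≤ d :=
    (hkε.trans (hp2.trans (le_mul_of_one_le_left (by linarith) (by linarith)))).trans hd.le
  have hCn' : C < n := by exact_mod_cast hCn
  have hkd' : k ≤ d := by exact_mod_cast hkd
  have hn1 : 1 ≤ n := by omega
  have hd1 : 1 ≤ d := hk.trans hkd'
  have hY := one_le_size hn1 hd1 hk h0 h1
  set q := ⌈1 / ε⌉₊ with hq
  set l := Nat.clog 2 (n * k) with hl
  have hq1 : 1 ≤ q := one_le_ceil h0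
  -- Since n is large the logarithm is positive, so the sketch AT has at least one column and its
  -- memory layout is well defined.
  have hl1 : 1 ≤ l := Nat.clog_pos (by norm_num) (by
    have := Nat.le_mul_of_pos_right n hk
    omega)
  refine ⟨memCells n d k q l, wordBound n d k q l, K * (loopBound n d k q l + 1) ^ D, ?_, ?_,
    steps_le (by omega) hk hkn hkd' h0 h1 (by omega) hCD, fun us => ?_⟩
  · have hL := memCells_le hn1 hd1 hk h0 h1
    have hΛ : 0 ≤ Real.log (n * d * k / ε) := Real.log_nonneg hY.2.2
    have hX : 0 ≤ (n : ℝ) / ε ^ 2 + d * k / ε := by positivity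
    push_cast
    calc (64 : ℝ) * memCells n d k q l ≤ 64 * (30000000 *
          ((n / ε ^ 2 + d * k / ε) * (1 + Real.log (n * d * k / ε)))) := by gcongr
      _ = 1920000000 * (n / ε ^ 2 + d * k / ε) * (1 + Real.log (n * d * k / ε)) := by ring
      _ ≤ C * (n / ε ^ 2 + d * k / ε) * (1 + Real.log (n * d * k / ε)) ^ C := by
          refine mul_le_mul ?_ (le_self_pow₀ (by linarith) (by omega)) (by linarith) (by positivity)
          exact mul_le_mul_of_nonneg_right (by linarith) hX
  · refine (wordBound_le hn1 hd1 hk h0 h1).trans ?_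
    exact mul_le_mul (by linarith) (pow_le_pow_right₀ hY.2.2 (by omega))
      (pow_nonneg (by linarith [hY.2.2]) 3) (by linarith)
  have hrun := fun ω : Tape => exists_runs (n := n) (d := d) (k := k) (ε := ε)
    (memCells_setup ω rfl rfl rfl hn1 hk hkd' hq1) hl1 h0 hq hl
    (by rw [wordBound]; omega) (by rw [wordBound]; omega) (by rw [loopBound]; omega)
    (numCoeffs_le_memCells hn1 hd1) (hcost₁ _) (hcost₂ _) (hcost₃ _) us
  constructor
  · intro ω
    obtain ⟨mid, out, hr, hmem, -⟩ := hrun ω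
    refine ⟨mid, out, hr, fun M hM hint hbd a x => ?_⟩
    obtain ⟨z, hz, hz'⟩ := hmem.integral (streamMatrix_integral us hint) (Nat.cast_nonneg M)
      (hbd us (List.prefix_refl us)) a x
    exact ⟨z, hz, hz'.trans (integral_bound hn1 hd1 hk h0 h1 hM (by omega))⟩
  · have hP' := le_nextPrime (n + d + 5)
    obtain ⟨P, hP⟩ : ∃ P, hashPrime n d = P + 1 := ⟨hashPrime n d - 1, by rw [hashPrime]; omega⟩
    rw [← hashPrime, hP] at hP'
    have : Fact (P + 1).Prime := ⟨hP ▸ nextPrime_prime (n + d + 5)⟩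
    refine (two_thirds_le_tapeMeasure (P := P) (streamMatrix us) hn1 hk hq1 hl (by omega) (by omega)
      (by omega) (one_le_ceil_mul h0)).trans (measure_mono fun ω hω => ?_)
    obtain ⟨mid, out, hr, hmem, hout⟩ := hrun ω
    have ht : 0 < widthT q l := Nat.mul_pos (Nat.mul_pos (by norm_num) hl1)
      (Nat.mul_pos (by norm_num) (Nat.mul_pos hq1 hq1))
    exact ⟨mid, out, hr, hmem.isApproxKMeans hP (by linarith) ht hω hout⟩
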